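/- Let $N\ge 3$, let indices $n$ be read in $\mathbb Z/N\mathbb Z$, and let $k_n,\ell_n$ be positive integers. Let $T^{\boldsymbol k}_{\boldsymbol\ell}$ be the simply-laced diagram with vertices $(n,i)$, $-\ell_n+1\le i\le k_n-1$, where $(n,i)$ is joined to $(n,i+1)$ and $(n,0)$ is joined to $(n+1,0)$; its Weyl group $W=W(T^{\boldsymbol k}_{\boldsymbol\ell})$ is the group with generators $s_n^i$ and relations $s_\alpha^2=1$, $s_\alpha s_\beta s_\alpha=s_\beta s_\alpha s_\beta$ for adjacent vertices $\alpha,\beta$, and $s_\alpha s_\beta=s_\beta s_\alpha$ for distinct non-adjacent ones. Let $a=(a_n^i)$ be variables attached to the vertices, and put $$u_n=\frac{\bigl(a_n^0\prod_{j=1}^{\ell_n-1}(a_n^{-j})^{1-j/\ell_n}\bigr)^{\ell_n/(k_n+\ell_n)}}{\bigl(\prod_{i=1}^{k_n-1}(a_n^i)^{1-i/k_n}\bigr)^{k_n/(k_n+\ell_n)}},\qquad v_n=\frac{\bigl(a_n^0\prod_{i=1}^{k_n-1}(a_n^i)^{1-i/k_n}\bigr)^{k_n/(k_n+\ell_n)}}{\bigl(\prod_{j=1}^{\ell_n-1}(a_n^{-j})^{1-j/\ell_n}\bigr)^{\ell_n/(k_n+\ell_n)}},$$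 $u_n^1=u_n$, $u_n^{i+1}=a_n^iu_n^i$, $v_n^{-1}=v_n$, $v_n^{-j-1}=a_n^{-j}v_n^{-j}$. Let $p\ge1$ be divisible by every $k_n+\ell_n$, so that these are monomials in the $p$-th roots $b_n^i=(a_n^i)^{1/p}$, and let $\mathbb K=\mathbb C(a^{1/p})$ be the rational function field in the $b_n^i$. Let $s_n^i$ act on $a$ (and by the same formulas on $b$) by $$s_n^i(a_n^i)=1/a_n^i,\qquad s_n^i(a_m^j)=a_n^ia_m^j\ \text{ if }(m,j)\text{ is adjacent to }(n,i),\qquad s_n^i(a_m^j)=a_m^j\ \text{ otherwise},$$ and on the coordinates $f_1,\dots,f_N$ by $$s_n^0(f_{n-1})=(a_n^0)^{\ell_{n-1}/(k_{n-1}+\ell_{n-1})}f_{n-1}\frac{f_n+1/v_n}{f_n+u_n},\qquad s_n^0(f_{n+1})=(a_n^0)^{-k_{n+1}/(k_{n+1}+\ell_{n+1})}f_{n+1}\frac{f_n+u_n}{f_n+1/v_n},$$ and $s_n^i(f_m)=f_m$ otherwise. (1) These formulas define automorphisms $s_n^i$ of the field $\mathbb K(f)$ over $\mathbb C$, and they satisfy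 the defining relations of $W$, i.e. they define a homomorphism from $W$ to the automorphism group of $\mathbb K(f)$. (2) Now give the $b_n^i$ nonzero complex values, and let $X_a\to(\mathbb P^1)^N$ be the blow-up along the subvarieties $$C_n^i=\{f_{n-1}=0,\ f_n=-u_n^i,\ f_{n+1}=\infty\}\ (1\le i\le k_n),\qquad C_n^{-j}=\{f_{n-1}=\infty,\ f_n=-1/v_n^{-j},\ f_{n+1}=0\}\ (1\le j\le\ell_n),$$ performed one after another along strict transforms, in any order. Fix $(n,i)$ and assume that $a$ is generic in the sense that $a_n^i\neq1$, that the centres of $X_a$ are pairwise distinct, and that the centres of $X_{s_n^i(a)}$ are pairwise distinct. Then the birational map $X_a\dashrightarrow X_{s_n^i(a)}$ given by $s_n^i$ is a pseudo-isomorphism: it restricts to an isomorphism between open subsets whose complements have codimension at least $2$. (3) In the same situation, the group $H^2(X_a,\mathbb Z)=NS(X_a)$ of divisor classes is free with basis the classes $H_m$ of the hyperplanes $\{f_m=\mathrm{const}\}$ and the classes $E_m^j$ of the exceptional divisors over $C_m^j$, and $H_2(X_a,\mathbb Z)$ is its dual, with basis $h_m,e_m^j$ such that $\langle H_m,h_{m'}\rangle=\delta_{m,m'}$,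 $\langle E_m^j,e_{m'}^{j'}\rangle=-\delta_{m,m'}\delta_{j,j'}$ and all other pairings of basis elements are $0$; likewise for $X_{s_n^i(a)}$. Put $\alpha_n^0=H_n-E_n^1-E_n^{-1}$, $\check\alpha_n^0=h_{n-1}+h_{n+1}-e_n^1-e_n^{-1}$, and, for $i,j\ge1$, $\alpha_n^i=E_n^i-E_n^{i+1}$, $\check\alpha_n^i=e_n^i-e_n^{i+1}$, $\alpha_n^{-j}=E_n^{-j}-E_n^{-j-1}$, $\check\alpha_n^{-j}=e_n^{-j}-e_n^{-j-1}$. Then, in these bases, the pullback along $s_n^i:X_a\dashrightarrow X_{s_n^i(a)}$ is the reflection $\Lambda\mapsto\Lambda+\langle\Lambda,\check\alpha_n^i\rangle\alpha_n^i$ on divisor classes, and the induced (contragredient) action on $H_2$ is $\lambda\mapsto\lambda+\langle\alpha_n^i,\lambda\rangle\check\alpha_n^i$. -/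

import Mathlib

noncomputable section

open scoped Classical

namespace TropicalWeyl

/-! ### Root data: the Dynkin diagram, the Weyl group, the lattices `H²` and `H₂` -/

/-- Vertices of `T^k_ℓ`: pairs `(n, i)` with `n ∈ ℤ/N` and `-ℓ n + 1 ≤ i ≤ k n - 1`. -/
abbrev Root {N : ℕ} (k l : ZMod N → ℕ) : Type :=
  {r : ZMod N × ℤ // -(l r.1 : ℤ) + 1 ≤ r.2 ∧ r.2 ≤ (k r.1 : ℤ) - 1}

/-- Labels of the blow-up centres: pairs `(n, i)` with `1 ≤ i ≤ k n` or `-ℓ n ≤ i ≤ -1`. -/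
abbrev Label {N : ℕ} (k l : ZMod N → ℕ) : Type :=
  {c : ZMod N × ℤ // c.2 ≠ 0 ∧ -(l c.1 : ℤ) ≤ c.2 ∧ c.2 ≤ (k c.1 : ℤ)}

section RootData

variable {N : ℕ} {k l : ZMod N → ℕ}

/-- Adjacency of two vertices in the Dynkin diagram `T^k_ℓ` (for `N ≥ 3`). -/
def Adj (r t : Root k l) : Prop :=
  (r.1.1 = t.1.1 ∧ (r.1.2 = t.1.2 + 1 ∨ t.1.2 = r.1.2 + 1)) ∨
  (r.1.2 = 0 ∧ t.1.2 = 0 ∧ r.1.1 ≠ t.1.1 ∧ (r.1.1 = t.1.1 + 1 ∨ t.1.1 = r.1.1 + 1))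

theorem Adj.symm {r t : Root k l} (h : Adj r t) : Adj t r := by
  rcases h with ⟨h1, h2⟩ | ⟨h1, h2, h3, h4⟩
  · exact Or.inl ⟨h1.symm, h2.symm⟩
  · exact Or.inr ⟨h2, h1, h3.symm, h4.symm⟩

/-- The Coxeter matrix of the simply-laced diagram `T^k_ℓ`. Its Coxeter group
`(coxeterMatrix k l).Group` is the Weyl group `W(T^k_ℓ)`. -/
def coxeterMatrix (k l : ZMod N → ℕ) : CoxeterMatrix (Root k l) where
  M := Matrix.of fun r t => if r = t then 1 else if Adj r t then 3 else 2
  isSymm := by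
    ext r t
    exact if_congr eq_comm rfl (if_congr ⟨Adj.symm, Adj.symm⟩ rfl rfl)
  diagonal := by intro r; simp
  off_diagonal := by
    intro r t h
    simp only [Matrix.of_apply, h, if_false]
    split_ifs <;> decide

/-- The free abelian group on `ℤ/N ⊔ {labels}`. It is used for `H²(X, ℤ)`, with basis
`H_n, E_n^i`, and for `H₂(X, ℤ)`, with basis `h_n, e_n^i`. -/
abbrev Lat {N : ℕ} (k l : ZMod N → ℕ) : Type := (ZMod N ⊕ Label k l) →₀ ℤ

/-- The basis vector `H_n` of `H²` (and `h_n` of `H₂`). -/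
def latH (k l : ZMod N → ℕ) (n : ZMod N) : Lat k l := Finsupp.single (Sum.inl n) 1

/-- The basis vector `E_n^i` of `H²` (and `e_n^i` of `H₂`); it is only used where `(n, i)` is a
label. -/
def latE (k l : ZMod N → ℕ) (n : ZMod N) (i : ℤ) : Lat k l :=
  if h : i ≠ 0 ∧ -(l n : ℤ) ≤ i ∧ i ≤ (k n : ℤ) then
    Finsupp.single (Sum.inr ⟨(n, i), h⟩) 1
  else 0

/-- The intersection pairing `H² × H₂ → ℤ`: `⟨H_m, h_n⟩ = δ_{mn}`, `⟨E, e⟩ = -δ`, and `0`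
otherwise. -/
def pairing (x y : Lat k l) : ℤ :=
  x.sum fun s z => (Sum.elim (fun _ => (1 : ℤ)) (fun _ => -1) s) * z * y s

/-- The simple roots `α_n^i ∈ H²`. -/
def simpleRoot (r : Root k l) : Lat k l :=
  if r.1.2 = 0 then latH k l r.1.1 - latE k l r.1.1 1 - latE k l r.1.1 (-1)
  else if 0 < r.1.2 then latE k l r.1.1 r.1.2 - latE k l r.1.1 (r.1.2 + 1)
  else latE k l r.1.1 r.1.2 - latE k l r.1.1 (r.1.2 - 1)

/-- The simple coroots `α̌_n^i ∈ H₂`. -/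
def simpleCoroot (r : Root k l) : Lat k l :=
  if r.1.2 = 0 then
    latH k l (r.1.1 - 1) + latH k l (r.1.1 + 1) - latE k l r.1.1 1 - latE k l r.1.1 (-1)
  else if 0 < r.1.2 then latE k l r.1.1 r.1.2 - latE k l r.1.1 (r.1.2 + 1)
  else latE k l r.1.1 r.1.2 - latE k l r.1.1 (r.1.2 - 1)

/-- The reflection on `H²`: `s(Λ) = Λ + ⟨Λ, α̌⟩ α`. -/
def reflH2 (r : Root k l) (x : Lat k l) : Lat k l :=
  x + pairing x (simpleCoroot r) • simpleRoot r

/-- The reflection on `H₂`: `s(λ) = λ + ⟨α, λ⟩ α̌`. -/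
def reflH1 (r : Root k l) (y : Lat k l) : Lat k l :=
  y + pairing (simpleRoot r) y • simpleCoroot r

/-! ### Root variables, parameters and the explicit birational maps

Throughout `p` is a positive integer divisible by all `k n + ℓ n`, and `b = (b_n^i)` are the
`p`-th roots of the multiplicative root variables, `a_n^i = (b_n^i) ^ p`. A rational power
`(a_n^i) ^ (c / (k n + ℓ n))` is `(b_n^i) ^ (c * (p / (k n + ℓ n)))`. -/

variable {L : Type*} [Field L]

/-- The action of `s_r` on the root variables (same formula for `a` and for its `p`-th root `b`):
`s_r(b_r) = 1 / b_r`, `s_r(b_t) = b_r b_t` if `t` is adjacent to `r`, `s_r(b_t) = b_t` otherwise. -/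
def actRoot (r : Root k l) (b : Root k l → L) : Root k l → L := fun t =>
  if t = r then (b r)⁻¹ else if Adj r t then b r * b t else b t

/-- `b_n^i`, with value `1` where `(n, i)` is not a vertex (never used there). -/
def rv (b : Root k l → L) (n : ZMod N) (i : ℤ) : L :=
  if h : -(l n : ℤ) + 1 ≤ i ∧ i ≤ (k n : ℤ) - 1 then b ⟨(n, i), h⟩ else 1

/-- `u_n = (a_n^0 ∏_{j=1}^{ℓ-1} (a_n^{-j})^{1-j/ℓ})^{ℓ/(k+ℓ)} /
(∏_{i=1}^{k-1} (a_n^i)^{1-i/k})^{k/(k+ℓ)}`. -/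
def uPar (p : ℕ) (b : Root k l → L) (n : ZMod N) : L :=
  (rv b n 0 ^ (l n * (p / (k n + l n))) *
      ∏ j ∈ Finset.Icc 1 (l n - 1), rv b n (-(j : ℤ)) ^ ((l n - j) * (p / (k n + l n)))) /
    ∏ i ∈ Finset.Icc 1 (k n - 1), rv b n (i : ℤ) ^ ((k n - i) * (p / (k n + l n)))

/-- `v_n = (a_n^0 ∏_{i=1}^{k-1} (a_n^i)^{1-i/k})^{k/(k+ℓ)} /
(∏_{j=1}^{ℓ-1} (a_n^{-j})^{1-j/ℓ})^{ℓ/(k+ℓ)}`. -/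
def vPar (p : ℕ) (b : Root k l → L) (n : ZMod N) : L :=
  (rv b n 0 ^ (k n * (p / (k n + l n))) *
      ∏ i ∈ Finset.Icc 1 (k n - 1), rv b n (i : ℤ) ^ ((k n - i) * (p / (k n + l n)))) /
    ∏ j ∈ Finset.Icc 1 (l n - 1), rv b n (-(j : ℤ)) ^ ((l n - j) * (p / (k n + l n)))

/-- `u_n^i` for `i ≥ 1`: `u_n^1 = u_n` and `u_n^{i+1} = a_n^i u_n^i`. -/
def uSeq (p : ℕ) (b : Root k l → L) (n : ZMod N) (i : ℕ) : L :=
  uPar p b n * ∏ m ∈ Finset.Icc 1 (i - 1), rv b n (m : ℤ) ^ p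

/-- `v_n^{-j}` for `j ≥ 1`: `v_n^{-1} = v_n` and `v_n^{-(j+1)} = a_n^{-j} v_n^{-j}`. -/
def vSeq (p : ℕ) (b : Root k l → L) (n : ZMod N) (j : ℕ) : L :=
  vPar p b n * ∏ m ∈ Finset.Icc 1 (j - 1), rv b n (-(m : ℤ)) ^ p

/-- The value `s_n^i(f_m)`, as an expression in the `p`-th roots `b` of the root variables and in
the coordinates `f`:
`s_n^0(f_{n-1}) = (a_n^0)^{ℓ_{n-1}/(k_{n-1}+ℓ_{n-1})} f_{n-1} (f_n + 1/v_n) / (f_n + u_n)`,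
`s_n^0(f_{n+1}) = (a_n^0)^{-k_{n+1}/(k_{n+1}+ℓ_{n+1})} f_{n+1} (f_n + u_n) / (f_n + 1/v_n)`,
and `s_n^i(f_m) = f_m` otherwise. -/
def actCoord (p : ℕ) (b : Root k l → L) (f : ZMod N → L) (r : Root k l) (m : ZMod N) : L :=
  if r.1.2 = 0 ∧ m = r.1.1 - 1 then
    b r ^ (l m * (p / (k m + l m))) * f m *
      ((f r.1.1 + 1 / vPar p b r.1.1) / (f r.1.1 + uPar p b r.1.1))
  else if r.1.2 = 0 ∧ m = r.1.1 + 1 then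
    (b r ^ (k m * (p / (k m + l m))))⁻¹ * f m *
      ((f r.1.1 + uPar p b r.1.1) / (f r.1.1 + 1 / vPar p b r.1.1))
  else f m

end RootData

/-! ### The fields -/

/-- `𝕂 = ℂ(a^{1/p})`, the rational function field in the variables `b_n^i = (a_n^i)^{1/p}`. -/
abbrev ParamField {N : ℕ} (k l : ZMod N → ℕ) : Type := FractionRing (MvPolynomial (Root k l) ℂ)

/-- `𝕂(f)`, the field of rational functions in `f = (f_n)` over `𝕂`. -/
abbrev GenField {N : ℕ} (k l : ZMod N → ℕ) : Type :=
  FractionRing (MvPolynomial (ZMod N) (ParamField k l))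

/-- The element `b_n^i = (a_n^i)^{1/p}` of `𝕂(f)`. -/
def genRoot {N : ℕ} (k l : ZMod N → ℕ) (r : Root k l) : GenField k l :=
  algebraMap (MvPolynomial (ZMod N) (ParamField k l)) (GenField k l)
    (MvPolynomial.C (algebraMap (MvPolynomial (Root k l) ℂ) (ParamField k l) (MvPolynomial.X r)))

/-- The coordinate `f_n` in `𝕂(f)`. -/
def genCoord {N : ℕ} (k l : ZMod N → ℕ) (n : ZMod N) : GenField k l :=
  algebraMap (MvPolynomial (ZMod N) (ParamField k l)) (GenField k l) (MvPolynomial.X n)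

/-- `ℂ(f)`, the function field of `(ℙ¹)^N` over `ℂ`. -/
abbrev FunField (N : ℕ) : Type := FractionRing (MvPolynomial (ZMod N) ℂ)

/-- The coordinate function `f_n ∈ ℂ(f)`. -/
def coord {N : ℕ} (n : ZMod N) : FunField N :=
  algebraMap (MvPolynomial (ZMod N) ℂ) (FunField N) (MvPolynomial.X n)

/-! ### Varieties with a given function field

An integral separated scheme `X` of finite type over a field, with function field `F`, is the same
thing as the set of its local rings `𝒪_{X,x} ⊆ F` (a *model* of `F`, or Chevalley scheme): the
points of `X` (generic points of irreducible closed subvarieties included) correspond bijectively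
to their local rings, the sets `{x | g₁, …, g_m ∈ 𝒪_{X,x}}` form a basis of the Zariski topology,
and the sections over an open set `U` are the elements of `⋂_{x ∈ U} 𝒪_{X,x}`. Below, a variety is
always given as its set of local rings. A point `P` lies in the local scheme at `R`, that is, the
subvariety with generic point `P` passes through `R`, if and only if `R ⊆ P`. -/

section Models

variable {F : Type*} [Field F]

/-- The affine scheme `Spec A` of a subring `A ⊆ F`: all localizations of `A` at primes. -/
def specModel (A : Subring F) : Set (LocalSubring F) :=
  {Q | ∃ (q : Ideal A) (_ : q.IsPrime), Q = LocalSubring.ofPrime A q}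

/-- The stalk at `R` of the (radical) ideal sheaf of the closed subvariety with generic point `P`:
the functions in `R` vanishing at `P` if the subvariety passes through `R`, and the unit ideal
otherwise. -/
def idealAt (P R : LocalSubring F) : Ideal R.toSubring :=
  if h : R.toSubring ≤ P.toSubring then
    (IsLocalRing.maximalIdeal P.toSubring).comap (Subring.inclusion h)
  else ⊤

/-- The ring `R[I/g]`. -/
def blowUpChart (R : LocalSubring F) (I : Ideal R.toSubring) (g : R.toSubring) : Subring F :=
  Subring.closure ((R.toSubring : Set F) ∪ {x | ∃ y ∈ I, x = (y : F) / (g : F)})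

/-- The blow-up of the variety `M` along the closed subvariety with generic point `P`: over the
local scheme at `R ∈ M`, with `I` the stalk of the ideal sheaf, it is `Proj (⨁ Iᵈ)`, the union of
the affine charts `Spec R[I/g]`, `0 ≠ g ∈ I`. -/
def blowUp (M : Set (LocalSubring F)) (P : LocalSubring F) : Set (LocalSubring F) :=
  {Q | ∃ R ∈ M, ∃ g ∈ idealAt P R, g ≠ 0 ∧ Q ∈ specModel (blowUpChart R (idealAt P R) g)}

/-- `U` is a Zariski open subset of the variety `X`. -/
def IsOpenIn (X U : Set (LocalSubring F)) : Prop :=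
  U ⊆ X ∧ ∀ R ∈ U, ∃ S : Finset F, (∀ x ∈ S, x ∈ R.toSubring) ∧
    ∀ R' ∈ X, (∀ x ∈ S, x ∈ R'.toSubring) → R' ∈ U

/-- The complement of `U` in `X` has codimension at least two: all its points have local rings of
Krull dimension at least two. -/
def CodimComplGETwo (X U : Set (LocalSubring F)) : Prop :=
  ∀ R ∈ X, R ∉ U → 2 ≤ ringKrullDim R.toSubring

/-- Let `σ` be the automorphism of the function field given by the pullback of functions along a
birational map `φ : X ⇢ X'`. Then `φ` is a pseudo-isomorphism: it restricts to an isomorphism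
`U ≅ U'` between open subsets whose complements have codimension at least two. (`φ` is a local
isomorphism at `x` with `φ x = x'` if and only if `σ` maps `𝒪_{X',x'}` onto `𝒪_{X,x}`.) -/
def IsPseudoIso (σ : F →+* F) (X X' : Set (LocalSubring F)) : Prop :=
  ∃ U U' : Set (LocalSubring F),
    IsOpenIn X U ∧ CodimComplGETwo X U ∧ IsOpenIn X' U' ∧ CodimComplGETwo X' U' ∧
    LocalSubring.map σ '' U' = U

/-- The prime divisors of `X`, given by their generic points: the points of codimension one. -/
abbrev PrimeDivisor (X : Set (LocalSubring F)) : Type _ :=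
  {R : LocalSubring F // R ∈ X ∧ ringKrullDim R.toSubring = 1}

/-- `x` has order `m` along the prime divisor with local ring `R` (a discrete valuation ring):
`x = u π ^ m` with `π` a uniformizer and `u` a unit. -/
def HasOrd (R : LocalSubring F) (x : F) (m : ℤ) : Prop :=
  ∃ π : R.toSubring, IsLocalRing.maximalIdeal R.toSubring = Ideal.span {π} ∧
    ∃ u : (R.toSubring)ˣ, x = ((u : R.toSubring) : F) * (π : F) ^ m

/-- The group of principal divisors on `X`. -/
def principalDivisors (X : Set (LocalSubring F)) : AddSubgroup (PrimeDivisor X →₀ ℤ) :=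
  AddSubgroup.closure {D | ∃ x : F, x ≠ 0 ∧ ∀ R : PrimeDivisor X, HasOrd R.1 x (D R)}

/-- The group of divisor classes of `X` (divisors modulo linear equivalence). On a smooth
projective rational variety this is `Pic X = NS(X) = H²(X, ℤ)`. -/
abbrev ClassGroup (X : Set (LocalSubring F)) : Type _ :=
  (PrimeDivisor X →₀ ℤ) ⧸ principalDivisors X

/-- The class of a divisor. -/
def divClass (X : Set (LocalSubring F)) (D : PrimeDivisor X →₀ ℤ) : ClassGroup X :=
  QuotientAddGroup.mk D

/-- `D` is the divisor of zeros of the rational function `x` on `X`; for `x = f_n - c` it is the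
(total transform of the) hyperplane `f_n = c`. -/
def IsDivisorOfZeros (X : Set (LocalSubring F)) (x : F) (D : PrimeDivisor X →₀ ℤ) : Prop :=
  ∀ R : PrimeDivisor X, ∃ m : ℤ, HasOrd R.1 x m ∧ D R = max m 0

/-- `Φ` is the pullback of divisor classes along the pseudo-isomorphism `X ⇢ X'` with pullback of
functions `σ`: it takes the class of a prime divisor of `X'` to the class of the prime divisor of
`X` that corresponds to it. -/
def IsPullback (σ : F →+* F) (X X' : Set (LocalSubring F))
    (Φ : ClassGroup X' →+ ClassGroup X) : Prop :=
  ∀ V' : PrimeDivisor X', ∃ V : PrimeDivisor X, V.1 = LocalSubring.map σ V'.1 ∧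
    Φ (divClass X' (Finsupp.single V' 1)) = divClass X (Finsupp.single V 1)

end Models

/-! ### `(ℙ¹)^N`, the centres and the blow-ups `X_a` -/

section Geometry

variable {N : ℕ}

/-- The coordinates of the affine chart of `(ℙ¹)^N` given by `inv`: `1 / f_n` if `inv n`, and `f_n`
otherwise. -/
def chartCoord (inv : ZMod N → Prop) (n : ZMod N) : FunField N :=
  if inv n then (coord n)⁻¹ else coord n

/-- The polynomial functions in the chart coordinates, as rational functions in `f`. -/
def chartHom (inv : ZMod N → Prop) : MvPolynomial (ZMod N) ℂ →ₐ[ℂ] FunField N :=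
  MvPolynomial.aeval (chartCoord inv)

theorem chartHom_injective (inv : ZMod N → Prop) : Function.Injective (chartHom inv) := by
  let S : Submonoid (MvPolynomial (ZMod N) ℂ) := Submonoid.closure (Set.range MvPolynomial.X)
  have hS : S ≤ nonZeroDivisors (MvPolynomial (ZMod N) ℂ) := by
    refine (Submonoid.closure_le).2 ?_
    rintro _ ⟨n, rfl⟩
    exact mem_nonZeroDivisors_of_ne_zero (MvPolynomial.X_ne_zero n)
  let B := Localization S
  have hX : ∀ n : ZMod N, IsUnit (algebraMap (MvPolynomial (ZMod N) ℂ) B (MvPolynomial.X n)) := fun n =>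
    IsLocalization.map_units B (⟨_, Submonoid.subset_closure ⟨n, rfl⟩⟩ : S)
  let y : ZMod N → Bˣ := fun n => if inv n then (hX n).unit⁻¹ else (hX n).unit
  let h₁ : (MvPolynomial (ZMod N) ℂ) →+* B := MvPolynomial.eval₂Hom (algebraMap ℂ B) fun n => (y n : B)
  have h₁X : ∀ n, h₁ (MvPolynomial.X n) = y n := fun n => by simp [h₁]
  have h₁S : ∀ s : S, IsUnit (h₁ s) := by
    rintro ⟨s, hs⟩
    induction hs using Submonoid.closure_induction with
    | mem x hx => obtain ⟨n, rfl⟩ := hx; simp only [h₁X]; exact (y n).isUnit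
    | one => simp
    | mul a c _ _ ha hc => simpa using ha.mul hc
  let η : B →+* B := IsLocalization.lift (M := S) (g := h₁) h₁S
  have hηX : ∀ n, η (algebraMap (MvPolynomial (ZMod N) ℂ) B (MvPolynomial.X n)) = y n := fun n => by
    simp only [η, IsLocalization.lift_eq, h₁X]
  have hηU : ∀ n, η ((hX n).unit⁻¹ : Bˣ) = ((y n)⁻¹ : Bˣ) := fun n => by
    have h1 : η ((hX n).unit⁻¹ : Bˣ) * y n = 1 := by
      rw [← hηX, ← map_mul]
      simp
    exact Units.eq_inv_of_mul_eq_one_right h1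
  have hηη : η.comp η = RingHom.id B := by
    refine IsLocalization.ringHom_ext S (MvPolynomial.ringHom_ext ?_ ?_)
    · intro z
      have h1 : ∀ w : ℂ, η (algebraMap (MvPolynomial (ZMod N) ℂ) B (MvPolynomial.C w)) =
          algebraMap (MvPolynomial (ZMod N) ℂ) B (MvPolynomial.C w) := fun w => by
        simp only [η, IsLocalization.lift_eq, h₁, MvPolynomial.coe_eval₂Hom,
          MvPolynomial.eval₂_C]
        rw [IsScalarTower.algebraMap_apply ℂ (MvPolynomial (ZMod N) ℂ) B,
          MvPolynomial.algebraMap_eq]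
      simp [h1]
    · intro n
      simp only [RingHom.comp_apply, hηX, RingHom.id_apply]
      by_cases h : inv n
      · simp only [y, h, if_true, hηU, inv_inv]
        simp
      · simp only [y, h, if_false, IsUnit.unit_spec, hηX]
  have hη : Function.Injective η := fun a c h => by
    have := congrArg η h
    rwa [← RingHom.comp_apply, ← RingHom.comp_apply, hηη] at this
  have hF : ∀ s : S, IsUnit (algebraMap (MvPolynomial (ZMod N) ℂ) (FunField N) s) := fun s =>
    IsLocalization.map_units (FunField N) (⟨s, hS s.2⟩ : nonZeroDivisors (MvPolynomial (ZMod N) ℂ))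
  let j : B →+* FunField N := IsLocalization.lift (M := S) hF
  have hj : Function.Injective j :=
    (IsLocalization.lift_injective_iff (M := S) hF).2 fun a c => by
      rw [(IsLocalization.injective B hS).eq_iff,
        (IsFractionRing.injective (MvPolynomial (ZMod N) ℂ) (FunField N)).eq_iff]
  have hA : Function.Injective (algebraMap (MvPolynomial (ZMod N) ℂ) B) := IsLocalization.injective B hS
  have key : (chartHom inv).toRingHom = (j.comp η).comp (algebraMap (MvPolynomial (ZMod N) ℂ) B) := by
    refine MvPolynomial.ringHom_ext ?_ ?_
    · intro z
      simp only [RingHom.comp_apply, η, IsLocalization.lift_eq, h₁, MvPolynomial.coe_eval₂Hom,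
        MvPolynomial.eval₂_C, chartHom, AlgHom.toRingHom_eq_coe, RingHom.coe_coe,
        MvPolynomial.algHom_C]
      rw [IsScalarTower.algebraMap_apply ℂ (MvPolynomial (ZMod N) ℂ) B]
      simp only [j, IsLocalization.lift_eq]
      rw [← IsScalarTower.algebraMap_apply]
    · intro n
      simp only [RingHom.comp_apply, hηX, chartHom]
      simp only [AlgHom.toRingHom_eq_coe, RingHom.coe_coe, MvPolynomial.aeval_X, chartCoord]
      have hjX : j (algebraMap (MvPolynomial (ZMod N) ℂ) B (MvPolynomial.X n)) = coord n := by
        simp only [j, IsLocalization.lift_eq, coord]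
      by_cases h : inv n
      · simp only [y, h, if_true]
        refine (eq_inv_of_mul_eq_one_left ?_).symm
        rw [← hjX, ← map_mul]
        simp
      · simp only [y, h, if_false, IsUnit.unit_spec, hjX]
  intro a c h
  have h' : (chartHom inv).toRingHom a = (chartHom inv).toRingHom c := h
  rw [key] at h'
  exact hA (hη (hj h'))

/-- `(ℙ¹)^N`, the union of its `2^N` standard affine charts. -/
def projLineProd (N : ℕ) : Set (LocalSubring (FunField N)) :=
  {Q | ∃ inv : ZMod N → Prop, Q ∈ specModel (chartHom inv).toRingHom.range}

/-- The ideal of polynomials vanishing on the linear subspace `y_n = c n` (for those `n` for which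
`c n` is a number; `y_n` is free if `c n = none`). -/
def linearIdeal (c : ZMod N → Option ℂ) : Ideal (MvPolynomial (ZMod N) ℂ) :=
  RingHom.ker (MvPolynomial.aeval (R := ℂ)
    (fun n => (c n).elim (MvPolynomial.X n) (fun z => MvPolynomial.C z)) :
      MvPolynomial (ZMod N) ℂ →ₐ[ℂ] MvPolynomial (ZMod N) ℂ).toRingHom

instance (c : ZMod N → Option ℂ) : (linearIdeal c).IsPrime := RingHom.ker_isPrime _

/-- The chart ring is a polynomial ring. -/
def chartEquiv (inv : ZMod N → Prop) :
    MvPolynomial (ZMod N) ℂ ≃+* (chartHom inv).toRingHom.range :=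
  RingEquiv.ofBijective (chartHom inv).toRingHom.rangeRestrict
    ⟨fun _ _ h => chartHom_injective inv (congrArg Subtype.val h),
      (chartHom inv).toRingHom.rangeRestrict_surjective⟩

/-- The generic point (local ring) of the subvariety `{y_n = c n}` of the affine chart. -/
def linearPoint (inv : ZMod N → Prop) (c : ZMod N → Option ℂ) : LocalSubring (FunField N) :=
  LocalSubring.ofPrime (chartHom inv).toRingHom.range
    ((linearIdeal c).comap ((chartEquiv inv).symm : _ →+* _))

variable {k l : ZMod N → ℕ}

/-- The generic point of the centre `C_n^i`. For `i ≥ 1` this is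
`{f_{n-1} = 0, f_n = -u_n^i, f_{n+1} = ∞}`, and for `i = -j ≤ -1` it is
`{f_{n-1} = ∞, f_n = -1/v_n^{-j}, f_{n+1} = 0}`. -/
def centre (p : ℕ) (b : Root k l → ℂ) (c : Label k l) : LocalSubring (FunField N) :=
  if 0 < c.1.2 then
    linearPoint (fun m => m = c.1.1 + 1)
      (fun m => if m = c.1.1 - 1 ∨ m = c.1.1 + 1 then some 0
        else if m = c.1.1 then some (-uSeq p b c.1.1 c.1.2.natAbs) else none)
  else
    linearPoint (fun m => m = c.1.1 - 1)
      (fun m => if m = c.1.1 - 1 ∨ m = c.1.1 + 1 then some 0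
        else if m = c.1.1 then some (-1 / vSeq p b c.1.1 c.1.2.natAbs) else none)

/-- The centres `C_n^i` (for all labels) are pairwise distinct. -/
def DistinctCentres (p : ℕ) (b : Root k l → ℂ) : Prop :=
  Function.Injective (centre p b)

/-- A list that contains every label exactly once: an order in which to blow up the centres. -/
def IsOrdering (o : List (Label k l)) : Prop := o.Nodup ∧ ∀ c, c ∈ o

/-- `X_a`: the blow-up of `(ℙ¹)^N` along the centres, one after another in the order `o`. In each
step the strict transform of the centre is blown up; it has the same generic point as the centre,
since no centre contains another one. -/
def blowUpX (p : ℕ) (b : Root k l → ℂ) (o : List (Label k l)) :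
    Set (LocalSubring (FunField N)) :=
  o.foldl (fun M c => blowUp M (centre p b c)) (projLineProd N)

/-- `ι` identifies the lattice with basis `H_n, E_n^i` with the divisor class group of `X = X_a`,
and `κ` identifies the lattice with basis `h_n, e_n^i` with the dual group, so that the pair is the
Néron–Severi bilattice `N(X) = (H²(X, ℤ), H₂(X, ℤ))`:
`H_n` is the class of any hyperplane `{f_n = z}`, `E_n^i` is the class of the exceptional divisor
over `C_n^i` (the unique prime divisor of `X` whose generic point lies over that of `C_n^i`), and
the evaluation of functionals on classes is the intersection pairing. -/
def IsBilattice (p : ℕ) (b : Root k l → ℂ) (X : Set (LocalSubring (FunField N)))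
    (ι : Lat k l ≃+ ClassGroup X) (κ : Lat k l ≃+ (ClassGroup X →+ ℤ)) : Prop :=
  (∀ (n : ZMod N) (z : ℂ), ∃ D : PrimeDivisor X →₀ ℤ,
    IsDivisorOfZeros X (coord n - algebraMap ℂ (FunField N) z) D ∧ ι (latH k l n) = divClass X D) ∧
  (∀ c : Label k l, ∃ V : PrimeDivisor X, (∀ V' : PrimeDivisor X, centre p b c ≤ V'.1 ↔ V' = V) ∧
    ι (latE k l c.1.1 c.1.2) = divClass X (Finsupp.single V 1)) ∧
  (∀ x y : Lat k l, κ y (ι x) = pairing x y)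

end Geometry

end TropicalWeyl

end

noncomputable section

set_option linter.unusedSectionVars false

open scoped Classical

namespace TropicalWeyl

/-! ### Systems of generators of a rational function field -/

section Coordinates

variable {ι κ K F : Type*} [Field K] [Field F] [Algebra K F]

/-! The parameters of row `n` form one sequence `W_θ`, `1 - ℓ_n ≤ θ ≤ k_n` (`par`): `W_θ = u_n^θ`
for `θ ≥ 1` and `W_θ = 1 / v_n^{θ-1}` for `θ ≤ 0`, with `W_{θ+1} = a_n^θ W_θ` throughout
(`par_succ`). The reflection `s_n^i` exchanges `W_i` and `W_{i+1}` in row `n` (`par_actRoot_same`).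
For `i = 0` it also rescales the two neighbouring rows, by a power of `a_n^0` that depends only on
whether `θ` is positive (`par_actRoot_adj`). It multiplies `f_{n-1}` and `f_{n+1}` by monomials
times `Y_n` and `1 / Y_n`, where `Y_n = (f_n + W_0) / (f_n + W_1)`.

Weyl group. The images of the generators again generate the field. Their number is the transcendence
degree, so they are algebraically independent and the formulas define automorphisms. A product of
reflections is computed by iterating the substitution. The relations then reduce to statements about
`Y`: exchanging `W_0` and `W_1` inverts it, non-adjacent reflections preserve it, and for adjacent
vertices it satisfies the multiplicative identity `parQuot_braid`. That identity telescopes inside a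
row and is a rational function identity between neighbouring rows.

Pseudo-isomorphism. Blowing up a linear subspace of affine space gives charts that are affine
spaces, and in these the remaining centres are again coordinate subspaces of codimension three
(`IsGood.blowUp`). Hence every `X_a` is separated, of finite type and locally an affine space, and
its points of codimension at most one are those of `(ℙ¹)^N` together with one exceptional divisor
for each centre (`isBlowUpOf_blowUpX`). It suffices that the map is defined, in both directions, at
these points (`isPseudoIso_of_codim`). For `i ≠ 0` the map is the identity on `f` and two centres
trade places. For `i = 0` it is an elementary transformation (`ElemTransf`): the divisors `f_n =
-W_0` and `f_n = -W_1` on one side correspond to the exceptional divisors over `C_n^{-1}` and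
`C_n^1` on the other, while every other exceptional divisor corresponds to the one with the same
label (`mapLoc_hyper`, `mapLoc_exc`). Genericity ensures `W_0 ≠ W_1` and that no further centre of
row `n` lies on these two hyperplanes.

Divisor classes. The ring `ℂ[f]` is factorial and its units are constants. So the class group is
free on the divisors that miss `Spec ℂ[f]`, namely the `f_m = ∞` and the exceptional ones; a
triangular change of basis gives `H_m`, `E_c` (`latHom_injective`, `latHom_surjective`). The
pullback is computed on this basis. The hyperplane `f_n = -W_0` has class `H_n - E_n^{-1}`, and the
zero divisor of the image of `f_{n±1}` is read off from the orders of its factors (`zeroDiv_σ_α`).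
This gives `H_{n±1} + α_n^0`. The statement on `H_2` follows because the pairing is perfect, the two
reflections are adjoint, and the reflection on `H^2` is an involution. -/

/-- `y` is an algebraically independent family that generates the field extension `F / K`. -/
structure IsCoord (K : Type*) {F ι : Type*} [Field K] [Field F] [Algebra K F] (y : ι → F) :
    Prop where
  indep : AlgebraicIndependent K y
  top : IntermediateField.adjoin K (Set.range y) = ⊤

theorem isAlgebraic_adjoin_of_adjoin_eq_top {s : Set F} (h : IntermediateField.adjoin K s = ⊤) :
    Algebra.IsAlgebraic (Algebra.adjoin K s) F := by
  constructor
  intro x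
  have hx : x ∈ IntermediateField.adjoin K s := h ▸ IntermediateField.mem_top
  obtain ⟨a, ha, c, hc, rfl⟩ := IntermediateField.mem_adjoin_iff_div.1 hx
  rw [div_eq_mul_inv]
  exact (isAlgebraic_algebraMap (A := F) (⟨a, ha⟩ : Algebra.adjoin K s)).mul
    (isAlgebraic_algebraMap (A := F) (⟨c, hc⟩ : Algebra.adjoin K s)).inv

/-- A generating family with as many members as the transcendence degree must be algebraically
independent. Thus a substitution defines an automorphism as soon as the old coordinates can be
recovered from the new ones. -/
theorem IsCoord.of_adjoin_eq_top [Finite ι] {y w : ι → F} (hy : IsCoord K y)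
    (hw : IntermediateField.adjoin K (Set.range w) = ⊤) : IsCoord K w := by
  refine ⟨?_, hw⟩
  have h1 := isAlgebraic_adjoin_of_adjoin_eq_top hy.top
  have h2 := isAlgebraic_adjoin_of_adjoin_eq_top hw
  have h3 : IsTranscendenceBasis K y := hy.indep.isTranscendenceBasis_iff_isAlgebraic.2 h1
  refine (Algebra.IsAlgebraic.isTranscendenceBasis_of_lift_le_trdeg_of_finite K w ?_).1
  exact h3.lift_cardinalMk_eq_trdeg.le

theorem IsCoord.exists_equiv {y w : ι → F} (hy : IsCoord K y) (hw : IsCoord K w) :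
    ∃ σ : F ≃ₐ[K] F, ∀ i, σ (y i) = w i := by
  let e1 := hy.indep.aevalEquivField
  let e2 := hw.indep.aevalEquivField
  let t1 := (IntermediateField.equivOfEq hy.top).trans IntermediateField.topEquiv
  let t2 := (IntermediateField.equivOfEq hw.top).trans IntermediateField.topEquiv
  refine ⟨(t1.symm.trans e1.symm).trans (e2.trans t2), fun i => ?_⟩
  have h1 : t1.symm (y i) = e1 (algebraMap (MvPolynomial ι K) (FractionRing (MvPolynomial ι K)) (MvPolynomial.X i)) := by
    rw [AlgEquiv.symm_apply_eq]
    change y i = ((e1 (algebraMap (MvPolynomial ι K) (FractionRing (MvPolynomial ι K)) (MvPolynomial.X i)) : IntermediateField.adjoin K (Set.range y)) : F)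
    simp [e1]
  have h2 : t2 (e2 (algebraMap (MvPolynomial ι K) (FractionRing (MvPolynomial ι K)) (MvPolynomial.X i))) = w i := by
    change ((e2 (algebraMap (MvPolynomial ι K) (FractionRing (MvPolynomial ι K)) (MvPolynomial.X i)) : IntermediateField.adjoin K (Set.range w)) : F) = w i
    simp [e2]
  simp [h1, h2]

theorem algHom_ext_of_adjoin_eq_top {L : Type*} [Field L] [Algebra K L] {s : Set F}
    (hs : IntermediateField.adjoin K s = ⊤) {f g : F →ₐ[K] L} (h : ∀ x ∈ s, f x = g x) : f = g := by
  ext x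
  have hx : x ∈ IntermediateField.adjoin K s := hs ▸ IntermediateField.mem_top
  induction hx using IntermediateField.adjoin_induction with
  | mem x hx => exact h x hx
  | algebraMap x => simp
  | add x y _ _ hx hy => simp [hx, hy]
  | inv x _ hx => simp [hx]
  | mul x y _ _ hx hy => simp [hx, hy]

theorem adjoin_eq_top_of_mem {s t : Set F} (hs : IntermediateField.adjoin K s = ⊤)
    (h : ∀ x ∈ s, x ∈ IntermediateField.adjoin K t) : IntermediateField.adjoin K t = ⊤ :=
  top_le_iff.1 (hs ▸ IntermediateField.adjoin_le_iff.2 h)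

theorem IsCoord.of_mem [Finite ι] {y w : ι → F} (hy : IsCoord K y)
    (h : ∀ i, y i ∈ IntermediateField.adjoin K (Set.range w)) : IsCoord K w :=
  hy.of_adjoin_eq_top (adjoin_eq_top_of_mem hy.top (by rintro _ ⟨i, rfl⟩; exact h i))

theorem IsCoord.ne_zero {y : ι → F} (hy : IsCoord K y) (i : ι) : y i ≠ 0 := hy.indep.ne_zero i

theorem IsCoord.aeval_injective {y : ι → F} (hy : IsCoord K y) :
    Function.Injective (MvPolynomial.aeval y : MvPolynomial ι K →ₐ[K] F) := hy.indep

theorem IsCoord.exists_div {y : ι → F} (hy : IsCoord K y) (x : F) :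
    ∃ a c : MvPolynomial ι K, c ≠ 0 ∧ x = MvPolynomial.aeval y a / MvPolynomial.aeval y c := by
  have hx : x ∈ IntermediateField.adjoin K (Set.range y) := hy.top ▸ IntermediateField.mem_top
  rw [IntermediateField.mem_adjoin_range_iff] at hx
  obtain ⟨a, c, rfl⟩ := hx
  by_cases hc : c = 0
  · exact ⟨0, 1, one_ne_zero, by simp [hc]⟩
  · exact ⟨a, c, hc, rfl⟩

end Coordinates

/-! ### Local subrings -/

section Local

variable {F : Type*} [Field F]

theorem isUnit_toSubring_iff {Q : LocalSubring F} (x : Q.toSubring) :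
    IsUnit x ↔ (x : F) ≠ 0 ∧ (x : F)⁻¹ ∈ Q.toSubring := by
  constructor
  · rintro ⟨u, rfl⟩
    have h : ((u : Q.toSubring) : F) * ((u⁻¹ : Q.toSubringˣ) : Q.toSubring) = 1 := by
      rw [← Subring.coe_mul, Units.mul_inv]; rfl
    refine ⟨left_ne_zero_of_mul_eq_one h, ?_⟩
    rw [inv_eq_of_mul_eq_one_right h]
    exact Subtype.coe_prop _
  · rintro ⟨h0, h⟩
    exact IsUnit.of_mul_eq_one ⟨_, h⟩ (Subtype.ext (mul_inv_cancel₀ h0))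

/-- `x` is a non-unit of the local ring `Q`. -/
def InMax (Q : LocalSubring F) (x : F) : Prop :=
  x ∈ Q.toSubring ∧ (x = 0 ∨ x⁻¹ ∉ Q.toSubring)

theorem inMax_iff {Q : LocalSubring F} {x : F} (hx : x ∈ Q.toSubring) :
    InMax Q x ↔ (⟨x, hx⟩ : Q.toSubring) ∈ IsLocalRing.maximalIdeal Q.toSubring := by
  rw [IsLocalRing.mem_maximalIdeal, mem_nonunits_iff, isUnit_toSubring_iff, InMax]
  simp only [hx, true_and, not_and_or, not_not]

theorem InMax.add {Q : LocalSubring F} {x y : F} (hx : InMax Q x) (hy : InMax Q y) :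
    InMax Q (x + y) :=
  (inMax_iff (add_mem hx.1 hy.1)).2 (add_mem ((inMax_iff hx.1).1 hx) ((inMax_iff hy.1).1 hy))

theorem InMax.neg {Q : LocalSubring F} {x : F} (hx : InMax Q x) : InMax Q (-x) :=
  (inMax_iff (neg_mem hx.1)).2 (neg_mem ((inMax_iff hx.1).1 hx))

theorem InMax.sub {Q : LocalSubring F} {x y : F} (hx : InMax Q x) (hy : InMax Q y) :
    InMax Q (x - y) := sub_eq_add_neg x y ▸ hx.add hy.neg

theorem InMax.mul_left {Q : LocalSubring F} {x y : F} (hx : x ∈ Q.toSubring) (hy : InMax Q y) :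
    InMax Q (x * y) :=
  (inMax_iff (mul_mem hx hy.1)).2
    (Ideal.mul_mem_left _ (⟨x, hx⟩ : Q.toSubring) ((inMax_iff hy.1).1 hy))

theorem InMax.mul_right {Q : LocalSubring F} {x y : F} (hx : InMax Q x) (hy : y ∈ Q.toSubring) :
    InMax Q (x * y) := mul_comm y x ▸ hx.mul_left hy

theorem inMax_zero (Q : LocalSubring F) : InMax Q 0 := ⟨zero_mem _, Or.inl rfl⟩

theorem not_inMax_one (Q : LocalSubring F) : ¬ InMax Q 1 := by
  simp [InMax, one_mem]

theorem InMax.ne_zero_imp {Q : LocalSubring F} {x : F} (h : InMax Q x) (h0 : x ≠ 0) :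
    x⁻¹ ∉ Q.toSubring := h.2.resolve_left h0

theorem not_inMax_iff {Q : LocalSubring F} {x : F} (hx : x ∈ Q.toSubring) :
    ¬ InMax Q x ↔ x ≠ 0 ∧ x⁻¹ ∈ Q.toSubring := by
  simp [InMax, hx]

/-- `x` is a unit of the local ring `Q`. -/
def UnitIn (Q : LocalSubring F) (x : F) : Prop :=
  x ≠ 0 ∧ x ∈ Q.toSubring ∧ x⁻¹ ∈ Q.toSubring

theorem unitIn_iff {Q : LocalSubring F} {x : F} (hx : x ∈ Q.toSubring) :
    UnitIn Q x ↔ ¬ InMax Q x := by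
  rw [not_inMax_iff hx, UnitIn]; tauto

theorem UnitIn.not_inMax {Q : LocalSubring F} {x : F} (h : UnitIn Q x) : ¬ InMax Q x :=
  (unitIn_iff h.2.1).1 h

theorem InMax.not_unitIn {Q : LocalSubring F} {x : F} (h : InMax Q x) : ¬ UnitIn Q x :=
  fun h' => h'.not_inMax h

theorem UnitIn.inv {Q : LocalSubring F} {x : F} (h : UnitIn Q x) : UnitIn Q x⁻¹ :=
  ⟨inv_ne_zero h.1, h.2.2, by rw [inv_inv]; exact h.2.1⟩

theorem UnitIn.mul {Q : LocalSubring F} {x y : F} (hx : UnitIn Q x) (hy : UnitIn Q y) :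
    UnitIn Q (x * y) :=
  ⟨mul_ne_zero hx.1 hy.1, mul_mem hx.2.1 hy.2.1, by rw [mul_inv]; exact mul_mem hx.2.2 hy.2.2⟩

theorem UnitIn.div {Q : LocalSubring F} {x y : F} (hx : UnitIn Q x) (hy : UnitIn Q y) :
    UnitIn Q (x / y) := div_eq_mul_inv x y ▸ hx.mul hy.inv

theorem unitIn_one (Q : LocalSubring F) : UnitIn Q 1 :=
  ⟨one_ne_zero, one_mem _, by rw [inv_one]; exact one_mem _⟩

theorem UnitIn.add_inMax {Q : LocalSubring F} {x y : F} (hx : UnitIn Q x) (hy : InMax Q y) :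
    UnitIn Q (x + y) := by
  rw [unitIn_iff (add_mem hx.2.1 hy.1)]
  intro h
  exact hx.not_inMax (by simpa using h.sub hy)

theorem UnitIn.mono {Q Q' : LocalSubring F} (h : Q.toSubring ≤ Q'.toSubring) {x : F}
    (hx : UnitIn Q x) : UnitIn Q' x := ⟨hx.1, h hx.2.1, h hx.2.2⟩

theorem InMax.of_le {Q Q' : LocalSubring F} (h : Q.toSubring ≤ Q'.toSubring) {x : F}
    (hx : InMax Q' x) (hxQ : x ∈ Q.toSubring) : InMax Q x := by
  by_contra hc
  exact ((unitIn_iff hxQ).2 hc).mono h |>.not_inMax hx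

/-- The order on local subrings is domination: the inclusion is a local homomorphism. It is
rephrased here through elements of `F`, so that no subtypes are needed later. -/
theorem le_iff {P Q : LocalSubring F} :
    P ≤ Q ↔ P.toSubring ≤ Q.toSubring ∧ ∀ x, InMax P x → InMax Q x := by
  rw [LocalSubring.le_def]
  constructor
  · rintro ⟨h, h'⟩
    refine ⟨h, fun x hx => ?_⟩
    by_contra hc
    have hu := (unitIn_iff (h hx.1)).2 hc
    have h1 : IsUnit (Subring.inclusion h ⟨x, hx.1⟩) :=
      (isUnit_toSubring_iff (Q := Q) _).2 ⟨hu.1, hu.2.2⟩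
    have h2 := (isUnit_toSubring_iff (Q := P) ⟨x, hx.1⟩).1 (isUnit_of_map_unit _ _ h1)
    exact hx.ne_zero_imp h2.1 h2.2
  · rintro ⟨h, h'⟩
    refine ⟨h, ⟨fun x hx => ?_⟩⟩
    have h1 := (isUnit_toSubring_iff (Q := Q) _).1 hx
    by_contra hc
    have : InMax P (x : F) := (inMax_iff x.2).2 ((IsLocalRing.mem_maximalIdeal _).2 hc)
    exact (h' _ this).ne_zero_imp h1.1 h1.2

theorem UnitIn.of_le {P Q : LocalSubring F} (h : P ≤ Q) {x : F} (hx : x ∈ P.toSubring)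
    (hu : UnitIn Q x) : UnitIn P x := by
  rw [unitIn_iff hx]; intro hc; exact hu.not_inMax ((le_iff.1 h).2 x hc)

theorem InMax.mono {P Q : LocalSubring F} (h : P ≤ Q) {x : F} (hx : InMax P x) : InMax Q x :=
  (le_iff.1 h).2 x hx

theorem mem_ofPrime_iff {A : Subring F} (q : Ideal A) [q.IsPrime] (x : F) :
    x ∈ (LocalSubring.ofPrime A q).toSubring ↔
      ∃ a s : A, s ∉ q ∧ x = (a : F) / (s : F) := by
  constructor
  · intro hx
    obtain ⟨a, s, h⟩ := IsLocalization.exists_mk'_eq q.primeCompl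
      (⟨x, hx⟩ : (LocalSubring.ofPrime A q).toSubring)
    refine ⟨a, s, s.2, ?_⟩
    have hs0 : ((s : A) : F) ≠ 0 := fun h0 => s.2 (by
      rw [show (s : A) = 0 from Subtype.ext h0]; exact q.zero_mem)
    rw [eq_div_iff hs0]
    have := IsLocalization.mk'_spec (LocalSubring.ofPrime A q).toSubring a s
    rw [h] at this
    exact congrArg Subtype.val this
  · rintro ⟨a, s, hs, rfl⟩
    have hs0 : ((s : A) : F) ≠ 0 := fun h0 => hs (by
      rw [show (s : A) = 0 from Subtype.ext h0]; exact q.zero_mem)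
    have := IsLocalization.mk'_spec (LocalSubring.ofPrime A q).toSubring a (⟨s, hs⟩ : q.primeCompl)
    have h2 := congrArg Subtype.val this
    have h3 : ((IsLocalization.mk' (LocalSubring.ofPrime A q).toSubring a (⟨s, hs⟩ : q.primeCompl) :
      (LocalSubring.ofPrime A q).toSubring) : F) = (a : F) / s := by
      rw [eq_div_iff hs0]; exact h2
    rw [← h3]
    exact Subtype.coe_prop _

theorem inMax_ofPrime_iff {A : Subring F} (q : Ideal A) [q.IsPrime] (a : A) :
    InMax (LocalSubring.ofPrime A q) (a : F) ↔ a ∈ q := by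
  have ha := LocalSubring.le_ofPrime A q a.2
  rw [inMax_iff ha]
  have := IsLocalization.AtPrime.to_map_mem_maximal_iff (LocalSubring.ofPrime A q).toSubring q a
  exact this

/-- The prime is forced: it is the contraction of the maximal ideal of `Q`. So being a point of
`Spec A` only means that `Q` contains `A` and consists of fractions over `A` whose denominators are
units of `Q`. -/
theorem mem_specModel_iff {A : Subring F} {Q : LocalSubring F} :
    Q ∈ specModel A ↔ A ≤ Q.toSubring ∧
      ∀ x ∈ Q.toSubring, ∃ a ∈ A, ∃ s ∈ A, UnitIn Q s ∧ x = a / s := by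
  constructor
  · rintro ⟨q, hq, rfl⟩
    refine ⟨LocalSubring.le_ofPrime A q, fun x hx => ?_⟩
    obtain ⟨a, s, hs, rfl⟩ := (mem_ofPrime_iff q x).1 hx
    refine ⟨a, a.2, s, s.2, ?_, rfl⟩
    rw [unitIn_iff (LocalSubring.le_ofPrime A q s.2), inMax_ofPrime_iff]
    exact hs
  · rintro ⟨hA, h⟩
    refine ⟨(IsLocalRing.maximalIdeal Q.toSubring).comap (Subring.inclusion hA), inferInstance, ?_⟩
    apply LocalSubring.toSubring_injective
    ext x
    rw [mem_ofPrime_iff]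
    have key : ∀ s : A, s ∉ (IsLocalRing.maximalIdeal Q.toSubring).comap (Subring.inclusion hA) ↔
        UnitIn Q (s : F) := fun s => by
      rw [unitIn_iff (hA s.2), inMax_iff (hA s.2)]; rfl
    constructor
    · intro hx
      obtain ⟨a, ha, s, hs, hu, rfl⟩ := h x hx
      exact ⟨⟨a, ha⟩, ⟨s, hs⟩, (key _).2 hu, rfl⟩
    · rintro ⟨a, s, hs, rfl⟩
      rw [div_eq_mul_inv]
      exact mul_mem (hA a.2) ((key s).1 hs).2.2

/-- The subring of fractions `a / s` with `a, s ∈ A` and `s` a unit of `Q`. -/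
def fracIn (A : Subring F) (Q : LocalSubring F) : Subring F where
  carrier := {x | ∃ a ∈ A, ∃ s ∈ A, UnitIn Q s ∧ x = a / s}
  mul_mem' := by
    rintro _ _ ⟨a, ha, s, hs, hu, rfl⟩ ⟨a', ha', s', hs', hu', rfl⟩
    exact ⟨_, mul_mem ha ha', _, mul_mem hs hs', hu.mul hu', div_mul_div_comm _ _ _ _⟩
  one_mem' := ⟨1, one_mem _, 1, one_mem _, unitIn_one Q, by simp⟩
  add_mem' := by
    rintro _ _ ⟨a, ha, s, hs, hu, rfl⟩ ⟨a', ha', s', hs', hu', rfl⟩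
    exact ⟨_, add_mem (mul_mem ha hs') (mul_mem hs ha'), _, mul_mem hs hs', hu.mul hu',
      div_add_div _ _ hu.1 hu'.1⟩
  zero_mem' := ⟨0, zero_mem _, 1, one_mem _, unitIn_one Q, by simp⟩
  neg_mem' := by
    rintro _ ⟨a, ha, s, hs, hu, rfl⟩
    exact ⟨-a, neg_mem ha, s, hs, hu, by rw [neg_div]⟩

theorem le_fracIn (A : Subring F) (Q : LocalSubring F) : A ≤ fracIn A Q := fun a ha =>
  ⟨a, ha, 1, one_mem _, unitIn_one Q, by simp⟩

theorem fracIn_inv_mem {A : Subring F} {Q : LocalSubring F} {x : F}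
    (hx : x ∈ fracIn A Q) (hu : UnitIn Q x) : x⁻¹ ∈ fracIn A Q := by
  obtain ⟨a, ha, s, hs, hu', rfl⟩ := hx
  refine ⟨s, hs, a, ha, ?_, inv_div _ _⟩
  have := hu.mul hu'
  rwa [div_mul_cancel₀ _ hu'.1] at this

theorem mem_specModel_iff_le {A : Subring F} {Q : LocalSubring F} :
    Q ∈ specModel A ↔ A ≤ Q.toSubring ∧ Q.toSubring ≤ fracIn A Q := mem_specModel_iff

theorem le_of_mem_specModel {A : Subring F} {Q : LocalSubring F} (h : Q ∈ specModel A) :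
    A ≤ Q.toSubring := (mem_specModel_iff.1 h).1

/-- If `Q` is a localization of `B` and the elements of `B` are fractions over a subring `A` of `Q`,
then `Q` is a localization of `A`. -/
theorem mem_specModel_of_le_fracIn {A B : Subring F} {Q : LocalSubring F} (hB : Q ∈ specModel B)
    (hA : A ≤ Q.toSubring) (h : B ≤ fracIn A Q) : Q ∈ specModel A := by
  rw [mem_specModel_iff_le]
  refine ⟨hA, fun x hx => ?_⟩
  obtain ⟨a, ha, s, hs, hu, rfl⟩ := (mem_specModel_iff.1 hB).2 x hx
  rw [div_eq_mul_inv]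
  exact mul_mem (h ha) (fracIn_inv_mem (h hs) hu)

theorem mem_specModel_of_le {A B : Subring F} {Q : LocalSubring F} (hB : Q ∈ specModel B)
    (hBA : B ≤ A) (hA : A ≤ Q.toSubring) : Q ∈ specModel A :=
  mem_specModel_of_le_fracIn hB hA (hBA.trans (le_fracIn A Q))

theorem mem_specModel_self (Q : LocalSubring F) : Q ∈ specModel Q.toSubring :=
  mem_specModel_iff_le.2 ⟨le_rfl, le_fracIn _ _⟩

theorem mem_specModel_trans {A : Subring F} {R Q : LocalSubring F} (hR : R ∈ specModel A)
    (hQ : Q ∈ specModel R.toSubring) : Q ∈ specModel A := by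
  have hRQ := le_of_mem_specModel hQ
  refine mem_specModel_of_le_fracIn hQ ((le_of_mem_specModel hR).trans hRQ) fun x hx => ?_
  obtain ⟨a, ha, s, hs, hu, rfl⟩ := (mem_specModel_iff.1 hR).2 x hx
  exact ⟨a, ha, s, hs, hu.mono hRQ, rfl⟩

/-- The localization of `A` at the contraction of the maximal ideal of `Q`. -/
theorem exists_localization {A : Subring F} {Q : LocalSubring F} (hA : A ≤ Q.toSubring) :
    ∃ R ∈ specModel A, R ≤ Q ∧ R.toSubring = fracIn A Q := by
  refine ⟨LocalSubring.ofPrime A ((IsLocalRing.maximalIdeal Q.toSubring).comap (Subring.inclusion hA)),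
    ⟨_, inferInstance, rfl⟩, ?_⟩
  set q := (IsLocalRing.maximalIdeal Q.toSubring).comap (Subring.inclusion hA) with hq
  have key : ∀ s : A, s ∉ q ↔ UnitIn Q (s : F) := fun s => by
    rw [unitIn_iff (hA s.2), inMax_iff (hA s.2)]; rfl
  have h1 : (LocalSubring.ofPrime A q).toSubring = fracIn A Q := by
    ext x
    rw [mem_ofPrime_iff]
    constructor
    · rintro ⟨a, s, hs, rfl⟩
      exact ⟨a, a.2, s, s.2, (key s).1 hs, rfl⟩
    · rintro ⟨a, ha, s, hs, hu, rfl⟩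
      exact ⟨⟨a, ha⟩, ⟨s, hs⟩, (key _).2 hu, rfl⟩
  have h2 : fracIn A Q ≤ Q.toSubring := by
    rintro _ ⟨a, ha, s, hs, hu, rfl⟩
    rw [div_eq_mul_inv]; exact mul_mem (hA ha) hu.2.2
  refine ⟨le_iff.2 ⟨h1.trans_le h2, fun x hx => ?_⟩, h1⟩
  by_contra hc
  have hu := (unitIn_iff (h2 (h1 ▸ hx.1))).2 hc
  have := fracIn_inv_mem (h1 ▸ hx.1) hu
  rw [← h1] at this
  exact hx.ne_zero_imp hu.1 this

/-- Affine schemes are separated: a denominator that is a unit of `Q₁` is a unit of the dominating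
ring `Q`, and domination of `Q₂` by `Q` makes it a unit of `Q₂`. -/
theorem eq_of_mem_specModel_of_le {A : Subring F} {Q₁ Q₂ Q : LocalSubring F}
    (h₁ : Q₁ ∈ specModel A) (h₂ : Q₂ ∈ specModel A) (h₁Q : Q₁ ≤ Q) (h₂Q : Q₂ ≤ Q) : Q₁ = Q₂ := by
  have key : ∀ {Q₁ Q₂ : LocalSubring F}, Q₁ ∈ specModel A → Q₂ ∈ specModel A → Q₁ ≤ Q → Q₂ ≤ Q →
      Q₁.toSubring ≤ Q₂.toSubring := by
    intro Q₁ Q₂ h₁ h₂ h₁Q h₂Q x hx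
    obtain ⟨a, ha, s, hs, hu, rfl⟩ := (mem_specModel_iff.1 h₁).2 x hx
    rw [div_eq_mul_inv]
    exact mul_mem (le_of_mem_specModel h₂ ha)
      ((hu.mono (LocalSubring.toSubring_mono h₁Q)).of_le h₂Q (le_of_mem_specModel h₂ hs)).2.2
  exact LocalSubring.toSubring_injective
    (le_antisymm (key h₁ h₂ h₁Q h₂Q) (key h₂ h₁ h₂Q h₁Q))

/-- The condition says that `R` and `Q` contract to the same prime of `A`, so the localization `R`
of `A` is dominated by `Q`. -/
theorem le_of_mem_specModel_of_inMax {A : Subring F} {R Q : LocalSubring F} (hR : R ∈ specModel A)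
    (hA : A ≤ Q.toSubring) (h : ∀ a ∈ A, InMax R a ↔ InMax Q a) : R ≤ Q := by
  have hu : ∀ s ∈ A, UnitIn R s → UnitIn Q s := fun s hs hu => by
    rw [unitIn_iff (hA hs), ← h s hs]; exact hu.not_inMax
  refine le_iff.2 ⟨fun x hx => ?_, fun x hx => ?_⟩
  · obtain ⟨a, ha, s, hs, hus, rfl⟩ := (mem_specModel_iff.1 hR).2 x hx
    rw [div_eq_mul_inv]
    exact mul_mem (hA ha) (hu s hs hus).2.2
  · obtain ⟨a, ha, s, hs, hus, rfl⟩ := (mem_specModel_iff.1 hR).2 x hx.1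
    rw [div_eq_mul_inv]
    refine InMax.mul_right ((h a ha).1 ?_) (hu s hs hus).2.2
    have := hx.mul_right hus.2.1
    rwa [div_mul_cancel₀ _ hus.1] at this

theorem eq_of_mem_specModel_of_inMax {A : Subring F} {R Q : LocalSubring F} (hR : R ∈ specModel A)
    (hQ : Q ∈ specModel A) (h : ∀ a ∈ A, InMax R a ↔ InMax Q a) : R = Q :=
  le_antisymm (le_of_mem_specModel_of_inMax hR (le_of_mem_specModel hQ) h)
    (le_of_mem_specModel_of_inMax hQ (le_of_mem_specModel hR) fun a ha => (h a ha).symm)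

/-! ### Transport of local rings along field isomorphisms. -/

section Map

variable {F' : Type*} [Field F']

theorem mem_map_iff (σ : F ≃+* F') (Q : LocalSubring F) (x : F') :
    x ∈ (LocalSubring.map (σ : F →+* F') Q).toSubring ↔ σ.symm x ∈ Q.toSubring := by
  constructor
  · rintro ⟨y, hy, rfl⟩
    simpa using hy
  · intro h
    exact ⟨_, h, by simp⟩

theorem apply_mem_map_iff (σ : F ≃+* F') (Q : LocalSubring F) (x : F) :
    σ x ∈ (LocalSubring.map (σ : F →+* F') Q).toSubring ↔ x ∈ Q.toSubring := by
  simp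

theorem inMax_map_iff (σ : F ≃+* F') (Q : LocalSubring F) (x : F) :
    InMax (LocalSubring.map (σ : F →+* F') Q) (σ x) ↔ InMax Q x := by
  simp [InMax, ← map_inv₀]

theorem unitIn_map_iff (σ : F ≃+* F') (Q : LocalSubring F) (x : F) :
    UnitIn (LocalSubring.map (σ : F →+* F') Q) (σ x) ↔ UnitIn Q x := by
  simp [UnitIn, ← map_inv₀]

theorem map_mem_specModel_map (σ : F ≃+* F') {A : Subring F} {Q : LocalSubring F}
    (h : Q ∈ specModel A) :
    LocalSubring.map (σ : F →+* F') Q ∈ specModel (A.map (σ : F →+* F')) := by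
  rw [mem_specModel_iff] at h ⊢
  refine ⟨(Subring.gc_map_comap _).monotone_l h.1, ?_⟩
  rintro _ ⟨x, hx, rfl⟩
  obtain ⟨a, ha, s, hs, hu, rfl⟩ := h.2 x hx
  exact ⟨_, ⟨a, ha, rfl⟩, _, ⟨s, hs, rfl⟩, (unitIn_map_iff σ Q s).2 hu, by simp⟩

theorem map_symm_map (σ : F ≃+* F') (Q : LocalSubring F) :
    LocalSubring.map (σ.symm : F' →+* F) (LocalSubring.map (σ : F →+* F') Q) = Q := by
  apply LocalSubring.toSubring_injective
  ext x
  rw [mem_map_iff σ.symm, mem_map_iff]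
  simp

theorem ringKrullDim_map (σ : F ≃+* F') (Q : LocalSubring F) :
    ringKrullDim (LocalSubring.map (σ : F →+* F') Q).toSubring = ringKrullDim Q.toSubring :=
  (ringKrullDim_eq_of_ringEquiv
    (Q.toSubring.equivMapOfInjective (σ : F →+* F') σ.injective)).symm

end Map

end Local

/-! ### Localizations of polynomial rings -/

section CoordRing

variable {ι F : Type*} [Field F] [Algebra ℂ F]

/-- The subring `ℂ[y]` of `F`. -/
def coordRing (y : ι → F) : Subring F :=
  (MvPolynomial.aeval y : MvPolynomial ι ℂ →ₐ[ℂ] F).toRingHom.range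

variable {y w : ι → F}

theorem aeval_mem_coordRing (y : ι → F) (g : MvPolynomial ι ℂ) :
    MvPolynomial.aeval y g ∈ coordRing y := ⟨g, rfl⟩

theorem coord_mem_coordRing (y : ι → F) (i : ι) : y i ∈ coordRing y :=
  ⟨MvPolynomial.X i, by simp⟩

theorem algebraMap_mem_coordRing (y : ι → F) (z : ℂ) : algebraMap ℂ F z ∈ coordRing y :=
  ⟨MvPolynomial.C z, by simp⟩

theorem aeval_mem_of_mem {B : Subring F} (hC : ∀ z : ℂ, algebraMap ℂ F z ∈ B)
    (h : ∀ i, y i ∈ B) (g : MvPolynomial ι ℂ) : MvPolynomial.aeval y g ∈ B := by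
  induction g using MvPolynomial.induction_on with
  | C z => simpa using hC z
  | add p q hp hq => rw [map_add]; exact add_mem hp hq
  | mul_X p i hp => rw [map_mul, MvPolynomial.aeval_X]; exact mul_mem hp (h i)

theorem coordRing_le {B : Subring F} (hC : ∀ z : ℂ, algebraMap ℂ F z ∈ B)
    (h : ∀ i, y i ∈ B) : coordRing y ≤ B := by
  rintro _ ⟨g, rfl⟩
  exact aeval_mem_of_mem hC h g

theorem algebraMap_mem_of_mem_specModel {Q : LocalSubring F} (h : Q ∈ specModel (coordRing y))
    (z : ℂ) : algebraMap ℂ F z ∈ Q.toSubring :=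
  le_of_mem_specModel h (algebraMap_mem_coordRing y z)

theorem coord_mem_of_mem_specModel {Q : LocalSubring F} (h : Q ∈ specModel (coordRing y))
    (i : ι) : y i ∈ Q.toSubring :=
  le_of_mem_specModel h (coord_mem_coordRing y i)

/-- The local ring contains the constants. -/
def ContainsC (Q : LocalSubring F) : Prop := ∀ z : ℂ, algebraMap ℂ F z ∈ Q.toSubring

theorem ContainsC.unitIn {Q : LocalSubring F} (h : ContainsC Q) {z : ℂ} (hz : z ≠ 0) :
    UnitIn Q (algebraMap ℂ F z) :=
  ⟨by simpa using hz, h z, by rw [← map_inv₀]; exact h _⟩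

theorem mem_specModel_coordRing {κ : Type*} {w : κ → F} {Q : LocalSubring F}
    (hQ : Q ∈ specModel (coordRing w)) (hy : ∀ i, y i ∈ Q.toSubring)
    (h : ∀ i, w i ∈ fracIn (coordRing y) Q) : Q ∈ specModel (coordRing y) := by
  have hC := algebraMap_mem_of_mem_specModel hQ
  exact mem_specModel_of_le_fracIn hQ (coordRing_le hC hy)
    (coordRing_le (fun z => le_fracIn _ _ (algebraMap_mem_coordRing y z)) h)

/-- Restriction of polynomials to the linear subspace `X_t = 0` (`t ∈ T`). -/
def restr (T : Finset ι) : MvPolynomial ι ℂ →ₐ[ℂ] MvPolynomial ι ℂ :=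
  MvPolynomial.aeval fun j => if j ∈ T then 0 else MvPolynomial.X j

theorem restr_X_of_mem {T : Finset ι} {i : ι} (h : i ∈ T) :
    restr T (MvPolynomial.X i) = 0 := by simp [restr, h]

theorem restr_X_of_notMem {T : Finset ι} {i : ι} (h : i ∉ T) :
    restr T (MvPolynomial.X i) = MvPolynomial.X i := by simp [restr, h]

/-- Modulo the ideal of the subspace, the restriction and the identity are algebra homomorphisms
that agree on the variables. -/
theorem sub_restr_mem_span (T : Finset ι) (g : MvPolynomial ι ℂ) :
    g - restr T g ∈ Ideal.span (MvPolynomial.X '' (T : Set ι)) := by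
  rw [← Ideal.Quotient.eq]
  have : (Ideal.Quotient.mkₐ ℂ (Ideal.span (MvPolynomial.X '' (T : Set ι)))) =
      (Ideal.Quotient.mkₐ ℂ (Ideal.span (MvPolynomial.X '' (T : Set ι)))).comp (restr T) := by
    apply MvPolynomial.algHom_ext
    intro i
    by_cases h : i ∈ T
    · simp only [AlgHom.comp_apply, restr_X_of_mem h, map_zero]
      exact Ideal.Quotient.eq_zero_iff_mem.2 (Ideal.subset_span ⟨i, h, rfl⟩)
    · simp [restr_X_of_notMem h]
  exact DFunLike.congr_fun this g

theorem restr_eq_zero_iff {T : Finset ι} {g : MvPolynomial ι ℂ} :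
    restr T g = 0 ↔ g ∈ Ideal.span (MvPolynomial.X '' (T : Set ι)) := by
  constructor
  · intro h
    simpa [h] using sub_restr_mem_span T g
  · intro h
    have h2 : Ideal.span (MvPolynomial.X '' (T : Set ι)) ≤ RingHom.ker (restr T) := by
      rw [Ideal.span_le]
      rintro _ ⟨i, hi, rfl⟩
      exact restr_X_of_mem hi
    exact h2 h

theorem restr_singleton_eq_zero_iff {i : ι} {g : MvPolynomial ι ℂ} :
    restr {i} g = 0 ↔ g ∈ Ideal.span {(MvPolynomial.X i : MvPolynomial ι ℂ)} := by
  rw [restr_eq_zero_iff]; simp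

/-- `Q` is the local ring of `Spec ℂ[y]` at the generic point of the linear subspace
`y_t = 0` (`t ∈ T`). -/
def IsLin (y : ι → F) (T : Finset ι) (Q : LocalSubring F) : Prop :=
  Q ∈ specModel (coordRing y) ∧
    ∀ g : MvPolynomial ι ℂ, InMax Q (MvPolynomial.aeval y g) ↔ restr T g = 0

theorem IsLin.containsC {T : Finset ι} {Q : LocalSubring F} (h : IsLin y T Q) : ContainsC Q :=
  algebraMap_mem_of_mem_specModel h.1

theorem IsLin.inMax {T : Finset ι} {Q : LocalSubring F} (h : IsLin y T Q) {i : ι} (hi : i ∈ T) :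
    InMax Q (y i) := by
  have := (h.2 (MvPolynomial.X i)).2 (restr_X_of_mem hi)
  simpa using this

theorem IsLin.unique {T : Finset ι} {P Q : LocalSubring F} (hP : IsLin y T P)
    (hQ : IsLin y T Q) : P = Q := by
  refine eq_of_mem_specModel_of_inMax hP.1 hQ.1 ?_
  rintro _ ⟨g, rfl⟩
  exact (hP.2 g).trans (hQ.2 g).symm

/-- The field of rational functions in the free coordinates is contained in the local ring of a
linear subspace. -/
theorem IsLin.unitIn_of_mem_adjoin {T : Finset ι} {P : LocalSubring F} (hP : IsLin y T P)
    {x : F} (hx : x ∈ IntermediateField.adjoin ℂ (Set.range fun j : {j // j ∉ T} => y j))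
    (h0 : x ≠ 0) : UnitIn P x := by
  rw [IntermediateField.mem_adjoin_range_iff] at hx
  obtain ⟨a, c, rfl⟩ := hx
  have key : ∀ a : MvPolynomial {j // j ∉ T} ℂ,
      MvPolynomial.aeval (fun j : {j // j ∉ T} => y j) a ≠ 0 →
      UnitIn P (MvPolynomial.aeval (fun j : {j // j ∉ T} => y j) a) := by
    intro a ha
    have h1 : MvPolynomial.aeval (fun j : {j // j ∉ T} => y j) a =
        MvPolynomial.aeval y (MvPolynomial.rename Subtype.val a) := by
      rw [MvPolynomial.aeval_rename]; rfl
    have h2 : restr T (MvPolynomial.rename Subtype.val a) = MvPolynomial.rename Subtype.val a := by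
      have : (restr T).comp (MvPolynomial.rename (Subtype.val : {j // j ∉ T} → ι)) =
          MvPolynomial.rename Subtype.val := by
        apply MvPolynomial.algHom_ext
        rintro ⟨j, hj⟩
        simp [restr_X_of_notMem hj]
      exact DFunLike.congr_fun this a
    rw [h1] at ha ⊢
    rw [unitIn_iff (le_of_mem_specModel hP.1 (aeval_mem_coordRing y _)), hP.2, h2]
    intro h3
    exact ha (by rw [h3, map_zero])
  exact (key a (left_ne_zero_of_mul (div_eq_mul_inv (G := F) _ _ ▸ h0))).div
    (key c (fun h => h0 (by rw [h, div_zero])))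

theorem IsLin.unitIn {T : Finset ι} {Q : LocalSubring F} (h : IsLin y T Q) {i : ι} (hi : i ∉ T) :
    UnitIn Q (y i) := by
  rw [unitIn_iff (coord_mem_of_mem_specModel h.1 i)]
  have := h.2 (MvPolynomial.X i)
  rw [MvPolynomial.aeval_X] at this
  rw [this, restr_X_of_notMem hi]
  exact MvPolynomial.X_ne_zero i

theorem aeval_sub_restr_inMax {T : Finset ι} {Q : LocalSubring F} (hQ : Q ∈ specModel (coordRing y))
    (hT : ∀ t ∈ T, InMax Q (y t)) (g : MvPolynomial ι ℂ) :
    InMax Q (MvPolynomial.aeval y g - MvPolynomial.aeval y (restr T g)) := by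
  rw [← map_sub]
  have h := sub_restr_mem_span T g
  generalize g - restr T g = r at h
  induction h using Submodule.span_induction with
  | mem x hx =>
    obtain ⟨t, ht, rfl⟩ := hx
    simpa using hT t ht
  | zero => simpa using inMax_zero Q
  | add x y _ _ hx hy => rw [map_add]; exact hx.add hy
  | smul a x _ hx =>
    rw [smul_eq_mul, map_mul]
    exact hx.mul_left (le_of_mem_specModel hQ (aeval_mem_coordRing y a))

theorem aeval_mem_adjoin_range {κ : Type*} (z : κ → F) (a : MvPolynomial κ ℂ) (s : Set F)
    (h : ∀ j, z j ∈ IntermediateField.adjoin ℂ s) :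
    MvPolynomial.aeval z a ∈ IntermediateField.adjoin ℂ s :=
  aeval_mem_of_mem (B := (IntermediateField.adjoin ℂ s).toSubalgebra.toSubring)
    (fun z => (IntermediateField.adjoin ℂ s).algebraMap_mem z) h a

/-- Change of linear coordinates at the generic point of a linear subspace. -/
theorem IsLin.change {T : Finset ι} {P : LocalSubring F} (hP : IsLin y T P) (hw : IsCoord ℂ w)
    (hPw : P ∈ specModel (coordRing w)) (hT : ∀ t ∈ T, InMax P (w t))
    (hfree : ∀ j, j ∉ T →
      w j ∈ IntermediateField.adjoin ℂ (Set.range fun j : {j // j ∉ T} => y j)) :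
    IsLin w T P := by
  refine ⟨hPw, fun g => ?_⟩
  have h1 := aeval_sub_restr_inMax hPw hT g
  constructor
  · intro h
    -- The restriction of `g` becomes a nonzero element of the field generated by the free
    -- coordinates, and such elements are units at `P`; but it differs from a non-unit by a
    -- non-unit.
    by_contra hne
    have h2 : MvPolynomial.aeval w (restr T g) ∈
        IntermediateField.adjoin ℂ (Set.range fun j : {j // j ∉ T} => y j) := by
      rw [restr, ← AlgHom.comp_apply, MvPolynomial.comp_aeval]
      apply aeval_mem_adjoin_range
      intro j
      by_cases hj : j ∈ T
      · simp [hj]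
      · simpa [hj] using hfree j hj
    have h3 : MvPolynomial.aeval w (restr T g) ≠ 0 := fun h0 =>
      hne (hw.aeval_injective (by rw [h0, map_zero]))
    have := h.sub h1
    rw [sub_sub_cancel] at this
    exact (hP.unitIn_of_mem_adjoin h2 h3).not_inMax this
  · intro h
    simpa [h] using h1

theorem exists_isLin (hy : IsCoord ℂ y) (T : Finset ι) : ∃ P, IsLin y T P := by
  let e : MvPolynomial ι ℂ ≃+* coordRing y :=
    RingEquiv.ofBijective (MvPolynomial.aeval y : MvPolynomial ι ℂ →ₐ[ℂ] F).toRingHom.rangeRestrict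
      ⟨fun _ _ h => hy.aeval_injective (congrArg Subtype.val h),
        RingHom.rangeRestrict_surjective _⟩
  let q : Ideal (coordRing y) := (RingHom.ker (restr T)).comap (e.symm : coordRing y →+* _)
  have hq : q.IsPrime := by
    have := RingHom.ker_isPrime (restr T)
    infer_instance
  refine ⟨LocalSubring.ofPrime (coordRing y) q, ⟨q, hq, rfl⟩, fun g => ?_⟩
  have h1 := inMax_ofPrime_iff q (e g)
  have h2 : ((e g : coordRing y) : F) = MvPolynomial.aeval y g := rfl
  rw [h2] at h1
  rw [h1, Ideal.mem_comap, RingHom.mem_ker]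
  simp

/-- The prime of the polynomial ring that belongs to a point of `Spec ℂ[y]`. -/
theorem exists_prime_of_mem_specModel (hy : IsCoord ℂ y) {Q : LocalSubring F}
    (hQ : Q ∈ specModel (coordRing y)) :
    ∃ p : Ideal (MvPolynomial ι ℂ), p.IsPrime ∧
      (∀ g, g ∈ p ↔ InMax Q (MvPolynomial.aeval y g)) ∧
      ringKrullDim Q.toSubring = p.height ∧
      ∀ π, p = Ideal.span {π} → ∀ x : Q.toSubring, (x : F) = MvPolynomial.aeval y π →
        IsLocalRing.maximalIdeal Q.toSubring = Ideal.span {x} := by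
  let ψ : MvPolynomial ι ℂ →+* Q.toSubring :=
    (MvPolynomial.aeval y : MvPolynomial ι ℂ →ₐ[ℂ] F).toRingHom.codRestrict Q.toSubring
      fun g => le_of_mem_specModel hQ (aeval_mem_coordRing y g)
  let _ : Algebra (MvPolynomial ι ℂ) Q.toSubring := ψ.toAlgebra
  have hψ : ∀ g, ((algebraMap (MvPolynomial ι ℂ) Q.toSubring g : Q.toSubring) : F) =
      MvPolynomial.aeval y g := fun g => rfl
  let p : Ideal (MvPolynomial ι ℂ) := (IsLocalRing.maximalIdeal Q.toSubring).comap ψ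
  have hp : p.IsPrime := inferInstance
  have hmem : ∀ g, g ∈ p ↔ InMax Q (MvPolynomial.aeval y g) := fun g => by
    rw [inMax_iff (le_of_mem_specModel hQ (aeval_mem_coordRing y g))]; rfl
  have hloc : IsLocalization.AtPrime Q.toSubring p := by
    refine (isLocalization_iff _ _).2 ⟨?_, ?_, ?_⟩
    · rintro ⟨g, hg⟩
      rw [isUnit_toSubring_iff, hψ]
      have hu := (unitIn_iff (le_of_mem_specModel hQ (aeval_mem_coordRing y g))).2
        (fun h => hg ((hmem g).2 h))
      exact ⟨hu.1, hu.2.2⟩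
    · rintro ⟨x, hx⟩
      obtain ⟨_, ⟨a, rfl⟩, _, ⟨s, rfl⟩, hu, rfl⟩ := (mem_specModel_iff.1 hQ).2 x hx
      refine ⟨(a, ⟨s, fun h => hu.not_inMax ((hmem s).1 h)⟩), Subtype.ext ?_⟩
      exact div_mul_cancel₀ _ hu.1
    · intro a c h
      refine ⟨1, ?_⟩
      have := congrArg Subtype.val h
      rw [hψ, hψ] at this
      rw [hy.aeval_injective this]
  refine ⟨p, hp, hmem, IsLocalization.AtPrime.ringKrullDim_eq_height p _, ?_⟩
  rintro π hπ x hx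
  rw [← IsLocalization.AtPrime.map_eq_maximalIdeal p Q.toSubring, hπ, Ideal.map_span,
    Set.image_singleton]
  congr 2
  exact Subtype.ext hx.symm

/-- Otherwise `0 < (π) < p` would be a chain of primes of length two. -/
theorem eq_span_of_height_lt {R : Type*} [CommRing R] [IsDomain R] {p : Ideal R}
    [hp : p.IsPrime] (h : ¬ (2 : ℕ∞) ≤ p.height) {π : R} (hπ : Prime π) (hmem : π ∈ p) :
    p = Ideal.span {π} := by
  have hpr : (Ideal.span {π}).IsPrime := (Ideal.span_singleton_prime hπ.ne_zero).2 hπ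
  by_contra hne
  have hlt : Ideal.span {π} < p :=
    lt_of_le_of_ne ((Ideal.span_singleton_le_iff_mem _).2 hmem) (Ne.symm hne)
  have hlt2 : (⊥ : Ideal R) < Ideal.span {π} := bot_lt_iff_ne_bot.2 (by
    rw [Ne, Ideal.span_singleton_eq_bot]; exact hπ.ne_zero)
  have : (⊥ : Ideal R).IsPrime := Ideal.isPrime_bot
  have h1 := Ideal.height_add_one_le_of_lt_of_isPrime hlt2
  have h2 := Ideal.height_add_one_le_of_lt_of_isPrime hlt
  apply h
  calc (2 : ℕ∞) = 0 + 1 + 1 := by norm_num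
    _ ≤ (⊥ : Ideal R).height + 1 + 1 := by gcongr; exact zero_le
    _ ≤ _ := (add_le_add_left h1 1).trans h2

/-- Krull's principal ideal theorem gives the upper bound; the chain `0 < (π)` gives the lower one.
-/
theorem height_span_prime {R : Type*} [CommRing R] [IsDomain R] [IsNoetherianRing R] {π : R}
    (hπ : Prime π) : (Ideal.span {π}).height = 1 := by
  have hpr : (Ideal.span {π}).IsPrime := (Ideal.span_singleton_prime hπ.ne_zero).2 hπ
  apply le_antisymm
  · have : (Ideal.span {π}).IsPrincipal := ⟨⟨π, rfl⟩⟩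
    apply Ideal.height_le_one_of_isPrincipal_of_mem_minimalPrimes (Ideal.span {π})
    rw [Ideal.minimalPrimes_eq_subsingleton_self]; rfl
  · have hlt2 : (⊥ : Ideal R) < Ideal.span {π} := bot_lt_iff_ne_bot.2 (by
      rw [Ne, Ideal.span_singleton_eq_bot]; exact hπ.ne_zero)
    have : (⊥ : Ideal R).IsPrime := Ideal.isPrime_bot
    exact le_trans (by simp) (Ideal.height_add_one_le_of_lt_of_isPrime hlt2)

/-- A point of codimension at most one at which a prime element vanishes. -/
theorem inMax_iff_dvd_of_dim_lt (hy : IsCoord ℂ y) {Q : LocalSubring F}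
    (hQ : Q ∈ specModel (coordRing y)) (hd : ¬ 2 ≤ ringKrullDim Q.toSubring)
    {π : MvPolynomial ι ℂ} (hπ : Prime π) (h : InMax Q (MvPolynomial.aeval y π))
    (g : MvPolynomial ι ℂ) : InMax Q (MvPolynomial.aeval y g) ↔ π ∣ g := by
  obtain ⟨p, hp, hmem, hdim, -⟩ := exists_prime_of_mem_specModel hy hQ
  have h2 : ¬ (2 : ℕ∞) ≤ p.height := fun h' => hd (by rw [hdim]; exact WithBot.coe_le_coe.2 h')
  rw [← hmem, eq_span_of_height_lt h2 hπ ((hmem π).2 h), Ideal.mem_span_singleton]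

/-- This is how prime divisors are recognised throughout: in an affine chart, a point of codimension
at most one with a single non-unit coordinate must be the generic point of that coordinate
hyperplane. -/
theorem isLin_singleton_of_dim_lt (hy : IsCoord ℂ y) {Q : LocalSubring F}
    (hQ : Q ∈ specModel (coordRing y)) (hd : ¬ 2 ≤ ringKrullDim Q.toSubring) {i : ι}
    (h : InMax Q (y i)) : IsLin y {i} Q := by
  refine ⟨hQ, fun g => ?_⟩
  rw [inMax_iff_dvd_of_dim_lt hy hQ hd MvPolynomial.X_prime (by simpa using h),
    restr_singleton_eq_zero_iff, Ideal.mem_span_singleton]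

theorem two_le_dim_of_inMax (hy : IsCoord ℂ y) {Q : LocalSubring F}
    (hQ : Q ∈ specModel (coordRing y)) {i j : ι} (hij : i ≠ j) (hi : InMax Q (y i))
    (hj : InMax Q (y j)) : 2 ≤ ringKrullDim Q.toSubring := by
  by_contra hd
  have := isLin_singleton_of_dim_lt hy hQ hd hi
  exact (this.unitIn (i := j) (by simpa using hij.symm)).not_inMax hj

theorem dim_eq_one_of_inMax_iff_dvd [Finite ι] (hy : IsCoord ℂ y) {Q : LocalSubring F}
    (hQ : Q ∈ specModel (coordRing y)) {π : MvPolynomial ι ℂ} (hπ : Prime π)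
    (h : ∀ g, InMax Q (MvPolynomial.aeval y g) ↔ π ∣ g) : ringKrullDim Q.toSubring = 1 := by
  obtain ⟨p, hp, hmem, hdim, -⟩ := exists_prime_of_mem_specModel hy hQ
  have : p = Ideal.span {π} := by
    ext g; rw [hmem, h, Ideal.mem_span_singleton]
  rw [hdim, this, height_span_prime hπ]
  rfl

theorem IsLin.dim_eq_one [Finite ι] (hy : IsCoord ℂ y) {Q : LocalSubring F} {i : ι} (h : IsLin y {i} Q) :
    ringKrullDim Q.toSubring = 1 :=
  dim_eq_one_of_inMax_iff_dvd hy h.1 MvPolynomial.X_prime fun g => by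
    rw [h.2, restr_singleton_eq_zero_iff, Ideal.mem_span_singleton]

/-- A point at which no prime element vanishes is the generic point; a point of codimension one is
the generic point of a hypersurface. -/
theorem exists_prime_inMax (hy : IsCoord ℂ y) {Q : LocalSubring F}
    (hQ : Q ∈ specModel (coordRing y)) :
    (∀ x : F, x ∈ Q.toSubring) ∨
      ∃ π : MvPolynomial ι ℂ, Prime π ∧ InMax Q (MvPolynomial.aeval y π) := by
  obtain ⟨p, hp, hmem, hdim, -⟩ := exists_prime_of_mem_specModel hy hQ
  by_cases h : p = ⊥
  · left
    intro x
    obtain ⟨a, c, hc, rfl⟩ := hy.exists_div x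
    have h1 := aeval_mem_coordRing y c
    have h2 : ¬ InMax Q (MvPolynomial.aeval y c) := by
      rw [← hmem, h]; simpa using hc
    rw [div_eq_mul_inv]
    exact mul_mem (le_of_mem_specModel hQ (aeval_mem_coordRing y a))
      ((not_inMax_iff (le_of_mem_specModel hQ h1)).1 h2).2
  · right
    obtain ⟨π, hπ, hpr⟩ := hp.exists_mem_prime_of_ne_bot h
    exact ⟨π, hpr, (hmem π).1 hπ⟩

end CoordRing

/-! ### Blow-ups of linear centres -/

section BlowUp

variable {F : Type*} [Field F]

theorem mem_idealAt_iff {P R : LocalSubring F} (h : R.toSubring ≤ P.toSubring)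
    (x : R.toSubring) : x ∈ idealAt P R ↔ InMax P (x : F) := by
  rw [idealAt, dif_pos h, Ideal.mem_comap, inMax_iff (h x.2)]
  rfl

theorem idealAt_eq_top {P R : LocalSubring F} (h : ¬ R.toSubring ≤ P.toSubring) :
    idealAt P R = ⊤ := dif_neg h

theorem le_blowUpChart (R : LocalSubring F) (I : Ideal R.toSubring) (g : R.toSubring) :
    R.toSubring ≤ blowUpChart R I g := fun _ hx => Subring.subset_closure (Or.inl hx)

theorem div_mem_blowUpChart {R : LocalSubring F} {I : Ideal R.toSubring} (g : R.toSubring)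
    {x : R.toSubring} (hx : x ∈ I) : (x : F) / g ∈ blowUpChart R I g :=
  Subring.subset_closure (Or.inr ⟨x, hx, rfl⟩)

theorem blowUpChart_le {R : LocalSubring F} {I : Ideal R.toSubring} {g : R.toSubring}
    {B : Subring F} (hR : R.toSubring ≤ B) (h : ∀ x ∈ I, (x : F) / g ∈ B) :
    blowUpChart R I g ≤ B := by
  refine Subring.closure_le.2 (Set.union_subset hR ?_)
  rintro _ ⟨x, hx, rfl⟩
  exact h x hx

/-- Away from the centre the blow-up does not change anything. -/
theorem mem_blowUp_of_not_le {M : Set (LocalSubring F)} {P R : LocalSubring F} (hR : R ∈ M)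
    (h : ¬ R.toSubring ≤ P.toSubring) : R ∈ blowUp M P := by
  refine ⟨R, hR, 1, by rw [idealAt_eq_top h]; trivial, one_ne_zero, ?_⟩
  refine mem_specModel_of_le (mem_specModel_self R) (le_blowUpChart _ _ _)
    (blowUpChart_le le_rfl fun x _ => ?_)
  simp

/-- Off the centre the ideal contains `1`, so the chart contains `1 / g` and is itself a
localization of `R`. -/
theorem mem_specModel_of_mem_chart {P R Q : LocalSubring F} (h : ¬ R.toSubring ≤ P.toSubring)
    {g : R.toSubring} (hg : g ≠ 0) (hQ : Q ∈ specModel (blowUpChart R (idealAt P R) g)) :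
    Q ∈ specModel R.toSubring := by
  have hg0 : (g : F) ≠ 0 := fun h => hg (Subtype.ext h)
  have hle := le_of_mem_specModel hQ
  have hRQ := (le_blowUpChart R (idealAt P R) g).trans hle
  have hu : UnitIn Q (g : F) := by
    refine ⟨hg0, hRQ g.2, hle ?_⟩
    have := div_mem_blowUpChart (I := idealAt P R) g (x := 1) (by rw [idealAt_eq_top h]; trivial)
    simpa using this
  refine mem_specModel_of_le_fracIn hQ hRQ (blowUpChart_le (le_fracIn _ _) fun x _ => ?_)
  exact ⟨x, x.2, g, g.2, hu, rfl⟩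

variable {ι : Type*} {y : ι → F}

/-- Coordinates of the blow-up of the linear subspace `y_t = 0` (`t ∈ T`) in its `i`-th chart. -/
def chartZ (y : ι → F) (T : Finset ι) (i : ι) : ι → F := fun j =>
  if j ∈ T ∧ j ≠ i then y j / y i else y j

theorem chartZ_self (y : ι → F) (T : Finset ι) (i : ι) : chartZ y T i i = y i := by
  simp [chartZ]

theorem chartZ_of_notMem {T : Finset ι} {i j : ι} (h : j ∉ T) : chartZ y T i j = y j := by
  simp [chartZ, h]

theorem chartZ_of_ne {T : Finset ι} {i j : ι} (h : j ∈ T) (hj : j ≠ i) :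
    chartZ y T i j = y j / y i := by
  simp [chartZ, h, hj]

variable [Algebra ℂ F]

theorem eq_chartZ_mul (hy : IsCoord ℂ y) {T : Finset ι} {i j : ι} (h : j ∈ T) (hj : j ≠ i) :
    y j = chartZ y T i j * chartZ y T i i := by
  rw [chartZ_of_ne h hj, chartZ_self, div_mul_cancel₀ _ (hy.ne_zero i)]

theorem coord_mem_chartZ (hy : IsCoord ℂ y) (T : Finset ι) (i j : ι) :
    y j ∈ coordRing (chartZ y T i) := by
  by_cases h : j ∈ T ∧ j ≠ i
  · rw [eq_chartZ_mul hy h.1 h.2]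
    exact mul_mem (coord_mem_coordRing _ _) (coord_mem_coordRing _ _)
  · have : y j = chartZ y T i j := by rw [chartZ, if_neg h]
    rw [this]
    exact coord_mem_coordRing _ _

theorem coordRing_le_chartZ (hy : IsCoord ℂ y) (T : Finset ι) (i : ι) :
    coordRing y ≤ coordRing (chartZ y T i) :=
  coordRing_le (algebraMap_mem_coordRing _) (coord_mem_chartZ hy T i)

theorem isCoord_chartZ [Finite ι] (hy : IsCoord ℂ y) (T : Finset ι) (i : ι) :
    IsCoord ℂ (chartZ y T i) := by
  refine hy.of_mem fun j => ?_
  obtain ⟨g, hg⟩ := coord_mem_chartZ hy T i j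
  rw [← hg]
  exact aeval_mem_adjoin_range _ _ _ fun j => IntermediateField.subset_adjoin _ _ ⟨j, rfl⟩

theorem exists_sum_of_restr_eq_zero {T : Finset ι} {G : MvPolynomial ι ℂ} (h : restr T G = 0) :
    ∃ r : ι → MvPolynomial ι ℂ, MvPolynomial.aeval y G =
      ∑ t ∈ T, MvPolynomial.aeval y (r t) * y t := by
  rw [restr_eq_zero_iff, Submodule.mem_span_image_finset_iff_exists_fun'] at h
  obtain ⟨r, rfl⟩ := h
  exact ⟨r, by simp⟩

/-- The stalk of the ideal of a linear subspace is generated by the coordinates. -/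
theorem exists_sum_of_inMax {T : Finset ι} {P R : LocalSubring F} (hP : IsLin y T P)
    (hR : R ∈ specModel (coordRing y)) (hRP : R.toSubring ≤ P.toSubring) {x : F}
    (hx : x ∈ R.toSubring) (hxP : InMax P x) :
    ∃ a : ι → F, ∃ s : F, (∀ t, a t ∈ coordRing y) ∧ s ∈ coordRing y ∧ UnitIn R s ∧
      x = (∑ t ∈ T, a t * y t) / s := by
  obtain ⟨_, ⟨G, rfl⟩, s, hs, hu, rfl⟩ := (mem_specModel_iff.1 hR).2 x hx
  have h1 : InMax P (MvPolynomial.aeval y G) := by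
    have := hxP.mul_right (hRP hu.2.1)
    rwa [div_mul_cancel₀ _ hu.1] at this
  obtain ⟨r, hr⟩ := exists_sum_of_restr_eq_zero (y := y) ((hP.2 G).1 h1)
  exact ⟨fun t => MvPolynomial.aeval y (r t), s, fun t => aeval_mem_coordRing y _, hs, hu,
    congrArg (· / s) hr⟩

/-- The charts `R[I/g]` for arbitrary `g ∈ I` are reduced to the finitely many with `g` a coordinate
`y_i`, because the coordinates of `T` generate the stalk `I`. -/
theorem exists_chartZ_of_mem_chart (hy : IsCoord ℂ y) {T : Finset ι} {P R Q : LocalSubring F}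
    (hP : IsLin y T P) (hR : R ∈ specModel (coordRing y)) (hRP : R.toSubring ≤ P.toSubring)
    {g : R.toSubring} (hgI : g ∈ idealAt P R) (hg : g ≠ 0)
    (hQ : Q ∈ specModel (blowUpChart R (idealAt P R) g)) :
    ∃ i ∈ T, Q ∈ specModel (coordRing (chartZ y T i)) := by
  have hg0 : (g : F) ≠ 0 := fun h => hg (Subtype.ext h)
  have hle := le_of_mem_specModel hQ
  have hRQ := (le_blowUpChart R (idealAt P R) g).trans hle
  have hyR : ∀ t, y t ∈ R.toSubring := coord_mem_of_mem_specModel hR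
  have hyI : ∀ t ∈ T, y t / (g : F) ∈ Q.toSubring := fun t ht =>
    hle (div_mem_blowUpChart g (x := ⟨y t, hyR t⟩) ((mem_idealAt_iff hRP _).2 (hP.inMax ht)))
  obtain ⟨a, s, ha, hs, hu, hgs⟩ :=
    exists_sum_of_inMax hP hR hRP g.2 ((mem_idealAt_iff hRP _).1 hgI)
  have haQ : ∀ t, a t ∈ Q.toSubring := fun t => hRQ (le_of_mem_specModel hR (ha t))
  -- Writing `g = (∑ a_t y_t) / s` gives `s = ∑ a_t (y_t / g)`. Since `s` is a unit of `Q`, not all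
  -- the `y_t / g` can lie in its maximal ideal.
  obtain ⟨i, hiT, hi⟩ : ∃ i ∈ T, UnitIn Q (y i / (g : F)) := by
    by_contra hcon
    push Not at hcon
    have h1 : InMax Q (∑ t ∈ T, a t * (y t / (g : F))) := by
      refine Finset.sum_induction _ (InMax Q) (fun _ _ => InMax.add) (inMax_zero Q) fun t ht => ?_
      refine InMax.mul_left (haQ t) ?_
      by_contra hc
      exact hcon t ht ((unitIn_iff (hyI t ht)).2 hc)
    have h2 : ∑ t ∈ T, a t * (y t / (g : F)) = s := by
      rw [eq_div_iff hu.1] at hgs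
      simp only [← mul_div_assoc]
      rw [← Finset.sum_div, ← hgs, mul_div_cancel_left₀ _ hg0]
    rw [h2] at h1
    exact (hu.mono hRQ).not_inMax h1
  have hquot : ∀ t ∈ T, y t / y i ∈ Q.toSubring := fun t ht => by
    have : y t / y i = (y t / g) * (y i / g)⁻¹ := by
      rw [inv_div, div_mul_div_comm, mul_comm (g : F), mul_div_mul_right _ _ hg0]
    rw [this]
    exact mul_mem (hyI t ht) hi.2.2
  refine ⟨i, hiT, ?_⟩
  set z := chartZ y T i with hz
  have hzmem : ∀ t ∈ T, y t / y i ∈ coordRing z := fun t ht => by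
    by_cases h : t = i
    · rw [h, div_self (hy.ne_zero i)]; exact one_mem _
    · rw [← chartZ_of_ne ht h]; exact coord_mem_coordRing _ _
  have hzQ : coordRing z ≤ Q.toSubring := by
    refine coordRing_le (fun c => hRQ (algebraMap_mem_of_mem_specModel hR c)) fun j => ?_
    by_cases h : j ∈ T ∧ j ≠ i
    · rw [hz, chartZ_of_ne h.1 h.2]; exact hquot j h.1
    · rw [hz, chartZ, if_neg h]; exact hRQ (hyR j)
  have hyz := coordRing_le_chartZ hy T i
  have hRf : R.toSubring ≤ fracIn (coordRing z) Q := fun x hx => by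
    obtain ⟨b, hb, c, hc, huc, rfl⟩ := (mem_specModel_iff.1 hR).2 x hx
    exact ⟨b, hyz hb, c, hyz hc, huc.mono hRQ, rfl⟩
  have hsum : ∀ x ∈ R.toSubring, InMax P x → x / y i ∈ fracIn (coordRing z) Q := by
    intro x hx hxP
    obtain ⟨b, c, hb, hc, huc, rfl⟩ := exists_sum_of_inMax hP hR hRP hx hxP
    refine ⟨∑ t ∈ T, b t * (y t / y i), sum_mem fun t ht => mul_mem (hyz (hb t)) (hzmem t ht), c,
      hyz hc, huc.mono hRQ, ?_⟩
    simp only [← mul_div_assoc]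
    rw [← Finset.sum_div, div_right_comm]
  refine mem_specModel_of_le_fracIn hQ hzQ (blowUpChart_le hRf fun x hx => ?_)
  have h1 := hsum x x.2 ((mem_idealAt_iff hRP _).1 hx)
  -- Since `g / y_i` is a unit of `Q`, dividing by `g` and dividing by `y_i` produce the same
  -- localization.
  have h2 := fracIn_inv_mem (hsum g g.2 ((mem_idealAt_iff hRP _).1 hgI))
    (by rw [← inv_div]; exact hi.inv)
  have h3 : (x : F) / g = x / y i * (g / y i)⁻¹ := by
    rw [inv_div, div_mul_div_comm, mul_comm (y i), mul_div_mul_right _ _ (hy.ne_zero i)]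
  rw [h3]
  exact mul_mem h1 h2

/-! ### The exceptional divisor of a linear centre. -/

section Exceptional

/-- On `z_i = 0` all `y_t` with `t ∈ T` vanish, while the other coordinates are unchanged and stay
independent. So the contraction of the maximal ideal of `E` to `ℂ[y]` is exactly the ideal of the
centre. -/
theorem IsLin.le_of_chartZ (hy : IsCoord ℂ y) {T : Finset ι} {i : ι} (hi : i ∈ T)
    {P E : LocalSubring F} (hP : IsLin y T P) (hE : IsLin (chartZ y T i) {i} E) : P ≤ E := by
  have hyE : ∀ t ∈ T, InMax E (y t) := fun t ht => by
    have h1 : InMax E (chartZ y T i i) := hE.inMax (by simp)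
    by_cases h : t = i
    · rw [h, ← chartZ_self y T i]; exact h1
    · rw [eq_chartZ_mul hy ht h]
      exact h1.mul_left (coord_mem_of_mem_specModel hE.1 t)
  have hyz := (coordRing_le_chartZ hy T i).trans (le_of_mem_specModel hE.1)
  have key : ∀ G, restr T G = 0 → InMax E (MvPolynomial.aeval y G) := by
    intro G hG
    obtain ⟨r, hr⟩ := exists_sum_of_restr_eq_zero (y := y) hG
    rw [hr]
    refine Finset.sum_induction _ (InMax E) (fun _ _ => InMax.add) (inMax_zero E) fun t ht => ?_
    exact InMax.mul_left (hyz (aeval_mem_coordRing y _)) (hyE t ht)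
  refine le_of_mem_specModel_of_inMax hP.1 hyz ?_
  rintro _ ⟨G, rfl⟩
  change InMax P (MvPolynomial.aeval y G) ↔ InMax E (MvPolynomial.aeval y G)
  rw [hP.2]
  refine ⟨key G, fun h => ?_⟩
  -- If `G` vanishes at `E`, then so does its restriction, which involves only free coordinates;
  -- these are common to `y` and the chart, and a nonzero polynomial in them does not vanish on `z_i
  -- = 0`.
  by_contra hne
  have hidem : ∀ G, restr T (restr T G) = restr T G := fun G => by
    have : (restr T).comp (restr T) = restr T := by
      apply MvPolynomial.algHom_ext
      intro j
      by_cases hj : j ∈ T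
      · simp [restr_X_of_mem hj]
      · simp [restr_X_of_notMem hj]
    exact DFunLike.congr_fun this G
  have h1 := h.sub (key (G - restr T G) (by rw [map_sub, hidem, sub_self]))
  rw [map_sub, sub_sub_cancel] at h1
  have h2 : MvPolynomial.aeval y (restr T G) = MvPolynomial.aeval (chartZ y T i) (restr T G) := by
    have : (MvPolynomial.aeval y).comp (restr T) =
        (MvPolynomial.aeval (chartZ y T i)).comp (restr T) := by
      apply MvPolynomial.algHom_ext
      intro j
      by_cases hj : j ∈ T
      · simp [restr_X_of_mem hj]
      · simp [restr_X_of_notMem hj, chartZ_of_notMem hj]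
    exact DFunLike.congr_fun this G
  rw [h2, hE.2] at h1
  have h3 : (restr {i}).comp (restr T) = restr T := by
    apply MvPolynomial.algHom_ext
    intro j
    by_cases hj : j ∈ T
    · simp [restr_X_of_mem hj]
    · have : j ∉ ({i} : Finset ι) := fun h => hj (by rw [Finset.mem_singleton.1 h]; exact hi)
      simp [restr_X_of_notMem hj, restr_X_of_notMem this]
  have h4 := DFunLike.congr_fun h3 G
  rw [AlgHom.comp_apply, h1] at h4
  exact hne h4.symm

theorem IsLin.mem_chart_of_chartZ (hy : IsCoord ℂ y) {T : Finset ι} {i : ι} (hi : i ∈ T)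
    {P E : LocalSubring F} (hP : IsLin y T P) (hE : IsLin (chartZ y T i) {i} E) :
    ∃ g ∈ idealAt P P, g ≠ 0 ∧ E ∈ specModel (blowUpChart P (idealAt P P) g) := by
  have hPE := hP.le_of_chartZ hy hi hE
  have hle := LocalSubring.toSubring_mono hPE
  have hyP : ∀ t, y t ∈ P.toSubring := coord_mem_of_mem_specModel hP.1
  refine ⟨⟨y i, hyP i⟩, (mem_idealAt_iff le_rfl _).2 (hP.inMax hi),
    fun h => hy.ne_zero i (congrArg Subtype.val h), ?_⟩
  have hquot : ∀ t ∈ T, y t / y i ∈ E.toSubring := fun t ht => by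
    by_cases h : t = i
    · rw [h, div_self (hy.ne_zero i)]; exact one_mem _
    · rw [← chartZ_of_ne ht h]; exact coord_mem_of_mem_specModel hE.1 t
  refine mem_specModel_of_le hE.1 (coordRing_le
    (fun c => le_blowUpChart _ _ _ (hP.containsC c)) fun j => ?_) (blowUpChart_le hle ?_)
  · by_cases h : j ∈ T ∧ j ≠ i
    · rw [chartZ_of_ne h.1 h.2]
      exact div_mem_blowUpChart (⟨y i, hyP i⟩ : P.toSubring) (x := ⟨y j, hyP j⟩)
        ((mem_idealAt_iff le_rfl _).2 (hP.inMax h.1))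
    · rw [chartZ, if_neg h]; exact le_blowUpChart _ _ _ (hyP j)
  · intro x hx
    obtain ⟨a, s, ha, hs, hu, hxs⟩ :=
      exists_sum_of_inMax hP hP.1 le_rfl x.2 ((mem_idealAt_iff le_rfl _).1 hx)
    have h1 : (x : F) / y i = (∑ t ∈ T, a t * (y t / y i)) * s⁻¹ := by
      simp only [← mul_div_assoc]
      rw [← Finset.sum_div, hxs, div_right_comm, div_eq_mul_inv _ s]
    change (x : F) / y i ∈ _
    rw [h1]
    exact mul_mem (sum_mem fun t ht => mul_mem (hle (le_of_mem_specModel hP.1 (ha t)))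
      (hquot t ht)) (hu.mono hle).2.2

/-- `E` is the generic point of the exceptional divisor of the blow-up along `P`. -/
def IsExc (ι : Type*) (P E : LocalSubring F) : Prop :=
  ∃ (y : ι → F) (T : Finset ι) (i : ι), IsCoord ℂ y ∧ T.card = 3 ∧ IsLin y T P ∧ i ∈ T ∧
    IsLin (chartZ y T i) {i} E

theorem IsExc.le {P E : LocalSubring F} (h : IsExc ι P E) : P ≤ E := by
  obtain ⟨y, T, i, hy, -, hP, hi, hE⟩ := h
  exact hP.le_of_chartZ hy hi hE

variable [Finite ι]

/-- The quotient `y_j / y_i` is a unit at the exceptional divisor, so its generic point lies in the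
overlap of all the charts. -/
theorem IsLin.chartZ_of_chartZ (hy : IsCoord ℂ y) {T : Finset ι} {i j : ι} (hi : i ∈ T)
    (hj : j ∈ T) {E : LocalSubring F} (hE : IsLin (chartZ y T i) {i} E) :
    IsLin (chartZ y T j) {j} E := by
  by_cases hij : j = i
  · rwa [hij]
  have hi0 := hy.ne_zero i
  have hj0 := hy.ne_zero j
  have hu : UnitIn E (y j / y i) := by
    rw [← chartZ_of_ne hj hij]; exact hE.unitIn (by simpa using hij)
  have hquot : ∀ t ∈ T, y t / y i ∈ E.toSubring := fun t ht => by
    by_cases h : t = i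
    · rw [h, div_self (hy.ne_zero i)]; exact one_mem _
    · rw [← chartZ_of_ne ht h]; exact coord_mem_of_mem_specModel hE.1 t
  have hyE : ∀ t, y t ∈ E.toSubring := fun t =>
    le_of_mem_specModel hE.1 (coord_mem_chartZ hy T i t)
  have hzE : ∀ t, chartZ y T j t ∈ E.toSubring := fun t => by
    by_cases h : t ∈ T ∧ t ≠ j
    · rw [chartZ_of_ne h.1 h.2]
      have : y t / y j = (y t / y i) * (y j / y i)⁻¹ := by field_simp
      rw [this]
      exact mul_mem (hquot t h.1) hu.2.2
    · rw [chartZ, if_neg h]; exact hyE t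
  have hquot' : ∀ t ∈ T, y t / y j ∈ coordRing (chartZ y T j) := fun t ht => by
    by_cases h : t = j
    · rw [h, div_self (hy.ne_zero j)]; exact one_mem _
    · rw [← chartZ_of_ne ht h]; exact coord_mem_coordRing _ _
  have hspec : E ∈ specModel (coordRing (chartZ y T j)) := by
    refine mem_specModel_coordRing hE.1 hzE fun t => ?_
    by_cases h : t ∈ T ∧ t ≠ i
    · rw [chartZ_of_ne h.1 h.2]
      refine ⟨_, hquot' t h.1, _, hquot' i hi, ?_, ?_⟩
      · rw [← inv_div]; exact hu.inv
      · field_simp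
    · rw [chartZ, if_neg h]
      exact le_fracIn _ _ (coord_mem_chartZ hy T j t)
  refine isLin_singleton_of_dim_lt (isCoord_chartZ hy T j) hspec ?_ ?_
  · rw [hE.dim_eq_one (isCoord_chartZ hy T i)]; decide
  · rw [chartZ_self, eq_chartZ_mul hy hj hij]
    exact InMax.mul_left (coord_mem_of_mem_specModel hE.1 j) (hE.inMax (by simp))

theorem IsExc.dim_eq_one {P E : LocalSubring F} (h : IsExc ι P E) :
    ringKrullDim E.toSubring = 1 := by
  obtain ⟨y, T, i, hy, -, hP, hi, hE⟩ := h
  exact hE.dim_eq_one (isCoord_chartZ hy T i)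

theorem not_two_le_one : ¬ (2 : WithBot ℕ∞) ≤ 1 := by decide

/-- The definition of `IsExc` fixes some coordinates adapted to `P`; any others serve equally well.
Indeed `E` lies in the intrinsic blow-up, hence in one of the new charts, has dimension one there,
and the new equation vanishes at it. -/
theorem IsExc.isLin {P E : LocalSubring F} (h : IsExc ι P E) (hy : IsCoord ℂ y) {T : Finset ι}
    (hP : IsLin y T P) {i : ι} (hi : i ∈ T) : IsLin (chartZ y T i) {i} E := by
  have hle := h.le
  have hdim := h.dim_eq_one
  obtain ⟨y', T', i', hy', -, hP', hi', hE⟩ := h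
  obtain ⟨g, hgI, hg, hEg⟩ := hP'.mem_chart_of_chartZ hy' hi' hE
  obtain ⟨j, hj, hEj⟩ := exists_chartZ_of_mem_chart hy hP hP.1 le_rfl hgI hg hEg
  have : IsLin (chartZ y T j) {j} E := by
    refine isLin_singleton_of_dim_lt (isCoord_chartZ hy T j) hEj
      (by rw [hdim]; exact not_two_le_one) ?_
    rw [chartZ_self]
    exact (hP.inMax hj).mono hle
  exact this.chartZ_of_chartZ hy hj hi

theorem IsExc.unique {P E E' : LocalSubring F} (h : IsExc ι P E) (h' : IsExc ι P E') : E = E' := by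
  obtain ⟨y, T, i, hy, -, hP, hi, hE⟩ := h
  exact hE.unique (h'.isLin hy hP hi)

theorem exists_isExc (hy : IsCoord ℂ y) {T : Finset ι} (hT : T.card = 3) {P : LocalSubring F}
    (hP : IsLin y T P) : ∃ E, IsExc ι P E := by
  obtain ⟨i, hi⟩ : T.Nonempty := Finset.card_pos.1 (by omega)
  obtain ⟨E, hE⟩ := exists_isLin (isCoord_chartZ hy T i) {i}
  exact ⟨E, y, T, i, hy, hT, hP, hi, hE⟩

end Exceptional

end BlowUp

/-! ### Models with linear centres -/

section Good

variable {F : Type*} [Field F] [Algebra ℂ F] {ι : Type*}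

/-- A model of finite type over `ℂ`. -/
def LocallyFG (M : Set (LocalSubring F)) : Prop :=
  ∀ R ∈ M, ∃ A : Subalgebra ℂ F, A.FG ∧ R ∈ specModel A.toSubring ∧ specModel A.toSubring ⊆ M

/-- A separated model. -/
def Separated (M : Set (LocalSubring F)) : Prop :=
  ∀ R₁ ∈ M, ∀ R₂ ∈ M, ∀ Q : LocalSubring F, R₁ ≤ Q → R₂ ≤ Q → R₁ = R₂

/-- A model that is locally an affine space in which the given centres are linear subspaces of
codimension three. -/
structure IsGood (ι : Type*) (Ps : Set (LocalSubring F)) (M : Set (LocalSubring F)) : Prop where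
  lfg : LocallyFG M
  sep : Separated M
  adapted : ∀ R ∈ M, ∃ y : ι → F, IsCoord ℂ y ∧ R ∈ specModel (coordRing y) ∧
    ∀ P ∈ Ps, R.toSubring ≤ P.toSubring → ∃ T : Finset ι, T.card = 3 ∧ IsLin y T P
  centres : Ps ⊆ M

theorem LocallyFG.mem_of_mem_specModel {M : Set (LocalSubring F)} (hM : LocallyFG M)
    {R Q : LocalSubring F} (hR : R ∈ M) (hQ : Q ∈ specModel R.toSubring) : Q ∈ M := by
  obtain ⟨A, -, hA, hAM⟩ := hM R hR
  exact hAM (mem_specModel_trans hA hQ)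

theorem LocallyFG.containsC {M : Set (LocalSubring F)} (hM : LocallyFG M)
    {R : LocalSubring F} (hR : R ∈ M) : ContainsC R := by
  obtain ⟨A, -, hA, -⟩ := hM R hR
  exact fun z => le_of_mem_specModel hA (A.algebraMap_mem z)

/-- A point of the blow-up lies over a point of the model that it dominates. -/
theorem exists_le_of_mem_blowUp {M : Set (LocalSubring F)} (hM : LocallyFG M)
    {P Q : LocalSubring F} (hQ : Q ∈ blowUp M P) :
    ∃ R ∈ M, R ≤ Q ∧ ∃ g ∈ idealAt P R, g ≠ 0 ∧ Q ∈ specModel (blowUpChart R (idealAt P R) g) := by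
  obtain ⟨R, hR, g, hgI, hg, hQ⟩ := hQ
  have hle := le_of_mem_specModel hQ
  have hRQ := (le_blowUpChart R (idealAt P R) g).trans hle
  have hg0 : (g : F) ≠ 0 := fun h => hg (Subtype.ext h)
  obtain ⟨R', hR', hR'Q, hR'f⟩ := exists_localization hRQ
  have hRR' := le_of_mem_specModel hR'
  have hgI' : (⟨g, hRR' g.2⟩ : R'.toSubring) ∈ idealAt P R' := by
    by_cases h' : R'.toSubring ≤ P.toSubring
    · rw [mem_idealAt_iff h']
      exact (mem_idealAt_iff (hRR'.trans h') g).1 hgI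
    · rw [idealAt_eq_top h']; trivial
  refine ⟨R', hM.mem_of_mem_specModel hR hR', hR'Q, ⟨g, hRR' g.2⟩, hgI',
    fun h => hg0 (congrArg Subtype.val h), ?_⟩
  refine mem_specModel_of_le hQ (blowUpChart_le (hRR'.trans (le_blowUpChart _ _ _)) ?_)
    (blowUpChart_le (LocalSubring.toSubring_mono hR'Q) ?_)
  · intro x hx
    refine div_mem_blowUpChart (⟨g, hRR' g.2⟩ : R'.toSubring) (x := ⟨x, hRR' x.2⟩) ?_
    by_cases h' : R'.toSubring ≤ P.toSubring
    · rw [mem_idealAt_iff h']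
      exact (mem_idealAt_iff (hRR'.trans h') x).1 hx
    · rw [idealAt_eq_top h']; trivial
  · intro x hx
    change (x : F) / g ∈ Q.toSubring
    have hxf : (x : F) ∈ fracIn R.toSubring Q := hR'f ▸ x.2
    obtain ⟨a, ha, s, hs, hu, hxs⟩ := hxf
    by_cases hRP : R.toSubring ≤ P.toSubring
    · by_cases h' : R'.toSubring ≤ P.toSubring
      · have hxP := (mem_idealAt_iff h' x).1 hx
        have haP : InMax P a := by
          have := hxP.mul_right (hRP hs)
          rwa [hxs, div_mul_cancel₀ _ hu.1] at this
        have h1 := hle (div_mem_blowUpChart g (x := ⟨a, ha⟩) ((mem_idealAt_iff hRP _).2 haP))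
        rw [hxs, div_right_comm, div_eq_mul_inv _ s]
        exact mul_mem h1 hu.2.2
      -- The centre passes through `R` but not through `R'`, so some denominator used to form `R'`
      -- vanishes at `P`. It lies in the centre's ideal at `R` and is a unit of `Q`.
      · have : ∃ s ∈ R.toSubring, UnitIn Q s ∧ InMax P s := by
          by_contra hcon
          push Not at hcon
          refine h' fun x hx => ?_
          obtain ⟨a, ha, s, hs, hu, rfl⟩ := (mem_specModel_iff.1 hR').2 x hx
          have := (unitIn_iff (hRP hs)).2 (hcon s hs (hu.mono (LocalSubring.toSubring_mono hR'Q)))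
          rw [div_eq_mul_inv]
          exact mul_mem (hRP ha) this.2.2
        obtain ⟨s', hs', hu', hsP⟩ := this
        have h1 := hle (div_mem_blowUpChart g (x := ⟨s', hs'⟩) ((mem_idealAt_iff hRP _).2 hsP))
        have h2 : (x : F) / g = x * (s' / g) * s'⁻¹ := by
          field_simp [hu'.1]
        rw [h2]
        exact mul_mem (mul_mem (LocalSubring.toSubring_mono hR'Q x.2) h1) hu'.2.2
    · have h1 := hle (div_mem_blowUpChart g (x := 1) (by rw [idealAt_eq_top hRP]; trivial))
      rw [div_eq_mul_inv]
      refine mul_mem (LocalSubring.toSubring_mono hR'Q x.2) ?_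
      simpa using h1

/-- Two points dominated by the same `Q` lie over the same point of `M` by separatedness of `M`. The
quotient `g₂ / g₁` belongs to the first point and is a unit in `Q`, hence is a unit already in the
first point. So both points are localizations of the ring generated by both charts. -/
theorem Separated.blowUp {M : Set (LocalSubring F)} (hM : LocallyFG M) (hs : Separated M)
    (P : LocalSubring F) : Separated (blowUp M P) := by
  intro Q₁ hQ₁ Q₂ hQ₂ Q h₁ h₂
  obtain ⟨R₁, hR₁, hRQ₁, g₁, hgI₁, hg₁, hQ₁⟩ := exists_le_of_mem_blowUp hM hQ₁
  obtain ⟨R, hR, hRQ₂, g₂, hgI₂, hg₂, hQ₂⟩ := exists_le_of_mem_blowUp hM hQ₂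
  obtain rfl := hs R₁ hR₁ R hR Q (hRQ₁.trans h₁) (hRQ₂.trans h₂)
  have h10 : (g₁ : F) ≠ 0 := fun h => hg₁ (Subtype.ext h)
  have h20 : (g₂ : F) ≠ 0 := fun h => hg₂ (Subtype.ext h)
  have key : ∀ {Q₁ Q₂ : LocalSubring F} {g₁ g₂ : R₁.toSubring}, g₁ ∈ idealAt P R₁ →
      g₂ ∈ idealAt P R₁ → (g₁ : F) ≠ 0 → (g₂ : F) ≠ 0 →
      Q₁ ∈ specModel (blowUpChart R₁ (idealAt P R₁) g₁) →
      Q₂ ∈ specModel (blowUpChart R₁ (idealAt P R₁) g₂) → Q₁ ≤ Q → Q₂ ≤ Q →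
      blowUpChart R₁ (idealAt P R₁) g₂ ≤ Q₁.toSubring := by
    intro Q₁ Q₂ g₁ g₂ hgI₁ hgI₂ h10 h20 hQ₁ hQ₂ h₁ h₂
    have a1 := le_of_mem_specModel hQ₁
    have a2 := le_of_mem_specModel hQ₂
    have h12 := a1 (div_mem_blowUpChart g₁ hgI₂)
    have h21 := a2 (div_mem_blowUpChart g₂ hgI₁)
    have hu : UnitIn Q₁ ((g₂ : F) / g₁) := by
      refine UnitIn.of_le h₁ h12 ⟨div_ne_zero h20 h10, LocalSubring.toSubring_mono h₁ h12, ?_⟩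
      rw [inv_div]
      exact LocalSubring.toSubring_mono h₂ h21
    refine blowUpChart_le ((le_blowUpChart _ _ _).trans a1) fun x hx => ?_
    have h3 : (x : F) / g₂ = x / g₁ * ((g₂ : F) / g₁)⁻¹ := by field_simp
    rw [h3]
    exact mul_mem (a1 (div_mem_blowUpChart g₁ hx)) hu.2.2
  have k1 := key hgI₁ hgI₂ h10 h20 hQ₁ hQ₂ h₁ h₂
  have k2 := key hgI₂ hgI₁ h20 h10 hQ₂ hQ₁ h₂ h₁
  refine eq_of_mem_specModel_of_le
    (A := blowUpChart R₁ (idealAt P R₁) g₁ ⊔ blowUpChart R₁ (idealAt P R₁) g₂) ?_ ?_ h₁ h₂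
  · exact mem_specModel_of_le hQ₁ le_sup_left (sup_le (le_of_mem_specModel hQ₁) k1)
  · exact mem_specModel_of_le hQ₂ le_sup_right (sup_le k2 (le_of_mem_specModel hQ₂))

/-- Over `Spec A` the chart is `A[J/γ]`, where `J` is the ideal of the centre. Since `A` is
noetherian, finitely many quotients by `γ` generate it. -/
theorem LocallyFG.blowUp {M : Set (LocalSubring F)} (hM : LocallyFG M) (P : LocalSubring F) :
    LocallyFG (blowUp M P) := by
  rintro Q ⟨R, hR, g, hgI, hg, hQ⟩
  have hg0 : (g : F) ≠ 0 := fun h => hg (Subtype.ext h)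
  obtain ⟨A, hAfg, hRA, hAM⟩ := hM R hR
  have hAR := le_of_mem_specModel hRA
  by_cases hAP : A.toSubring ≤ P.toSubring
  swap
  · have hRP : ¬ R.toSubring ≤ P.toSubring := fun h => hAP (hAR.trans h)
    refine ⟨A, hAfg, mem_specModel_trans hRA (mem_specModel_of_mem_chart hRP hg hQ), ?_⟩
    intro R' hR'
    exact mem_blowUp_of_not_le (hAM hR') fun h => hAP ((le_of_mem_specModel hR').trans h)
  have hle := le_of_mem_specModel hQ
  have hRQ := (le_blowUpChart R (idealAt P R) g).trans hle
  let J : Ideal A := (IsLocalRing.maximalIdeal P.toSubring).comap (Subring.inclusion hAP)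
  have hJ : ∀ a : A, a ∈ J ↔ InMax P (a : F) := fun a => by
    rw [inMax_iff (hAP a.2)]; rfl
  have hJfg : J.FG := by
    have : Algebra.FiniteType ℂ A := A.fg_iff_finiteType.1 hAfg
    have := Algebra.FiniteType.isNoetherianRing ℂ A
    exact IsNoetherian.noetherian J
  obtain ⟨G, hG⟩ := hJfg
  -- elements of the ideal of the centre at a point of `Spec A`
  have hstalk : ∀ R' ∈ specModel A.toSubring, ∀ x ∈ idealAt P R', ∃ a : A, a ∈ J ∧
      ∃ s ∈ A, UnitIn R' s ∧ (x : F) = a / s := by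
    intro R' hR' x hx
    obtain ⟨a, ha, s, hs, hu, hxs⟩ := (mem_specModel_iff.1 hR').2 x x.2
    by_cases h : R'.toSubring ≤ P.toSubring
    · refine ⟨⟨a, ha⟩, (hJ _).2 ?_, s, hs, hu, hxs⟩
      have := ((mem_idealAt_iff h x).1 hx).mul_right (hAP hs)
      rwa [hxs, div_mul_cancel₀ _ hu.1] at this
    -- At a point off the centre, some element of `J` is a unit, and multiplying by it puts any
    -- numerator into `J`.
    · have : ∃ t ∈ A, UnitIn R' t ∧ InMax P t := by
        by_contra hcon
        push Not at hcon
        refine h fun x hx => ?_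
        obtain ⟨a, ha, s, hs, hu, rfl⟩ := (mem_specModel_iff.1 hR').2 x hx
        have := (unitIn_iff (hAP hs)).2 (hcon s hs hu)
        rw [div_eq_mul_inv]
        exact mul_mem (hAP ha) this.2.2
      obtain ⟨t, ht, hut, htP⟩ := this
      refine ⟨⟨a * t, A.mul_mem ha ht⟩, (hJ _).2 (htP.mul_left (hAP ha)), s * t, A.mul_mem hs ht,
        hu.mul hut, ?_⟩
      change (x : F) = (a * t) / (s * t)
      rw [mul_div_mul_right _ _ hut.1, hxs]
  have hJstalk : ∀ R' ∈ specModel A.toSubring, ∀ a : A, a ∈ J → ∀ h : (a : F) ∈ R'.toSubring,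
      (⟨a, h⟩ : R'.toSubring) ∈ idealAt P R' := by
    intro R' hR' a ha h
    by_cases h' : R'.toSubring ≤ P.toSubring
    · rw [mem_idealAt_iff h']; exact (hJ a).1 ha
    · rw [idealAt_eq_top h']; trivial
  obtain ⟨γ, hγJ, s, hs, hu, hgγ⟩ := hstalk R hRA g hgI
  have hγ0 : (γ : F) ≠ 0 := fun h => hg0 (by rw [hgγ, h, zero_div])
  have hγA : (γ : F) ∈ A := γ.2
  -- the affine chart of the blow-up of `Spec A`
  let B : Subalgebra ℂ F := A ⊔ Algebra.adjoin ℂ ((fun a : A => (a : F) / γ) '' (G : Set A))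
  have hBfg : B.FG := hAfg.sup (Subalgebra.fg_def.2 ⟨_, G.finite_toSet.image _, rfl⟩)
  have hAB : A.toSubring ≤ B.toSubring := fun x hx => (le_sup_left : A ≤ B) hx
  have hJB : ∀ a : A, a ∈ J → (a : F) / γ ∈ B := by
    intro a ha
    rw [← hG] at ha
    induction ha using Submodule.span_induction with
    | mem x hx => exact (le_sup_right : _ ≤ B) (Algebra.subset_adjoin ⟨x, hx, rfl⟩)
    | zero => simp [B.zero_mem]
    | add x y _ _ hx hy => rw [Subalgebra.coe_add, add_div]; exact B.add_mem hx hy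
    | smul c x _ hx =>
      rw [smul_eq_mul, Subalgebra.coe_mul, mul_div_assoc]
      exact B.mul_mem ((le_sup_left : A ≤ B) c.2) hx
  have hBle : ∀ {S : Subring F}, A.toSubring ≤ S → (∀ a : A, a ∈ J → (a : F) / γ ∈ S) →
      B.toSubring ≤ S := by
    intro S hAS hS
    let S' : Subalgebra ℂ F := { S with algebraMap_mem' := fun z => hAS (A.algebraMap_mem z) }
    have : B ≤ S' := by
      refine sup_le (fun x hx => hAS hx) (Algebra.adjoin_le ?_)
      rintro _ ⟨a, ha, rfl⟩
      exact hS a (hG ▸ Ideal.subset_span ha)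
    exact fun x hx => this hx
  refine ⟨B, hBfg, ?_, ?_⟩
  · have hBQ : B.toSubring ≤ Q.toSubring := by
      refine hBle (hAR.trans hRQ) fun a ha => ?_
      have h1 := hle (div_mem_blowUpChart g (hJstalk R hRA a ha (hAR a.2)))
      have h2 : (a : F) / γ = a / g * s⁻¹ := by
        rw [hgγ]; field_simp [hu.1]
      rw [h2]
      exact mul_mem h1 (hu.mono hRQ).2.2
    refine mem_specModel_of_le_fracIn hQ hBQ (blowUpChart_le ?_ ?_)
    · intro x hx
      obtain ⟨a, ha, s, hs, hu, rfl⟩ := (mem_specModel_iff.1 hRA).2 x hx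
      exact ⟨a, hAB ha, s, hAB hs, hu.mono hRQ, rfl⟩
    · intro x hx
      obtain ⟨a, ha, t, ht, hut, hxa⟩ := hstalk R hRA x hx
      refine ⟨a / γ * s, mul_mem (hJB a ha) (hAB hs), t, hAB ht, hut.mono hRQ, ?_⟩
      rw [hxa, hgγ]
      field_simp [hu.1]
  -- Every point of `Spec A[J/γ]` belongs to the blow-up: it lies in the chart of `γ` over the
  -- localization of `A` below it.
  · intro Q' hQ'
    have hBQ' := le_of_mem_specModel hQ'
    obtain ⟨R', hR', hR'Q', hR'f⟩ := exists_localization (hAB.trans hBQ')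
    have hAR' := le_of_mem_specModel hR'
    refine ⟨R', hAM hR', ⟨γ, hAR' γ.2⟩, hJstalk R' hR' γ hγJ _,
      fun h => hγ0 (congrArg Subtype.val h), ?_⟩
    refine mem_specModel_of_le hQ' (hBle (hAR'.trans (le_blowUpChart _ _ _)) fun a ha => ?_)
      (blowUpChart_le (LocalSubring.toSubring_mono hR'Q') fun x hx => ?_)
    · exact div_mem_blowUpChart (⟨γ, hAR' γ.2⟩ : R'.toSubring) (hJstalk R' hR' a ha (hAR' a.2))
    · obtain ⟨a, ha, t, ht, hut, hxa⟩ := hstalk R' hR' x hx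
      have h1 : (x : F) / γ = a / γ * t⁻¹ := by rw [hxa]; field_simp [hut.1]
      change (x : F) / γ ∈ Q'.toSubring
      rw [h1]
      exact mul_mem (hBQ' (hJB a ha)) (hut.mono (LocalSubring.toSubring_mono hR'Q')).2.2

theorem exists_mem_notMem_of_card {T T' : Finset ι} (h : T.card = 3) (h' : T'.card = 3)
    (hne : T ≠ T') : ∃ j ∈ T, j ∉ T' := by
  by_contra hcon
  push Not at hcon
  exact hne (Finset.eq_of_subset_of_card_le hcon (by omega))

/-- Centres do not contain each other. -/
theorem IsGood.eq_of_le {Ps M : Set (LocalSubring F)} (h : IsGood ι Ps M) {P P' : LocalSubring F}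
    (hP : P ∈ Ps) (hP' : P' ∈ Ps) (hle : P'.toSubring ≤ P.toSubring) : P = P' := by
  obtain ⟨y, hy, -, hyP⟩ := h.adapted P' (h.centres hP')
  obtain ⟨T, hT, hlin⟩ := hyP P hP hle
  obtain ⟨T', hT', hlin'⟩ := hyP P' hP' le_rfl
  by_cases hTT : T = T'
  · subst hTT; exact hlin.unique hlin'
  · obtain ⟨j, hj, hj'⟩ := exists_mem_notMem_of_card hT hT' hTT
    exact absurd (hlin.inMax hj) ((hlin'.unitIn hj').mono hle).not_inMax

/-- A point through which a centre of codimension three passes has at least two vanishing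
coordinates, hence dimension at least two; so points of codimension at most one are untouched. -/
theorem IsGood.mem_blowUp_of_dim_lt {Ps M : Set (LocalSubring F)} {P : LocalSubring F}
    (h : IsGood ι (insert P Ps) M) {R : LocalSubring F} (hR : R ∈ M)
    (hd : ¬ 2 ≤ ringKrullDim R.toSubring) : R ∈ TropicalWeyl.blowUp M P := by
  refine mem_blowUp_of_not_le hR fun hle => ?_
  obtain ⟨y, hy, hRy, hyP⟩ := h.adapted R hR
  obtain ⟨T, hT, hlin⟩ := hyP P (Set.mem_insert _ _) hle
  obtain ⟨i, hi, j, hj, hij⟩ := Finset.one_lt_card.1 (by omega : 1 < T.card)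
  exact hd (two_le_dim_of_inMax hy hRy hij
    ((hlin.inMax hi).of_le hle (coord_mem_of_mem_specModel hRy i))
    ((hlin.inMax hj).of_le hle (coord_mem_of_mem_specModel hRy j)))

theorem IsGood.mem_blowUp_of_isExc {Ps M : Set (LocalSubring F)} {P : LocalSubring F}
    (h : IsGood ι (insert P Ps) M) {E : LocalSubring F} (hE : IsExc ι P E) :
    E ∈ TropicalWeyl.blowUp M P := by
  obtain ⟨y, T, i, hy, hT, hlin, hi, hE⟩ := hE
  exact ⟨P, h.centres (Set.mem_insert _ _), hlin.mem_chart_of_chartZ hy hi hE⟩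

variable [Finite ι]

/-- The class of models is stable because another centre through the same chart is a coordinate
subspace `T' ≠ T` on which `y_i` is invertible. Dividing coordinates by `y_i` therefore keeps it
linear. The generic point of its strict transform is the old one, since centres do not contain each
other. -/
theorem IsGood.blowUp {Ps M : Set (LocalSubring F)} {P : LocalSubring F}
    (h : IsGood ι (insert P Ps) M) (hP : P ∉ Ps) : IsGood ι Ps (blowUp M P) where
  lfg := h.lfg.blowUp P
  sep := h.sep.blowUp h.lfg P
  centres := fun P' hP' => mem_blowUp_of_not_le (h.centres (Set.mem_insert_of_mem _ hP'))
    fun hle => hP (h.eq_of_le (Set.mem_insert _ _) (Set.mem_insert_of_mem _ hP') hle ▸ hP')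
  adapted := by
    rintro Q ⟨R, hR, g, hgI, hg, hQ⟩
    by_cases hRP : R.toSubring ≤ P.toSubring
    swap
    · obtain ⟨y, hy, hQy, hyP⟩ := h.adapted Q
        (h.lfg.mem_of_mem_specModel hR (mem_specModel_of_mem_chart hRP hg hQ))
      exact ⟨y, hy, hQy, fun P' hP' => hyP P' (Set.mem_insert_of_mem _ hP')⟩
    obtain ⟨y, hy, hRy, hyP⟩ := h.adapted R hR
    obtain ⟨T, hT, hlin⟩ := hyP P (Set.mem_insert _ _) hRP
    obtain ⟨i, hi, hQz⟩ := exists_chartZ_of_mem_chart hy hlin hRy hRP hgI hg hQ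
    have hRQ := (le_blowUpChart R (idealAt P R) g).trans (le_of_mem_specModel hQ)
    refine ⟨chartZ y T i, isCoord_chartZ hy T i, hQz, fun P' hP' hQP' => ?_⟩
    obtain ⟨T', hT', hlin'⟩ := hyP P' (Set.mem_insert_of_mem _ hP') (hRQ.trans hQP')
    refine ⟨T', hT', ?_⟩
    have hTT : T ≠ T' := by
      rintro rfl
      exact hP (hlin.unique hlin' ▸ hP')
    obtain ⟨j, hj, hj'⟩ := exists_mem_notMem_of_card hT hT' hTT
    have hzP' := fun t => hQP' (coord_mem_of_mem_specModel hQz t)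
    -- If `y_i` vanished on `P'`, then so would `y_j = z_j y_i`, because the point `P'` lies in this
    -- chart; but `j ∉ T'`.
    have hiT' : i ∉ T' := fun hi' => by
      have hji : j ≠ i := fun h => hj' (h ▸ hi')
      have h1 := InMax.mul_left (hzP' j) (hlin'.inMax hi')
      rw [← chartZ_self y T i, ← eq_chartZ_mul hy hj hji] at h1
      exact (hlin'.unitIn hj').not_inMax h1
    have hyi := hlin'.unitIn hiT'
    refine hlin'.change (isCoord_chartZ hy T i) ?_ ?_ ?_
    · exact mem_specModel_of_le hlin'.1 (coordRing_le_chartZ hy T i)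
        ((le_of_mem_specModel hQz).trans hQP')
    · intro t ht
      by_cases hc : t ∈ T ∧ t ≠ i
      · rw [chartZ_of_ne hc.1 hc.2, div_eq_mul_inv]
        exact (hlin'.inMax ht).mul_right hyi.2.2
      · rw [chartZ, if_neg hc]
        exact hlin'.inMax ht
    · intro t ht
      have hmem : ∀ {t}, t ∉ T' → y t ∈
          IntermediateField.adjoin ℂ (Set.range fun j : {j // j ∉ T'} => y j) := fun {t} ht =>
        IntermediateField.subset_adjoin _ _ ⟨⟨t, ht⟩, rfl⟩
      by_cases hc : t ∈ T ∧ t ≠ i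
      · rw [chartZ_of_ne hc.1 hc.2]
        exact div_mem (hmem ht) (hmem hiT')
      · rw [chartZ, if_neg hc]
        exact hmem ht

/-- In the `i`-th chart the exceptional locus is `y_i = 0`. Where `y_i` is a unit, the chart is a
localization of the ring below. -/
theorem IsGood.mem_or_isExc_of_mem_blowUp {Ps M : Set (LocalSubring F)} {P : LocalSubring F}
    (h : IsGood ι (insert P Ps) M) {Q : LocalSubring F} (hQ : Q ∈ TropicalWeyl.blowUp M P)
    (hd : ¬ 2 ≤ ringKrullDim Q.toSubring) : Q ∈ M ∨ IsExc ι P Q := by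
  obtain ⟨R, hR, g, hgI, hg, hQ⟩ := hQ
  by_cases hRP : R.toSubring ≤ P.toSubring
  swap
  · exact Or.inl (h.lfg.mem_of_mem_specModel hR (mem_specModel_of_mem_chart hRP hg hQ))
  obtain ⟨y, hy, hRy, hyP⟩ := h.adapted R hR
  obtain ⟨T, hT, hlin⟩ := hyP P (Set.mem_insert _ _) hRP
  obtain ⟨i, hi, hQz⟩ := exists_chartZ_of_mem_chart hy hlin hRy hRP hgI hg hQ
  have hRQ := (le_blowUpChart R (idealAt P R) g).trans (le_of_mem_specModel hQ)
  have hyR : ∀ t, y t ∈ R.toSubring := coord_mem_of_mem_specModel hRy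
  by_cases hyi : InMax Q (y i)
  · refine Or.inr ⟨y, T, i, hy, hT, hlin, hi, ?_⟩
    exact isLin_singleton_of_dim_lt (isCoord_chartZ hy T i) hQz hd (by rwa [chartZ_self])
  · refine Or.inl (h.lfg.mem_of_mem_specModel hR ?_)
    have hu := (unitIn_iff (hRQ (hyR i))).2 hyi
    refine mem_specModel_of_le_fracIn hQz hRQ (coordRing_le
      (fun c => le_fracIn _ _ (algebraMap_mem_of_mem_specModel hRy c)) fun t => ?_)
    by_cases hc : t ∈ T ∧ t ≠ i
    · rw [chartZ_of_ne hc.1 hc.2]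
      exact ⟨_, hyR t, _, hyR i, hu, rfl⟩
    · rw [chartZ, if_neg hc]
      exact le_fracIn _ _ (hyR t)

/-- The successive blow-up along a list of centres. -/
theorem IsGood.foldl {κ : Type*} (c : κ → LocalSubring F) (hc : Function.Injective c) (o : List κ) :
    o.Nodup → ∀ {M : Set (LocalSubring F)}, IsGood ι (c '' {a | a ∈ o}) M →
      IsGood ι ∅ (o.foldl (fun M a => TropicalWeyl.blowUp M (c a)) M) ∧
      ∀ Q : LocalSubring F, ¬ 2 ≤ ringKrullDim Q.toSubring →
        (Q ∈ o.foldl (fun M a => TropicalWeyl.blowUp M (c a)) M ↔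
          Q ∈ M ∨ ∃ a ∈ o, IsExc ι (c a) Q) := by
  induction o with
  | nil => intro _ M hM; simpa using hM
  | cons a o ih =>
    intro ho M hM
    have hset : c '' {x | x ∈ a :: o} = insert (c a) (c '' {x | x ∈ o}) := by
      rw [← Set.image_insert_eq]; congr 1; ext x; simp
    rw [hset] at hM
    have hna : c a ∉ c '' {x | x ∈ o} := by
      rintro ⟨x, hx, hxa⟩
      exact (List.nodup_cons.1 ho).1 (hc hxa ▸ hx)
    obtain ⟨h1, h2⟩ := ih (List.nodup_cons.1 ho).2 (hM.blowUp hna)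
    refine ⟨h1, fun Q hd => (h2 Q hd).trans ?_⟩
    constructor
    · rintro (h | ⟨x, hx, hE⟩)
      · rcases hM.mem_or_isExc_of_mem_blowUp h hd with h | h
        · exact Or.inl h
        · exact Or.inr ⟨a, by simp, h⟩
      · exact Or.inr ⟨x, by simp [hx], hE⟩
    · rintro (h | ⟨x, hx, hE⟩)
      · exact Or.inl (hM.mem_blowUp_of_dim_lt h hd)
      · rcases List.mem_cons.1 hx with rfl | hx
        · exact Or.inl (hM.mem_blowUp_of_isExc hE)
        · exact Or.inr ⟨x, hx, hE⟩

end Good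

/-! ### The product of projective lines -/

section Shift

variable {F ι : Type*} [Field F] [Algebra ℂ F]

/-- Translation of coordinates. -/
def shift (y : ι → F) (s : ι → ℂ) : ι → F := fun j => y j - algebraMap ℂ F (s j)

theorem coordRing_shift (y : ι → F) (s : ι → ℂ) : coordRing (shift y s) = coordRing y := by
  apply le_antisymm
  · exact coordRing_le (algebraMap_mem_coordRing y) fun j =>
      sub_mem (coord_mem_coordRing y j) (algebraMap_mem_coordRing y _)
  · refine coordRing_le (algebraMap_mem_coordRing _) fun j => ?_
    have : y j = shift y s j + algebraMap ℂ F (s j) := by simp [shift]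
    rw [this]
    exact add_mem (coord_mem_coordRing _ j) (algebraMap_mem_coordRing _ _)

theorem IsCoord.of_coordRing [Finite ι] {y w : ι → F} (hy : IsCoord ℂ y)
    (h : ∀ j, y j ∈ coordRing w) : IsCoord ℂ w := by
  refine hy.of_mem fun j => ?_
  obtain ⟨g, hg⟩ := h j
  rw [← hg]
  exact aeval_mem_adjoin_range _ _ _ fun j => IntermediateField.subset_adjoin _ _ ⟨j, rfl⟩

theorem IsCoord.shift [Finite ι] {y : ι → F} (hy : IsCoord ℂ y) (s : ι → ℂ) :
    IsCoord ℂ (shift y s) :=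
  hy.of_coordRing fun j => by rw [coordRing_shift]; exact coord_mem_coordRing y j

theorem fg_coordRing [Finite ι] (y : ι → F) :
    ∃ A : Subalgebra ℂ F, A.FG ∧ A.toSubring = coordRing y := by
  refine ⟨Algebra.adjoin ℂ (Set.range y),
    Subalgebra.fg_def.2 ⟨_, Set.finite_range y, rfl⟩, ?_⟩
  ext x
  change x ∈ Algebra.adjoin ℂ (Set.range y) ↔ _
  rw [Algebra.adjoin_range_eq_range_aeval]
  rfl

end Shift

/-! ### Affine charts and linear subspaces of `(ℙ¹)^N`. -/

section ProjLine

variable {N : ℕ}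

theorem isCoord_coord : IsCoord ℂ (coord : ZMod N → FunField N) := by
  have h : (MvPolynomial.aeval (coord : ZMod N → FunField N) : MvPolynomial (ZMod N) ℂ →ₐ[ℂ] _) =
      IsScalarTower.toAlgHom ℂ (MvPolynomial (ZMod N) ℂ) (FunField N) := by
    apply MvPolynomial.algHom_ext
    intro i
    simp [coord]
  constructor
  · rw [algebraicIndependent_iff_injective_aeval, h]
    exact IsFractionRing.injective (MvPolynomial (ZMod N) ℂ) (FunField N)
  · rw [eq_top_iff]
    rintro x -
    obtain ⟨a, c, -, rfl⟩ := IsFractionRing.div_surjective (A := MvPolynomial (ZMod N) ℂ) x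
    rw [IntermediateField.mem_adjoin_range_iff]
    exact ⟨a, c, by rw [h]; rfl⟩

theorem chartCoord_ne_zero (inv : ZMod N → Prop) (m : ZMod N) : chartCoord inv m ≠ 0 := by
  have := (isCoord_coord (N := N)).ne_zero m
  rw [chartCoord]; split_ifs <;> simp [this]

theorem chartCoord_eq_or (inv inv' : ZMod N → Prop) (m : ZMod N) :
    chartCoord inv' m = chartCoord inv m ∨ chartCoord inv' m = (chartCoord inv m)⁻¹ := by
  rw [chartCoord, chartCoord]; split_ifs <;> simp

theorem isCoord_chartCoord [Finite (ZMod N)] (inv : ZMod N → Prop) : IsCoord ℂ (chartCoord inv) := by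
  refine isCoord_coord.of_mem fun j => ?_
  have h : chartCoord inv j ∈ IntermediateField.adjoin ℂ (Set.range (chartCoord inv)) :=
    IntermediateField.subset_adjoin _ _ ⟨j, rfl⟩
  by_cases hj : inv j
  · have : coord j = (chartCoord inv j)⁻¹ := by simp [chartCoord, hj]
    rw [this]; exact inv_mem h
  · have : coord j = chartCoord inv j := by simp [chartCoord, hj]
    rw [this]; exact h

theorem mem_projLineProd_iff {Q : LocalSubring (FunField N)} :
    Q ∈ projLineProd N ↔ ∃ inv : ZMod N → Prop, Q ∈ specModel (coordRing (chartCoord inv)) :=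
  Iff.rfl

/-- Two charts differ by inverting coordinates. If a coordinate and its inverse are both regular at
`Q`, it is a unit there, so passing between the charts is a localization at `Q`. -/
theorem mem_specModel_chart {Q : LocalSubring (FunField N)} (hQ : Q ∈ projLineProd N)
    {inv : ZMod N → Prop} (h : ∀ m, chartCoord inv m ∈ Q.toSubring) :
    Q ∈ specModel (coordRing (chartCoord inv)) := by
  obtain ⟨inv', hQ⟩ := mem_projLineProd_iff.1 hQ
  refine mem_specModel_coordRing hQ h fun m => ?_
  rcases chartCoord_eq_or inv inv' m with h1 | h1
  · rw [h1]; exact le_fracIn _ _ (coord_mem_coordRing _ m)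
  · have h2 := coord_mem_of_mem_specModel hQ m
    have hu : UnitIn Q (chartCoord inv m) := ⟨chartCoord_ne_zero _ _, h m, h1 ▸ h2⟩
    rw [h1]
    exact fracIn_inv_mem (le_fracIn _ _ (coord_mem_coordRing _ m)) hu

/-- If the two charts use inverse coordinates in some factor, then both belong to the dominating
ring. The coordinate is thus a unit there, hence a unit in the dominated local ring. -/
theorem separated_projLineProd (N : ℕ) : Separated (projLineProd N) := by
  intro R₁ h₁ R₂ h₂ Q h₁Q h₂Q
  obtain ⟨inv₁, hR₁⟩ := mem_projLineProd_iff.1 h₁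
  obtain ⟨inv₂, hR₂⟩ := mem_projLineProd_iff.1 h₂
  refine eq_of_mem_specModel_of_le hR₁ (mem_specModel_chart h₂ fun m => ?_) h₁Q h₂Q
  have a1 := coord_mem_of_mem_specModel hR₁ m
  have a2 := coord_mem_of_mem_specModel hR₂ m
  rcases chartCoord_eq_or inv₂ inv₁ m with h | h
  · rw [h]; exact a2
  · have hu : UnitIn Q (chartCoord inv₂ m) :=
      ⟨chartCoord_ne_zero _ _, LocalSubring.toSubring_mono h₂Q a2,
        h ▸ LocalSubring.toSubring_mono h₁Q a1⟩
    rw [h]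
    exact (hu.of_le h₂Q a2).2.2

theorem locallyFG_projLineProd [Finite (ZMod N)] : LocallyFG (projLineProd N) := by
  rintro R ⟨inv, hR⟩
  obtain ⟨A, hA, hAy⟩ := fg_coordRing (chartCoord inv)
  refine ⟨A, hA, by rw [hAy]; exact hR, fun Q hQ => ⟨inv, ?_⟩⟩
  rw [hAy] at hQ
  exact hQ

/-- The points `linearPoint inv c` are generic points of linear subspaces. -/
theorem isLin_linearPoint (inv : ZMod N → Prop) (c : ZMod N → Option ℂ) (T : Finset (ZMod N))
    (hT : ∀ m, m ∈ T ↔ c m ≠ none) :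
    IsLin (shift (chartCoord inv) fun m => (c m).getD 0) T (linearPoint inv c) := by
  have h0 : linearPoint inv c ∈ specModel (chartHom inv).toRingHom.range :=
    ⟨_, inferInstance, rfl⟩
  refine ⟨by rw [coordRing_shift]; exact h0, fun g => ?_⟩
  let g' : MvPolynomial (ZMod N) ℂ :=
    MvPolynomial.aeval (fun j => MvPolynomial.X j - MvPolynomial.C ((c j).getD 0)) g
  have h1 : MvPolynomial.aeval (shift (chartCoord inv) fun m => (c m).getD 0) g =
      ((chartEquiv inv g' : (chartHom inv).toRingHom.range) : FunField N) := by
    change _ = chartHom inv g'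
    have : (chartHom inv).comp (MvPolynomial.aeval
        (fun j => MvPolynomial.X j - MvPolynomial.C ((c j).getD 0))) =
        MvPolynomial.aeval (shift (chartCoord inv) fun m => (c m).getD 0) := by
      apply MvPolynomial.algHom_ext
      intro j
      simp [chartHom, shift]
    exact (DFunLike.congr_fun this g).symm
  rw [h1, linearPoint, inMax_ofPrime_iff, Ideal.mem_comap]
  have h2 : ((chartEquiv inv).symm : _ →+* MvPolynomial (ZMod N) ℂ) (chartEquiv inv g') = g' :=
    (chartEquiv inv).symm_apply_apply g'
  rw [h2, linearIdeal, RingHom.mem_ker]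
  have h3 : (MvPolynomial.aeval (R := ℂ)
      (fun n => (c n).elim (MvPolynomial.X n) (fun z => MvPolynomial.C z)) :
      MvPolynomial (ZMod N) ℂ →ₐ[ℂ] MvPolynomial (ZMod N) ℂ).comp (MvPolynomial.aeval
        (fun j => MvPolynomial.X j - MvPolynomial.C ((c j).getD 0))) = restr T := by
    apply MvPolynomial.algHom_ext
    intro j
    by_cases hj : c j = none
    · rw [restr_X_of_notMem (by rw [hT]; simpa using hj)]
      simp [hj]
    · rw [restr_X_of_mem ((hT j).2 hj)]
      obtain ⟨z, hz⟩ := Option.ne_none_iff_exists'.1 hj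
      simp [hz]
  have h4 := DFunLike.congr_fun h3 g
  rw [← h4]
  rfl

theorem linearPoint_mem_projLineProd (inv : ZMod N → Prop) (c : ZMod N → Option ℂ) :
    linearPoint inv c ∈ projLineProd N := ⟨inv, _, inferInstance, rfl⟩

theorem inMax_shift_unique {F : Type*} [Field F] [Algebra ℂ F] {R : LocalSubring F}
    (hC : ContainsC R) {x : F} {s t : ℂ}
    (hs : InMax R (x - algebraMap ℂ F s)) (ht : InMax R (x - algebraMap ℂ F t)) : s = t := by
  by_contra hne
  have := ht.sub hs
  rw [sub_sub_sub_cancel_left, ← map_sub] at this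
  exact (hC.unitIn (sub_ne_zero.2 hne)).not_inMax this

variable [Finite (ZMod N)]

/-- `(ℙ¹)^N` is adapted to linear subspaces of codimension three. -/
theorem isGood_projLineProd {Ps : Set (LocalSubring (FunField N))}
    (hPs : ∀ P ∈ Ps, ∃ (inv : ZMod N → Prop) (c : ZMod N → Option ℂ) (T : Finset (ZMod N)),
      T.card = 3 ∧ (∀ m, m ∈ T ↔ c m ≠ none) ∧ P = linearPoint inv c) :
    IsGood (ZMod N) Ps (projLineProd N) where
  lfg := locallyFG_projLineProd
  sep := separated_projLineProd N
  centres := by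
    intro P hP
    obtain ⟨inv, c, -, -, -, rfl⟩ := hPs P hP
    exact linearPoint_mem_projLineProd inv c
  adapted := by
    intro R hR
    have hRC := locallyFG_projLineProd.containsC hR
    obtain ⟨inv, hR⟩ := mem_projLineProd_iff.1 hR
    -- The translation depends on `R` alone: it moves the constant value of a coordinate at `R`, if
    -- it has one, to `0`. All centres through `R` must share this value, so one translation serves
    -- them all; the default `0` covers coordinates without a constant value at `R`.
    let s : ZMod N → ℂ := fun m =>
      if h : ∃ z, InMax R (chartCoord inv m - algebraMap ℂ _ z) then h.choose else 0
    have hs : ∀ m z, InMax R (chartCoord inv m - algebraMap ℂ _ z) → s m = z := fun m z hz => by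
      have h : ∃ z, InMax R (chartCoord inv m - algebraMap ℂ _ z) := ⟨z, hz⟩
      simp only [s, dif_pos h]
      exact inMax_shift_unique hRC h.choose_spec hz
    refine ⟨shift (chartCoord inv) s, (isCoord_chartCoord inv).shift s,
      by rw [coordRing_shift]; exact hR, fun P hP hRP => ?_⟩
    obtain ⟨inv', c, T, hcard, hT, rfl⟩ := hPs P hP
    refine ⟨T, hcard, ?_⟩
    have hlin := isLin_linearPoint inv' c T hT
    have hyP : ∀ m, chartCoord inv m ∈ (linearPoint inv' c).toSubring := fun m =>
      hRP (coord_mem_of_mem_specModel hR m)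
    refine hlin.change ((isCoord_chartCoord inv).shift s) ?_ ?_ ?_
    · rw [coordRing_shift]
      exact mem_specModel_chart (linearPoint_mem_projLineProd inv' c) hyP
    · intro t ht
      obtain ⟨z, hz⟩ := Option.ne_none_iff_exists'.1 ((hT t).1 ht)
      have h1 := hlin.inMax ht
      simp only [shift, hz, Option.getD_some] at h1
      have key : ∀ z', InMax (linearPoint inv' c) (chartCoord inv t - algebraMap ℂ _ z') →
          InMax (linearPoint inv' c) (shift (chartCoord inv) s t) := fun z' h => by
        have := hs t z' (h.of_le hRP (sub_mem (coord_mem_of_mem_specModel hR t) (hRC z')))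
        rw [shift, this]; exact h
      rcases chartCoord_eq_or inv inv' t with h2 | h2
      · exact key z (by rwa [h2] at h1)
      · have hx0 := chartCoord_ne_zero inv t
        -- Here the centre is described by the inverse of the coordinate used at `R`. A value `0`
        -- would give the latter a pole along a subvariety through `R`, so the value in the chart of
        -- `R` is `1 / z`.
        have hz0 : z ≠ 0 := by
          rintro rfl
          rw [map_zero, sub_zero, h2] at h1
          exact h1.ne_zero_imp (inv_ne_zero hx0) (by rw [inv_inv]; exact hyP t)
        have hz0' : algebraMap ℂ (FunField N) z ≠ 0 := by simpa using hz0
        refine key z⁻¹ ?_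
        have h3 := h1.mul_left (mul_mem (hyP t) (hlin.containsC (-z⁻¹)))
        convert h3 using 1
        rw [h2, map_neg, map_inv₀]
        field_simp
        ring
    · intro j hj
      have hc : c j = none := by simpa using fun h => hj ((hT j).2 h)
      have h1 : chartCoord inv' j ∈ IntermediateField.adjoin ℂ (Set.range fun j : {j // j ∉ T} =>
          shift (chartCoord inv') (fun m => (c m).getD 0) j) := by
        refine IntermediateField.subset_adjoin _ _ ⟨⟨j, hj⟩, ?_⟩
        simp [shift, hc]
      refine sub_mem ?_ (IntermediateField.algebraMap_mem _ _)
      rcases chartCoord_eq_or inv' inv j with h2 | h2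
      · rw [h2]; exact h1
      · rw [h2]; exact inv_mem h1

end ProjLine

/-! ### Orders along prime divisors -/

section Order

variable {F : Type*} [Field F]

/-- `V` is a discrete valuation ring of `F` with uniformizer `ϖ`. -/
structure IsUnif (V : LocalSubring F) (ϖ : F) : Prop where
  inMax : InMax V ϖ
  ne_zero : ϖ ≠ 0
  exists_unit : ∀ x : F, x ≠ 0 → ∃ m : ℤ, ∃ u : F, UnitIn V u ∧ x = u * ϖ ^ m

/-- `V` is a discrete valuation ring of `F`. -/
def IsDV (V : LocalSubring F) : Prop := ∃ ϖ, IsUnif V ϖ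

theorem IsUnif.zpow_mem {V : LocalSubring F} {ϖ : F} (h : IsUnif V ϖ) {m : ℤ} (hm : 0 ≤ m) :
    ϖ ^ m ∈ V.toSubring := by
  lift m to ℕ using hm
  rw [zpow_natCast]
  exact pow_mem h.inMax.1 m

theorem IsUnif.zpow_inMax {V : LocalSubring F} {ϖ : F} (h : IsUnif V ϖ) {m : ℤ} (hm : 0 < m) :
    InMax V (ϖ ^ m) := by
  have : ϖ ^ m = ϖ ^ (m - 1) * ϖ := by
    rw [← zpow_add_one₀ h.ne_zero, sub_add_cancel]
  rw [this]
  exact h.inMax.mul_left (h.zpow_mem (by omega))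

theorem IsUnif.eq_zero_of_unitIn {V : LocalSubring F} {ϖ : F} (h : IsUnif V ϖ) {m : ℤ}
    (hu : UnitIn V (ϖ ^ m)) : m = 0 := by
  rcases lt_trichotomy m 0 with hm | hm | hm
  · have h1 := hu.inv
    rw [← zpow_neg] at h1
    exact absurd (h.zpow_inMax (by omega)) h1.not_inMax
  · exact hm
  · exact absurd (h.zpow_inMax hm) hu.not_inMax

/-- Two uniformizers differ by a unit. This is needed because `HasOrd` may use any generator of the
maximal ideal. -/
theorem IsUnif.unitIn_div {V : LocalSubring F} {ϖ ϖ' : F} (h : IsUnif V ϖ) (h0 : ϖ' ≠ 0)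
    (h' : ∃ π : V.toSubring, IsLocalRing.maximalIdeal V.toSubring = Ideal.span {π} ∧ (π : F) = ϖ') :
    UnitIn V (ϖ' / ϖ) := by
  obtain ⟨π, hπ, rfl⟩ := h'
  have h1 : InMax V (π : F) := (inMax_iff π.2).2 (by
    change π ∈ _
    rw [hπ]; exact Ideal.mem_span_singleton_self π)
  obtain ⟨m, u, hu, hx⟩ := h.exists_unit _ h0
  have h2 := (inMax_iff h.inMax.1).1 h.inMax
  rw [hπ, Ideal.mem_span_singleton] at h2
  obtain ⟨c, hc⟩ := h2
  have hc' : ϖ = (π : F) * c := congrArg Subtype.val hc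
  have h3 : (π : F) / ϖ = u * ϖ ^ (m - 1) := by
    rw [zpow_sub_one₀ h.ne_zero, ← mul_assoc, ← hx, div_eq_mul_inv]
  have hm : 0 < m := by
    by_contra hcon
    refine (h1.mul_left (mul_mem hu.2.2 (h.zpow_mem (m := -m) (by omega)))).not_unitIn ?_
    rw [hx, zpow_neg]
    have h4 := zpow_ne_zero m h.ne_zero
    have h5 := hu.1
    have : u⁻¹ * (ϖ ^ m)⁻¹ * (u * ϖ ^ m) = 1 := by field_simp
    rw [this]
    exact unitIn_one V
  refine ⟨div_ne_zero h0 h.ne_zero, ?_, ?_⟩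
  · rw [h3]
    exact mul_mem hu.2.1 (h.zpow_mem (by omega))
  · rw [inv_div]
    have : ϖ / π = c := by
      have := h.ne_zero
      rw [div_eq_iff h0, mul_comm]; exact hc'
    rw [this]; exact c.2

theorem IsUnif.maximalIdeal_eq {V : LocalSubring F} {ϖ : F} (h : IsUnif V ϖ) :
    IsLocalRing.maximalIdeal V.toSubring = Ideal.span {⟨ϖ, h.inMax.1⟩} := by
  ext ⟨x, hx⟩
  rw [← inMax_iff hx, Ideal.mem_span_singleton]
  constructor
  · intro hxm
    by_cases h0 : x = 0
    · exact ⟨0, Subtype.ext (by simp [h0])⟩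
    obtain ⟨m, u, hu, rfl⟩ := h.exists_unit x h0
    have hm : 0 < m := by
      by_contra hcon
      refine (hxm.mul_left (h.zpow_mem (m := -m) (by omega))).not_unitIn ?_
      have h4 := zpow_ne_zero m h.ne_zero
      have : ϖ ^ (-m) * (u * ϖ ^ m) = u := by rw [zpow_neg]; field_simp
      rw [this]
      exact hu
    refine ⟨⟨u * ϖ ^ (m - 1), mul_mem hu.2.1 (h.zpow_mem (by omega))⟩, Subtype.ext ?_⟩
    change u * ϖ ^ m = ϖ * (u * ϖ ^ (m - 1))
    rw [zpow_sub_one₀ h.ne_zero]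
    field_simp [h.ne_zero]
  · rintro ⟨c, hc⟩
    have hc' : x = ϖ * c := congrArg Subtype.val hc
    rw [hc']
    exact h.inMax.mul_right c.2

theorem IsUnif.hasOrd_iff {V : LocalSubring F} {ϖ : F} (h : IsUnif V ϖ) {x : F} {m : ℤ} :
    HasOrd V x m ↔ ∃ u, UnitIn V u ∧ x = u * ϖ ^ m := by
  constructor
  · rintro ⟨π, hπ, u, rfl⟩
    have hu : UnitIn V ((u : V.toSubring) : F) := by
      have := (isUnit_toSubring_iff (u : V.toSubring)).1 u.isUnit
      exact ⟨this.1, (u : V.toSubring).2, this.2⟩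
    have h0 : (π : F) ≠ 0 := by
      intro h0
      have h1 := (inMax_iff h.inMax.1).1 h.inMax
      rw [hπ, Ideal.mem_span_singleton] at h1
      obtain ⟨c, hc⟩ := h1
      have : ϖ = (π : F) * c := congrArg Subtype.val hc
      exact h.ne_zero (by rw [this, h0, zero_mul])
    have hd := h.unitIn_div h0 ⟨π, hπ, rfl⟩
    have hdm : UnitIn V (((π : F) / ϖ) ^ m) := by
      cases m with
      | ofNat n =>
        induction n with
        | zero => simpa using unitIn_one V
        | succ n ih =>
          rw [Int.ofNat_eq_natCast, zpow_natCast] at ih ⊢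
          rw [pow_succ]; exact ih.mul hd
      | negSucc n =>
        rw [zpow_negSucc]
        refine UnitIn.inv ?_
        induction n with
        | zero => simpa using hd
        | succ n ih => rw [pow_succ]; exact ih.mul hd
    refine ⟨_, hu.mul hdm, ?_⟩
    rw [div_zpow, mul_assoc, div_mul_cancel₀ _ (zpow_ne_zero m h.ne_zero)]
  · rintro ⟨u, hu, rfl⟩
    obtain ⟨w, hw⟩ := (isUnit_toSubring_iff (⟨u, hu.2.1⟩ : V.toSubring)).2 ⟨hu.1, hu.2.2⟩
    exact ⟨⟨ϖ, h.inMax.1⟩, h.maximalIdeal_eq, w, by rw [hw]⟩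

/-- The order of `x` along `V`. -/
def ordAt (V : LocalSubring F) (x : F) : ℤ :=
  if h : ∃ m, HasOrd V x m then h.choose else 0

theorem IsUnif.hasOrd_unique {V : LocalSubring F} {ϖ : F} (h : IsUnif V ϖ) {x : F} {m m' : ℤ}
    (hm : HasOrd V x m) (hm' : HasOrd V x m') : m = m' := by
  obtain ⟨u, hu, rfl⟩ := h.hasOrd_iff.1 hm
  obtain ⟨u', hu', he⟩ := h.hasOrd_iff.1 hm'
  have h1 : ϖ ^ (m - m') = u' / u := by
    rw [zpow_sub₀ h.ne_zero, div_eq_div_iff (zpow_ne_zero _ h.ne_zero) hu.1, mul_comm, he]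
  have := h.eq_zero_of_unitIn (m := m - m') (by rw [h1]; exact hu'.div hu)
  omega

variable {V : LocalSubring F} {x y : F}

theorem IsDV.hasOrd_iff (hV : IsDV V) {m : ℤ} : HasOrd V x m ↔ x ≠ 0 ∧ ordAt V x = m := by
  obtain ⟨ϖ, h⟩ := hV
  constructor
  · intro hm
    have hx : ∃ m, HasOrd V x m := ⟨m, hm⟩
    refine ⟨?_, ?_⟩
    · obtain ⟨u, hu, rfl⟩ := h.hasOrd_iff.1 hm
      exact mul_ne_zero hu.1 (zpow_ne_zero _ h.ne_zero)
    · rw [ordAt, dif_pos hx]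
      exact h.hasOrd_unique hx.choose_spec hm
  · rintro ⟨hx, rfl⟩
    obtain ⟨m, u, hu, he⟩ := h.exists_unit x hx
    have hx : ∃ m, HasOrd V x m := ⟨m, h.hasOrd_iff.2 ⟨u, hu, he⟩⟩
    rw [ordAt, dif_pos hx]
    exact hx.choose_spec

theorem IsUnif.ordAt_eq {ϖ u : F} (h : IsUnif V ϖ) {m : ℤ} (hu : UnitIn V u) :
    ordAt V (u * ϖ ^ m) = m :=
  ((IsDV.hasOrd_iff ⟨ϖ, h⟩).1 (h.hasOrd_iff.2 ⟨u, hu, rfl⟩)).2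

theorem IsUnif.ordAt_self {ϖ : F} (h : IsUnif V ϖ) : ordAt V ϖ = 1 := by
  have := h.ordAt_eq (m := 1) (unitIn_one V)
  simpa using this

theorem IsDV.ordAt_mul (hV : IsDV V) (hx : x ≠ 0) (hy : y ≠ 0) :
    ordAt V (x * y) = ordAt V x + ordAt V y := by
  obtain ⟨ϖ, h⟩ := hV
  obtain ⟨m, u, hu, rfl⟩ := h.exists_unit x hx
  obtain ⟨m', u', hu', rfl⟩ := h.exists_unit y hy
  have : u * ϖ ^ m * (u' * ϖ ^ m') = (u * u') * ϖ ^ (m + m') := by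
    rw [zpow_add₀ h.ne_zero]; ring
  rw [this, h.ordAt_eq hu, h.ordAt_eq hu', h.ordAt_eq (hu.mul hu')]

theorem IsDV.ordAt_of_unitIn (hV : IsDV V) (hx : UnitIn V x) : ordAt V x = 0 := by
  obtain ⟨ϖ, h⟩ := hV
  have := h.ordAt_eq (m := 0) hx
  simpa using this

theorem IsDV.ordAt_inv (hV : IsDV V) (hx : x ≠ 0) : ordAt V x⁻¹ = -ordAt V x := by
  have h1 := hV.ordAt_mul hx (inv_ne_zero hx)
  rw [mul_inv_cancel₀ hx, hV.ordAt_of_unitIn (unitIn_one V)] at h1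
  omega

theorem IsDV.ordAt_div (hV : IsDV V) (hx : x ≠ 0) (hy : y ≠ 0) :
    ordAt V (x / y) = ordAt V x - ordAt V y := by
  rw [div_eq_mul_inv, hV.ordAt_mul hx (inv_ne_zero hy), hV.ordAt_inv hy]; ring

theorem IsDV.mem_iff (hV : IsDV V) (hx : x ≠ 0) : x ∈ V.toSubring ↔ 0 ≤ ordAt V x := by
  obtain ⟨ϖ, h⟩ := hV
  obtain ⟨m, u, hu, rfl⟩ := h.exists_unit x hx
  rw [h.ordAt_eq hu]
  constructor
  · intro hmem
    by_contra hm
    have h1 : ϖ ^ m ∈ V.toSubring := by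
      have := mul_mem hu.2.2 hmem
      rwa [inv_mul_cancel_left₀ hu.1] at this
    have h2 := h.zpow_inMax (m := -m) (by omega)
    exact h2.ne_zero_imp (zpow_ne_zero _ h.ne_zero) (by rwa [zpow_neg, inv_inv])
  · intro hm
    exact mul_mem hu.2.1 (h.zpow_mem hm)

theorem IsDV.inMax_iff (hV : IsDV V) (hx : x ≠ 0) : InMax V x ↔ 0 < ordAt V x := by
  rw [InMax, hV.mem_iff hx, hV.mem_iff (inv_ne_zero hx), hV.ordAt_inv hx]
  constructor
  · rintro ⟨h1, h2 | h2⟩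
    · exact absurd h2 hx
    · omega
  · intro h
    exact ⟨h.le, Or.inr (by omega)⟩

theorem IsDV.mem_or_inv_inMax (hV : IsDV V) (hx : x ≠ 0) : x ∈ V.toSubring ∨ InMax V x⁻¹ := by
  rw [hV.mem_iff hx, hV.inMax_iff (inv_ne_zero hx), hV.ordAt_inv hx]
  omega

variable [Algebra ℂ F]

/-- Subtracting a constant does not change poles: where `x` has a pole, `x - z = x (1 - z / x)` and
the last factor is a unit. Hence all hyperplanes `f_n = z` are linearly equivalent to the pole
divisor of `f_n`. -/
theorem IsDV.neg_part_sub (hV : IsDV V) (hC : ContainsC V) (z : ℂ) (hx : x ≠ 0)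
    (hxz : x - algebraMap ℂ F z ≠ 0) :
    max (-ordAt V (x - algebraMap ℂ F z)) 0 = max (-ordAt V x) 0 := by
  by_cases h : x ∈ V.toSubring
  · have h1 := (hV.mem_iff hx).1 h
    have h2 := (hV.mem_iff hxz).1 (sub_mem h (hC z))
    rw [max_eq_right (by omega), max_eq_right (by omega)]
  · have h1 := (hV.mem_or_inv_inMax hx).resolve_left h
    have h2 : UnitIn V (1 - algebraMap ℂ F z * x⁻¹) := by
      rw [sub_eq_add_neg]
      exact (unitIn_one V).add_inMax (h1.mul_left (hC z)).neg
    have h3 : x - algebraMap ℂ F z = x * (1 - algebraMap ℂ F z * x⁻¹) := by field_simp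
    rw [h3, hV.ordAt_mul hx h2.1, hV.ordAt_of_unitIn h2, add_zero]

variable {ι : Type*} {y : ι → F}

/-- By finite divisibility one can split off the maximal power of `π` from a nonzero polynomial; the
remaining factor is not divisible by `π`, hence is a unit of `V`. -/
theorem isUnif_of_inMax_iff_dvd (hy : IsCoord ℂ y) (hV : V ∈ specModel (coordRing y))
    {π : MvPolynomial ι ℂ} (hπ : Prime π)
    (h : ∀ g, InMax V (MvPolynomial.aeval y g) ↔ π ∣ g) : IsUnif V (MvPolynomial.aeval y π) := by
  have h0 : MvPolynomial.aeval y π ≠ 0 := fun h0 =>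
    hπ.ne_zero (hy.aeval_injective (by rw [h0, map_zero]))
  refine ⟨(h π).2 dvd_rfl, h0, fun x hx => ?_⟩
  have key : ∀ g : MvPolynomial ι ℂ, g ≠ 0 → ∃ m : ℕ, ∃ u : F, UnitIn V u ∧
      MvPolynomial.aeval y g = u * MvPolynomial.aeval y π ^ m := by
    intro g hg
    obtain ⟨m, g', hg', rfl⟩ := WfDvdMonoid.max_power_factor hg hπ.irreducible
    refine ⟨m, MvPolynomial.aeval y g', ?_, by rw [map_mul, map_pow, mul_comm]⟩
    rw [unitIn_iff (le_of_mem_specModel hV (aeval_mem_coordRing y g')), h]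
    exact hg'
  obtain ⟨a, c, hc, rfl⟩ := hy.exists_div x
  have ha : a ≠ 0 := by rintro rfl; simp at hx
  obtain ⟨m, u, hu, h1⟩ := key a ha
  obtain ⟨m', u', hu', h2⟩ := key c hc
  refine ⟨m - m', u / u', hu.div hu', ?_⟩
  rw [h1, h2, zpow_sub₀ h0, zpow_natCast, zpow_natCast, mul_div_mul_comm]

theorem IsLin.isUnif (hy : IsCoord ℂ y) {i : ι} (h : IsLin y {i} V) : IsUnif V (y i) := by
  have := isUnif_of_inMax_iff_dvd hy h.1 (MvPolynomial.X_prime (i := i)) fun g => by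
    rw [h.2, restr_singleton_eq_zero_iff, Ideal.mem_span_singleton]
  simpa using this

/-- If no prime polynomial vanished at `V`, the local ring would be the whole field, of dimension
zero. -/
theorem exists_prime_of_dim_eq_one (hy : IsCoord ℂ y) (hV : V ∈ specModel (coordRing y))
    (hd : ringKrullDim V.toSubring = 1) : ∃ π : MvPolynomial ι ℂ, Prime π ∧
      ∀ g, InMax V (MvPolynomial.aeval y g) ↔ π ∣ g := by
  rcases exists_prime_inMax hy hV with h | ⟨π, hπ, hmem⟩
  · have hf : IsField V.toSubring := by
      refine ⟨⟨0, 1, zero_ne_one⟩, mul_comm, fun {a} ha => ?_⟩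
      exact ⟨⟨(a : F)⁻¹, h _⟩, Subtype.ext (mul_inv_cancel₀ fun h0 => ha (Subtype.ext h0))⟩
    rw [ringKrullDim_eq_zero_of_isField hf] at hd
    exact absurd hd (by decide)
  · exact ⟨π, hπ, inMax_iff_dvd_of_dim_lt hy hV (by rw [hd]; decide) hπ hmem⟩

theorem isDV_of_dim_eq_one (hy : IsCoord ℂ y) (hV : V ∈ specModel (coordRing y))
    (hd : ringKrullDim V.toSubring = 1) : IsDV V := by
  obtain ⟨π, hπ, h⟩ := exists_prime_of_dim_eq_one hy hV hd
  exact ⟨_, isUnif_of_inMax_iff_dvd hy hV hπ h⟩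

end Order

/-! ### Blow-ups of `(ℙ¹)^N` along centres `{f_α = 0, f_n = -d, f_β = ∞}` -/

section Centres

variable {N : ℕ}

/-- Coordinates in which the centre `{f_α = 0, f_n = -d, f_β = ∞}` is a coordinate subspace. -/
def cenCoord (n β : ZMod N) (d : ℂ) : ZMod N → FunField N := fun m =>
  if m = n then coord n + algebraMap ℂ _ d else if m = β then (coord m)⁻¹ else coord m

theorem cenCoord_self (n β : ZMod N) (d : ℂ) :
    cenCoord n β d n = coord n + algebraMap ℂ _ d := by simp [cenCoord]

theorem cenCoord_inf {n β : ZMod N} (h : β ≠ n) (d : ℂ) :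
    cenCoord n β d β = (coord β)⁻¹ := by simp [cenCoord, h]

theorem cenCoord_of_ne {n β m : ZMod N} (h : m ≠ n) (h' : m ≠ β) (d : ℂ) :
    cenCoord n β d m = coord m := by simp [cenCoord, h, h']

theorem cenCoord_eq_shift {n β : ZMod N} (h : β ≠ n) (d : ℂ) :
    cenCoord n β d = shift (chartCoord (· = β)) (fun m => if m = n then -d else 0) := by
  funext m
  by_cases h1 : m = n
  · subst h1
    simp [cenCoord, shift, chartCoord, h.symm]
  · by_cases h2 : m = β
    · subst h2
      simp [cenCoord, shift, chartCoord, h]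
    · simp [cenCoord, shift, chartCoord, h1, h2]

theorem isCoord_cenCoord [Finite (ZMod N)] {n β : ZMod N} (h : β ≠ n) (d : ℂ) :
    IsCoord ℂ (cenCoord n β d) := by
  rw [cenCoord_eq_shift h]
  exact (isCoord_chartCoord _).shift _

/-- A family of distinct centres `P c = {f_α = 0, f_n = -d, f_β = ∞}`. -/
structure CentreData (N : ℕ) (κ : Type*) where
  /-- the index of the coordinate with a nonzero finite value -/
  n : κ → ZMod N
  /-- the index of the vanishing coordinate -/
  zer : κ → ZMod N
  /-- the index of the infinite coordinate -/
  inf : κ → ZMod N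
  /-- minus the value of the finite coordinate -/
  d : κ → ℂ
  /-- the generic point -/
  P : κ → LocalSubring (FunField N)
  zer_ne : ∀ c, zer c ≠ n c
  inf_ne : ∀ c, inf c ≠ n c
  zer_ne_inf : ∀ c, zer c ≠ inf c
  isLin : ∀ c, IsLin (cenCoord (n c) (inf c) (d c)) {zer c, n c, inf c} (P c)
  mem : ∀ c, P c ∈ projLineProd N
  inj : Function.Injective P

variable {κ : Type*}

theorem CentreData.card_eq (D : CentreData N κ) (c : κ) :
    ({D.zer c, D.n c, D.inf c} : Finset (ZMod N)).card = 3 :=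
  Finset.card_eq_three.2 ⟨_, _, _, D.zer_ne c, D.zer_ne_inf c, (D.inf_ne c).symm, rfl⟩

/-- The blow-up of `(ℙ¹)^N` along the centres, up to codimension two. -/
structure IsBlowUpOf (D : CentreData N κ) (X : Set (LocalSubring (FunField N))) : Prop where
  lfg : LocallyFG X
  sep : Separated X
  coords : ∀ R ∈ X, ∃ y : ZMod N → FunField N, IsCoord ℂ y ∧ R ∈ specModel (coordRing y)
  codim : ∀ Q : LocalSubring (FunField N), ¬ 2 ≤ ringKrullDim Q.toSubring →
    (Q ∈ X ↔ Q ∈ projLineProd N ∨ ∃ c, IsExc (ZMod N) (D.P c) Q)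

variable [Finite (ZMod N)] (D : CentreData N κ)

theorem CentreData.exists_exc (c : κ) : ∃ E, IsExc (ZMod N) (D.P c) E :=
  exists_isExc (isCoord_cenCoord (D.inf_ne c) _) (D.card_eq c) (D.isLin c)

/-- The generic point of the exceptional divisor. -/
def CentreData.exc (c : κ) : LocalSubring (FunField N) := (D.exists_exc c).choose

theorem CentreData.isExc (c : κ) : IsExc (ZMod N) (D.P c) (D.exc c) := (D.exists_exc c).choose_spec

theorem CentreData.dim_exc (c : κ) : ringKrullDim (D.exc c).toSubring = 1 :=
  (D.isExc c).dim_eq_one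

theorem CentreData.isExc_iff {c : κ} {E : LocalSubring (FunField N)} :
    IsExc (ZMod N) (D.P c) E ↔ E = D.exc c :=
  ⟨fun h => h.unique (D.isExc c), fun h => h ▸ D.isExc c⟩

theorem CentreData.le_exc (c : κ) : D.P c ≤ D.exc c := (D.isExc c).le

/-- Coordinates at the exceptional divisor. -/
def CentreData.excCoord (c : κ) (i : ZMod N) : ZMod N → FunField N :=
  chartZ (cenCoord (D.n c) (D.inf c) (D.d c)) {D.zer c, D.n c, D.inf c} i

theorem CentreData.isCoord_excCoord (c : κ) (i : ZMod N) : IsCoord ℂ (D.excCoord c i) :=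
  isCoord_chartZ (isCoord_cenCoord (D.inf_ne c) _) _ _

theorem CentreData.isLin_exc (c : κ) {i : ZMod N} (hi : i ∈ ({D.zer c, D.n c, D.inf c} : Finset _)) :
    IsLin (D.excCoord c i) {i} (D.exc c) :=
  (D.isExc c).isLin (isCoord_cenCoord (D.inf_ne c) _) (D.isLin c) hi

theorem CentreData.containsC_exc (c : κ) : ContainsC (D.exc c) :=
  (D.isLin_exc c (i := D.n c) (by simp)).containsC

theorem CentreData.two_le_dim (c : κ) : 2 ≤ ringKrullDim (D.P c).toSubring :=
  two_le_dim_of_inMax (isCoord_cenCoord (D.inf_ne c) _) (D.isLin c).1 (D.zer_ne c)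
    ((D.isLin c).inMax (by simp)) ((D.isLin c).inMax (by simp))

/-- Separatedness of `(ℙ¹)^N` allows an exceptional divisor to dominate only one of its points, so
distinct centres have distinct exceptional divisors. -/
theorem CentreData.le_exc_iff {c c' : κ} : D.P c ≤ D.exc c' ↔ c = c' := by
  refine ⟨fun h => ?_, fun h => h ▸ D.le_exc c⟩
  exact D.inj (separated_projLineProd N _ (D.mem c) _ (D.mem c') _ h (D.le_exc c'))

theorem CentreData.exc_injective : Function.Injective D.exc := fun c _ h =>
  (D.le_exc_iff).1 (h ▸ D.le_exc c)

theorem CentreData.not_le_of_mem {c : κ} {V : LocalSubring (FunField N)} (hV : V ∈ projLineProd N)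
    (hd : ringKrullDim V.toSubring = 1) : ¬ D.P c ≤ V := fun h => by
  have := separated_projLineProd N _ (D.mem c) _ hV _ h le_rfl
  have h2 := D.two_le_dim c
  rw [this, hd] at h2
  exact not_two_le_one h2

theorem CentreData.exc_notMem (c : κ) : D.exc c ∉ projLineProd N := fun h =>
  D.not_le_of_mem h (D.dim_exc c) (D.le_exc c)

/-- The uniformizers of the exceptional divisor. -/
theorem CentreData.isUnif_exc (c : κ) {i : ZMod N}
    (hi : i ∈ ({D.zer c, D.n c, D.inf c} : Finset _)) :
    IsUnif (D.exc c) (cenCoord (D.n c) (D.inf c) (D.d c) i) := by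
  have := (D.isLin_exc c hi).isUnif (D.isCoord_excCoord c i)
  rwa [CentreData.excCoord, chartZ_self] at this

theorem CentreData.isDV_exc (c : κ) : IsDV (D.exc c) := ⟨_, D.isUnif_exc c (i := D.n c) (by simp)⟩

theorem CentreData.inv_coord_inMax_exc (c : κ) : InMax (D.exc c) (coord (D.inf c))⁻¹ := by
  have := (D.isUnif_exc c (i := D.inf c) (by simp)).inMax
  rwa [cenCoord_inf (D.inf_ne c)] at this

theorem CentreData.coord_notMem_exc (c : κ) : coord (D.inf c) ∉ (D.exc c).toSubring := fun h =>
  (D.inv_coord_inMax_exc c).ne_zero_imp (inv_ne_zero (isCoord_coord.ne_zero _)) (by rwa [inv_inv])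

theorem CentreData.ordAt_inf (c : κ) : ordAt (D.exc c) (coord (D.inf c)) = -1 := by
  have h := (D.isUnif_exc c (i := D.inf c) (by simp)).ordAt_self
  rw [cenCoord_inf (D.inf_ne c), (D.isDV_exc c).ordAt_inv (isCoord_coord.ne_zero _)] at h
  omega

theorem CentreData.ordAt_zer (c : κ) : ordAt (D.exc c) (coord (D.zer c)) = 1 := by
  have h := (D.isUnif_exc c (i := D.zer c) (by simp)).ordAt_self
  rwa [cenCoord_of_ne (D.zer_ne c) (D.zer_ne_inf c)] at h

theorem CentreData.ordAt_fin (c : κ) :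
    ordAt (D.exc c) (coord (D.n c) + algebraMap ℂ _ (D.d c)) = 1 := by
  have h := (D.isUnif_exc c (i := D.n c) (by simp)).ordAt_self
  rwa [cenCoord_self] at h

theorem coord_add_ne_zero (j : ZMod N) (s : ℂ) : coord j + algebraMap ℂ (FunField N) s ≠ 0 := by
  have := (isCoord_coord.shift (fun _ => -s)).ne_zero j
  simpa [shift] using this

theorem coord_sub_ne_zero (j : ZMod N) (s : ℂ) : coord j - algebraMap ℂ (FunField N) s ≠ 0 := by
  have := (isCoord_coord.shift (fun _ => s)).ne_zero j
  simpa [shift] using this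

/-- The functions `f_j + s` are units along the exceptional divisor, except for the finite
coordinate with its special value, the zero coordinate and the infinite coordinate. -/
theorem CentreData.unitIn_add (c : κ) {j : ZMod N} (hj : j ≠ D.inf c) {s : ℂ}
    (hz : j = D.zer c → s ≠ 0) (hn : j = D.n c → s ≠ D.d c) :
    UnitIn (D.exc c) (coord j + algebraMap ℂ _ s) := by
  by_cases h : j ∈ ({D.zer c, D.n c, D.inf c} : Finset _)
  -- A function with constant value `-d` along the divisor becomes a unit after adding any constant
  -- other than `d`. In the remaining case `f_j` is a free coordinate at the exceptional divisor.
  · simp only [Finset.mem_insert, Finset.mem_singleton] at h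
    have key : ∀ j s d, InMax (D.exc c) (coord j + algebraMap ℂ _ d) → s ≠ d →
        UnitIn (D.exc c) (coord j + algebraMap ℂ _ s) := by
      intro j s d hd hsd
      have h1 := ((D.containsC_exc c).unitIn (sub_ne_zero.2 hsd)).add_inMax hd
      rw [map_sub] at h1
      convert h1 using 1
      ring
    rcases h with h | h | h
    · refine key j s 0 ?_ (hz h)
      have := (D.isUnif_exc c (i := D.zer c) (by simp)).inMax
      rw [cenCoord_of_ne (D.zer_ne c) (D.zer_ne_inf c)] at this
      rw [map_zero, add_zero, h]; exact this
    · refine key j s (D.d c) ?_ (hn h)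
      have := (D.isUnif_exc c (i := D.n c) (by simp)).inMax
      rw [cenCoord_self] at this
      rw [h]; exact this
    · exact absurd h hj
  · have hjn : j ≠ D.n c := fun h' => h (by simp [h'])
    have hlin := D.isLin_exc c (i := D.n c) (by simp)
    refine hlin.unitIn_of_mem_adjoin (add_mem ?_ (IntermediateField.algebraMap_mem _ _))
      (coord_add_ne_zero j s)
    refine IntermediateField.subset_adjoin _ _ ⟨⟨j, by simpa using hjn⟩, ?_⟩
    simp only [CentreData.excCoord]
    rw [chartZ_of_notMem h, cenCoord_of_ne hjn hj]

end Centres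

/-! ### Prime divisors of `(ℙ¹)^N` -/

section PrimeDivisors

variable {N : ℕ} [Finite (ZMod N)]

/-- `V` is the divisor `f_m = ∞`. -/
def IsInfty (m : ZMod N) (V : LocalSubring (FunField N)) : Prop :=
  IsLin (chartCoord (· = m)) {m} V

theorem IsInfty.isUnif {m : ZMod N} {V : LocalSubring (FunField N)} (h : IsInfty m V) :
    IsUnif V (coord m)⁻¹ := by
  have := IsLin.isUnif (isCoord_chartCoord _) h
  simpa [chartCoord] using this

theorem IsInfty.mem_projLineProd {m : ZMod N} {V : LocalSubring (FunField N)} (h : IsInfty m V) :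
    V ∈ projLineProd N := ⟨_, h.1⟩

theorem IsInfty.unitIn {m j : ZMod N} {V : LocalSubring (FunField N)} (h : IsInfty m V)
    (hj : j ≠ m) : UnitIn V (coord j) := by
  have := IsLin.unitIn h (i := j) (by simpa using hj)
  simpa [chartCoord, hj] using this

theorem IsInfty.unitIn_add {m j : ZMod N} {V : LocalSubring (FunField N)} (h : IsInfty m V)
    (hj : j ≠ m) (s : ℂ) : UnitIn V (coord j + algebraMap ℂ _ s) := by
  refine IsLin.unitIn_of_mem_adjoin h (add_mem ?_ (IntermediateField.algebraMap_mem _ _))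
    (coord_add_ne_zero j s)
  refine IntermediateField.subset_adjoin _ _ ⟨⟨j, by simpa using hj⟩, ?_⟩
  simp [chartCoord, hj]

theorem IsInfty.dim_eq_one {m : ZMod N} {V : LocalSubring (FunField N)} (h : IsInfty m V) :
    ringKrullDim V.toSubring = 1 := IsLin.dim_eq_one (isCoord_chartCoord _) h

theorem IsInfty.notMem {m : ZMod N} {V : LocalSubring (FunField N)} (h : IsInfty m V) :
    coord m ∉ V.toSubring := fun hm =>
  h.isUnif.inMax.ne_zero_imp h.isUnif.ne_zero (by rwa [inv_inv])

theorem IsInfty.eq_of {m m' : ZMod N} {V : LocalSubring (FunField N)} (h : IsInfty m V)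
    (h' : IsInfty m' V) : m = m' := by
  by_contra hne
  exact h.notMem (h'.unitIn hne).2.1

theorem exists_isInfty (m : ZMod N) : ∃ V : LocalSubring (FunField N), IsInfty m V :=
  exists_isLin (isCoord_chartCoord _) _

/-- In a chart containing `V`, a coordinate without finite value is used through its inverse, which
is a non-unit. It cuts out the whole codimension-one point, so the other coordinates are units and
`V` lies in the chart that inverts only `f_m`. -/
theorem isInfty_of_notMem {V : LocalSubring (FunField N)} (hV : V ∈ projLineProd N)
    (hd2 : ¬ 2 ≤ ringKrullDim V.toSubring) {m : ZMod N} (hm : coord m ∉ V.toSubring) :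
    IsInfty m V := by
  obtain ⟨inv, hinv⟩ := mem_projLineProd_iff.1 hV
  have h1 := coord_mem_of_mem_specModel hinv
  have him : inv m := by
    by_contra h
    have := h1 m
    rw [chartCoord, if_neg h] at this
    exact hm this
  have h2 : InMax V (chartCoord inv m) := by
    refine ⟨h1 m, Or.inr ?_⟩
    rwa [chartCoord, if_pos him, inv_inv]
  have h3 := isLin_singleton_of_dim_lt (isCoord_chartCoord inv) hinv hd2 h2
  have h4 : V ∈ specModel (coordRing (chartCoord (· = m))) := by
    refine mem_specModel_chart hV fun j => ?_
    by_cases hj : j = m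
    · subst hj
      have := h1 j
      simpa [chartCoord, him] using this
    · have hu := h3.unitIn (i := j) (by simpa using hj)
      rcases chartCoord_eq_or inv (· = m) j with h | h
      · rw [h]; exact hu.2.1
      · rw [h]; exact hu.2.2
  refine isLin_singleton_of_dim_lt (isCoord_chartCoord _) h4 hd2 ?_
  simpa [chartCoord, him] using h2

/-- The divisor `f_j = -s`. -/
def IsHyper (j : ZMod N) (s : ℂ) (V : LocalSubring (FunField N)) : Prop :=
  IsLin (shift coord (fun m => if m = j then -s else 0)) {j} V

theorem chartCoord_false : chartCoord (fun _ : ZMod N => False) = coord := by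
  funext m; simp [chartCoord]

theorem mem_specModel_coord {V : LocalSubring (FunField N)} (hV : V ∈ projLineProd N)
    (h : ∀ j, coord j ∈ V.toSubring) : V ∈ specModel (coordRing coord) := by
  have := mem_specModel_chart hV (inv := fun _ => False) (by rw [chartCoord_false]; exact h)
  rwa [chartCoord_false] at this

theorem IsHyper.mem_projLineProd {j : ZMod N} {s : ℂ} {V : LocalSubring (FunField N)}
    (h : IsHyper j s V) : V ∈ projLineProd N := by
  refine ⟨fun _ => False, ?_⟩
  have := h.1
  rw [coordRing_shift, ← chartCoord_false] at this
  exact this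

theorem IsHyper.isUnif {j : ZMod N} {s : ℂ} {V : LocalSubring (FunField N)} (h : IsHyper j s V) :
    IsUnif V (coord j + algebraMap ℂ _ s) := by
  have := IsLin.isUnif (isCoord_coord.shift _) h
  simpa [shift] using this

theorem IsHyper.dim_eq_one {j : ZMod N} {s : ℂ} {V : LocalSubring (FunField N)}
    (h : IsHyper j s V) : ringKrullDim V.toSubring = 1 :=
  IsLin.dim_eq_one (isCoord_coord.shift _) h

theorem IsHyper.unitIn {j m : ZMod N} {s : ℂ} {V : LocalSubring (FunField N)} (h : IsHyper j s V)
    (hm : m ≠ j) : UnitIn V (coord m) := by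
  have := IsLin.unitIn h (i := m) (by simpa using hm)
  simpa [shift, hm] using this

theorem IsHyper.coord_mem {j : ZMod N} {s : ℂ} {V : LocalSubring (FunField N)} (h : IsHyper j s V)
    (m : ZMod N) : coord m ∈ V.toSubring := by
  have h1 := h.1
  rw [coordRing_shift] at h1
  exact coord_mem_of_mem_specModel h1 m

theorem IsHyper.unitIn_add {j : ZMod N} {s t : ℂ} {V : LocalSubring (FunField N)}
    (h : IsHyper j s V) (hst : t ≠ s) : UnitIn V (coord j + algebraMap ℂ _ t) := by
  have h1 := ((IsLin.containsC h).unitIn (sub_ne_zero.2 hst)).add_inMax h.isUnif.inMax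
  rw [map_sub] at h1
  convert h1 using 1
  ring

theorem IsHyper.unique {j : ZMod N} {s : ℂ} {V V' : LocalSubring (FunField N)}
    (h : IsHyper j s V) (h' : IsHyper j s V') : V = V' := IsLin.unique h h'

theorem exists_isHyper (j : ZMod N) (s : ℂ) : ∃ V : LocalSubring (FunField N), IsHyper j s V :=
  exists_isLin (isCoord_coord.shift _) _

theorem isHyper_of_inMax {V : LocalSubring (FunField N)} (hV : V ∈ projLineProd N)
    (hd2 : ¬ 2 ≤ ringKrullDim V.toSubring) {j : ZMod N} {s : ℂ}
    (h : InMax V (coord j + algebraMap ℂ _ s)) : IsHyper j s V := by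
  have hC := locallyFG_projLineProd.containsC hV
  have hall : ∀ m, coord m ∈ V.toSubring := by
    intro m
    by_contra hm
    have hinf := isInfty_of_notMem hV hd2 hm
    by_cases hj : j = m
    · subst hj
      have := sub_mem h.1 (hC s)
      rw [add_sub_cancel_right] at this
      exact hm this
    · exact (hinf.unitIn_add hj s).not_inMax h
  refine isLin_singleton_of_dim_lt (isCoord_coord.shift _)
    (by rw [coordRing_shift]; exact mem_specModel_coord hV hall) hd2 ?_
  simpa [shift] using h

end PrimeDivisors

/-! ### The divisor class group -/

section ClassGroups

variable {N : ℕ} {κ : Type*} [Finite (ZMod N)] {D : CentreData N κ}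
  {X : Set (LocalSubring (FunField N))}

namespace IsBlowUpOf

theorem isDV (hX : IsBlowUpOf D X) (V : PrimeDivisor X) : IsDV V.1 := by
  obtain ⟨y, hy, hV⟩ := hX.coords V.1 V.2.1
  exact isDV_of_dim_eq_one hy hV V.2.2

theorem containsC (hX : IsBlowUpOf D X) (V : PrimeDivisor X) : ContainsC V.1 :=
  hX.lfg.containsC V.2.1

theorem mem_or_eq_exc (hX : IsBlowUpOf D X) (V : PrimeDivisor X) :
    V.1 ∈ projLineProd N ∨ ∃ c, V.1 = D.exc c := by
  have := (hX.codim V.1 (by rw [V.2.2]; exact not_two_le_one)).1 V.2.1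
  simpa only [D.isExc_iff] using this

theorem mem_of_proj (hX : IsBlowUpOf D X) {V : LocalSubring (FunField N)}
    (hV : V ∈ projLineProd N) (hd : ringKrullDim V.toSubring = 1) : V ∈ X :=
  (hX.codim V (by rw [hd]; exact not_two_le_one)).2 (Or.inl hV)

theorem exc_mem (hX : IsBlowUpOf D X) (c : κ) : D.exc c ∈ X :=
  (hX.codim _ (by rw [D.dim_exc]; exact not_two_le_one)).2 (Or.inr ⟨c, D.isExc c⟩)

/-- The exceptional divisors. -/
def excDiv (hX : IsBlowUpOf D X) (c : κ) : PrimeDivisor X := ⟨D.exc c, hX.exc_mem c, D.dim_exc c⟩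

/-- The divisor `f_m = ∞`. -/
def inftyDiv (hX : IsBlowUpOf D X) (m : ZMod N) : PrimeDivisor X :=
  ⟨(exists_isInfty m).choose, hX.mem_of_proj (exists_isInfty m).choose_spec.mem_projLineProd
    (exists_isInfty m).choose_spec.dim_eq_one, (exists_isInfty m).choose_spec.dim_eq_one⟩

/-- The divisor `f_j = -s`. -/
def hyperDiv (hX : IsBlowUpOf D X) (j : ZMod N) (s : ℂ) : PrimeDivisor X :=
  ⟨(exists_isHyper j s).choose, hX.mem_of_proj (exists_isHyper j s).choose_spec.mem_projLineProd
    (exists_isHyper j s).choose_spec.dim_eq_one, (exists_isHyper j s).choose_spec.dim_eq_one⟩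

theorem isInfty_inftyDiv (hX : IsBlowUpOf D X) (m : ZMod N) : IsInfty m (hX.inftyDiv m).1 :=
  (exists_isInfty m).choose_spec

theorem isHyper_hyperDiv (hX : IsBlowUpOf D X) (j : ZMod N) (s : ℂ) :
    IsHyper j s (hX.hyperDiv j s).1 := (exists_isHyper j s).choose_spec

theorem eq_inftyDiv (hX : IsBlowUpOf D X) {V : PrimeDivisor X} {m : ZMod N}
    (h : IsInfty m V.1) : V = hX.inftyDiv m :=
  Subtype.ext (IsLin.unique h (hX.isInfty_inftyDiv m))

theorem eq_hyperDiv (hX : IsBlowUpOf D X) {V : PrimeDivisor X} {j : ZMod N} {s : ℂ}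
    (h : IsHyper j s V.1) : V = hX.hyperDiv j s :=
  Subtype.ext (h.unique (hX.isHyper_hyperDiv j s))

/-- A prime divisor that meets the affine space `Spec ℂ[f]`. -/
def IsFinDiv (V : PrimeDivisor X) : Prop := V.1 ∈ specModel (coordRing (coord (N := N)))

theorem finDiv_or (hX : IsBlowUpOf D X) (V : PrimeDivisor X) :
    IsFinDiv V ∨ (∃ m, V = hX.inftyDiv m) ∨ ∃ c, V = hX.excDiv c := by
  rcases hX.mem_or_eq_exc V with h | ⟨c, hc⟩
  · by_cases hall : ∀ j, coord j ∈ V.1.toSubring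
    · exact Or.inl (mem_specModel_coord h hall)
    · push Not at hall
      obtain ⟨m, hm⟩ := hall
      exact Or.inr (Or.inl ⟨m, hX.eq_inftyDiv (isInfty_of_notMem h (by rw [V.2.2]; exact not_two_le_one) hm)⟩)
  · exact Or.inr (Or.inr ⟨c, Subtype.ext hc⟩)

theorem IsFinDiv.coord_mem {V : PrimeDivisor X} (h : IsFinDiv V) (j : ZMod N) :
    coord j ∈ V.1.toSubring := coord_mem_of_mem_specModel h j

theorem IsFinDiv.mem_projLineProd {V : PrimeDivisor X} (h : IsFinDiv V) :
    V.1 ∈ projLineProd N := by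
  refine ⟨fun _ => False, ?_⟩
  have h' : V.1 ∈ specModel (coordRing (coord (N := N))) := h
  rw [← chartCoord_false] at h'
  exact h'

theorem exc_not_finDiv (hX : IsBlowUpOf D X) (c : κ) : ¬ IsFinDiv (hX.excDiv c) := fun h =>
  D.exc_notMem c h.mem_projLineProd

theorem infty_not_finDiv (hX : IsBlowUpOf D X) (m : ZMod N) : ¬ IsFinDiv (hX.inftyDiv m) :=
  fun h => (hX.isInfty_inftyDiv m).notMem (h.coord_mem m)

theorem excDiv_injective (hX : IsBlowUpOf D X) : Function.Injective hX.excDiv := fun _ _ h =>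
  D.exc_injective (congrArg Subtype.val h)

theorem inftyDiv_injective (hX : IsBlowUpOf D X) : Function.Injective hX.inftyDiv := fun m m' h =>
  (hX.isInfty_inftyDiv m).eq_of (h ▸ hX.isInfty_inftyDiv m')

theorem excDiv_ne_inftyDiv (hX : IsBlowUpOf D X) (c : κ) (m : ZMod N) :
    hX.excDiv c ≠ hX.inftyDiv m := fun h =>
  D.exc_notMem c (by
    have := (hX.isInfty_inftyDiv m).mem_projLineProd
    rw [← h] at this; exact this)

variable [Finite κ]

/-- By unique factorization this reduces to an irreducible polynomial, which vanishes at no more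
than one codimension-one point of affine space. -/
theorem finite_finDiv_inMax (g : MvPolynomial (ZMod N) ℂ) (hg : g ≠ 0) :
    {V : PrimeDivisor X | IsFinDiv V ∧ InMax V.1 (MvPolynomial.aeval coord g)}.Finite := by
  induction g using WfDvdMonoid.induction_on_irreducible with
  | zero => exact absurd rfl hg
  | unit u hu =>
    convert Set.finite_empty
    ext V
    simp only [Set.mem_ofPred_eq, Set.mem_empty_iff_false, iff_false, not_and]
    intro hV hmem
    obtain ⟨w, hw⟩ := hu.exists_right_inv
    have := hmem.mul_right (le_of_mem_specModel hV (aeval_mem_coordRing coord w))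
    rw [← map_mul, hw, map_one] at this
    exact not_inMax_one _ this
  | mul a i ha hi ih =>
    refine ((Set.Subsingleton.finite (s := {V : PrimeDivisor X | IsFinDiv V ∧
      InMax V.1 (MvPolynomial.aeval coord i)}) ?_).union (ih ha)).subset ?_
    · rintro V ⟨hV, hVi⟩ V' ⟨hV', hVi'⟩
      refine Subtype.ext (eq_of_mem_specModel_of_inMax hV hV' ?_)
      rintro _ ⟨g, rfl⟩
      have h1 := inMax_iff_dvd_of_dim_lt isCoord_coord hV (by rw [V.2.2]; exact not_two_le_one)
        hi.prime hVi g
      have h2 := inMax_iff_dvd_of_dim_lt isCoord_coord hV' (by rw [V'.2.2]; exact not_two_le_one)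
        hi.prime hVi' g
      exact h1.trans h2.symm
    · rintro V ⟨hV, hmem⟩
      rw [map_mul] at hmem
      by_cases hc : InMax V.1 (MvPolynomial.aeval coord i)
      · exact Or.inl ⟨hV, hc⟩
      · refine Or.inr ⟨hV, ?_⟩
        have hu := (unitIn_iff (le_of_mem_specModel hV (aeval_mem_coordRing coord i))).2 hc
        have := hmem.mul_left hu.2.2
        rwa [inv_mul_cancel_left₀ hu.1] at this

theorem finite_ordAt (hX : IsBlowUpOf D X) {x : FunField N} (hx : x ≠ 0) :
    {V : PrimeDivisor X | ordAt V.1 x ≠ 0}.Finite := by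
  obtain ⟨a, c, hc, rfl⟩ := isCoord_coord.exists_div x
  have ha : a ≠ 0 := by rintro rfl; simp at hx
  refine ((((finite_finDiv_inMax a ha).union (finite_finDiv_inMax c hc)).union
    (Set.finite_range hX.inftyDiv)).union (Set.finite_range hX.excDiv)).subset ?_
  intro V hV
  rcases hX.finDiv_or V with h | ⟨m, rfl⟩ | ⟨c, rfl⟩
  · refine Or.inl (Or.inl ?_)
    by_contra hcon
    have hcon1 := fun h1 => hcon (Or.inl ⟨h, h1⟩)
    have hcon2 := fun h1 => hcon (Or.inr ⟨h, h1⟩)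
    have u1 := (unitIn_iff (le_of_mem_specModel h (aeval_mem_coordRing coord a))).2 hcon1
    have u2 := (unitIn_iff (le_of_mem_specModel h (aeval_mem_coordRing coord c))).2 hcon2
    exact hV ((hX.isDV V).ordAt_of_unitIn (u1.div u2))
  · exact Or.inl (Or.inr ⟨m, rfl⟩)
  · exact Or.inr ⟨c, rfl⟩

/-- The divisor of a rational function. -/
def divisor (hX : IsBlowUpOf D X) {x : FunField N} (hx : x ≠ 0) : PrimeDivisor X →₀ ℤ :=
  Finsupp.ofSupportFinite (fun V => ordAt V.1 x) (hX.finite_ordAt hx)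

theorem divisor_apply (hX : IsBlowUpOf D X) {x : FunField N} (hx : x ≠ 0) (V : PrimeDivisor X) :
    hX.divisor hx V = ordAt V.1 x := rfl

/-- The divisor of poles of a rational function. -/
def poleDiv (hX : IsBlowUpOf D X) {x : FunField N} (hx : x ≠ 0) : PrimeDivisor X →₀ ℤ :=
  Finsupp.ofSupportFinite (fun V => max (-ordAt V.1 x) 0) ((hX.finite_ordAt hx).subset (by
    intro V hV h
    simp [h] at hV))

theorem poleDiv_apply (hX : IsBlowUpOf D X) {x : FunField N} (hx : x ≠ 0) (V : PrimeDivisor X) :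
    hX.poleDiv hx V = max (-ordAt V.1 x) 0 := rfl

theorem hasOrd_iff (hX : IsBlowUpOf D X) {x : FunField N} (V : PrimeDivisor X) {m : ℤ} :
    HasOrd V.1 x m ↔ x ≠ 0 ∧ ordAt V.1 x = m := (hX.isDV V).hasOrd_iff

/-- Products and inverses of functions show that divisors of functions already form a group, so the
closure in the definition adds nothing. -/
theorem mem_principalDivisors_iff (hX : IsBlowUpOf D X) {E : PrimeDivisor X →₀ ℤ} :
    E ∈ principalDivisors X ↔ ∃ x : FunField N, x ≠ 0 ∧ ∀ V : PrimeDivisor X, ordAt V.1 x = E V := by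
  constructor
  · intro h
    induction h using AddSubgroup.closure_induction with
    | mem E hE =>
      obtain ⟨x, hx, h⟩ := hE
      exact ⟨x, hx, fun V => ((hX.hasOrd_iff V).1 (h V)).2⟩
    | zero => exact ⟨1, one_ne_zero, fun V => (hX.isDV V).ordAt_of_unitIn (unitIn_one _)⟩
    | add E E' _ _ h h' =>
      obtain ⟨x, hx, h⟩ := h
      obtain ⟨x', hx', h'⟩ := h'
      refine ⟨x * x', mul_ne_zero hx hx', fun V => ?_⟩
      rw [(hX.isDV V).ordAt_mul hx hx', h, h', Finsupp.add_apply]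
    | neg E _ h =>
      obtain ⟨x, hx, h⟩ := h
      refine ⟨x⁻¹, inv_ne_zero hx, fun V => ?_⟩
      rw [(hX.isDV V).ordAt_inv hx, h, Finsupp.neg_apply]
  · rintro ⟨x, hx, h⟩
    exact AddSubgroup.subset_closure ⟨x, hx, fun V => (hX.hasOrd_iff V).2 ⟨hx, h V⟩⟩

theorem divClass_eq_iff (hX : IsBlowUpOf D X) {E E' : PrimeDivisor X →₀ ℤ} :
    divClass X E = divClass X E' ↔
      ∃ x : FunField N, x ≠ 0 ∧ ∀ V : PrimeDivisor X, ordAt V.1 x = E' V - E V := by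
  rw [divClass, divClass, QuotientAddGroup.eq, hX.mem_principalDivisors_iff]
  simp only [Finsupp.add_apply, Finsupp.neg_apply]
  constructor
  · rintro ⟨x, hx, h⟩; exact ⟨x, hx, fun V => by rw [h]; ring⟩
  · rintro ⟨x, hx, h⟩; exact ⟨x, hx, fun V => by rw [h]; ring⟩

/-- A rational function without zeros and poles in affine space is constant. -/
theorem exists_const (hX : IsBlowUpOf D X) {x : FunField N} (hx : x ≠ 0)
    (h : ∀ V : PrimeDivisor X, IsFinDiv V → ordAt V.1 x = 0) :
    ∃ z : ℂ, z ≠ 0 ∧ x = algebraMap ℂ _ z := by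
  -- Every hypersurface of affine space is a prime divisor of `X`, because `X` and `(ℙ¹)^N` agree
  -- there in codimension one.
  have key : ∀ p : MvPolynomial (ZMod N) ℂ, Prime p → ∃ V : PrimeDivisor X, IsFinDiv V ∧
      ∀ g, InMax V.1 (MvPolynomial.aeval coord g) ↔ p ∣ g := by
    intro p hp
    let e : MvPolynomial (ZMod N) ℂ ≃+* coordRing (coord (N := N)) :=
      RingEquiv.ofBijective
        (MvPolynomial.aeval coord : MvPolynomial (ZMod N) ℂ →ₐ[ℂ] FunField N).toRingHom.rangeRestrict
        ⟨fun _ _ h => isCoord_coord.aeval_injective (congrArg Subtype.val h),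
          RingHom.rangeRestrict_surjective _⟩
    have hp' : (Ideal.span {p}).IsPrime := (Ideal.span_singleton_prime hp.ne_zero).2 hp
    let q : Ideal (coordRing (coord (N := N))) :=
      (Ideal.span {p}).comap (e.symm : coordRing (coord (N := N)) →+* _)
    have hq : q.IsPrime := inferInstance
    let V := LocalSubring.ofPrime (coordRing (coord (N := N))) q
    have hV : V ∈ specModel (coordRing (coord (N := N))) := ⟨q, hq, rfl⟩
    have hVp : ∀ g, InMax V (MvPolynomial.aeval coord g) ↔ p ∣ g := by
      intro g
      have h1 := inMax_ofPrime_iff q (e g)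
      have h2 : ((e g : coordRing (coord (N := N))) : FunField N) =
        MvPolynomial.aeval coord g := rfl
      rw [h2] at h1
      rw [h1, Ideal.mem_comap, ← Ideal.mem_span_singleton]
      simp
    have hd := dim_eq_one_of_inMax_iff_dvd isCoord_coord hV hp hVp
    refine ⟨⟨V, hX.mem_of_proj ?_ hd, hd⟩, hV, hVp⟩
    refine ⟨fun _ => False, ?_⟩
    rw [← chartCoord_false] at hV
    exact hV
  obtain ⟨a, c, hc, rfl⟩ := isCoord_coord.exists_div x
  have ha : a ≠ 0 := by rintro rfl; simp at hx
  -- In lowest terms, an irreducible factor of the numerator or of the denominator would give a zero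
  -- or a pole along its hypersurface. So both are units of the polynomial ring, hence constants.
  obtain ⟨a', c', g, hcop, rfl, rfl⟩ :=
    UniqueFactorizationMonoid.exists_reduced_factors a ha c
  have hg : g ≠ 0 := left_ne_zero_of_mul ha
  have ha' : a' ≠ 0 := right_ne_zero_of_mul ha
  have hc' : c' ≠ 0 := right_ne_zero_of_mul hc
  have hne : ∀ q : MvPolynomial (ZMod N) ℂ, q ≠ 0 →
      (MvPolynomial.aeval coord q : FunField N) ≠ 0 := fun q hq h0 =>
    hq (isCoord_coord.aeval_injective (by rw [h0, map_zero]))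
  have hord : ∀ V : PrimeDivisor X, IsFinDiv V →
      ordAt V.1 (MvPolynomial.aeval coord a') = ordAt V.1 (MvPolynomial.aeval coord c') := by
    intro V hV
    have h1 := h V hV
    rw [map_mul, map_mul, mul_div_mul_left _ _ (hne g hg),
      (hX.isDV V).ordAt_div (hne _ ha') (hne _ hc')] at h1
    linarith
  have hunit : ∀ q q' : MvPolynomial (ZMod N) ℂ, q ≠ 0 → q' ≠ 0 → IsRelPrime q q' →
      (∀ V : PrimeDivisor X, IsFinDiv V →
        ordAt V.1 (MvPolynomial.aeval coord q) = ordAt V.1 (MvPolynomial.aeval coord q')) →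
      IsUnit q := by
    intro q q' hq hq' hrel ho
    by_contra hu
    obtain ⟨π, hπ, hdvd⟩ := WfDvdMonoid.exists_irreducible_factor hu hq
    obtain ⟨V, hV, hVπ⟩ := key π hπ.prime
    have h1 := ((hX.isDV V).inMax_iff (hne q hq)).1 ((hVπ q).2 hdvd)
    rw [ho V hV] at h1
    exact hπ.not_isUnit (hrel hdvd ((hVπ q').1 (((hX.isDV V).inMax_iff (hne q' hq')).2 h1)))
  have hu := hunit a' c' ha' hc' hcop hord
  have hu' := hunit c' a' hc' ha' hcop.symm fun V hV => (hord V hV).symm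
  obtain ⟨z, hz, hza⟩ := MvPolynomial.isUnit_iff_eq_C_of_isReduced.1 hu
  obtain ⟨w, hw, hwa⟩ := MvPolynomial.isUnit_iff_eq_C_of_isReduced.1 hu'
  refine ⟨z / w, div_ne_zero hz.ne_zero hw.ne_zero, ?_⟩
  rw [map_mul, map_mul, mul_div_mul_left _ _ (hne g hg), hza, hwa]
  simp [MvPolynomial.algHom_C, map_div₀]

theorem ordAt_finDiv_coord (hX : IsBlowUpOf D X) {V : PrimeDivisor X} (hV : IsFinDiv V)
    (n : ZMod N) : 0 ≤ ordAt V.1 (coord n) :=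
  ((hX.isDV V).mem_iff (isCoord_coord.ne_zero n)).1 (hV.coord_mem n)

/-- The divisors whose classes form the basis `H_n`, `E_c` of the class group. -/
def basisDiv (hX : IsBlowUpOf D X) : ZMod N ⊕ κ → (PrimeDivisor X →₀ ℤ) :=
  Sum.elim (fun n => hX.poleDiv (isCoord_coord.ne_zero n)) fun c => Finsupp.single (hX.excDiv c) 1

theorem basisDiv_finDiv (hX : IsBlowUpOf D X) {V : PrimeDivisor X} (hV : IsFinDiv V)
    (s : ZMod N ⊕ κ) : hX.basisDiv s V = 0 := by
  rcases s with n | c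
  · simp only [basisDiv, Sum.elim_inl, poleDiv_apply]
    have := hX.ordAt_finDiv_coord hV n
    simpa using this
  · simp only [basisDiv, Sum.elim_inr]
    exact Finsupp.single_eq_of_ne fun h => hX.exc_not_finDiv c (h ▸ hV)

theorem basisDiv_inl_infty (hX : IsBlowUpOf D X) (n m : ZMod N) :
    hX.basisDiv (Sum.inl n) (hX.inftyDiv m) = if n = m then 1 else 0 := by
  simp only [basisDiv, Sum.elim_inl, poleDiv_apply]
  have hI := hX.isInfty_inftyDiv m
  split_ifs with h
  · subst h
    have h1 := hI.isUnif.ordAt_self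
    rw [(hX.isDV _).ordAt_inv (isCoord_coord.ne_zero n)] at h1
    simp [h1]
  · rw [(hX.isDV _).ordAt_of_unitIn (hI.unitIn h)]
    simp

theorem basisDiv_inr (hX : IsBlowUpOf D X) (c : κ) :
    hX.basisDiv (Sum.inr c) = Finsupp.single (hX.excDiv c) 1 := rfl

theorem basisDiv_inr_infty (hX : IsBlowUpOf D X) (c : κ) (m : ZMod N) :
    hX.basisDiv (Sum.inr c) (hX.inftyDiv m) = 0 :=
  Finsupp.single_eq_of_ne fun h => hX.excDiv_ne_inftyDiv c m h.symm

/-- The homomorphism from the lattice to the class group. -/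
def latHom (hX : IsBlowUpOf D X) : ((ZMod N ⊕ κ) →₀ ℤ) →ₗ[ℤ] ClassGroup X :=
  Finsupp.linearCombination ℤ fun s => divClass X (hX.basisDiv s)

theorem latHom_single (hX : IsBlowUpOf D X) (s : ZMod N ⊕ κ) :
    hX.latHom (Finsupp.single s 1) = divClass X (hX.basisDiv s) := by
  simp [latHom]

theorem latHom_apply (hX : IsBlowUpOf D X) (x : (ZMod N ⊕ κ) →₀ ℤ) :
    hX.latHom x = divClass X (Finsupp.linearCombination ℤ hX.basisDiv x) := by
  change _ = (QuotientAddGroup.mk' (principalDivisors X)).toIntLinearMap _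
  rw [Finsupp.apply_linearCombination]
  rfl

theorem linearCombination_basisDiv_apply (hX : IsBlowUpOf D X) (x : (ZMod N ⊕ κ) →₀ ℤ)
    (V : PrimeDivisor X) :
    Finsupp.linearCombination ℤ hX.basisDiv x V = x.sum fun s z => z * hX.basisDiv s V := by
  simp [Finsupp.linearCombination_apply, Finsupp.sum, Finsupp.finsetSum_apply]

/-- A relation between the basis classes gives a function without zeros or poles in affine space,
which is constant; hence the corresponding divisor is zero. -/
theorem latHom_injective (hX : IsBlowUpOf D X) : Function.Injective hX.latHom := by
  rw [injective_iff_map_eq_zero]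
  intro x hx
  rw [latHom_apply] at hx
  have hx' : divClass X 0 = divClass X (Finsupp.linearCombination ℤ hX.basisDiv x) := hx.symm
  obtain ⟨f, hf, h⟩ := hX.divClass_eq_iff.1 hx'
  simp only [linearCombination_basisDiv_apply, Finsupp.coe_zero, Pi.zero_apply, sub_zero] at h
  obtain ⟨z, hz, rfl⟩ := hX.exists_const hf fun V hV => by
    rw [h V]
    exact Finset.sum_eq_zero fun s _ => by simp [hX.basisDiv_finDiv hV]
  have h0 : ∀ V : PrimeDivisor X, (x.sum fun s z => z * hX.basisDiv s V) = 0 := fun V => by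
    rw [← h V]
    exact (hX.isDV V).ordAt_of_unitIn ((hX.containsC V).unitIn hz)
  -- The matrix is triangular. Along `f_n = ∞` only the pole divisor of `f_n` contributes, so the
  -- `H`-coefficients go first; the pole divisors may contain exceptional divisors, so the
  -- `E`-coefficients are read off only afterwards.
  have hl : ∀ n, x (Sum.inl n) = 0 := by
    intro n
    have h1 := h0 (hX.inftyDiv n)
    rw [Finsupp.sum, Finset.sum_eq_single (Sum.inl n)] at h1
    · simpa [basisDiv_inl_infty] using h1
    · rintro (m | c) _ hne
      · rw [basisDiv_inl_infty, if_neg, mul_zero]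
        exact fun h => hne (by rw [h])
      · rw [basisDiv_inr_infty, mul_zero]
    · intro h; rw [Finsupp.notMem_support_iff.1 h, zero_mul]
  ext s
  rcases s with n | c
  · exact hl n
  · have h1 := h0 (hX.excDiv c)
    rw [Finsupp.sum, Finset.sum_eq_single (Sum.inr c)] at h1
    · simpa [basisDiv_inr] using h1
    · rintro (m | c') _ hne
      · rw [hl, zero_mul]
      · rw [basisDiv_inr, Finsupp.single_eq_of_ne, mul_zero]
        exact fun h => hne (by rw [hX.excDiv_injective h])
    · intro h; rw [Finsupp.notMem_support_iff.1 h, zero_mul]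

theorem divClass_add (E E' : PrimeDivisor X →₀ ℤ) :
    divClass X (E + E') = divClass X E + divClass X E' := rfl

theorem divClass_sub (E E' : PrimeDivisor X →₀ ℤ) :
    divClass X (E - E') = divClass X E - divClass X E' := rfl

theorem divClass_mem_of_support (E : PrimeDivisor X →₀ ℤ) (S : AddSubgroup (ClassGroup X))
    (h : ∀ V, E V ≠ 0 → divClass X (Finsupp.single V 1) ∈ S) : divClass X E ∈ S := by
  have h1 : divClass X E = ∑ V ∈ E.support, E V • divClass X (Finsupp.single V 1) := by
    change (QuotientAddGroup.mk' (principalDivisors X)) E =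
      ∑ V ∈ E.support, E V • (QuotientAddGroup.mk' (principalDivisors X)) (Finsupp.single V 1)
    simp_rw [← map_zsmul, ← map_sum]
    congr 1
    conv_lhs => rw [← Finsupp.sum_single E]
    simp [Finsupp.sum]
  rw [h1]
  exact sum_mem fun V hV => zsmul_mem (h V (Finsupp.mem_support_iff.1 hV)) _

/-- The pole divisor of `f_m` differs from `f_m = ∞` only by exceptional divisors. A divisor meeting
affine space is cut out there by one prime polynomial, so subtracting the divisor of this polynomial
moves it to the complement. -/
theorem latHom_surjective (hX : IsBlowUpOf D X) : Function.Surjective hX.latHom := by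
  let S : AddSubgroup (ClassGroup X) := hX.latHom.toAddMonoidHom.range
  have hb : ∀ s, divClass X (hX.basisDiv s) ∈ S := fun s => ⟨Finsupp.single s 1, hX.latHom_single s⟩
  have hexc : ∀ c, divClass X (Finsupp.single (hX.excDiv c) 1) ∈ S := fun c => hb (Sum.inr c)
  have hinf : ∀ m, divClass X (Finsupp.single (hX.inftyDiv m) 1) ∈ S := by
    intro m
    have h1 : divClass X (hX.basisDiv (Sum.inl m) - Finsupp.single (hX.inftyDiv m) 1) ∈ S := by
      refine divClass_mem_of_support _ S fun V hV => ?_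
      rcases hX.finDiv_or V with h | ⟨m', rfl⟩ | ⟨c, rfl⟩
      · refine absurd ?_ hV
        rw [Finsupp.sub_apply, hX.basisDiv_finDiv h, Finsupp.single_eq_of_ne, sub_zero]
        rintro rfl
        exact hX.infty_not_finDiv m h
      · refine absurd ?_ hV
        rw [Finsupp.sub_apply, basisDiv_inl_infty, Finsupp.single_apply]
        by_cases hm : m = m'
        · simp [hm]
        · rw [if_neg hm, if_neg fun h => hm (hX.inftyDiv_injective h), sub_zero]
      · exact hexc c
    have h2 := S.sub_mem (hb (Sum.inl m)) h1
    rwa [← divClass_sub, sub_sub_cancel] at h2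
  have hfin : ∀ V : PrimeDivisor X, divClass X (Finsupp.single V 1) ∈ S := by
    intro V
    rcases hX.finDiv_or V with h | ⟨m', rfl⟩ | ⟨c, rfl⟩
    · obtain ⟨π, hπ, hV⟩ := exists_prime_of_dim_eq_one isCoord_coord h V.2.2
      have hu := isUnif_of_inMax_iff_dvd isCoord_coord h hπ hV
      have h1 : divClass X (Finsupp.single V 1) =
          divClass X (Finsupp.single V 1 - hX.divisor hu.ne_zero) :=
        hX.divClass_eq_iff.2 ⟨(MvPolynomial.aeval coord π)⁻¹, inv_ne_zero hu.ne_zero, fun V' => by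
          rw [Finsupp.sub_apply, divisor_apply, (hX.isDV V').ordAt_inv hu.ne_zero]; ring⟩
      rw [h1]
      refine divClass_mem_of_support _ S fun V' hV' => ?_
      rcases hX.finDiv_or V' with h' | ⟨m', rfl⟩ | ⟨c, rfl⟩
      · refine absurd ?_ hV'
        rw [Finsupp.sub_apply, divisor_apply]
        by_cases hVV : V' = V
        · subst hVV
          rw [hu.ordAt_self]; simp
        · rw [Finsupp.single_eq_of_ne hVV, (hX.isDV V').ordAt_of_unitIn, sub_zero]
          refine (unitIn_iff (le_of_mem_specModel h' (aeval_mem_coordRing coord π))).2 fun hin => hVV ?_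
          refine Subtype.ext (eq_of_mem_specModel_of_inMax h' h ?_)
          rintro _ ⟨g, rfl⟩
          exact (inMax_iff_dvd_of_dim_lt isCoord_coord h' (by rw [V'.2.2]; exact not_two_le_one)
            hπ hin g).trans (hV g).symm
      · exact hinf m'
      · exact hexc c
    · exact hinf m'
    · exact hexc c
  intro x
  obtain ⟨E, rfl⟩ := QuotientAddGroup.mk_surjective x
  exact divClass_mem_of_support E S fun V _ => hfin V

/-- The class group is free with basis `H_n`, `E_c`. -/
def latEquiv (hX : IsBlowUpOf D X) : ((ZMod N ⊕ κ) →₀ ℤ) ≃+ ClassGroup X :=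
  AddEquiv.ofBijective hX.latHom.toAddMonoidHom ⟨hX.latHom_injective, hX.latHom_surjective⟩

theorem latEquiv_single (hX : IsBlowUpOf D X) (s : ZMod N ⊕ κ) :
    hX.latEquiv (Finsupp.single s 1) = divClass X (hX.basisDiv s) := hX.latHom_single s

/-- The divisor of zeros of a rational function. -/
def zeroDiv (hX : IsBlowUpOf D X) {x : FunField N} (hx : x ≠ 0) : PrimeDivisor X →₀ ℤ :=
  Finsupp.ofSupportFinite (fun V => max (ordAt V.1 x) 0) ((hX.finite_ordAt hx).subset (by
    intro V hV h
    simp [h] at hV))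

theorem zeroDiv_apply (hX : IsBlowUpOf D X) {x : FunField N} (hx : x ≠ 0) (V : PrimeDivisor X) :
    hX.zeroDiv hx V = max (ordAt V.1 x) 0 := rfl

theorem isDivisorOfZeros_zeroDiv (hX : IsBlowUpOf D X) {x : FunField N} (hx : x ≠ 0) :
    IsDivisorOfZeros X x (hX.zeroDiv hx) := fun V =>
  ⟨ordAt V.1 x, (hX.hasOrd_iff V).2 ⟨hx, rfl⟩, rfl⟩

theorem divClass_zeroDiv (hX : IsBlowUpOf D X) {x : FunField N} (hx : x ≠ 0) :
    divClass X (hX.zeroDiv hx) = divClass X (hX.poleDiv hx) :=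
  hX.divClass_eq_iff.2 ⟨x⁻¹, inv_ne_zero hx, fun V => by
    rw [(hX.isDV V).ordAt_inv hx, zeroDiv_apply, poleDiv_apply]
    rcases le_total 0 (ordAt V.1 x) with h | h
    · rw [max_eq_left h, max_eq_right (by linarith)]; ring
    · rw [max_eq_right h, max_eq_left (by linarith)]; ring⟩

theorem divClass_zeroDiv_sub (hX : IsBlowUpOf D X) (n : ZMod N) (z : ℂ) :
    divClass X (hX.zeroDiv (coord_sub_ne_zero n z)) =
      hX.latEquiv (Finsupp.single (Sum.inl n) 1) := by
  rw [divClass_zeroDiv, latEquiv_single]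
  congr 1
  ext V
  exact (hX.isDV V).neg_part_sub (hX.containsC V) z (isCoord_coord.ne_zero n)
    (coord_sub_ne_zero n z)

end IsBlowUpOf

end ClassGroups

/-! ### Birational maps that are isomorphisms in codimension one -/

section Transport

variable {F : Type*} [Field F] [Algebra ℂ F]

/-- Pulling a local ring back along an automorphism of the function field. -/
def mapLoc (σ : F ≃ₐ[ℂ] F) (Q : LocalSubring F) : LocalSubring F :=
  LocalSubring.map (σ.toRingEquiv : F →+* F) Q

theorem mem_mapLoc_iff (σ : F ≃ₐ[ℂ] F) (Q : LocalSubring F) (x : F) :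
    x ∈ (mapLoc σ Q).toSubring ↔ σ.symm x ∈ Q.toSubring := mem_map_iff σ.toRingEquiv Q x

theorem apply_mem_mapLoc_iff (σ : F ≃ₐ[ℂ] F) (Q : LocalSubring F) (x : F) :
    σ x ∈ (mapLoc σ Q).toSubring ↔ x ∈ Q.toSubring := apply_mem_map_iff σ.toRingEquiv Q x

theorem inMax_mapLoc_iff (σ : F ≃ₐ[ℂ] F) (Q : LocalSubring F) (x : F) :
    InMax (mapLoc σ Q) (σ x) ↔ InMax Q x := inMax_map_iff σ.toRingEquiv Q x

theorem unitIn_mapLoc_iff (σ : F ≃ₐ[ℂ] F) (Q : LocalSubring F) (x : F) :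
    UnitIn (mapLoc σ Q) (σ x) ↔ UnitIn Q x := unitIn_map_iff σ.toRingEquiv Q x

theorem mapLoc_symm_mapLoc (σ : F ≃ₐ[ℂ] F) (Q : LocalSubring F) :
    mapLoc σ.symm (mapLoc σ Q) = Q := map_symm_map σ.toRingEquiv Q

theorem mapLoc_mapLoc_symm (σ : F ≃ₐ[ℂ] F) (Q : LocalSubring F) :
    mapLoc σ (mapLoc σ.symm Q) = Q := map_symm_map σ.symm.toRingEquiv Q

theorem mapLoc_mem_specModel (σ : F ≃ₐ[ℂ] F) {A : Subring F} {Q : LocalSubring F}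
    (h : Q ∈ specModel A) : mapLoc σ Q ∈ specModel (A.map (σ.toRingEquiv : F →+* F)) :=
  map_mem_specModel_map σ.toRingEquiv h

theorem ringKrullDim_mapLoc (σ : F ≃ₐ[ℂ] F) (Q : LocalSubring F) :
    ringKrullDim (mapLoc σ Q).toSubring = ringKrullDim Q.toSubring :=
  ringKrullDim_map σ.toRingEquiv Q

theorem LocallyFG.image {M : Set (LocalSubring F)} (hM : LocallyFG M) (σ : F ≃ₐ[ℂ] F) :
    LocallyFG (mapLoc σ '' M) := by
  rintro _ ⟨R, hR, rfl⟩
  obtain ⟨A, hA, hRA, hAM⟩ := hM R hR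
  have hmap : (A.map (σ : F →ₐ[ℂ] F)).toSubring = A.toSubring.map (σ.toRingEquiv : F →+* F) := by
    ext x; rfl
  refine ⟨A.map (σ : F →ₐ[ℂ] F), hA.map _, ?_, ?_⟩
  · rw [hmap]; exact mapLoc_mem_specModel σ hRA
  · intro Q hQ
    rw [hmap] at hQ
    refine ⟨mapLoc σ.symm Q, hAM ?_, mapLoc_mapLoc_symm σ Q⟩
    have := mapLoc_mem_specModel σ.symm hQ
    rw [Subring.map_map] at this
    have hid : ((σ.symm.toRingEquiv : F →+* F).comp (σ.toRingEquiv : F →+* F)) = RingHom.id F := by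
      ext x; simp
    rwa [hid, Subring.map_id] at this

/-- The common points of two varieties form an open subset. -/
theorem isOpenIn_inter {X Y : Set (LocalSubring F)} (hX : LocallyFG X) (hs : Separated X)
    (hY : LocallyFG Y) : IsOpenIn X (X ∩ Y) := by
  refine ⟨Set.inter_subset_left, ?_⟩
  rintro R ⟨hRX, hRY⟩
  obtain ⟨A, ⟨SA, rfl⟩, hRA, hAY⟩ := hY R hRY
  obtain ⟨B, ⟨SB, rfl⟩, hRB, hBX⟩ := hX R hRX
  have hgen : ∀ (S : Finset F) (C : Subring F), (∀ z : ℂ, algebraMap ℂ F z ∈ C) →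
      (∀ x ∈ S, x ∈ C) → (Algebra.adjoin ℂ (S : Set F)).toSubring ≤ C := by
    intro S C hC hS x hx
    replace hx : x ∈ Algebra.adjoin ℂ (S : Set F) := hx
    induction hx using Algebra.adjoin_induction with
    | mem x h => exact hS x h
    | algebraMap r => exact hC r
    | add x y hx hy h h' => exact add_mem h h'
    | mul x y hx hy h h' => exact mul_mem h h'
  -- The generators of the affine neighbourhood in `X` are fractions over the one in `Y`. Requiring
  -- both sets of generators and the inverse denominators to be regular defines an open subset of
  -- `X` whose points are localizations of both rings.
  have hden : ∀ x ∈ SB, ∃ a ∈ (Algebra.adjoin ℂ (SA : Set F)).toSubring,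
      ∃ s ∈ (Algebra.adjoin ℂ (SA : Set F)).toSubring, UnitIn R s ∧ x = a / s := by
    intro x hx
    exact (mem_specModel_iff.1 hRA).2 x (le_of_mem_specModel hRB (Algebra.subset_adjoin hx))
  choose! a ha s hs' hu hxs using hden
  refine ⟨SA ∪ SB ∪ SB.image fun x => (s x)⁻¹, ?_, ?_⟩
  · intro x hx
    simp only [Finset.mem_union, Finset.mem_image] at hx
    rcases hx with (hx | hx) | ⟨y, hy, rfl⟩
    · exact le_of_mem_specModel hRA (Algebra.subset_adjoin hx)
    · exact le_of_mem_specModel hRB (Algebra.subset_adjoin hx)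
    · exact (hu y hy).2.2
  · intro R' hR' hS
    refine ⟨hR', hAY ?_⟩
    have hC := hX.containsC hR'
    have hA' := hgen SA R'.toSubring hC fun x hx => hS x (by simp [hx])
    have hB' := hgen SB R'.toSubring hC fun x hx => hS x (by simp [hx])
    obtain ⟨R₁, hR₁, hle, -⟩ := exists_localization hB'
    have hR₁' : R₁ = R' := hs R₁ (hBX hR₁) R' hR' R' hle le_rfl
    subst hR₁'
    refine mem_specModel_of_le_fracIn hR₁ hA' (hgen SB _ (fun z => ?_) fun x hx => ?_)
    · exact le_fracIn _ _ (Subalgebra.algebraMap_mem _ z)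
    · rw [hxs x hx]
      exact ⟨_, ha x hx, _, hs' x hx, ⟨(hu x hx).1, hA' (hs' x hx), hS _ (by
        simp only [Finset.mem_union, Finset.mem_image]; exact Or.inr ⟨x, hx, rfl⟩)⟩, rfl⟩

/-- The open sets are the common points of `X` and the transported `X'`, and symmetrically. By
assumption, points outside them have dimension at least two. -/
theorem isPseudoIso_of_codim {X X' : Set (LocalSubring F)} (hX : LocallyFG X) (hs : Separated X)
    (hX' : LocallyFG X') (hs' : Separated X') (σ : F ≃ₐ[ℂ] F)
    (h : ∀ Q ∈ X', ¬ 2 ≤ ringKrullDim Q.toSubring → mapLoc σ Q ∈ X)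
    (h' : ∀ Q ∈ X, ¬ 2 ≤ ringKrullDim Q.toSubring → mapLoc σ.symm Q ∈ X') :
    IsPseudoIso (σ : F →+* F) X X' := by
  refine ⟨X ∩ mapLoc σ '' X', X' ∩ mapLoc σ.symm '' X, isOpenIn_inter hX hs (hX'.image σ), ?_,
    isOpenIn_inter hX' hs' (hX.image σ.symm), ?_, ?_⟩
  · intro R hR hn
    by_contra hd
    exact hn ⟨hR, _, h' R hR hd, mapLoc_mapLoc_symm σ R⟩
  · intro R hR hn
    by_contra hd
    exact hn ⟨hR, _, h R hR hd, mapLoc_symm_mapLoc σ R⟩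
  · change mapLoc σ '' _ = _
    ext R
    constructor
    · rintro ⟨_, ⟨hQ, R, hR, rfl⟩, rfl⟩
      rw [mapLoc_mapLoc_symm]
      exact ⟨hR, _, hQ, mapLoc_mapLoc_symm σ R⟩
    · rintro ⟨hR, Q, hQ, rfl⟩
      exact ⟨Q, ⟨hQ, _, hR, mapLoc_symm_mapLoc σ Q⟩, rfl⟩

theorem IsUnif.mapLoc {V : LocalSubring F} {ϖ : F} (h : IsUnif V ϖ) (σ : F ≃ₐ[ℂ] F) :
    IsUnif (mapLoc σ V) (σ ϖ) where
  inMax := (inMax_mapLoc_iff σ V ϖ).2 h.inMax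
  ne_zero := by simpa using h.ne_zero
  exists_unit := fun x hx => by
    obtain ⟨m, u, hu, hxu⟩ := h.exists_unit (σ.symm x) (by simpa using hx)
    refine ⟨m, σ u, (unitIn_mapLoc_iff σ V u).2 hu, ?_⟩
    rw [← map_zpow₀, ← map_mul, ← hxu, AlgEquiv.apply_symm_apply]

theorem IsDV.ordAt_mapLoc {V : LocalSubring F} (hV : IsDV V) (σ : F ≃ₐ[ℂ] F) {x : F}
    (hx : x ≠ 0) : ordAt (TropicalWeyl.mapLoc σ V) (σ x) = ordAt V x := by
  obtain ⟨ϖ, h⟩ := hV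
  obtain ⟨m, u, hu, rfl⟩ := h.exists_unit x hx
  rw [map_mul, map_zpow₀, (h.mapLoc σ).ordAt_eq ((unitIn_mapLoc_iff σ V u).2 hu), h.ordAt_eq hu]

end Transport

/-! ### Pullback of divisor classes. -/

section Pullback

variable {N : ℕ} {κ κ' : Type*} [Finite (ZMod N)] [Finite κ] [Finite κ'] {D : CentreData N κ}
  {D' : CentreData N κ'} {X X' : Set (LocalSubring (FunField N))}

/-- The bijection of prime divisors given by a pseudo-isomorphism. -/
def divEquiv (σ : FunField N ≃ₐ[ℂ] FunField N)
    (h : ∀ Q ∈ X', ¬ 2 ≤ ringKrullDim Q.toSubring → mapLoc σ Q ∈ X)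
    (h' : ∀ Q ∈ X, ¬ 2 ≤ ringKrullDim Q.toSubring → mapLoc σ.symm Q ∈ X') :
    PrimeDivisor X' ≃ PrimeDivisor X where
  toFun V := ⟨mapLoc σ V.1, h V.1 V.2.1 (by rw [V.2.2]; exact not_two_le_one), by
    rw [ringKrullDim_mapLoc, V.2.2]⟩
  invFun V := ⟨mapLoc σ.symm V.1, h' V.1 V.2.1 (by rw [V.2.2]; exact not_two_le_one), by
    rw [ringKrullDim_mapLoc, V.2.2]⟩
  left_inv V := Subtype.ext (mapLoc_symm_mapLoc σ V.1)
  right_inv V := Subtype.ext (mapLoc_mapLoc_symm σ V.1)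

/-- The automorphism preserves orders along corresponding divisors, so the divisor of `x` is carried
to the divisor of `σ x`. -/
theorem IsBlowUpOf.map_principalDivisors (hX : IsBlowUpOf D X) (hX' : IsBlowUpOf D' X')
    (σ : FunField N ≃ₐ[ℂ] FunField N) (e : PrimeDivisor X' ≃ PrimeDivisor X)
    (he : ∀ V, (e V).1 = mapLoc σ V.1) :
    (principalDivisors X').map (Finsupp.domCongr e : (PrimeDivisor X' →₀ ℤ) ≃+ _).toAddMonoidHom =
      principalDivisors X := by
  ext E
  rw [hX.mem_principalDivisors_iff]
  constructor
  · rintro ⟨E', hE', rfl⟩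
    obtain ⟨x, hx, h⟩ := hX'.mem_principalDivisors_iff.1 hE'
    refine ⟨σ x, by simpa using hx, fun V => ?_⟩
    obtain ⟨V', rfl⟩ := e.surjective V
    rw [he, (hX'.isDV V').ordAt_mapLoc σ hx, h]
    simp
  · rintro ⟨x, hx, h⟩
    refine ⟨Finsupp.domCongr e.symm E, hX'.mem_principalDivisors_iff.2
      ⟨σ.symm x, by simpa using hx, fun V => ?_⟩, ?_⟩
    · rw [← (hX'.isDV V).ordAt_mapLoc σ (by simpa using hx), AlgEquiv.apply_symm_apply, ← he, h]
      simp
    · ext V; simp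

/-- The pullback of divisor classes along a pseudo-isomorphism. -/
def IsBlowUpOf.pullback (hX : IsBlowUpOf D X) (hX' : IsBlowUpOf D' X')
    (σ : FunField N ≃ₐ[ℂ] FunField N) (e : PrimeDivisor X' ≃ PrimeDivisor X)
    (he : ∀ V, (e V).1 = mapLoc σ V.1) : ClassGroup X' ≃+ ClassGroup X :=
  QuotientAddGroup.congr _ _ (Finsupp.domCongr e) (hX.map_principalDivisors hX' σ e he)

theorem IsBlowUpOf.pullback_divClass (hX : IsBlowUpOf D X) (hX' : IsBlowUpOf D' X')
    (σ : FunField N ≃ₐ[ℂ] FunField N) (e : PrimeDivisor X' ≃ PrimeDivisor X)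
    (he : ∀ V, (e V).1 = mapLoc σ V.1) (E : PrimeDivisor X' →₀ ℤ) :
    hX.pullback hX' σ e he (divClass X' E) = divClass X (Finsupp.equivMapDomain e E) := rfl

theorem IsBlowUpOf.isPullback (hX : IsBlowUpOf D X) (hX' : IsBlowUpOf D' X')
    (σ : FunField N ≃ₐ[ℂ] FunField N) (e : PrimeDivisor X' ≃ PrimeDivisor X)
    (he : ∀ V, (e V).1 = mapLoc σ V.1) :
    IsPullback (σ : FunField N →+* FunField N) X X'
      (hX.pullback hX' σ e he).toAddMonoidHom := fun V' =>
  ⟨e V', he V', by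
    change hX.pullback hX' σ e he _ = _
    rw [pullback_divClass, Finsupp.equivMapDomain_single]⟩

end Pullback

/-! ### Elementary transformations of the function field -/

section Transfer

variable {F : Type*} [Field F] [Algebra ℂ F] {ι : Type*}

theorem quot_mem_fracIn {A : Subring F} {Q : LocalSubring F} {g₁ g₂ : F} (h₁ : g₁ ∈ A)
    (h₂ : g₂ ∈ A) (u₁ : UnitIn Q g₁) (u₂ : UnitIn Q g₂) :
    g₁ / g₂ ∈ fracIn A Q ⊓ Q.toSubring :=
  ⟨⟨g₁, h₁, g₂, h₂, u₂, rfl⟩, (u₁.div u₂).2.1⟩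

/-- An automorphism that is triangular with respect to two coordinate systems, up to units, maps
points of the first affine space to points of the second one. -/
theorem mapLoc_mem_specModel_of_triangular {z z' : ι → F} {Q : LocalSubring F}
    (hQ : Q ∈ specModel (coordRing z')) (σ : F ≃ₐ[ℂ] F)
    (h : ∀ m, ∃ U W : F, U ≠ 0 ∧
      U ∈ fracIn (coordRing z) (mapLoc σ Q) ⊓ (mapLoc σ Q).toSubring ∧
      U⁻¹ ∈ fracIn (coordRing z) (mapLoc σ Q) ⊓ (mapLoc σ Q).toSubring ∧
      W ∈ fracIn (coordRing z) (mapLoc σ Q) ⊓ (mapLoc σ Q).toSubring ∧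
      σ (z' m) = U * z m + W) :
    mapLoc σ Q ∈ specModel (coordRing z) := by
  have hmap : (coordRing z').map (σ.toRingEquiv : F →+* F) ≤ coordRing fun m => σ (z' m) := by
    rintro _ ⟨x, ⟨g, rfl⟩, rfl⟩
    have : (MvPolynomial.aeval (fun m => σ (z' m)) g : F) = σ (MvPolynomial.aeval z' g) := by
      rw [← AlgEquiv.coe_toAlgHom, ← MvPolynomial.comp_aeval_apply]
    exact ⟨g, this⟩
  have hmem : ∀ m, σ (z' m) ∈ (mapLoc σ Q).toSubring := fun m =>
    (apply_mem_mapLoc_iff σ Q _).2 (coord_mem_of_mem_specModel hQ m)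
  have hC : ∀ x : ℂ, algebraMap ℂ F x ∈ (mapLoc σ Q).toSubring := fun x => by
    rw [mem_mapLoc_iff, AlgEquiv.commutes]
    exact algebraMap_mem_of_mem_specModel hQ x
  have h1 : mapLoc σ Q ∈ specModel (coordRing fun m => σ (z' m)) :=
    mem_specModel_of_le (mapLoc_mem_specModel σ hQ) hmap (coordRing_le hC hmem)
  refine mem_specModel_coordRing h1 (fun m => ?_) fun m => ?_
  · obtain ⟨U, W, h0, -, hU, hW, he⟩ := h m
    have : z m = U⁻¹ * (σ (z' m) - W) := by rw [he]; field_simp; ring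
    rw [this]
    exact mul_mem hU.2 (sub_mem (hmem m) hW.2)
  · obtain ⟨U, W, h0, hU, -, hW, he⟩ := h m
    rw [he]
    exact add_mem (mul_mem hU.1 (le_fracIn _ _ (coord_mem_coordRing z m))) hW.1

end Transfer

/-- The birational map that multiplies `f_α` by a multiple of `(f_n + s) / (f_n + t)` and `f_β` by a
multiple of its inverse, together with the behaviour of the centres. -/
structure ElemTransf {N : ℕ} {κ : Type*} (D D' : CentreData N κ)
    (σ : FunField N ≃ₐ[ℂ] FunField N) where
  /-- the index of the coordinate defining the transformation -/
  n : ZMod N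
  /-- the first index whose coordinate changes -/
  α : ZMod N
  /-- the second index whose coordinate changes -/
  β : ZMod N
  /-- minus the zero of the multiplier of `f_α` -/
  s : ℂ
  /-- minus the pole of the multiplier of `f_α` -/
  t : ℂ
  /-- the constant factor of the multiplier of `f_α` -/
  A : ℂ
  /-- the constant factor of the multiplier of `f_β` -/
  B : ℂ
  /-- the centre on `f_n = -t` -/
  cp : κ
  /-- the centre on `f_n = -s` -/
  cm : κ
  α_ne : α ≠ n
  β_ne : β ≠ n
  α_ne_β : α ≠ β
  s_ne : s ≠ 0
  t_ne : t ≠ 0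
  s_ne_t : s ≠ t
  A_ne : A ≠ 0
  B_ne : B ≠ 0
  σ_α : σ (coord α) = algebraMap ℂ _ A * coord α *
    ((coord n + algebraMap ℂ _ s) / (coord n + algebraMap ℂ _ t))
  σ_β : σ (coord β) = algebraMap ℂ _ B * coord β *
    ((coord n + algebraMap ℂ _ t) / (coord n + algebraMap ℂ _ s))
  σ_of_ne : ∀ m, m ≠ α → m ≠ β → σ (coord m) = coord m
  n_eq : ∀ c, D'.n c = D.n c
  zer_eq : ∀ c, D'.zer c = D.zer c
  inf_eq : ∀ c, D'.inf c = D.inf c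
  n_cp : D.n cp = n
  zer_cp : D.zer cp = α
  inf_cp : D.inf cp = β
  d_cp : D.d cp = t
  d'_cp : D'.d cp = s
  n_cm : D.n cm = n
  zer_cm : D.zer cm = β
  inf_cm : D.inf cm = α
  d_cm : D.d cm = s
  d'_cm : D'.d cm = t
  d_eq : ∀ c, c ≠ cp → c ≠ cm → D.n c ≠ α → D.n c ≠ β → D'.d c = D.d c
  -- This keeps the multiplier a unit along the other exceptional divisors of row `n`, and keeps
  -- them out of the zero divisors of `f_n + s` and `f_n + t`.
  d_ne : ∀ c, c ≠ cp → c ≠ cm → D.n c = n → D.d c ≠ s ∧ D.d c ≠ t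
  -- A centre in row `α` has `f_n = ∞` or `f_n = 0` among its equations, where the multiplier of
  -- `f_α` takes the value `A` or `A s / t`. The finite value of the centre has to be rescaled by
  -- precisely this factor.
  d_α : ∀ c, D.n c = α → (D.inf c = n ∧ D'.d c = A * D.d c) ∨
    (D.zer c = n ∧ D'.d c = A * (s / t) * D.d c)
  d_β : ∀ c, D.n c = β → (D.inf c = n ∧ D'.d c = B * D.d c) ∨
    (D.zer c = n ∧ D'.d c = B * (t / s) * D.d c)

namespace ElemTransf

variable {N : ℕ} [Finite (ZMod N)] {κ : Type*} {D D' : CentreData N κ} {σ : FunField N ≃ₐ[ℂ] FunField N}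

/-- Exchange the roles of the two coordinates that change. -/
def flip (T : ElemTransf D D' σ) : ElemTransf D D' σ where
  n := T.n
  α := T.β
  β := T.α
  s := T.t
  t := T.s
  A := T.B
  B := T.A
  cp := T.cm
  cm := T.cp
  α_ne := T.β_ne
  β_ne := T.α_ne
  α_ne_β := T.α_ne_β.symm
  s_ne := T.t_ne
  t_ne := T.s_ne
  s_ne_t := T.s_ne_t.symm
  A_ne := T.B_ne
  B_ne := T.A_ne
  σ_α := T.σ_β
  σ_β := T.σ_α
  σ_of_ne := fun m h h' => T.σ_of_ne m h' h
  n_eq := T.n_eq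
  zer_eq := T.zer_eq
  inf_eq := T.inf_eq
  n_cp := T.n_cm
  zer_cp := T.zer_cm
  inf_cp := T.inf_cm
  d_cp := T.d_cm
  d'_cp := T.d'_cm
  n_cm := T.n_cp
  zer_cm := T.zer_cp
  inf_cm := T.inf_cp
  d_cm := T.d_cp
  d'_cm := T.d'_cp
  d_eq := fun c h1 h2 h3 h4 => T.d_eq c h2 h1 h4 h3
  d_ne := fun c h1 h2 h3 => (T.d_ne c h2 h1 h3).symm
  d_α := T.d_β
  d_β := T.d_α

theorem σ_n (T : ElemTransf D D' σ) : σ (coord T.n) = coord T.n :=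
  T.σ_of_ne _ T.α_ne.symm T.β_ne.symm

theorem symm_apply_aux {F : Type*} [Field F] {A x g h y : F} (hA : A ≠ 0) (hg : g ≠ 0)
    (hh : h ≠ 0) (H : x = A * y * (g / h)) : y = A⁻¹ * x * (h / g) := by
  rw [H]; field_simp

/-- The inverse transformation. -/
def symm (T : ElemTransf D D' σ) : ElemTransf D' D σ.symm where
  n := T.n
  α := T.α
  β := T.β
  s := T.t
  t := T.s
  A := T.A⁻¹
  B := T.B⁻¹
  cp := T.cp
  cm := T.cm
  α_ne := T.α_ne
  β_ne := T.β_ne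
  α_ne_β := T.α_ne_β
  s_ne := T.t_ne
  t_ne := T.s_ne
  s_ne_t := T.s_ne_t.symm
  A_ne := inv_ne_zero T.A_ne
  B_ne := inv_ne_zero T.B_ne
  σ_α := by
    have h0 := T.σ_α
    apply σ.injective
    simp only [AlgEquiv.apply_symm_apply, map_mul, map_div₀, map_add, AlgEquiv.commutes, T.σ_n,
      map_inv₀]
    exact symm_apply_aux (by simpa using T.A_ne) (coord_add_ne_zero _ _) (coord_add_ne_zero _ _) h0
  σ_β := by
    have h0 := T.σ_β
    apply σ.injective
    simp only [AlgEquiv.apply_symm_apply, map_mul, map_div₀, map_add, AlgEquiv.commutes, T.σ_n,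
      map_inv₀]
    exact symm_apply_aux (by simpa using T.B_ne) (coord_add_ne_zero _ _) (coord_add_ne_zero _ _) h0
  σ_of_ne := fun m h h' => by rw [AlgEquiv.symm_apply_eq, T.σ_of_ne m h h']
  n_eq := fun c => (T.n_eq c).symm
  zer_eq := fun c => (T.zer_eq c).symm
  inf_eq := fun c => (T.inf_eq c).symm
  n_cp := by rw [T.n_eq, T.n_cp]
  zer_cp := by rw [T.zer_eq, T.zer_cp]
  inf_cp := by rw [T.inf_eq, T.inf_cp]
  d_cp := T.d'_cp
  d'_cp := T.d_cp
  n_cm := by rw [T.n_eq, T.n_cm]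
  zer_cm := by rw [T.zer_eq, T.zer_cm]
  inf_cm := by rw [T.inf_eq, T.inf_cm]
  d_cm := T.d'_cm
  d'_cm := T.d_cm
  d_eq := fun c h1 h2 h3 h4 => (T.d_eq c h1 h2 (T.n_eq c ▸ h3) (T.n_eq c ▸ h4)).symm
  d_ne := fun c h1 h2 h3 => by
    rw [T.n_eq] at h3
    rw [T.d_eq c h1 h2 (h3 ▸ T.α_ne.symm) (h3 ▸ T.β_ne.symm)]
    exact (T.d_ne c h1 h2 h3).symm
  d_α := fun c h => by
    rw [T.n_eq] at h
    have := T.A_ne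
    have := T.s_ne
    have := T.t_ne
    rw [T.inf_eq, T.zer_eq]
    refine (T.d_α c h).imp (And.imp_right fun h => ?_) (And.imp_right fun h => ?_)
    · rw [h]; field_simp
    · rw [h]; field_simp
  d_β := fun c h => by
    rw [T.n_eq] at h
    have := T.B_ne
    have := T.s_ne
    have := T.t_ne
    rw [T.inf_eq, T.zer_eq]
    refine (T.d_β c h).imp (And.imp_right fun h => ?_) (And.imp_right fun h => ?_)
    · rw [h]; field_simp
    · rw [h]; field_simp

/-- The multiplier of `f_α`, up to a constant. -/
def mult (T : ElemTransf D D' σ) : FunField N :=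
  (coord T.n + algebraMap ℂ _ T.s) / (coord T.n + algebraMap ℂ _ T.t)

theorem mult_ne_zero (T : ElemTransf D D' σ) : T.mult ≠ 0 :=
  div_ne_zero (coord_add_ne_zero _ _) (coord_add_ne_zero _ _)

theorem flip_mult (T : ElemTransf D D' σ) : T.flip.mult = T.mult⁻¹ := (inv_div _ _).symm

theorem mult_mem_of_coord (T : ElemTransf D D' σ) {R : Subring (FunField N)}
    {Q : LocalSubring (FunField N)} (hC : ∀ z : ℂ, algebraMap ℂ _ z ∈ R) (hn : coord T.n ∈ R)
    (hs : UnitIn Q (coord T.n + algebraMap ℂ _ T.s))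
    (ht : UnitIn Q (coord T.n + algebraMap ℂ _ T.t)) :
    T.mult ∈ fracIn R Q ⊓ Q.toSubring ∧ T.mult⁻¹ ∈ fracIn R Q ⊓ Q.toSubring := by
  rw [mult, inv_div]
  exact ⟨quot_mem_fracIn (add_mem hn (hC _)) (add_mem hn (hC _)) hs ht,
    quot_mem_fracIn (add_mem hn (hC _)) (add_mem hn (hC _)) ht hs⟩

/-- Near `f_n = ∞` one divides numerator and denominator of the multiplier by `f_n`; each becomes
`1` plus a non-unit. -/
theorem mult_mem_of_inv_coord (T : ElemTransf D D' σ) {R : Subring (FunField N)}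
    {Q : LocalSubring (FunField N)} (hC : ∀ z : ℂ, algebraMap ℂ _ z ∈ R)
    (hn : (coord T.n)⁻¹ ∈ R) (hQ : ContainsC Q) (h : InMax Q (coord T.n)⁻¹) :
    T.mult ∈ fracIn R Q ⊓ Q.toSubring ∧ T.mult⁻¹ ∈ fracIn R Q ⊓ Q.toSubring := by
  have h0 := isCoord_coord.ne_zero T.n
  have hu : ∀ z : ℂ, UnitIn Q (1 + algebraMap ℂ _ z * (coord T.n)⁻¹) := fun z =>
    (unitIn_one Q).add_inMax (h.mul_left (hQ z))
  have hm : ∀ z : ℂ, 1 + algebraMap ℂ _ z * (coord T.n)⁻¹ ∈ R := fun z =>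
    add_mem (one_mem _) (mul_mem (hC z) hn)
  have he : T.mult = (1 + algebraMap ℂ _ T.s * (coord T.n)⁻¹) /
      (1 + algebraMap ℂ _ T.t * (coord T.n)⁻¹) := by
    have h1 := (hu T.t).1
    have h2 := coord_add_ne_zero T.n T.t
    rw [mult, div_eq_div_iff h2 h1]
    field_simp
  rw [he, inv_div]
  exact ⟨quot_mem_fracIn (hm _) (hm _) (hu _) (hu _), quot_mem_fracIn (hm _) (hm _) (hu _) (hu _)⟩

/-- The coordinates are multiplied by units of any ring in which the multiplier is a unit. -/
theorem exists_mul (T : ElemTransf D D' σ) {S : Subring (FunField N)}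
    (hC : ∀ z : ℂ, algebraMap ℂ _ z ∈ S) (h : T.mult ∈ S ∧ T.mult⁻¹ ∈ S) (m : ZMod N) :
    ∃ U, U ≠ 0 ∧ U ∈ S ∧ U⁻¹ ∈ S ∧ σ (coord m) = U * coord m := by
  by_cases hα : m = T.α
  · subst hα
    refine ⟨algebraMap ℂ _ T.A * T.mult, mul_ne_zero (by simpa using T.A_ne) T.mult_ne_zero,
      mul_mem (hC _) h.1, ?_, ?_⟩
    · rw [mul_inv, ← map_inv₀]; exact mul_mem (hC _) h.2
    · rw [T.σ_α, mult]; ring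
  by_cases hβ : m = T.β
  · subst hβ
    refine ⟨algebraMap ℂ _ T.B * T.mult⁻¹,
      mul_ne_zero (by simpa using T.B_ne) (inv_ne_zero T.mult_ne_zero), mul_mem (hC _) h.2, ?_, ?_⟩
    · rw [mul_inv, inv_inv, ← map_inv₀]; exact mul_mem (hC _) h.1
    · rw [T.σ_β, mult, inv_div]; ring
  · exact ⟨1, one_ne_zero, one_mem _, by simp, by rw [T.σ_of_ne m hα hβ, one_mul]⟩

theorem containsC_mapLoc {Q : LocalSubring (FunField N)} (hQ : ContainsC Q) :
    ContainsC (mapLoc σ Q) := fun z => by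
  rw [mem_mapLoc_iff, AlgEquiv.commutes]; exact hQ z

theorem mem_inter {z : ZMod N → FunField N} {Q : LocalSubring (FunField N)} (hQ : ContainsC Q)
    (x : ℂ) : algebraMap ℂ _ x ∈ fracIn (coordRing z) Q ⊓ Q.toSubring :=
  ⟨le_fracIn _ _ (algebraMap_mem_coordRing z x), hQ x⟩

theorem unitIn_mapLoc_add (T : ElemTransf D D' σ) {Q : LocalSubring (FunField N)} {x : ℂ} :
    UnitIn (mapLoc σ Q) (coord T.n + algebraMap ℂ _ x) ↔ UnitIn Q (coord T.n + algebraMap ℂ _ x) := by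
  rw [← unitIn_mapLoc_iff σ Q, map_add, T.σ_n, AlgEquiv.commutes]

/-- Away from `f_n = -s` and `f_n = -t` the multiplier is a unit, so in a suitable chart of `(ℙ¹)^N`
each coordinate is only multiplied by a unit. -/
theorem mapLoc_mem_projLineProd (T : ElemTransf D D' σ) {Q : LocalSubring (FunField N)}
    (hQ : Q ∈ projLineProd N) (hd : ¬ 2 ≤ ringKrullDim Q.toSubring) (hs : ¬ IsHyper T.n T.s Q)
    (ht : ¬ IsHyper T.n T.t Q) : mapLoc σ Q ∈ projLineProd N := by
  have hC := locallyFG_projLineProd.containsC hQ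
  have hC' : ContainsC (mapLoc σ Q) := containsC_mapLoc hC
  obtain ⟨inv₀, hinv₀⟩ := mem_projLineProd_iff.1 hQ
  -- This chart inverts a coordinate only if it has no finite value at `Q`, so that `f_n` itself is
  -- available whenever possible.
  let inv : ZMod N → Prop := fun m => coord m ∉ Q.toSubring
  have hinv : Q ∈ specModel (coordRing (chartCoord inv)) := by
    refine mem_specModel_chart hQ fun m => ?_
    by_cases hm : coord m ∈ Q.toSubring
    · simp [chartCoord, inv, hm]
    · have := coord_mem_of_mem_specModel hinv₀ m
      rw [chartCoord] at this ⊢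
      rw [if_pos hm]
      split_ifs at this with h
      · exact this
      · exact absurd this hm
  have hmult : T.mult ∈ fracIn (coordRing (chartCoord inv)) (mapLoc σ Q) ⊓ (mapLoc σ Q).toSubring ∧
      T.mult⁻¹ ∈ fracIn (coordRing (chartCoord inv)) (mapLoc σ Q) ⊓ (mapLoc σ Q).toSubring := by
    by_cases hn : coord T.n ∈ Q.toSubring
    · have hz : chartCoord inv T.n = coord T.n := by simp [chartCoord, inv, hn]
      refine T.mult_mem_of_coord (algebraMap_mem_coordRing _)
        (hz ▸ coord_mem_coordRing (chartCoord inv) T.n) (T.unitIn_mapLoc_add.2 ?_)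
        (T.unitIn_mapLoc_add.2 ?_)
      · exact (unitIn_iff (add_mem hn (hC _))).2 fun h => hs (isHyper_of_inMax hQ hd h)
      · exact (unitIn_iff (add_mem hn (hC _))).2 fun h => ht (isHyper_of_inMax hQ hd h)
    · have hz : chartCoord inv T.n = (coord T.n)⁻¹ := by simp [chartCoord, inv, hn]
      have hmem : (coord T.n)⁻¹ ∈ Q.toSubring := hz ▸ coord_mem_of_mem_specModel hinv T.n
      refine T.mult_mem_of_inv_coord (algebraMap_mem_coordRing _)
        (hz ▸ coord_mem_coordRing (chartCoord inv) T.n) hC' ?_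
      have := (inMax_mapLoc_iff σ Q (coord T.n)⁻¹).2 ⟨hmem, Or.inr (by rwa [inv_inv])⟩
      rwa [map_inv₀, T.σ_n] at this
  refine mem_projLineProd_iff.2 ⟨inv, mapLoc_mem_specModel_of_triangular hinv σ fun m => ?_⟩
  obtain ⟨U, h0, hU, hU', he⟩ := T.exists_mul (mem_inter hC') hmult m
  by_cases hm : inv m
  · refine ⟨U⁻¹, 0, inv_ne_zero h0, hU', by rwa [inv_inv], zero_mem _, ?_⟩
    simp only [chartCoord, hm, if_true, map_inv₀, he, mul_inv, add_zero]
  · refine ⟨U, 0, h0, hU, hU', zero_mem _, ?_⟩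
    simp only [chartCoord, hm, if_false, he, add_zero]

theorem eq_exc_of_mem {c : κ} {i : ZMod N} (hi : i ∈ ({D.zer c, D.n c, D.inf c} : Finset _))
    {Q : LocalSubring (FunField N)} (hQ : Q ∈ specModel (coordRing (D.excCoord c i)))
    (hd : ¬ 2 ≤ ringKrullDim Q.toSubring)
    (h : InMax Q (cenCoord (D.n c) (D.inf c) (D.d c) i)) : Q = D.exc c := by
  refine (isLin_singleton_of_dim_lt (D.isCoord_excCoord c i) hQ hd ?_).unique (D.isLin_exc c hi)
  rwa [CentreData.excCoord, chartZ_self]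

/-- The divisor `f_n = -t` is mapped to an exceptional divisor. -/
theorem mapLoc_hyper (T : ElemTransf D D' σ) {Q : LocalSubring (FunField N)}
    (hQ : IsHyper T.n T.t Q) : mapLoc σ Q = D.exc T.cp := by
  have hC' : ContainsC (mapLoc σ Q) := containsC_mapLoc hQ.containsC
  have hchart : Q ∈ specModel (coordRing (chartCoord (· = T.β))) := by
    refine mem_specModel_chart hQ.mem_projLineProd fun m => ?_
    rw [chartCoord]
    split_ifs with h
    · exact (hQ.unitIn (h ▸ T.β_ne)).2.2
    · exact hQ.coord_mem m
  have hn : T.n ∈ ({D.zer T.cp, D.n T.cp, D.inf T.cp} : Finset _) := by simp [T.n_cp]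
  have hg := coord_add_ne_zero T.n T.t
  have hg' := coord_add_ne_zero T.n T.s
  -- In this chart the coordinates of the three directions are `f_n + t`, `f_α / (f_n + t)` and `1 /
  -- (f_β (f_n + t))`. The pole of the multiplier of `f_α` and the zero of that of `f_β` are
  -- absorbed, leaving only the unit factor `f_n + s` and constants.
  have hzn : D.excCoord T.cp T.n T.n = coord T.n + algebraMap ℂ _ T.t := by
    rw [CentreData.excCoord, chartZ_self, T.n_cp, cenCoord_self, T.d_cp]
  have hzα : D.excCoord T.cp T.n T.α = coord T.α / (coord T.n + algebraMap ℂ _ T.t) := by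
    rw [CentreData.excCoord, chartZ_of_ne (by simp [T.zer_cp]) T.α_ne, T.n_cp, T.inf_cp, T.d_cp,
      cenCoord_self, cenCoord_of_ne T.α_ne T.α_ne_β]
  have hzβ : D.excCoord T.cp T.n T.β = (coord T.β)⁻¹ / (coord T.n + algebraMap ℂ _ T.t) := by
    rw [CentreData.excCoord, chartZ_of_ne (by simp [T.inf_cp]) T.β_ne, T.n_cp, T.inf_cp, T.d_cp,
      cenCoord_self, cenCoord_inf T.β_ne]
  have hzm : ∀ m, m ≠ T.n → m ≠ T.α → m ≠ T.β → D.excCoord T.cp T.n m = coord m := by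
    intro m h1 h2 h3
    rw [CentreData.excCoord, chartZ_of_notMem (by simp [T.n_cp, T.inf_cp, T.zer_cp, h1, h2, h3]),
      T.n_cp, T.inf_cp, cenCoord_of_ne h1 h3]
  have hU : coord T.n + algebraMap ℂ _ T.s ∈ coordRing (D.excCoord T.cp T.n) := by
    have : coord T.n + algebraMap ℂ _ T.s =
        D.excCoord T.cp T.n T.n + algebraMap ℂ _ (T.s - T.t) := by
      rw [hzn, map_sub]; ring
    rw [this]
    exact add_mem (coord_mem_coordRing _ _) (algebraMap_mem_coordRing _ _)
  have hUu : UnitIn (mapLoc σ Q) (coord T.n + algebraMap ℂ _ T.s) :=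
    T.unitIn_mapLoc_add.2 (hQ.unitIn_add T.s_ne_t)
  have hUS := quot_mem_fracIn hU (one_mem _) hUu (unitIn_one _)
  have hUS' := quot_mem_fracIn (one_mem _) hU (unitIn_one _) hUu
  rw [div_one] at hUS
  rw [one_div] at hUS'
  have hA := T.A_ne
  have hB := T.B_ne
  refine eq_exc_of_mem hn (mapLoc_mem_specModel_of_triangular hchart σ fun m => ?_) ?_ ?_
  · by_cases hmn : m = T.n
    · subst hmn
      refine ⟨1, -algebraMap ℂ _ T.t, one_ne_zero, one_mem _, by simp,
        neg_mem (mem_inter hC' _), ?_⟩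
      rw [hzn, chartCoord, if_neg T.β_ne.symm, T.σ_n]; ring
    by_cases hmα : m = T.α
    · subst hmα
      refine ⟨algebraMap ℂ _ T.A * (coord T.n + algebraMap ℂ _ T.s), 0,
        mul_ne_zero (by simpa using hA) hg', mul_mem (mem_inter hC' _) hUS, ?_, zero_mem _, ?_⟩
      · rw [mul_inv, ← map_inv₀]; exact mul_mem (mem_inter hC' _) hUS'
      · rw [hzα, chartCoord, if_neg T.α_ne_β, T.σ_α]; ring
    by_cases hmβ : m = T.β
    · subst hmβ
      refine ⟨algebraMap ℂ _ T.B⁻¹ * (coord T.n + algebraMap ℂ _ T.s), 0,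
        mul_ne_zero (by simpa using hB) hg', mul_mem (mem_inter hC' _) hUS, ?_, zero_mem _, ?_⟩
      · rw [mul_inv, ← map_inv₀, inv_inv]; exact mul_mem (mem_inter hC' _) hUS'
      · rw [hzβ, chartCoord, if_pos rfl, map_inv₀, T.σ_β, mul_inv, mul_inv, inv_div, map_inv₀]; ring
    · refine ⟨1, 0, one_ne_zero, one_mem _, by simp, zero_mem _, ?_⟩
      rw [hzm m hmn hmα hmβ, chartCoord, if_neg hmβ, T.σ_of_ne m hmα hmβ]; ring
  · rw [ringKrullDim_mapLoc, hQ.dim_eq_one]; exact not_two_le_one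
  · have := (inMax_mapLoc_iff σ Q _).2 hQ.isUnif.inMax
    rwa [map_add, T.σ_n, AlgEquiv.commutes, ← T.d_cp, ← cenCoord_self _ (D.inf T.cp),
      ← congrFun (congrArg (fun n => cenCoord n (D.inf T.cp) (D.d T.cp)) T.n_cp) T.n] at this

theorem excCoord_of_mem {c : κ} {i m : ZMod N} (hm : m ∈ ({D.zer c, D.n c, D.inf c} : Finset _))
    (hmi : m ≠ i) : D.excCoord c i m = cenCoord (D.n c) (D.inf c) (D.d c) m /
      cenCoord (D.n c) (D.inf c) (D.d c) i := chartZ_of_ne hm hmi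

theorem excCoord_self (c : κ) (i : ZMod N) :
    D.excCoord c i i = cenCoord (D.n c) (D.inf c) (D.d c) i := chartZ_self _ _ _

theorem excCoord_of_notMem {c : κ} {i m : ZMod N}
    (hm : m ∉ ({D.zer c, D.n c, D.inf c} : Finset _)) : D.excCoord c i m = coord m := by
  rw [CentreData.excCoord, chartZ_of_notMem hm, cenCoord_of_ne] <;> rintro rfl <;> simp at hm

/-- The effect of the transformation on the equation of a centre in the row of `α`. -/
theorem exists_remainder_α (T : ElemTransf D D' σ) {S : Subring (FunField N)}
    (hC : ∀ z : ℂ, algebraMap ℂ _ z ∈ S) (h : T.mult ∈ S ∧ T.mult⁻¹ ∈ S) {c : κ}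
    (hc : D.n c = T.α) :
    ∃ U W, U ≠ 0 ∧ U ∈ S ∧ U⁻¹ ∈ S ∧ W ∈ S ∧
      σ (coord (D.n c) + algebraMap ℂ _ (D'.d c)) =
        U * (coord (D.n c) + algebraMap ℂ _ (D.d c)) +
          W * cenCoord (D.n c) (D.inf c) (D.d c) T.n := by
  have h1 := coord_add_ne_zero T.n T.t
  have h0 := isCoord_coord.ne_zero T.n
  have ht : algebraMap ℂ (FunField N) T.t ≠ 0 := by simpa using T.t_ne
  have hne : T.n ≠ D.n c := hc ▸ T.α_ne.symm
  have hσ : σ (coord (D.n c)) = algebraMap ℂ _ T.A * T.mult * coord (D.n c) := by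
    rw [hc, T.σ_α, mult]; ring
  refine ⟨algebraMap ℂ _ T.A * T.mult, ?_⟩
  rw [map_add, AlgEquiv.commutes, hσ]
  have hU0 : algebraMap ℂ _ T.A * T.mult ≠ 0 :=
    mul_ne_zero (by simpa using T.A_ne) T.mult_ne_zero
  have hU : algebraMap ℂ _ T.A * T.mult ∈ S := mul_mem (hC _) h.1
  have hU' : (algebraMap ℂ _ T.A * T.mult)⁻¹ ∈ S := by
    rw [mul_inv, ← map_inv₀]; exact mul_mem (hC _) h.2
  have hm : T.mult * (coord T.n + algebraMap ℂ _ T.t) = coord T.n + algebraMap ℂ _ T.s :=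
    div_mul_cancel₀ _ h1
  -- The remainder measures how far the multiplier is from its value on the centre. The relation
  -- `mult * (f_n + t) = f_n + s` makes it divisible by `1 / f_n` in the first case and by `f_n` in
  -- the second.
  rcases T.d_α c hc with ⟨hi, hd⟩ | ⟨hz, hd⟩
  · refine ⟨algebraMap ℂ _ (T.A * D.d c) * (algebraMap ℂ _ T.t * T.mult - algebraMap ℂ _ T.s),
      hU0, hU, hU', mul_mem (hC _) (sub_mem (mul_mem (hC _) h.1) (hC _)), ?_⟩
    rw [hi, cenCoord_inf hne, hd, map_mul]
    field_simp
    linear_combination (-(algebraMap ℂ _ T.A * algebraMap ℂ _ (D.d c))) * hm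
  · have hni : T.n ≠ D.inf c := hz ▸ D.zer_ne_inf c
    refine ⟨algebraMap ℂ _ (T.A * D.d c * T.t⁻¹) * (T.mult - 1),
      hU0, hU, hU', mul_mem (hC _) (sub_mem h.1 (one_mem _)), ?_⟩
    rw [cenCoord_of_ne hne hni, hd]
    simp only [map_mul, map_inv₀, map_div₀]
    field_simp
    linear_combination (-(algebraMap ℂ _ T.A * algebraMap ℂ _ (D.d c))) * hm

theorem exists_remainder (T : ElemTransf D D' σ) {S : Subring (FunField N)}
    (hC : ∀ z : ℂ, algebraMap ℂ _ z ∈ S) (h : T.mult ∈ S ∧ T.mult⁻¹ ∈ S) {c : κ} (hp : c ≠ T.cp)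
    (hm : c ≠ T.cm) :
    ∃ U W, U ≠ 0 ∧ U ∈ S ∧ U⁻¹ ∈ S ∧ W ∈ S ∧
      σ (coord (D.n c) + algebraMap ℂ _ (D'.d c)) =
        U * (coord (D.n c) + algebraMap ℂ _ (D.d c)) +
          W * cenCoord (D.n c) (D.inf c) (D.d c) T.n := by
  by_cases hα : D.n c = T.α
  · exact T.exists_remainder_α hC h hα
  by_cases hβ : D.n c = T.β
  · exact T.flip.exists_remainder_α hC (by rw [flip_mult, inv_inv]; exact h.symm) hβ
  refine ⟨1, 0, one_ne_zero, one_mem _, by simp, zero_mem _, ?_⟩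
  rw [map_add, AlgEquiv.commutes, T.σ_of_ne _ hα hβ, T.d_eq c hp hm hα hβ]
  ring

/-- The other exceptional divisors are mapped to exceptional divisors. -/
theorem mapLoc_exc (T : ElemTransf D D' σ) {c : κ} (hp : c ≠ T.cp) (hm : c ≠ T.cm) :
    mapLoc σ (D'.exc c) = D.exc c := by
  have hC' : ContainsC (mapLoc σ (D'.exc c)) := containsC_mapLoc (D'.containsC_exc c)
  -- The chart is chosen so that its exceptional equation is preserved: the one of `f_n` if `f_n`
  -- occurs in the equations of the centre, and otherwise the one of the finite coordinate, which is
  -- then unaffected.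
  obtain ⟨i, hi, hiσ, hin, hni⟩ : ∃ i ∈ ({D.zer c, D.n c, D.inf c} : Finset _),
      σ (cenCoord (D.n c) (D.inf c) (D'.d c) i) = cenCoord (D.n c) (D.inf c) (D.d c) i ∧
      (i ≠ D.n c → i = T.n) ∧ (T.n ∈ ({D.zer c, D.n c, D.inf c} : Finset _) → i = T.n) := by
    by_cases hT : T.n ∈ ({D.zer c, D.n c, D.inf c} : Finset _)
    · refine ⟨T.n, hT, ?_, fun _ => rfl, fun _ => rfl⟩
      by_cases h1 : T.n = D.n c
      · rw [h1, cenCoord_self, cenCoord_self, map_add, ← h1, T.σ_n, AlgEquiv.commutes,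
          T.d_eq c hp hm (h1 ▸ T.α_ne.symm) (h1 ▸ T.β_ne.symm)]
      by_cases h2 : T.n = D.inf c
      · rw [← h2, cenCoord_inf h1, cenCoord_inf h1, map_inv₀, T.σ_n]
      · rw [cenCoord_of_ne h1 h2, cenCoord_of_ne h1 h2, T.σ_n]
    · have hα : D.n c ≠ T.α := fun h => hT (by
        rcases T.d_α c h with ⟨h, -⟩ | ⟨h, -⟩ <;> simp [h])
      have hβ : D.n c ≠ T.β := fun h => hT (by
        rcases T.d_β c h with ⟨h, -⟩ | ⟨h, -⟩ <;> simp [h])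
      refine ⟨D.n c, by simp, ?_, fun h => absurd rfl h, fun h => absurd h hT⟩
      rw [cenCoord_self, cenCoord_self, map_add, T.σ_of_ne _ hα hβ, AlgEquiv.commutes,
        T.d_eq c hp hm hα hβ]
  have hi' : i ∈ ({D'.zer c, D'.n c, D'.inf c} : Finset _) := by
    rw [T.zer_eq, T.n_eq, T.inf_eq]; exact hi
  have hlin := D'.isLin_exc c hi'
  have hmax : InMax (mapLoc σ (D'.exc c)) (cenCoord (D.n c) (D.inf c) (D.d c) i) := by
    rw [← hiσ, inMax_mapLoc_iff]
    have := (D'.isUnif_exc c hi').inMax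
    rwa [T.n_eq, T.inf_eq] at this
  set w := cenCoord (D.n c) (D.inf c) (D.d c) with hw
  have hwi : w i ≠ 0 := (isCoord_cenCoord (D.inf_ne c) _).ne_zero i
  have hmult : T.mult ∈ fracIn (coordRing (D.excCoord c i)) (mapLoc σ (D'.exc c)) ⊓
        (mapLoc σ (D'.exc c)).toSubring ∧
      T.mult⁻¹ ∈ fracIn (coordRing (D.excCoord c i)) (mapLoc σ (D'.exc c)) ⊓
        (mapLoc σ (D'.exc c)).toSubring := by
    by_cases hinf : T.n = D.inf c
    · have hiT : i = T.n := hni (by simp [hinf])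
      have hwn : w i = (coord T.n)⁻¹ := by
        rw [hw, hiT, hinf, cenCoord_inf (D.inf_ne c)]
      refine T.mult_mem_of_inv_coord (algebraMap_mem_coordRing _) ?_ hC' (hwn ▸ hmax)
      rw [← hwn, hw, ← excCoord_self]
      exact coord_mem_coordRing _ _
    · have hmem : coord T.n ∈ coordRing (D.excCoord c i) := by
        by_cases hT : T.n ∈ ({D.zer c, D.n c, D.inf c} : Finset _)
        · have hiT := hni hT
          have h1 := coord_mem_coordRing (D.excCoord c i) i
          rw [excCoord_self] at h1
          by_cases hn : T.n = D.n c
          · rw [hiT, hn, cenCoord_self] at h1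
            have := sub_mem h1 (algebraMap_mem_coordRing (D.excCoord c (D.n c)) (D.d c))
            rw [add_sub_cancel_right, ← hn] at this
            rwa [hiT]
          · rw [hiT, cenCoord_of_ne hn hinf] at h1
            rwa [hiT]
        · rw [← excCoord_of_notMem (i := i) hT]
          exact coord_mem_coordRing _ _
      have hne : T.n ≠ D'.inf c := by rwa [T.inf_eq]
      have hd : T.n = D'.n c → T.s ≠ D'.d c ∧ T.t ≠ D'.d c := by
        intro h
        rw [T.n_eq] at h
        rw [T.d_eq c hp hm (h ▸ T.α_ne.symm) (h ▸ T.β_ne.symm)]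
        exact ⟨(T.d_ne c hp hm h.symm).1.symm, (T.d_ne c hp hm h.symm).2.symm⟩
      exact T.mult_mem_of_coord (algebraMap_mem_coordRing _) hmem
        (T.unitIn_mapLoc_add.2 (D'.unitIn_add c hne (fun _ => T.s_ne) fun h => (hd h).1))
        (T.unitIn_mapLoc_add.2 (D'.unitIn_add c hne (fun _ => T.t_ne) fun h => (hd h).2))
  refine eq_exc_of_mem hi (mapLoc_mem_specModel_of_triangular hlin.1 σ fun m => ?_) ?_ hmax
  · by_cases hmT : m ∈ ({D.zer c, D.n c, D.inf c} : Finset _)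
    · have hmT' : m ∈ ({D'.zer c, D'.n c, D'.inf c} : Finset _) := by
        rw [T.zer_eq, T.n_eq, T.inf_eq]; exact hmT
      by_cases hmi : m = i
      · subst hmi
        refine ⟨1, 0, one_ne_zero, one_mem _, by simp, zero_mem _, ?_⟩
        rw [excCoord_self, excCoord_self, T.n_eq, T.inf_eq, hiσ]
        ring
      rw [excCoord_of_mem hmT hmi, excCoord_of_mem hmT' hmi, T.n_eq, T.inf_eq, map_div₀, hiσ]
      by_cases hmn : m = D.n c
      -- The exceptional equation here is that of `f_n`, so dividing by it turns the remainder into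
      -- the regular summand `W`.
      · obtain ⟨U, W, h0, hU, hU', hW, he⟩ := T.exists_remainder (mem_inter hC') hmult hp hm
        refine ⟨U, W, h0, hU, hU', hW, ?_⟩
        rw [hin (fun h => hmi (hmn.trans h.symm))] at hwi ⊢
        rw [hmn, cenCoord_self, cenCoord_self, he]
        simp only [hw] at hwi ⊢
        field_simp
      · obtain ⟨U, h0, hU, hU', he⟩ := T.exists_mul (mem_inter hC') hmult m
        by_cases hinf : m = D.inf c
        · refine ⟨U⁻¹, 0, inv_ne_zero h0, hU', by rwa [inv_inv], zero_mem _, ?_⟩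
          rw [hinf] at he ⊢
          rw [cenCoord_inf (D.inf_ne c), cenCoord_inf (D.inf_ne c), map_inv₀, he, mul_inv]
          ring
        · refine ⟨U, 0, h0, hU, hU', zero_mem _, ?_⟩
          rw [cenCoord_of_ne hmn hinf, cenCoord_of_ne hmn hinf, he]
          ring
    · have hmT' : m ∉ ({D'.zer c, D'.n c, D'.inf c} : Finset _) := by
        rw [T.zer_eq, T.n_eq, T.inf_eq]; exact hmT
      obtain ⟨U, h0, hU, hU', he⟩ := T.exists_mul (mem_inter hC') hmult m
      refine ⟨U, 0, h0, hU, hU', zero_mem _, ?_⟩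
      rw [excCoord_of_notMem hmT, excCoord_of_notMem hmT', he, add_zero]
  · rw [ringKrullDim_mapLoc, D'.dim_exc]; exact not_two_le_one

/-- The inverse transformation has `s` and `t` exchanged, and sends the hyperplane `f_n = -s` to the
exceptional divisor with the same label `cp` on the other side. -/
theorem mapLoc_exc_cp (T : ElemTransf D D' σ) {Q : LocalSubring (FunField N)}
    (hQ : IsHyper T.n T.s Q) : mapLoc σ (D'.exc T.cp) = Q := by
  have := T.symm.mapLoc_hyper hQ
  change _ = D'.exc T.cp at this
  rw [← this, mapLoc_mapLoc_symm]

theorem mapLoc_hyper_s (T : ElemTransf D D' σ) {Q : LocalSubring (FunField N)}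
    (hQ : IsHyper T.n T.s Q) : mapLoc σ Q = D.exc T.cm := T.flip.mapLoc_hyper hQ

theorem mapLoc_exc_cm (T : ElemTransf D D' σ) {Q : LocalSubring (FunField N)}
    (hQ : IsHyper T.n T.t Q) : mapLoc σ (D'.exc T.cm) = Q := T.flip.mapLoc_exc_cp hQ

variable {X X' : Set (LocalSubring (FunField N))}

/-- The transformation is defined at all points of codimension at most one. -/
theorem mapLoc_mem (T : ElemTransf D D' σ) (hX : IsBlowUpOf D X) (hX' : IsBlowUpOf D' X')
    {Q : LocalSubring (FunField N)} (hQ : Q ∈ X') (hd : ¬ 2 ≤ ringKrullDim Q.toSubring) :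
    mapLoc σ Q ∈ X := by
  rcases (hX'.codim Q hd).1 hQ with h | ⟨c, hc⟩
  · by_cases hs : IsHyper T.n T.s Q
    · rw [T.mapLoc_hyper_s hs]; exact hX.exc_mem _
    by_cases ht : IsHyper T.n T.t Q
    · rw [T.mapLoc_hyper ht]; exact hX.exc_mem _
    · exact (hX.codim _ (by rwa [ringKrullDim_mapLoc])).2
        (Or.inl (T.mapLoc_mem_projLineProd h hd hs ht))
  · rw [D'.isExc_iff] at hc
    subst hc
    by_cases hp : c = T.cp
    · subst hp
      rw [T.mapLoc_exc_cp (hX.isHyper_hyperDiv _ _)]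
      exact (hX.hyperDiv _ _).2.1
    by_cases hm : c = T.cm
    · subst hm
      rw [T.mapLoc_exc_cm (hX.isHyper_hyperDiv _ _)]
      exact (hX.hyperDiv _ _).2.1
    · rw [T.mapLoc_exc hp hm]; exact hX.exc_mem _

end ElemTransf

/-! ### The action of an elementary transformation on divisor classes. -/

namespace ElemTransf

variable {N : ℕ} [Finite (ZMod N)] {κ : Type*} [Finite κ] {D D' : CentreData N κ}
  {σ : FunField N ≃ₐ[ℂ] FunField N} {X X' : Set (LocalSubring (FunField N))}

/-- The bijection of prime divisors. -/
def divEquiv (T : ElemTransf D D' σ) (hX : IsBlowUpOf D X) (hX' : IsBlowUpOf D' X') :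
    PrimeDivisor X' ≃ PrimeDivisor X :=
  TropicalWeyl.divEquiv σ (fun _ => T.mapLoc_mem hX hX') (fun _ => T.symm.mapLoc_mem hX' hX)

theorem divEquiv_val (T : ElemTransf D D' σ) (hX : IsBlowUpOf D X) (hX' : IsBlowUpOf D' X')
    (V : PrimeDivisor X') : (T.divEquiv hX hX' V).1 = mapLoc σ V.1 := rfl

theorem isPseudoIso (T : ElemTransf D D' σ) (hX : IsBlowUpOf D X) (hX' : IsBlowUpOf D' X') :
    IsPseudoIso (σ : FunField N →+* FunField N) X X' :=
  isPseudoIso_of_codim hX.lfg hX.sep hX'.lfg hX'.sep σ (fun _ => T.mapLoc_mem hX hX')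
    (fun _ => T.symm.mapLoc_mem hX' hX)

/-- The pullback of divisor classes. -/
def pullback (T : ElemTransf D D' σ) (hX : IsBlowUpOf D X) (hX' : IsBlowUpOf D' X') :
    ClassGroup X' ≃+ ClassGroup X :=
  hX.pullback hX' σ (T.divEquiv hX hX') (T.divEquiv_val hX hX')

theorem pullback_single (T : ElemTransf D D' σ) (hX : IsBlowUpOf D X) (hX' : IsBlowUpOf D' X')
    (V : PrimeDivisor X') :
    T.pullback hX hX' (divClass X' (Finsupp.single V 1)) =
      divClass X (Finsupp.single (T.divEquiv hX hX' V) 1) := by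
  rw [pullback, hX.pullback_divClass, Finsupp.equivMapDomain_single]

theorem pullback_zeroDiv (T : ElemTransf D D' σ) (hX : IsBlowUpOf D X) (hX' : IsBlowUpOf D' X')
    {x : FunField N} (hx : x ≠ 0) (hx' : σ x ≠ 0) :
    T.pullback hX hX' (divClass X' (hX'.zeroDiv hx)) = divClass X (hX.zeroDiv hx') := by
  rw [pullback, hX.pullback_divClass]
  congr 1
  ext V
  obtain ⟨V', rfl⟩ := (T.divEquiv hX hX').surjective V
  rw [Finsupp.equivMapDomain_apply, Equiv.symm_apply_apply, hX.zeroDiv_apply, hX'.zeroDiv_apply,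
    divEquiv_val, (hX'.isDV V').ordAt_mapLoc σ hx]

theorem zeroDiv_add_s (T : ElemTransf D D' σ) (hX : IsBlowUpOf D X) :
    hX.zeroDiv (coord_add_ne_zero T.n T.s) =
      Finsupp.single (hX.hyperDiv T.n T.s) 1 + Finsupp.single (hX.excDiv T.cm) 1 := by
  ext V
  rw [hX.zeroDiv_apply, Finsupp.add_apply]
  have hne : hX.hyperDiv T.n T.s ≠ hX.excDiv T.cm := fun h =>
    D.exc_notMem T.cm (by
      have := (hX.isHyper_hyperDiv T.n T.s).mem_projLineProd
      rw [h] at this; exact this)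
  by_cases h1 : V = hX.hyperDiv T.n T.s
  · subst h1
    rw [(hX.isHyper_hyperDiv _ _).isUnif.ordAt_self, Finsupp.single_eq_same,
      Finsupp.single_eq_of_ne hne]
    rfl
  by_cases h2 : V = hX.excDiv T.cm
  · subst h2
    have := D.ordAt_fin T.cm
    rw [T.n_cm, T.d_cm] at this
    rw [Finsupp.single_eq_same, Finsupp.single_eq_of_ne hne.symm]
    change max (ordAt (D.exc T.cm) _) 0 = _
    rw [this]
    rfl
  rw [Finsupp.single_eq_of_ne h1, Finsupp.single_eq_of_ne h2, add_zero, max_eq_right_iff]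
  -- A further zero would be another component in `(ℙ¹)^N`, impossible for a hyperplane, or an
  -- exceptional divisor, excluded because its centre lies at a different or infinite value of
  -- `f_n`.
  by_contra hpos
  have hmax := ((hX.isDV V).inMax_iff (coord_add_ne_zero T.n T.s)).2 (not_le.1 hpos)
  rcases hX.mem_or_eq_exc V with h | ⟨c, hc⟩
  · exact h1 (hX.eq_hyperDiv (isHyper_of_inMax h (by rw [V.2.2]; exact not_two_le_one) hmax))
  · have hcm : c ≠ T.cm := fun h => h2 (Subtype.ext (by rw [hc, h]; rfl))
    rw [hc] at hmax
    by_cases hinf : T.n = D.inf c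
    · have := sub_mem hmax.1 (D.containsC_exc c T.s)
      rw [add_sub_cancel_right, hinf] at this
      exact D.coord_notMem_exc c this
    · refine (D.unitIn_add c hinf (fun _ => T.s_ne) fun hn => ?_).not_inMax hmax
      by_cases hcp : c = T.cp
      · rw [hcp, T.d_cp]; exact T.s_ne_t
      · exact (T.d_ne c hcp hcm hn.symm).1.symm

theorem zeroDiv_add_t (T : ElemTransf D D' σ) (hX : IsBlowUpOf D X) :
    hX.zeroDiv (coord_add_ne_zero T.n T.t) =
      Finsupp.single (hX.hyperDiv T.n T.t) 1 + Finsupp.single (hX.excDiv T.cp) 1 :=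
  T.flip.zeroDiv_add_s hX

theorem divClass_zeroDiv_add (hX : IsBlowUpOf D X) (n : ZMod N) (s : ℂ) :
    divClass X (hX.zeroDiv (coord_add_ne_zero n s)) =
      hX.latEquiv (Finsupp.single (Sum.inl n) 1) := by
  rw [← hX.divClass_zeroDiv_sub n (-s)]
  congr 2
  rw [map_neg, sub_neg_eq_add]

theorem latEquiv_exc (hX : IsBlowUpOf D X) (c : κ) :
    hX.latEquiv (Finsupp.single (Sum.inr c) 1) = divClass X (Finsupp.single (hX.excDiv c) 1) :=
  hX.latEquiv_single _

theorem divClass_hyper_s (T : ElemTransf D D' σ) (hX : IsBlowUpOf D X) :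
    divClass X (Finsupp.single (hX.hyperDiv T.n T.s) 1) =
      hX.latEquiv (Finsupp.single (Sum.inl T.n) 1 - Finsupp.single (Sum.inr T.cm) 1) := by
  rw [map_sub, ← divClass_zeroDiv_add hX T.n T.s, T.zeroDiv_add_s hX, latEquiv_exc,
    IsBlowUpOf.divClass_add, add_sub_cancel_right]

theorem divClass_hyper_t (T : ElemTransf D D' σ) (hX : IsBlowUpOf D X) :
    divClass X (Finsupp.single (hX.hyperDiv T.n T.t) 1) =
      hX.latEquiv (Finsupp.single (Sum.inl T.n) 1 - Finsupp.single (Sum.inr T.cp) 1) :=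
  T.flip.divClass_hyper_s hX

theorem pullback_exc (T : ElemTransf D D' σ) (hX : IsBlowUpOf D X) (hX' : IsBlowUpOf D' X')
    {c : κ} (hp : c ≠ T.cp) (hm : c ≠ T.cm) :
    T.pullback hX hX' (hX'.latEquiv (Finsupp.single (Sum.inr c) 1)) =
      hX.latEquiv (Finsupp.single (Sum.inr c) 1) := by
  rw [latEquiv_exc, latEquiv_exc, pullback_single]
  congr 3
  exact Subtype.ext (T.mapLoc_exc hp hm)

theorem pullback_cp (T : ElemTransf D D' σ) (hX : IsBlowUpOf D X) (hX' : IsBlowUpOf D' X') :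
    T.pullback hX hX' (hX'.latEquiv (Finsupp.single (Sum.inr T.cp) 1)) =
      hX.latEquiv (Finsupp.single (Sum.inl T.n) 1 - Finsupp.single (Sum.inr T.cm) 1) := by
  rw [latEquiv_exc, pullback_single, ← T.divClass_hyper_s]
  congr 3
  exact Subtype.ext (T.mapLoc_exc_cp (hX.isHyper_hyperDiv _ _))

theorem pullback_cm (T : ElemTransf D D' σ) (hX : IsBlowUpOf D X) (hX' : IsBlowUpOf D' X') :
    T.pullback hX hX' (hX'.latEquiv (Finsupp.single (Sum.inr T.cm) 1)) =
      hX.latEquiv (Finsupp.single (Sum.inl T.n) 1 - Finsupp.single (Sum.inr T.cp) 1) := by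
  rw [latEquiv_exc, pullback_single, ← T.divClass_hyper_t]
  congr 3
  exact Subtype.ext (T.mapLoc_exc_cm (hX.isHyper_hyperDiv _ _))

theorem divClass_zeroDiv_coord (hX : IsBlowUpOf D X) (m : ZMod N) :
    divClass X (hX.zeroDiv (isCoord_coord.ne_zero m)) =
      hX.latEquiv (Finsupp.single (Sum.inl m) 1) := by
  rw [← hX.divClass_zeroDiv_sub m 0]
  congr 2
  rw [map_zero, sub_zero]

theorem pullback_coord_of_ne (T : ElemTransf D D' σ) (hX : IsBlowUpOf D X)
    (hX' : IsBlowUpOf D' X') {m : ZMod N} (hα : m ≠ T.α) (hβ : m ≠ T.β) :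
    T.pullback hX hX' (hX'.latEquiv (Finsupp.single (Sum.inl m) 1)) =
      hX.latEquiv (Finsupp.single (Sum.inl m) 1) := by
  have h := T.σ_of_ne m hα hβ
  rw [← divClass_zeroDiv_coord, T.pullback_zeroDiv hX hX' _ (by rw [h]; exact isCoord_coord.ne_zero m),
    ← divClass_zeroDiv_coord]
  congr 2

theorem ordAt_add (hX : IsBlowUpOf D X) (V : PrimeDivisor X) (n : ZMod N) (s : ℂ) :
    ordAt V.1 (coord n + algebraMap ℂ _ s) =
      hX.zeroDiv (coord_add_ne_zero n s) V - hX.poleDiv (isCoord_coord.ne_zero n) V := by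
  have h := (hX.isDV V).neg_part_sub (hX.containsC V) (-s) (isCoord_coord.ne_zero n)
    (by rw [map_neg, sub_neg_eq_add]; exact coord_add_ne_zero n s)
  rw [map_neg, sub_neg_eq_add] at h
  rw [hX.zeroDiv_apply, hX.poleDiv_apply, ← h]
  rcases le_total 0 (ordAt V.1 (coord n + algebraMap ℂ _ s)) with h | h
  · rw [max_eq_left h, max_eq_right (by linarith)]; ring
  · rw [max_eq_right h, max_eq_left (by linarith)]; ring

theorem ordAt_σ_α (T : ElemTransf D D' σ) (hX : IsBlowUpOf D X) (V : PrimeDivisor X) :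
    ordAt V.1 (σ (coord T.α)) = ordAt V.1 (coord T.α) +
      (Finsupp.single (hX.hyperDiv T.n T.s) 1 V + Finsupp.single (hX.excDiv T.cm) 1 V) -
      (Finsupp.single (hX.hyperDiv T.n T.t) 1 V + Finsupp.single (hX.excDiv T.cp) 1 V) := by
  have hA : algebraMap ℂ (FunField N) T.A ≠ 0 := by simpa using T.A_ne
  have h1 := coord_add_ne_zero T.n T.s
  have h2 := coord_add_ne_zero T.n T.t
  have hα := isCoord_coord.ne_zero T.α
  rw [T.σ_α, (hX.isDV V).ordAt_mul (mul_ne_zero hA hα) (div_ne_zero h1 h2),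
    (hX.isDV V).ordAt_mul hA hα, (hX.isDV V).ordAt_div h1 h2,
    (hX.isDV V).ordAt_of_unitIn ((hX.containsC V).unitIn T.A_ne), ordAt_add hX, ordAt_add hX,
    T.zeroDiv_add_s hX, T.zeroDiv_add_t hX, Finsupp.add_apply, Finsupp.add_apply]
  ring

/-- Only four divisors matter. Along `E_cp` the zero of `f_α` cancels the pole of the multiplier;
along `E_cm` its pole cancels the zero of the multiplier; `f_n = -s` becomes a zero, and `f_n = -t`
a pole, which does not count. -/
theorem zeroDiv_σ_α (T : ElemTransf D D' σ) (hX : IsBlowUpOf D X) (h0 : σ (coord T.α) ≠ 0) :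
    hX.zeroDiv h0 = hX.zeroDiv (isCoord_coord.ne_zero T.α) - Finsupp.single (hX.excDiv T.cp) 1 +
      Finsupp.single (hX.hyperDiv T.n T.s) 1 := by
  ext V
  rw [Finsupp.add_apply, Finsupp.sub_apply, hX.zeroDiv_apply, hX.zeroDiv_apply, T.ordAt_σ_α hX]
  have hs := hX.isHyper_hyperDiv T.n T.s
  have ht := hX.isHyper_hyperDiv T.n T.t
  have e1 : ∀ c s, hX.excDiv c ≠ hX.hyperDiv T.n s := fun c s h =>
    D.exc_notMem c (by
      have := (hX.isHyper_hyperDiv T.n s).mem_projLineProd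
      rw [← h] at this; exact this)
  have e2 : hX.hyperDiv T.n T.s ≠ hX.hyperDiv T.n T.t := fun h =>
    (hs.unitIn_add T.s_ne_t.symm).not_inMax (h ▸ ht.isUnif.inMax)
  have e3 : hX.excDiv T.cp ≠ hX.excDiv T.cm := fun h => by
    have := congrArg D.zer (hX.excDiv_injective h)
    rw [T.zer_cp, T.zer_cm] at this
    exact T.α_ne_β this
  by_cases c1 : V = hX.hyperDiv T.n T.s
  · subst c1
    rw [(hX.isDV _).ordAt_of_unitIn (hs.unitIn T.α_ne)]
    simp [Finsupp.single_eq_of_ne e2, Finsupp.single_eq_of_ne (e1 _ _).symm]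
  by_cases c2 : V = hX.hyperDiv T.n T.t
  · subst c2
    rw [(hX.isDV _).ordAt_of_unitIn (ht.unitIn T.α_ne)]
    simp [Finsupp.single_eq_of_ne e2.symm, Finsupp.single_eq_of_ne (e1 _ _).symm]
  by_cases c3 : V = hX.excDiv T.cp
  · subst c3
    have := D.ordAt_zer T.cp
    rw [T.zer_cp] at this
    change max (ordAt (D.exc T.cp) _ + _ - _) 0 = max (ordAt (D.exc T.cp) _) 0 - _ + _
    rw [this]
    simp [Finsupp.single_eq_of_ne (e1 _ _), Finsupp.single_eq_of_ne e3]
  by_cases c4 : V = hX.excDiv T.cm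
  · subst c4
    have := D.ordAt_inf T.cm
    rw [T.inf_cm] at this
    change max (ordAt (D.exc T.cm) _ + _ - _) 0 = max (ordAt (D.exc T.cm) _) 0 - _ + _
    rw [this]
    simp [Finsupp.single_eq_of_ne (e1 _ _), Finsupp.single_eq_of_ne e3.symm]
  · simp [Finsupp.single_eq_of_ne c1, Finsupp.single_eq_of_ne c2, Finsupp.single_eq_of_ne c3,
      Finsupp.single_eq_of_ne c4]

theorem pullback_α (T : ElemTransf D D' σ) (hX : IsBlowUpOf D X) (hX' : IsBlowUpOf D' X') :
    T.pullback hX hX' (hX'.latEquiv (Finsupp.single (Sum.inl T.α) 1)) =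
      hX.latEquiv (Finsupp.single (Sum.inl T.α) 1 + (Finsupp.single (Sum.inl T.n) 1 -
        Finsupp.single (Sum.inr T.cp) 1 - Finsupp.single (Sum.inr T.cm) 1)) := by
  have h0 : σ (coord T.α) ≠ 0 := by simpa using isCoord_coord.ne_zero T.α
  rw [← divClass_zeroDiv_coord, T.pullback_zeroDiv hX hX' _ h0, T.zeroDiv_σ_α hX,
    IsBlowUpOf.divClass_add, IsBlowUpOf.divClass_sub, divClass_zeroDiv_coord, T.divClass_hyper_s,
    ← latEquiv_exc, ← map_sub, ← map_add]
  congr 1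
  abel

theorem pullback_β (T : ElemTransf D D' σ) (hX : IsBlowUpOf D X) (hX' : IsBlowUpOf D' X') :
    T.pullback hX hX' (hX'.latEquiv (Finsupp.single (Sum.inl T.β) 1)) =
      hX.latEquiv (Finsupp.single (Sum.inl T.β) 1 + (Finsupp.single (Sum.inl T.n) 1 -
        Finsupp.single (Sum.inr T.cp) 1 - Finsupp.single (Sum.inr T.cm) 1)) := by
  refine (T.flip.pullback_α hX hX').trans ?_
  congr 1
  change _ + (_ - Finsupp.single (Sum.inr T.cm) 1 - Finsupp.single (Sum.inr T.cp) 1) = _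
  rw [sub_right_comm]
  rfl

end ElemTransf

/-! ### Permutations of the centres -/

section Permutation

variable {N : ℕ} [Finite (ZMod N)] {κ : Type*} [Finite κ] {D D' : CentreData N κ}
  {X X' : Set (LocalSubring (FunField N))} {π : Equiv.Perm κ}

/-- The exceptional divisor is determined by its centre, so relabelling the centres relabels the
exceptional divisors. -/
theorem exc_eq_of_perm (h : ∀ c, D'.P c = D.P (π c)) (c : κ) : D'.exc c = D.exc (π c) :=
  D.isExc_iff.1 (h c ▸ D'.isExc c)

theorem mem_iff_of_perm (hX : IsBlowUpOf D X) (hX' : IsBlowUpOf D' X')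
    (h : ∀ c, D'.P c = D.P (π c)) {Q : LocalSubring (FunField N)}
    (hd : ¬ 2 ≤ ringKrullDim Q.toSubring) : Q ∈ X' ↔ Q ∈ X := by
  rw [hX.codim Q hd, hX'.codim Q hd]
  refine or_congr_right ⟨fun ⟨c, hc⟩ => ⟨π c, h c ▸ hc⟩, fun ⟨c, hc⟩ => ⟨π.symm c, ?_⟩⟩
  rw [h, Equiv.apply_symm_apply]; exact hc

theorem mapLoc_refl (Q : LocalSubring (FunField N)) :
    mapLoc (AlgEquiv.refl : FunField N ≃ₐ[ℂ] FunField N) Q = Q := by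
  have h1 : (mapLoc (AlgEquiv.refl : FunField N ≃ₐ[ℂ] FunField N) Q).toSubring = Q.toSubring := by
    ext x; exact mem_mapLoc_iff _ _ _
  exact LocalSubring.toSubring_injective h1

theorem isPseudoIso_refl_of_perm (hX : IsBlowUpOf D X) (hX' : IsBlowUpOf D' X')
    (h : ∀ c, D'.P c = D.P (π c)) :
    IsPseudoIso ((AlgEquiv.refl : FunField N ≃ₐ[ℂ] FunField N) : FunField N →+* FunField N) X X' :=
  isPseudoIso_of_codim hX.lfg hX.sep hX'.lfg hX'.sep AlgEquiv.refl
    (fun Q hQ hd => by rw [mapLoc_refl]; exact (mem_iff_of_perm hX hX' h hd).1 hQ)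
    (fun Q hQ hd => by
      change mapLoc AlgEquiv.refl Q ∈ X'
      rw [mapLoc_refl]; exact (mem_iff_of_perm hX hX' h hd).2 hQ)

/-- The identification of prime divisors of two blow-ups along the same centres. -/
def permDivEquiv (hX : IsBlowUpOf D X) (hX' : IsBlowUpOf D' X') (h : ∀ c, D'.P c = D.P (π c)) :
    PrimeDivisor X' ≃ PrimeDivisor X :=
  divEquiv AlgEquiv.refl
    (fun Q hQ hd => by rw [mapLoc_refl]; exact (mem_iff_of_perm hX hX' h hd).1 hQ)
    (fun Q hQ hd => by
      change mapLoc AlgEquiv.refl Q ∈ X'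
      rw [mapLoc_refl]; exact (mem_iff_of_perm hX hX' h hd).2 hQ)

theorem permDivEquiv_val (hX : IsBlowUpOf D X) (hX' : IsBlowUpOf D' X')
    (h : ∀ c, D'.P c = D.P (π c)) (V : PrimeDivisor X') :
    (permDivEquiv hX hX' h V).1 = mapLoc AlgEquiv.refl V.1 := rfl

theorem permDivEquiv_val' (hX : IsBlowUpOf D X) (hX' : IsBlowUpOf D' X')
    (h : ∀ c, D'.P c = D.P (π c)) (V : PrimeDivisor X') :
    (permDivEquiv hX hX' h V).1 = V.1 := mapLoc_refl V.1

/-- The identification of divisor classes of two blow-ups along the same centres. -/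
def permPullback (hX : IsBlowUpOf D X) (hX' : IsBlowUpOf D' X') (h : ∀ c, D'.P c = D.P (π c)) :
    ClassGroup X' ≃+ ClassGroup X :=
  hX.pullback hX' AlgEquiv.refl (permDivEquiv hX hX' h) (permDivEquiv_val hX hX' h)

theorem permPullback_exc (hX : IsBlowUpOf D X) (hX' : IsBlowUpOf D' X')
    (h : ∀ c, D'.P c = D.P (π c)) (c : κ) :
    permPullback hX hX' h (hX'.latEquiv (Finsupp.single (Sum.inr c) 1)) =
      hX.latEquiv (Finsupp.single (Sum.inr (π c)) 1) := by
  rw [ElemTransf.latEquiv_exc, ElemTransf.latEquiv_exc, permPullback, hX.pullback_divClass,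
    Finsupp.equivMapDomain_single]
  congr 3
  exact Subtype.ext ((permDivEquiv_val' hX hX' h _).trans (exc_eq_of_perm h c))

theorem permPullback_coord (hX : IsBlowUpOf D X) (hX' : IsBlowUpOf D' X')
    (h : ∀ c, D'.P c = D.P (π c)) (m : ZMod N) :
    permPullback hX hX' h (hX'.latEquiv (Finsupp.single (Sum.inl m) 1)) =
      hX.latEquiv (Finsupp.single (Sum.inl m) 1) := by
  rw [← ElemTransf.divClass_zeroDiv_coord, ← ElemTransf.divClass_zeroDiv_coord, permPullback,
    hX.pullback_divClass]
  congr 1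
  ext V
  obtain ⟨V', rfl⟩ := (permDivEquiv hX hX' h).surjective V
  rw [Finsupp.equivMapDomain_apply, Equiv.symm_apply_apply, hX.zeroDiv_apply, hX'.zeroDiv_apply,
    permDivEquiv_val']

end Permutation

/-! ### The parameters -/

section Parameters

variable {N : ℕ} {k l : ZMod N → ℕ} {L : Type*} [Field L]

/-- The exponent of `b_n^m` in the parameter `W_θ` of the row `n`. -/
def parExp (k l : ZMod N → ℕ) (p : ℕ) (n : ZMod N) (θ m : ℤ) : ℤ :=
  if m < θ then ((l n : ℤ) + m) * (p / (k n + l n) : ℕ) else (m - k n) * (p / (k n + l n) : ℕ)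

/-- The parameters `W_θ` of the row `n`, for `1 - ℓ ≤ θ ≤ k`. They are the `u_n^θ` for `θ ≥ 1`, and
the `1 / v_n^{θ-1}` for `θ ≤ 0`. -/
def par (p : ℕ) (b : Root k l → L) (n : ZMod N) (θ : ℤ) : L :=
  ∏ m ∈ Finset.Icc (1 - (l n : ℤ)) ((k n : ℤ) - 1), rv b n m ^ parExp k l p n θ m

theorem rv_self (b : Root k l → L) (r : Root k l) : rv b r.1.1 r.1.2 = b r := by
  have : -(l r.1.1 : ℤ) + 1 ≤ r.1.2 ∧ r.1.2 ≤ (k r.1.1 : ℤ) - 1 := r.2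
  rw [rv, dif_pos this]

theorem rv_ne_zero {b : Root k l → L} (hb : ∀ t, b t ≠ 0) (n : ZMod N) (m : ℤ) : rv b n m ≠ 0 := by
  rw [rv]; split_ifs
  · exact hb _
  · exact one_ne_zero

theorem rv_map {L' : Type*} [Field L'] (φ : L →+* L') (b : Root k l → L) (n : ZMod N) (m : ℤ) :
    rv (fun t => φ (b t)) n m = φ (rv b n m) := by
  rw [rv, rv]; split_ifs
  · rfl
  · rw [map_one]

theorem par_map {L' : Type*} [Field L'] (φ : L →+* L') (p : ℕ) (b : Root k l → L) (n : ZMod N)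
    (θ : ℤ) : par p (fun t => φ (b t)) n θ = φ (par p b n θ) := by
  simp only [par, rv_map, map_prod, map_zpow₀]

theorem par_ne_zero (p : ℕ) {b : Root k l → L} (hb : ∀ t, b t ≠ 0) (n : ZMod N) (θ : ℤ) :
    par p b n θ ≠ 0 :=
  Finset.prod_ne_zero_iff.2 fun m _ => zpow_ne_zero _ (rv_ne_zero hb n m)

/-- A row is the vertex `0` with a negative and a positive arm; this matches the single product in
`par` with the products in `uPar` and `vPar`. -/
theorem prod_Icc_split {M : Type*} [CommMonoid M] (f : ℤ → M) {k l : ℕ} (hk : 0 < k) (hl : 0 < l) :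
    ∏ m ∈ Finset.Icc (1 - (l : ℤ)) ((k : ℤ) - 1), f m =
      f 0 * (∏ j ∈ Finset.Icc 1 (l - 1), f (-(j : ℤ))) * ∏ i ∈ Finset.Icc 1 (k - 1), f (i : ℤ) := by
  have h : Finset.Icc (1 - (l : ℤ)) ((k : ℤ) - 1) =
      insert 0 (((Finset.Icc 1 (l - 1)).image fun j : ℕ => -(j : ℤ)) ∪
        (Finset.Icc 1 (k - 1)).image fun i : ℕ => (i : ℤ)) := by
    ext m
    simp only [Finset.mem_Icc, Finset.mem_insert, Finset.mem_union, Finset.mem_image]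
    constructor
    · rintro ⟨h1, h2⟩
      rcases lt_trichotomy m 0 with h | h | h
      · exact Or.inr (Or.inl ⟨m.natAbs, by omega, by omega⟩)
      · exact Or.inl h
      · exact Or.inr (Or.inr ⟨m.natAbs, by omega, by omega⟩)
    · rintro (h | ⟨j, h, rfl⟩ | ⟨j, h, rfl⟩) <;> omega
  rw [h, Finset.prod_insert, Finset.prod_union, Finset.prod_image, Finset.prod_image, mul_assoc]
  · intro a _ c _ h; simpa using h
  · intro a _ c _ h; simpa using h
  · rw [Finset.disjoint_left]
    simp only [Finset.mem_image, Finset.mem_Icc]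
    rintro _ ⟨j, h, rfl⟩ ⟨i, h', h''⟩
    omega
  · simp only [Finset.mem_image, Finset.mem_union, Finset.mem_Icc]
    rintro (⟨j, h, h'⟩ | ⟨j, h, h'⟩) <;> omega

theorem uPar_eq (hk : ∀ n, 0 < k n) (hl : ∀ n, 0 < l n) (p : ℕ) (b : Root k l → L) (n : ZMod N) :
    uPar p b n = par p b n 1 := by
  rw [par, prod_Icc_split _ (hk n) (hl n), uPar, div_eq_mul_inv, ← Finset.prod_inv_distrib]
  congr 1
  · congr 1
    · rw [← zpow_natCast]
      congr 1
    · refine Finset.prod_congr rfl fun j hj => ?_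
      rw [Finset.mem_Icc] at hj
      rw [← zpow_natCast, parExp, if_pos (by omega)]
      congr 1
      rw [Nat.cast_mul, Nat.cast_sub (by omega)]; ring
  · refine Finset.prod_congr rfl fun j hj => ?_
    rw [Finset.mem_Icc] at hj
    rw [← zpow_natCast, ← zpow_neg, parExp, if_neg (by omega)]
    congr 1
    rw [Nat.cast_mul, Nat.cast_sub (by omega)]; ring

theorem vPar_eq (hk : ∀ n, 0 < k n) (hl : ∀ n, 0 < l n) (p : ℕ) (b : Root k l → L) (n : ZMod N) :
    1 / vPar p b n = par p b n 0 := by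
  rw [par, prod_Icc_split _ (hk n) (hl n), vPar, one_div_div, div_eq_mul_inv, mul_inv,
    ← Finset.prod_inv_distrib, mul_left_comm, ← mul_assoc]
  congr 1
  · congr 1
    · rw [← zpow_natCast, ← zpow_neg]
      congr 1
      simp [parExp]
    · refine Finset.prod_congr rfl fun j hj => ?_
      rw [Finset.mem_Icc] at hj
      rw [← zpow_natCast, parExp, if_pos (by omega)]
      congr 1
      rw [Nat.cast_mul, Nat.cast_sub (by omega)]; ring
  · refine Finset.prod_congr rfl fun j hj => ?_
    rw [Finset.mem_Icc] at hj
    rw [← zpow_natCast, ← zpow_neg, parExp, if_neg (by omega)]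
    congr 1
    rw [Nat.cast_mul, Nat.cast_sub (by omega)]; ring

theorem par_mul_of_rv (p : ℕ) {b b' : Root k l → L} {x : L} (hx : x ≠ 0) (n : ZMod N) (θ : ℤ)
    (c : ℤ → ℤ) (h : ∀ m ∈ Finset.Icc (1 - (l n : ℤ)) ((k n : ℤ) - 1),
      rv b' n m = rv b n m * x ^ c m) :
    par p b' n θ = par p b n θ *
      x ^ ∑ m ∈ Finset.Icc (1 - (l n : ℤ)) ((k n : ℤ) - 1), c m * parExp k l p n θ m := by
  have hs : ∀ s : Finset ℤ, x ^ ∑ m ∈ s, c m * parExp k l p n θ m =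
      ∏ m ∈ s, x ^ (c m * parExp k l p n θ m) := by
    intro s
    induction s using Finset.induction_on with
    | empty => simp
    | insert a s ha ih => rw [Finset.sum_insert ha, zpow_add₀ hx, ih, Finset.prod_insert ha]
  rw [par, par, hs, ← Finset.prod_mul_distrib]
  refine Finset.prod_congr rfl fun m hm => ?_
  rw [h m hm, mul_zpow, zpow_mul]

/-- The exponents for `θ` and `θ + 1` differ only at the vertex `θ`, where they jump from `(θ - k) p
/ (k + ℓ)` to `(ℓ + θ) p / (k + ℓ)`, that is, by `p`. -/
theorem par_succ {p : ℕ} (hdvd : ∀ n, (k n + l n) ∣ p) {b : Root k l → L}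
    (hb : ∀ t, b t ≠ 0) (n : ZMod N) {θ : ℤ} (hθ : 1 - (l n : ℤ) ≤ θ) (hθ' : θ ≤ (k n : ℤ) - 1) :
    par p b n (θ + 1) = par p b n θ * rv b n θ ^ p := by
  have hmem : θ ∈ Finset.Icc (1 - (l n : ℤ)) ((k n : ℤ) - 1) := Finset.mem_Icc.2 ⟨hθ, hθ'⟩
  rw [par, par, ← Finset.mul_prod_erase _ _ hmem, ← Finset.mul_prod_erase _ _ hmem]
  have hp : ((k n : ℤ) + l n) * (p / (k n + l n) : ℕ) = p := by
    exact_mod_cast Nat.mul_div_cancel' (hdvd n)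
  have h1 : rv b n θ ^ parExp k l p n (θ + 1) θ = rv b n θ ^ parExp k l p n θ θ * rv b n θ ^ p := by
    rw [← zpow_natCast, ← zpow_add₀ (rv_ne_zero hb n θ), parExp, parExp, if_pos (by omega),
      if_neg (by omega), ← hp]
    congr 1
    ring
  have h2 : ∏ m ∈ (Finset.Icc (1 - (l n : ℤ)) ((k n : ℤ) - 1)).erase θ,
      rv b n m ^ parExp k l p n (θ + 1) m =
      ∏ m ∈ (Finset.Icc (1 - (l n : ℤ)) ((k n : ℤ) - 1)).erase θ,
        rv b n m ^ parExp k l p n θ m := by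
    refine Finset.prod_congr rfl fun m hm => ?_
    have hne : m ≠ θ := (Finset.mem_erase.1 hm).1
    congr 1
    rw [parExp, parExp]
    congr 1
    exact propext (by omega)
  rw [h1, h2]
  ring

theorem uSeq_eq (hk : ∀ n, 0 < k n) (hl : ∀ n, 0 < l n) {p : ℕ} (hdvd : ∀ n, (k n + l n) ∣ p)
    {b : Root k l → L} (hb : ∀ t, b t ≠ 0) (n : ZMod N) {i : ℕ} (hi : 1 ≤ i) (hik : i ≤ k n) :
    uSeq p b n i = par p b n i := by
  induction i, hi using Nat.le_induction with
  | base => simp [uSeq, uPar_eq hk hl]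
  | succ i hi ih =>
    have := hl n
    rw [Nat.cast_succ, par_succ hdvd hb n (by omega) (by omega), ← ih (by omega), uSeq, uSeq,
      mul_assoc]
    congr 1
    obtain ⟨j, rfl⟩ : ∃ j, i = j + 1 := ⟨i - 1, by omega⟩
    simp only [Nat.add_sub_cancel]
    rw [Finset.prod_Icc_succ_top (by omega)]

theorem vSeq_eq (hk : ∀ n, 0 < k n) (hl : ∀ n, 0 < l n) {p : ℕ} (hdvd : ∀ n, (k n + l n) ∣ p)
    {b : Root k l → L} (hb : ∀ t, b t ≠ 0) (n : ZMod N) {j : ℕ} (hj : 1 ≤ j) (hjl : j ≤ l n) :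
    1 / vSeq p b n j = par p b n (1 - j) := by
  induction j, hj using Nat.le_induction with
  | base => simp [vSeq, ← vPar_eq hk hl]
  | succ j hj ih =>
    have := hk n
    have h1 := par_succ (p := p) hdvd hb n (θ := -j) (by omega) (by omega)
    have h2 := ih (by omega)
    rw [neg_add_eq_sub, ← h2] at h1
    have h3 : vSeq p b n (j + 1) = vSeq p b n j * rv b n (-j) ^ p := by
      obtain ⟨i, rfl⟩ : ∃ i, j = i + 1 := ⟨j - 1, by omega⟩
      simp only [vSeq, Nat.add_sub_cancel]
      rw [Finset.prod_Icc_succ_top (by omega), mul_assoc]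
    have h4 : (rv b n (-j) ^ p) ≠ 0 := pow_ne_zero _ (rv_ne_zero hb n _)
    rw [h3, one_div, mul_inv, ← one_div, h1, Nat.cast_succ, sub_add_cancel_right,
      mul_inv_cancel_right₀ h4]

/-- The exponent of `b_r` by which `s_r` multiplies `b_n^m`. -/
def rootExp (r : Root k l) (n : ZMod N) (m : ℤ) : ℤ :=
  if n = r.1.1 then (if m = r.1.2 then -2 else 0) + (if m = r.1.2 + 1 then 1 else 0) +
    (if m = r.1.2 - 1 then 1 else 0)
  else if r.1.2 = 0 ∧ m = 0 ∧ (n = r.1.1 + 1 ∨ r.1.1 = n + 1) then 1 else 0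

theorem actRoot_eq {b : Root k l → L} (hb : ∀ t, b t ≠ 0) (r t : Root k l) :
    actRoot r b t = b t * b r ^ rootExp r t.1.1 t.1.2 := by
  have hr := hb r
  obtain ⟨⟨n, i⟩, hri⟩ := r
  obtain ⟨⟨n', i'⟩, hti⟩ := t
  simp only [actRoot, rootExp, Adj, Subtype.mk.injEq, Prod.mk.injEq]
  by_cases hn : n' = n
  · subst hn
    by_cases hi : i' = i
    · subst hi
      simp only [and_self, if_true, left_eq_add, one_ne_zero, if_false, add_zero,
        show ¬ i' = i' - 1 by omega]
      rw [zpow_neg]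
      have h2 : (2 : ℤ) = ((2 : ℕ) : ℤ) := rfl
      rw [h2, zpow_natCast]
      field_simp
    · by_cases h1 : i' = i + 1
      · subst h1
        simp [show ¬ i + 1 = i - 1 by omega, mul_comm]
      · by_cases h2 : i' = i - 1
        · subst h2
          simp [show ¬ i - 1 = i + 1 by omega, mul_comm]
        · simp [hi, h1, h2, show ¬ i = i' + 1 by omega]
  · have hn' : ¬ n = n' := fun h => hn h.symm
    simp only [hn, false_and, if_false, hn', false_or, ne_eq, not_false_eq_true, true_and]
    have hcomm : (i = 0 ∧ i' = 0 ∧ (n = n' + 1 ∨ n' = n + 1)) ↔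
        (i = 0 ∧ i' = 0 ∧ (n' = n + 1 ∨ n = n' + 1)) := by tauto
    by_cases h : i = 0 ∧ i' = 0 ∧ (n' = n + 1 ∨ n = n' + 1)
    · rw [if_pos (hcomm.2 h), if_pos h, zpow_one, mul_comm]
    · rw [if_neg (fun h' => h (hcomm.1 h')), if_neg h, zpow_zero, mul_one]

theorem actRoot_ne_zero {b : Root k l → L} (hb : ∀ t, b t ≠ 0) (r t : Root k l) :
    actRoot r b t ≠ 0 := by
  rw [actRoot_eq hb]; exact mul_ne_zero (hb t) (zpow_ne_zero _ (hb r))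

theorem rv_actRoot {b : Root k l → L} (hb : ∀ t, b t ≠ 0) (r : Root k l) {n : ZMod N} {m : ℤ}
    (hm : m ∈ Finset.Icc (1 - (l n : ℤ)) ((k n : ℤ) - 1)) :
    rv (actRoot r b) n m = rv b n m * b r ^ rootExp r n m := by
  rw [Finset.mem_Icc] at hm
  have h : -(l n : ℤ) + 1 ≤ m ∧ m ≤ (k n : ℤ) - 1 := by omega
  rw [rv, dif_pos h, rv, dif_pos h, actRoot_eq hb]

/-- The total exponent of `b_r` is the second difference at `r` of `m ↦ parExp k l p n θ m`. This
function is linear of slope `p / (k + ℓ)` with a drop by `p` on entering `m = θ`, so the second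
difference is `p` for `r = θ`, `-p` for `r = θ - 1` and `0` otherwise. -/
theorem par_actRoot_same {p : ℕ} (hdvd : ∀ n, (k n + l n) ∣ p) {b : Root k l → L}
    (hb : ∀ t, b t ≠ 0) (r : Root k l) {θ : ℤ} (hθ : 1 - (l r.1.1 : ℤ) ≤ θ) (hθ' : θ ≤ k r.1.1) :
    par p (actRoot r b) r.1.1 θ = par p b r.1.1 (Equiv.swap r.1.2 (r.1.2 + 1) θ) := by
  rw [par_mul_of_rv p (hb r) r.1.1 θ _ fun m hm => rv_actRoot hb r hm]
  have hr1 : -(l r.1.1 : ℤ) + 1 ≤ r.1.2 := r.2.1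
  have hr2 : r.1.2 ≤ (k r.1.1 : ℤ) - 1 := r.2.2
  have hp : ((k r.1.1 : ℤ) + l r.1.1) * (p / (k r.1.1 + l r.1.1) : ℕ) = p := by
    exact_mod_cast Nat.mul_div_cancel' (hdvd r.1.1)
  have hsum : ∑ m ∈ Finset.Icc (1 - (l r.1.1 : ℤ)) ((k r.1.1 : ℤ) - 1),
      rootExp r r.1.1 m * parExp k l p r.1.1 θ m =
      if θ = r.1.2 then (p : ℤ) else if θ = r.1.2 + 1 then -(p : ℤ) else 0 := by
    have hmem : r.1.2 ∈ Finset.Icc (1 - (l r.1.1 : ℤ)) ((k r.1.1 : ℤ) - 1) :=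
      Finset.mem_Icc.2 (by omega)
    -- At an end of the row one neighbour is missing, but the exponent formula vanishes at `m = k`
    -- (and likewise at `m = -ℓ`), so the second difference is still correct.
    have e1 : (if r.1.2 + 1 ∈ Finset.Icc (1 - (l r.1.1 : ℤ)) ((k r.1.1 : ℤ) - 1) then
        parExp k l p r.1.1 θ (r.1.2 + 1) else 0) = parExp k l p r.1.1 θ (r.1.2 + 1) := by
      split_ifs with h
      · rfl
      · rw [Finset.mem_Icc] at h
        rw [parExp, if_neg (by omega), show r.1.2 + 1 - (k r.1.1 : ℤ) = 0 by omega, zero_mul]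
    have e2 : (if r.1.2 - 1 ∈ Finset.Icc (1 - (l r.1.1 : ℤ)) ((k r.1.1 : ℤ) - 1) then
        parExp k l p r.1.1 θ (r.1.2 - 1) else 0) = parExp k l p r.1.1 θ (r.1.2 - 1) := by
      split_ifs with h
      · rfl
      · rw [Finset.mem_Icc] at h
        rw [parExp, if_pos (by omega), show (l r.1.1 : ℤ) + (r.1.2 - 1) = 0 by omega, zero_mul]
    simp only [rootExp, if_true, add_mul, Finset.sum_add_distrib, ite_mul, zero_mul, one_mul,
      Finset.sum_ite_eq', hmem, e1, e2]
    rcases lt_trichotomy θ r.1.2 with h | h | h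
    · rw [if_neg (by omega), if_neg (by omega), parExp, parExp, parExp, if_neg (by omega),
        if_neg (by omega), if_neg (by omega)]
      ring
    · rw [if_pos h, parExp, parExp, parExp, if_neg (by omega), if_neg (by omega), if_pos (by omega),
        ← hp]
      ring
    · rw [if_neg (by omega)]
      by_cases h' : θ = r.1.2 + 1
      · rw [if_pos h', parExp, parExp, parExp, if_pos (by omega), if_neg (by omega),
          if_pos (by omega), ← hp]
        ring
      · rw [if_neg h', parExp, parExp, parExp, if_pos (by omega), if_pos (by omega),
          if_pos (by omega)]
        ring
  rw [hsum]
  have hs := par_succ (p := p) hdvd hb r.1.1 (θ := r.1.2) (by omega) hr2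
  rw [rv_self] at hs
  by_cases h1 : θ = r.1.2
  · rw [if_pos h1, h1, Equiv.swap_apply_left, hs, zpow_natCast]
  by_cases h2 : θ = r.1.2 + 1
  · rw [if_neg h1, if_pos h2, h2, Equiv.swap_apply_right, hs, zpow_neg, zpow_natCast,
      mul_inv_cancel_right₀ (pow_ne_zero _ (hb r))]
  · rw [if_neg h1, if_neg h2, Equiv.swap_apply_of_ne_of_ne h1 h2, zpow_zero, mul_one]

theorem par_actRoot_adj (hk : ∀ n, 0 < k n) (hl : ∀ n, 0 < l n) (p : ℕ) {b : Root k l → L}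
    (hb : ∀ t, b t ≠ 0) {r : Root k l} (hr : r.1.2 = 0) {n : ZMod N} (hne : n ≠ r.1.1)
    (hn : n = r.1.1 + 1 ∨ r.1.1 = n + 1) (θ : ℤ) :
    par p (actRoot r b) n θ = par p b n θ * b r ^ parExp k l p n θ 0 := by
  rw [par_mul_of_rv p (hb r) n θ _ fun m hm => rv_actRoot hb r hm]
  congr 2
  have hmem : (0 : ℤ) ∈ Finset.Icc (1 - (l n : ℤ)) ((k n : ℤ) - 1) := by
    have := hk n
    have := hl n
    exact Finset.mem_Icc.2 (by omega)
  rw [Finset.sum_eq_single_of_mem 0 hmem fun m _ hm => by simp [rootExp, hne, hm]]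
  simp [rootExp, hne, hr, hn]

theorem par_actRoot_of_ne (p : ℕ) {b : Root k l → L} (hb : ∀ t, b t ≠ 0) {r : Root k l}
    {n : ZMod N} (hne : n ≠ r.1.1) (hn : ¬ (r.1.2 = 0 ∧ (n = r.1.1 + 1 ∨ r.1.1 = n + 1))) (θ : ℤ) :
    par p (actRoot r b) n θ = par p b n θ := by
  rw [par_mul_of_rv p (hb r) n θ _ fun m hm => rv_actRoot hb r hm, Finset.sum_eq_zero, zpow_zero,
    mul_one]
  intro m _
  have : ¬ (r.1.2 = 0 ∧ m = 0 ∧ (n = r.1.1 + 1 ∨ r.1.1 = n + 1)) := fun h => hn ⟨h.1, h.2.2⟩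
  rw [rootExp, if_neg hne, if_neg this, zero_mul]

theorem parExp_of_pos (p : ℕ) (n : ZMod N) {θ : ℤ} (h : 0 < θ) :
    parExp k l p n θ 0 = l n * (p / (k n + l n) : ℕ) := by
  simp [parExp, h]

theorem parExp_of_nonpos (p : ℕ) (n : ZMod N) {θ : ℤ} (h : θ ≤ 0) :
    parExp k l p n θ 0 = -(k n * (p / (k n + l n) : ℕ)) := by
  simp [parExp, not_lt.2 h]

end Parameters

/-! ### The action on the coordinates -/

section ZModFacts

variable {N : ℕ}

theorem zmod_one_ne_zero (hN : 3 ≤ N) : (1 : ZMod N) ≠ 0 := by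
  intro h
  have h1 : ((1 : ℕ) : ZMod N) = 0 := by exact_mod_cast h
  rw [ZMod.natCast_eq_zero_iff] at h1
  exact absurd (Nat.le_of_dvd one_pos h1) (by omega)

theorem zmod_two_ne_zero (hN : 3 ≤ N) : (1 : ZMod N) + 1 ≠ 0 := by
  intro h
  have h1 : ((2 : ℕ) : ZMod N) = 0 := by rw [← h]; push_cast; norm_num
  rw [ZMod.natCast_eq_zero_iff] at h1
  exact absurd (Nat.le_of_dvd two_pos h1) (by omega)

theorem zmod_add_one_ne (hN : 3 ≤ N) (n : ZMod N) : n + 1 ≠ n := fun h =>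
  zmod_one_ne_zero hN (by simpa using h)

theorem zmod_sub_one_ne (hN : 3 ≤ N) (n : ZMod N) : n - 1 ≠ n := fun h =>
  zmod_one_ne_zero hN (by simpa using h)

theorem zmod_sub_one_ne_add_one (hN : 3 ≤ N) (n : ZMod N) : n - 1 ≠ n + 1 := fun h =>
  zmod_two_ne_zero hN (by
    have : (n + 1) - (n - 1) = 0 := by rw [h]; ring
    rw [← this]; ring)

end ZModFacts

/-! ### Involution, commutation, and the rational identities behind the braid relation. -/

section Action

variable {N : ℕ} {k l : ZMod N → ℕ} {L : Type*} [Field L]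

/-- The exponent of `b_r` in `s_r(f_m) / f_m`. -/
def coordExp (p : ℕ) (r : Root k l) (m : ZMod N) : ℤ :=
  if r.1.2 = 0 ∧ m = r.1.1 - 1 then l m * (p / (k m + l m) : ℕ)
  else if r.1.2 = 0 ∧ m = r.1.1 + 1 then -(k m * (p / (k m + l m) : ℕ)) else 0

/-- The exponent of the basic quotient in `s_r(f_m) / f_m`. -/
def multExp (r : Root k l) (m : ZMod N) : ℤ :=
  if r.1.2 = 0 ∧ m = r.1.1 - 1 then 1
  else if r.1.2 = 0 ∧ m = r.1.1 + 1 then -1 else 0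

/-- The basic quotient. -/
def parQuot (p : ℕ) (b : Root k l → L) (f : ZMod N → L) (n : ZMod N) : L :=
  (f n + par p b n 0) / (f n + par p b n 1)

/-- One monomial formula covers all cases, so that the relations split into arithmetic of exponents
and statements about the quotient `parQuot`. -/
theorem actCoord_eq (hk : ∀ n, 0 < k n) (hl : ∀ n, 0 < l n) (p : ℕ) (b : Root k l → L)
    (f : ZMod N → L) (r : Root k l) (m : ZMod N) :
    actCoord p b f r m = f m * b r ^ coordExp p r m * parQuot p b f r.1.1 ^ multExp r m := by
  rw [actCoord, coordExp, multExp, parQuot, vPar_eq hk hl, uPar_eq hk hl]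
  split_ifs with h1 h2
  · rw [zpow_one, ← Nat.cast_mul, zpow_natCast]; ring
  · rw [zpow_neg, zpow_neg, zpow_one, ← Nat.cast_mul, zpow_natCast, inv_div]; ring
  · simp

theorem multExp_of_ne {r : Root k l} (h : r.1.2 ≠ 0) (m : ZMod N) : multExp r m = 0 := by
  simp [multExp, h]

theorem actCoord_of_ne_zero (p : ℕ) (b : Root k l → L) (f : ZMod N → L) {r : Root k l}
    (h : r.1.2 ≠ 0) (m : ZMod N) : actCoord p b f r m = f m := by
  simp [actCoord, h]

theorem actCoord_of_ne (p : ℕ) (b : Root k l → L) (f : ZMod N → L) {r : Root k l} {m : ZMod N}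
    (h : m ≠ r.1.1 - 1) (h' : m ≠ r.1.1 + 1) : actCoord p b f r m = f m := by
  simp [actCoord, h, h']

theorem actCoord_self (hN : 3 ≤ N) (p : ℕ) (b : Root k l → L) (f : ZMod N → L) (r : Root k l) :
    actCoord p b f r r.1.1 = f r.1.1 :=
  actCoord_of_ne p b f (zmod_sub_one_ne hN _).symm (zmod_add_one_ne hN _).symm

theorem actRoot_map {L' : Type*} [Field L'] (φ : L →+* L') (r : Root k l) (b : Root k l → L)
    (t : Root k l) : actRoot r (fun t => φ (b t)) t = φ (actRoot r b t) := by
  simp only [actRoot]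
  split_ifs <;> simp

theorem actCoord_map (hk : ∀ n, 0 < k n) (hl : ∀ n, 0 < l n) {L' : Type*} [Field L']
    (φ : L →+* L') (p : ℕ) (b : Root k l → L) (f : ZMod N → L) (r : Root k l) (m : ZMod N) :
    actCoord p (fun t => φ (b t)) (fun n => φ (f n)) r m = φ (actCoord p b f r m) := by
  simp only [actCoord_eq hk hl, parQuot, par_map, map_mul, map_zpow₀, map_div₀, map_add]

/-- No coordinate is equal to minus a parameter. -/
def Nonvanishing (p : ℕ) (b : Root k l → L) (f : ZMod N → L) : Prop :=
  ∀ n θ, f n + par p b n θ ≠ 0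

theorem Nonvanishing.map {L' : Type*} [Field L'] {p : ℕ} {b : Root k l → L} {f : ZMod N → L}
    (h : Nonvanishing p b f) (φ : L →+* L') :
    Nonvanishing p (fun t => φ (b t)) (fun n => φ (f n)) := fun n θ => by
  rw [par_map, ← map_add]
  exact (map_ne_zero φ).2 (h n θ)

theorem Nonvanishing.parQuot_ne_zero {p : ℕ} {b : Root k l → L} {f : ZMod N → L}
    (h : Nonvanishing p b f) (n : ZMod N) : parQuot p b f n ≠ 0 := div_ne_zero (h n 0) (h n 1)

theorem actRoot_self (b : Root k l → L) (r : Root k l) : actRoot r b r = (b r)⁻¹ := by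
  simp [actRoot]

theorem actRoot_of_adj (b : Root k l → L) {r t : Root k l} (hrt : r ≠ t) (h : Adj r t) :
    actRoot r b t = b r * b t := by
  simp [actRoot, hrt.symm, h]

theorem actRoot_of_not_adj (b : Root k l → L) {r t : Root k l} (hrt : r ≠ t) (h : ¬ Adj r t) :
    actRoot r b t = b t := by
  simp [actRoot, hrt.symm, h]

theorem actRoot_actRoot_self {b : Root k l → L} (hb : ∀ t, b t ≠ 0) (r t : Root k l) :
    actRoot r (actRoot r b) t = b t := by
  have := zpow_ne_zero (rootExp r t.1.1 t.1.2) (hb r)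
  rw [actRoot_eq (actRoot_ne_zero hb r), actRoot_self, actRoot_eq hb, inv_zpow,
    mul_inv_cancel_right₀ this]

theorem actRoot_comm {b : Root k l → L} (hb : ∀ t, b t ≠ 0) {r t : Root k l} (hrt : r ≠ t)
    (h : ¬ Adj r t) (x : Root k l) :
    actRoot t (actRoot r b) x = actRoot r (actRoot t b) x := by
  rw [actRoot_eq (actRoot_ne_zero hb r), actRoot_eq (actRoot_ne_zero hb t),
    actRoot_of_not_adj b hrt h, actRoot_of_not_adj b hrt.symm (fun h' => h h'.symm),
    actRoot_eq hb, actRoot_eq hb]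
  ring

theorem actRoot_actRoot_of_adj {b : Root k l → L} (hb : ∀ t, b t ≠ 0) {r t : Root k l}
    (hrt : r ≠ t) (h : Adj r t) : actRoot t (actRoot r b) r = b t := by
  rw [actRoot_of_adj _ hrt.symm h.symm, actRoot_of_adj b hrt h, actRoot_self]
  have := hb r
  field_simp

theorem actRoot_braid {b : Root k l → L} (hb : ∀ t, b t ≠ 0) {r t : Root k l} (hrt : r ≠ t)
    (h : Adj r t) (x : Root k l) :
    actRoot r (actRoot t (actRoot r b)) x = actRoot t (actRoot r (actRoot t b)) x := by
  have h1 := actRoot_ne_zero hb r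
  have h2 := actRoot_ne_zero hb t
  rw [actRoot_eq (actRoot_ne_zero h1 t), actRoot_eq (actRoot_ne_zero h2 r),
    actRoot_actRoot_of_adj hb hrt h, actRoot_actRoot_of_adj hb hrt.symm h.symm,
    actRoot_eq h1, actRoot_eq h2, actRoot_of_adj b hrt h, actRoot_of_adj b hrt.symm h.symm,
    actRoot_eq hb r x, actRoot_eq hb t x, mul_zpow, mul_zpow]
  ring

/-- The reflection fixes `f_n` and exchanges `W_0` with `W_1`, so it inverts `Y_n` just as it
inverts `b_r`; the factors of the two applications cancel. -/
theorem actCoord_actCoord_self (hN : 3 ≤ N) (hk : ∀ n, 0 < k n) (hl : ∀ n, 0 < l n) {p : ℕ}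
    (hdvd : ∀ n, (k n + l n) ∣ p) {b : Root k l → L} (hb : ∀ t, b t ≠ 0) {f : ZMod N → L}
    (hf : Nonvanishing p b f) (r : Root k l) (m : ZMod N) :
    actCoord p (actRoot r b) (actCoord p b f r) r m = f m := by
  by_cases hr : r.1.2 = 0
  · have hY : parQuot p (actRoot r b) (actCoord p b f r) r.1.1 = (parQuot p b f r.1.1)⁻¹ := by
      have := hk r.1.1
      have := hl r.1.1
      rw [parQuot, parQuot, inv_div, actCoord_self hN, par_actRoot_same hdvd hb r (by omega) (by omega),
        par_actRoot_same hdvd hb r (by omega) (by omega), hr]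
      simp
    rw [actCoord_eq hk hl, hY, actRoot_self, actCoord_eq hk hl, inv_zpow, inv_zpow]
    have h1 := zpow_ne_zero (coordExp p r m) (hb r)
    have h2 := zpow_ne_zero (multExp r m) (hf.parQuot_ne_zero r.1.1)
    field_simp
  · rw [actCoord_of_ne_zero _ _ _ hr, actCoord_of_ne_zero _ _ _ hr]

/-- For `t = (n, 0)`, the quotient involves only `f_n`, `W_0` and `W_1` of its row. A vertex `r ≠ t`
can change one of them only if it is `(n, ±1)` or `(n ± 1, 0)`, all of which are adjacent to `t`. -/
theorem parQuot_of_not_adj (hk : ∀ n, 0 < k n) (hl : ∀ n, 0 < l n) {p : ℕ}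
    (hdvd : ∀ n, (k n + l n) ∣ p) {b : Root k l → L} (hb : ∀ t, b t ≠ 0) (f : ZMod N → L)
    {r t : Root k l} (hrt : r ≠ t) (h : ¬ Adj r t) (ht : t.1.2 = 0) :
    parQuot p (actRoot r b) (actCoord p b f r) t.1.1 = parQuot p b f t.1.1 := by
  have hk' := hk t.1.1
  have hl' := hl t.1.1
  by_cases hr : r.1.2 = 0
  · have h1 : t.1.1 ≠ r.1.1 := fun h1 => hrt (Subtype.ext (Prod.ext h1.symm (by rw [hr, ht])))
    have h2 : t.1.1 ≠ r.1.1 + 1 := fun h2 => h (Or.inr ⟨hr, ht, h1.symm, Or.inr h2⟩)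
    have h3 : r.1.1 ≠ t.1.1 + 1 := fun h2 => h (Or.inr ⟨hr, ht, h1.symm, Or.inl h2⟩)
    have h4 : t.1.1 ≠ r.1.1 - 1 := fun h2 => h3 (by rw [h2]; ring)
    rw [parQuot, parQuot, actCoord_of_ne _ _ _ h4 h2, par_actRoot_of_ne p hb h1 (by tauto),
      par_actRoot_of_ne p hb h1 (by tauto)]
  · rw [parQuot, parQuot, actCoord_of_ne_zero _ _ _ hr]
    by_cases h1 : t.1.1 = r.1.1
    · have h2 : r.1.2 ≠ 1 := fun h2 => h (Or.inl ⟨h1.symm, Or.inl (by omega)⟩)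
      have h3 : r.1.2 ≠ -1 := fun h2 => h (Or.inl ⟨h1.symm, Or.inr (by omega)⟩)
      rw [h1] at hk' hl'
      rw [h1, par_actRoot_same hdvd hb r (by omega) (by omega),
        par_actRoot_same hdvd hb r (by omega) (by omega),
        Equiv.swap_apply_of_ne_of_ne (by omega) (by omega),
        Equiv.swap_apply_of_ne_of_ne (by omega) (by omega)]
    · rw [par_actRoot_of_ne p hb h1 (by tauto), par_actRoot_of_ne p hb h1 (by tauto)]

theorem actCoord_actCoord_of_not_adj (hk : ∀ n, 0 < k n) (hl : ∀ n, 0 < l n) {p : ℕ}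
    (hdvd : ∀ n, (k n + l n) ∣ p) {b : Root k l → L} (hb : ∀ t, b t ≠ 0) (f : ZMod N → L)
    {r t : Root k l} (hrt : r ≠ t) (h : ¬ Adj r t) (m : ZMod N) :
    actCoord p (actRoot r b) (actCoord p b f r) t m =
      f m * b r ^ coordExp p r m * parQuot p b f r.1.1 ^ multExp r m *
        (b t ^ coordExp p t m * parQuot p b f t.1.1 ^ multExp t m) := by
  rw [actCoord_eq hk hl, actRoot_of_not_adj b hrt h, actCoord_eq hk hl p b f r m]
  by_cases ht : t.1.2 = 0
  · rw [parQuot_of_not_adj hk hl hdvd hb f hrt h ht]; ring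
  · rw [multExp_of_ne ht, zpow_zero, zpow_zero]; ring

theorem actCoord_comm (hk : ∀ n, 0 < k n) (hl : ∀ n, 0 < l n) {p : ℕ}
    (hdvd : ∀ n, (k n + l n) ∣ p) {b : Root k l → L} (hb : ∀ t, b t ≠ 0) (f : ZMod N → L)
    {r t : Root k l} (hrt : r ≠ t) (h : ¬ Adj r t) (m : ZMod N) :
    actCoord p (actRoot r b) (actCoord p b f r) t m =
      actCoord p (actRoot t b) (actCoord p b f t) r m := by
  rw [actCoord_actCoord_of_not_adj hk hl hdvd hb f hrt h,
    actCoord_actCoord_of_not_adj hk hl hdvd hb f hrt.symm fun h' => h h'.symm]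
  ring

/-- The braid identity for the row `t` after the row `r`. Here `X, V` stand for `f_r, f_t`, the `W`
and `Z` for the parameters of the two rows, `rp, tp` for `a_r, a_t`, and `c, C, e` for the monomial
factors, which cancel. `Y₂` is the quotient of `t` after the reflection `r`. -/
theorem quot_identity_succ {X V W0 W1 Z0 Z1 c C e rp tp Y₁ Y₂ Y₃ : L} (hc : c ≠ 0) (hC : C ≠ 0)
    (he : e ≠ 0) (hrp : rp ≠ 0) (htp : tp ≠ 0) (hW : W1 = rp * W0) (hZ : Z1 = tp * Z0)
    (h0 : X + W0 ≠ 0) (h1 : X + W1 ≠ 0) (h3 : V + Z1 ≠ 0)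
    (hY₁ : Y₁ = (X + W0) / (X + W1))
    (h5 : V * (c / rp) * Y₁⁻¹ + c * Z1 ≠ 0)
    (hY₂ : Y₂ = (V * (c / rp) * Y₁⁻¹ + c / rp * Z0) / (V * (c / rp) * Y₁⁻¹ + c * Z1))
    (h7 : X * C * Y₂ + C * W0 ≠ 0)
    (hY₃ : Y₃ = (V + Z0) / (V + Z1))
    (h9 : X * e * Y₃ + e * W1 ≠ 0) :
    Y₁ * ((X * C * Y₂ + C / (rp * tp) * W1) / (X * C * Y₂ + C * W0)) =
      (X * e * Y₃ + e / tp * W0) / (X * e * Y₃ + e * W1) := by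
  have hQ : V * (X + W1) + rp * Z1 * (X + W0) ≠ 0 := by
    intro h
    apply h5
    have h' : V * (c / rp) * Y₁⁻¹ + c * Z1 =
        c / (rp * (X + W0)) * (V * (X + W1) + rp * Z1 * (X + W0)) := by
      rw [hY₁, inv_div]
      field_simp
    rw [h', h, mul_zero]
  have e2 : Y₂ = (V * (X + W1) + Z0 * (X + W0)) / (V * (X + W1) + rp * Z1 * (X + W0)) := by
    rw [hY₂, div_eq_div_iff h5 hQ, hY₁, inv_div]
    field_simp
  rw [div_eq_mul_inv, ← mul_assoc, ← div_eq_mul_inv, div_eq_div_iff h7 h9, e2, hY₃, hY₁]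
  -- The denominators are kept opaque while fractions are cleared; only then do the relations `W1 =
  -- rp * W0` and `Z1 = tp * Z0` turn the claim into a polynomial identity.
  generalize hq : V * (X + W1) + rp * Z1 * (X + W0) = q at hQ ⊢
  generalize hd : X + W1 = d at h1 ⊢
  generalize hv : V + Z1 = v at h3 ⊢
  field_simp
  rw [← hq, ← hd, ← hv, hW, hZ]
  ring

/-- The same identity for the row `t` before the row `r`, where each reflection multiplies the
neighbouring coordinate by the inverse kind of quotient. -/
theorem quot_identity_pred {X V W0 W1 Z0 Z1 c C e rp tp Y₁ Y₂ Y₃ : L} (hc : c ≠ 0) (hC : C ≠ 0)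
    (he : e ≠ 0) (hrp : rp ≠ 0) (htp : tp ≠ 0) (hW : W1 = rp * W0) (hZ : Z1 = tp * Z0)
    (h1 : X + W1 ≠ 0) (h2 : V + Z0 ≠ 0)
    (hY₁ : Y₁ = (X + W0) / (X + W1))
    (h4 : V * c * Y₁ + c / rp * Z0 ≠ 0)
    (h5 : V * c * Y₁ + c * Z1 ≠ 0)
    (hY₂ : Y₂ = (V * c * Y₁ + c / rp * Z0) / (V * c * Y₁ + c * Z1))
    (h7 : X * (C / (rp * tp)) * Y₂⁻¹ + C * W0 ≠ 0)
    (hY₃ : Y₃ = (V + Z0) / (V + Z1))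
    (h9 : X * (e / tp) * Y₃⁻¹ + e * W1 ≠ 0) :
    Y₁ * ((X * (C / (rp * tp)) * Y₂⁻¹ + C / (rp * tp) * W1) /
      (X * (C / (rp * tp)) * Y₂⁻¹ + C * W0)) =
      (X * (e / tp) * Y₃⁻¹ + e / tp * W0) / (X * (e / tp) * Y₃⁻¹ + e * W1) := by
  have hP : rp * V * (X + W0) + Z0 * (X + W1) ≠ 0 := by
    intro h
    apply h4
    have h' : V * c * Y₁ + c / rp * Z0 =
        c / (rp * (X + W1)) * (rp * V * (X + W0) + Z0 * (X + W1)) := by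
      rw [hY₁]
      field_simp
    rw [h', h, mul_zero]
  have hQ : V * (X + W0) + Z1 * (X + W1) ≠ 0 := by
    intro h
    apply h5
    have h' : V * c * Y₁ + c * Z1 = c / (X + W1) * (V * (X + W0) + Z1 * (X + W1)) := by
      rw [hY₁]
      field_simp
    rw [h', h, mul_zero]
  have e2 : Y₂⁻¹ = rp * (V * (X + W0) + Z1 * (X + W1)) / (rp * V * (X + W0) + Z0 * (X + W1)) := by
    rw [hY₂, inv_div, div_eq_div_iff h4 hP, hY₁]
    field_simp
  rw [div_eq_mul_inv, ← mul_assoc, ← div_eq_mul_inv, div_eq_div_iff h7 h9, e2, hY₃, hY₁, inv_div]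
  generalize hq : rp * V * (X + W0) + Z0 * (X + W1) = q at hP ⊢
  generalize hd : X + W1 = d at h1 ⊢
  generalize hv : V + Z0 = v at h2 ⊢
  field_simp
  rw [← hq, ← hv, hZ]
  rw [← hd, hW]
  ring

end Action

/-! ### The Coxeter relations -/

section Braid

variable {N : ℕ} {k l : ZMod N → ℕ} {L : Type*} [Field L]

theorem actCoord_pred (hk : ∀ n, 0 < k n) (hl : ∀ n, 0 < l n) (p : ℕ) (b : Root k l → L)
    (f : ZMod N → L) {r : Root k l} (hr : r.1.2 = 0) {m : ZMod N} (hm : m = r.1.1 - 1) :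
    actCoord p b f r m =
      f m * b r ^ ((l m : ℤ) * (p / (k m + l m) : ℕ)) * parQuot p b f r.1.1 := by
  rw [actCoord_eq hk hl, coordExp, multExp, if_pos ⟨hr, hm⟩, if_pos ⟨hr, hm⟩, zpow_one]

theorem actCoord_succ (hN : 3 ≤ N) (hk : ∀ n, 0 < k n) (hl : ∀ n, 0 < l n) (p : ℕ)
    (b : Root k l → L) (f : ZMod N → L) {r : Root k l} (hr : r.1.2 = 0) {m : ZMod N}
    (hm : m = r.1.1 + 1) :
    actCoord p b f r m =
      f m * b r ^ (-((k m : ℤ) * (p / (k m + l m) : ℕ))) * (parQuot p b f r.1.1)⁻¹ := by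
  have h : ¬ (r.1.2 = 0 ∧ m = r.1.1 - 1) := fun h =>
    zmod_sub_one_ne_add_one hN _ (h.2.symm.trans hm)
  rw [actCoord_eq hk hl, coordExp, multExp, if_neg h, if_neg h, if_pos ⟨hr, hm⟩, if_pos ⟨hr, hm⟩,
    zpow_neg_one]

/-- Because `(k + ℓ) (p / (k + ℓ)) = p`, the two possible scaling exponents of a neighbouring row
differ by `p`, a full power of `a`. This lets a single monomial `c` describe both. -/
theorem zpow_neg_exp {p : ℕ} {n : ZMod N} (hdvd : (k n + l n) ∣ p) {x : L} (hx : x ≠ 0) :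
    x ^ (-((k n : ℤ) * (p / (k n + l n) : ℕ))) =
      x ^ ((l n : ℤ) * (p / (k n + l n) : ℕ)) / x ^ p := by
  have hp : ((k n : ℤ) + l n) * (p / (k n + l n) : ℕ) = p := by
    exact_mod_cast Nat.mul_div_cancel' hdvd
  rw [← zpow_natCast x p, ← zpow_sub₀ hx, ← hp]
  congr 1
  ring

theorem par_actRoot_row {p : ℕ} (hdvd : ∀ n, (k n + l n) ∣ p) {b : Root k l → L}
    (hb : ∀ t, b t ≠ 0) (r : Root k l) {n : ZMod N} (hn : r.1.1 = n) {θ : ℤ}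
    (hθ : 1 - (l n : ℤ) ≤ θ) (hθ' : θ ≤ k n) :
    par p (actRoot r b) n θ = par p b n (Equiv.swap r.1.2 (r.1.2 + 1) θ) := by
  subst hn; exact par_actRoot_same hdvd hb r hθ hθ'

theorem par_one_eq {p : ℕ} (hk : ∀ n, 0 < k n) (hl : ∀ n, 0 < l n) (hdvd : ∀ n, (k n + l n) ∣ p)
    {b : Root k l → L} (hb : ∀ t, b t ≠ 0) {r : Root k l} (hr : r.1.2 = 0) :
    par p b r.1.1 1 = b r ^ p * par p b r.1.1 0 := by
  have := hk r.1.1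
  have := hl r.1.1
  have h := par_succ (p := p) hdvd hb r.1.1 (θ := 0) (by omega) (by omega)
  rw [zero_add, ← hr, rv_self, hr] at h
  rw [h, mul_comm]

/-- This is the heart of the braid relation: the two factors contributed by `r` in the word `r t r`
multiply to the single factor it contributes in `t r t`. -/
theorem parQuot_braid (hN : 3 ≤ N) (hk : ∀ n, 0 < k n) (hl : ∀ n, 0 < l n) {p : ℕ}
    (hdvd : ∀ n, (k n + l n) ∣ p) {b : Root k l → L} (hb : ∀ t, b t ≠ 0) {f : ZMod N → L}
    {r t : Root k l} (h : Adj r t) (hr : r.1.2 = 0)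
    (h₀ : Nonvanishing p b f) (h₁ : Nonvanishing p (actRoot r b) (actCoord p b f r))
    (h₂ : Nonvanishing p (actRoot t (actRoot r b))
      (actCoord p (actRoot r b) (actCoord p b f r) t))
    (h₃ : Nonvanishing p (actRoot t b) (actCoord p b f t)) :
    parQuot p b f r.1.1 *
        parQuot p (actRoot t (actRoot r b)) (actCoord p (actRoot r b) (actCoord p b f r) t) r.1.1 =
      parQuot p (actRoot t b) (actCoord p b f t) r.1.1 := by
  have hb₁ := actRoot_ne_zero hb r
  have hkr := hk r.1.1
  have hlr := hl r.1.1
  have sw : ∀ θ : ℤ, 1 - (l r.1.1 : ℤ) ≤ θ → θ ≤ k r.1.1 →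
      par p (actRoot r b) r.1.1 θ = par p b r.1.1 (Equiv.swap 0 1 θ) := fun θ h h' => by
    rw [par_actRoot_row hdvd hb r rfl h h', hr, zero_add]
  rcases h with ⟨h1, h2⟩ | ⟨-, ht, hne, hadj⟩
  -- Here `t = (n, ±1)` and `f_n` is unchanged, so the product telescopes: for `t = (n, 1)` it is
  -- `(f + W_0) / (f + W_1)` times `(f + W_1) / (f + W_2)`, and similarly with `W_{-1}`.
  · have ht : t.1.2 ≠ 0 := by omega
    rw [parQuot, parQuot, parQuot, actCoord_of_ne_zero _ _ _ ht, actCoord_of_ne_zero _ _ _ ht,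
      actCoord_self hN, par_actRoot_row hdvd hb₁ t h1.symm (by omega) (by omega),
      par_actRoot_row hdvd hb₁ t h1.symm (by omega) (by omega),
      par_actRoot_row hdvd hb t h1.symm (by omega) (by omega),
      par_actRoot_row hdvd hb t h1.symm (by omega) (by omega)]
    have ht1 : -(l t.1.1 : ℤ) + 1 ≤ t.1.2 := t.2.1
    have ht2 : t.1.2 ≤ (k t.1.1 : ℤ) - 1 := t.2.2
    rw [← h1] at ht1 ht2
    rcases h2 with h2 | h2
    · have h3 : t.1.2 = -1 := by omega
      have e0 : Equiv.swap (-1 : ℤ) (-1 + 1) 0 = -1 := Equiv.swap_apply_right _ _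
      have e1 : Equiv.swap (-1 : ℤ) (-1 + 1) 1 = 1 :=
        Equiv.swap_apply_of_ne_of_ne (by omega) (by omega)
      rw [h3, e0, e1, sw _ (by omega) (by omega), sw _ (by omega) (by omega),
        Equiv.swap_apply_right, Equiv.swap_apply_of_ne_of_ne (by omega) (by omega), mul_comm,
        div_mul_div_cancel₀ (h₀ _ _)]
    · have h3 : t.1.2 = 1 := by omega
      have e0 : Equiv.swap (1 : ℤ) (1 + 1) 0 = 0 :=
        Equiv.swap_apply_of_ne_of_ne (by omega) (by omega)
      have e1 : Equiv.swap (1 : ℤ) (1 + 1) 1 = 2 := Equiv.swap_apply_left _ _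
      rw [h3, e0, e1, sw _ (by omega) (by omega), sw _ (by omega) (by omega),
        Equiv.swap_apply_left, Equiv.swap_apply_of_ne_of_ne (by omega) (by omega),
        div_mul_div_cancel₀ (h₀ _ _)]
  · have hx := hb r
    have hy := hb t
    have hrt : r ≠ t := fun h => hne (by rw [h])
    have hAdj : Adj r t := Or.inr ⟨hr, ht, hne, hadj⟩
    have hp0 : ∀ {z : L}, z ≠ 0 → z ^ p ≠ 0 := fun hz => pow_ne_zero p hz
    have hadj' : r.1.1 = t.1.1 + 1 ∨ t.1.1 = r.1.1 + 1 := hadj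
    -- the parameters after each of the transformations
    have w0 : par p (actRoot r b) r.1.1 0 = par p b r.1.1 1 := by
      rw [sw _ (by omega) (by omega), Equiv.swap_apply_left]
    have w1 : par p (actRoot r b) r.1.1 1 = par p b r.1.1 0 := by
      rw [sw _ (by omega) (by omega), Equiv.swap_apply_right]
    have z0 : par p (actRoot r b) t.1.1 0 = (b r ^ ((l t.1.1 : ℤ) * (p / (k t.1.1 + l t.1.1) : ℕ)) /
        b r ^ p) * par p b t.1.1 0 := by
      rw [par_actRoot_adj hk hl p hb hr hne.symm hadj'.symm, parExp_of_nonpos _ _ le_rfl,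
        zpow_neg_exp (hdvd _) hx, mul_comm]
    have z1 : par p (actRoot r b) t.1.1 1 = b r ^ ((l t.1.1 : ℤ) * (p / (k t.1.1 + l t.1.1) : ℕ)) *
        par p b t.1.1 1 := by
      rw [par_actRoot_adj hk hl p hb hr hne.symm hadj'.symm, parExp_of_pos _ _ one_pos, mul_comm]
    have hxy : actRoot r b t = b r * b t := actRoot_of_adj b hrt hAdj
    have v0 : par p (actRoot t (actRoot r b)) r.1.1 0 =
        ((b r * b t) ^ ((l r.1.1 : ℤ) * (p / (k r.1.1 + l r.1.1) : ℕ)) / (b r ^ p * b t ^ p)) *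
          par p b r.1.1 1 := by
      rw [par_actRoot_adj hk hl p hb₁ ht hne hadj', parExp_of_nonpos _ _ le_rfl, hxy,
        zpow_neg_exp (hdvd _) (mul_ne_zero hx hy), w0, mul_pow, mul_comm]
    have v1 : par p (actRoot t (actRoot r b)) r.1.1 1 =
        (b r * b t) ^ ((l r.1.1 : ℤ) * (p / (k r.1.1 + l r.1.1) : ℕ)) * par p b r.1.1 0 := by
      rw [par_actRoot_adj hk hl p hb₁ ht hne hadj', parExp_of_pos _ _ one_pos, hxy, w1, mul_comm]
    have u0 : par p (actRoot t b) r.1.1 0 =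
        (b t ^ ((l r.1.1 : ℤ) * (p / (k r.1.1 + l r.1.1) : ℕ)) / b t ^ p) * par p b r.1.1 0 := by
      rw [par_actRoot_adj hk hl p hb ht hne hadj', parExp_of_nonpos _ _ le_rfl,
        zpow_neg_exp (hdvd _) hy, mul_comm]
    have u1 : par p (actRoot t b) r.1.1 1 =
        b t ^ ((l r.1.1 : ℤ) * (p / (k r.1.1 + l r.1.1) : ℕ)) * par p b r.1.1 1 := by
      rw [par_actRoot_adj hk hl p hb ht hne hadj', parExp_of_pos _ _ one_pos, mul_comm]
    have hW := par_one_eq hk hl hdvd hb hr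
    have hZ := par_one_eq hk hl hdvd hb ht
    have n0 := h₀ r.1.1 0
    have n1 := h₀ r.1.1 1
    have n2 := h₀ t.1.1 0
    have n3 := h₀ t.1.1 1
    have n4 := h₁ t.1.1 0
    have n5 := h₁ t.1.1 1
    have n7 := h₂ r.1.1 1
    have n9 := h₃ r.1.1 1
    rw [z0] at n4
    rw [z1] at n5
    rw [v1] at n7
    rw [u1] at n9
    have hY₂ : parQuot p (actRoot r b) (actCoord p b f r) t.1.1 = _ / _ := rfl
    rw [z0, z1] at hY₂
    rw [parQuot.eq_1 p (actRoot t (actRoot r b)), parQuot.eq_1 p (actRoot t b), v0, v1, u0, u1]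
    rcases hadj with hadj | hadj
    · have htr : t.1.1 = r.1.1 - 1 := by rw [hadj]; ring
      rw [actCoord_pred hk hl p b f hr htr] at n4 n5 hY₂
      rw [actCoord_succ hN hk hl p _ _ ht hadj, hxy, zpow_neg_exp (hdvd _) (mul_ne_zero hx hy),
        actCoord_self hN, mul_pow] at n7
      rw [actCoord_succ hN hk hl p _ _ ht hadj, zpow_neg_exp (hdvd _) hy] at n9
      rw [actCoord_succ hN hk hl p _ _ ht hadj, hxy, zpow_neg_exp (hdvd _) (mul_ne_zero hx hy),
        actCoord_self hN, mul_pow, actCoord_succ hN hk hl p _ _ ht hadj, zpow_neg_exp (hdvd _) hy]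
      exact quot_identity_pred (zpow_ne_zero _ hx) (zpow_ne_zero _ (mul_ne_zero hx hy))
        (zpow_ne_zero _ hy) (hp0 hx) (hp0 hy) hW hZ n1 n2 rfl n4 n5 hY₂ n7 rfl n9
    · have htr : r.1.1 = t.1.1 - 1 := by rw [hadj]; ring
      rw [actCoord_succ hN hk hl p b f hr hadj, zpow_neg_exp (hdvd _) hx] at n5 hY₂
      rw [actCoord_pred hk hl p _ _ ht htr, hxy, actCoord_self hN] at n7
      rw [actCoord_pred hk hl p _ _ ht htr] at n9
      rw [actCoord_pred hk hl p _ _ ht htr, hxy, actCoord_self hN,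
        actCoord_pred hk hl p _ _ ht htr]
      exact quot_identity_succ (zpow_ne_zero _ hx) (zpow_ne_zero _ (mul_ne_zero hx hy))
        (zpow_ne_zero _ hy) (hp0 hx) (hp0 hy) hW hZ n0 n1 n3 rfl n5 hY₂ n7 rfl n9

theorem actCoord_braid (hN : 3 ≤ N) (hk : ∀ n, 0 < k n) (hl : ∀ n, 0 < l n) {p : ℕ}
    (hdvd : ∀ n, (k n + l n) ∣ p) {b : Root k l → L} (hb : ∀ t, b t ≠ 0) {f : ZMod N → L}
    {r t : Root k l} (hrt : r ≠ t) (h : Adj r t) (h₀ : Nonvanishing p b f)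
    (h₁ : Nonvanishing p (actRoot r b) (actCoord p b f r))
    (h₂ : Nonvanishing p (actRoot t (actRoot r b))
      (actCoord p (actRoot r b) (actCoord p b f r) t))
    (h₃ : Nonvanishing p (actRoot t b) (actCoord p b f t))
    (h₄ : Nonvanishing p (actRoot r (actRoot t b))
      (actCoord p (actRoot t b) (actCoord p b f t) r)) (m : ZMod N) :
    actCoord p (actRoot t (actRoot r b)) (actCoord p (actRoot r b) (actCoord p b f r) t) r m =
      actCoord p (actRoot r (actRoot t b)) (actCoord p (actRoot t b) (actCoord p b f t) r) t m := by
  have hx := hb r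
  have hy := hb t
  rw [actCoord_eq hk hl _ (actRoot t (actRoot r b)), actCoord_eq hk hl _ (actRoot r b),
    actCoord_eq hk hl _ b f r m, actCoord_eq hk hl _ (actRoot r (actRoot t b)),
    actCoord_eq hk hl _ (actRoot t b), actCoord_eq hk hl _ b f t m,
    actRoot_actRoot_of_adj hb hrt h, actRoot_actRoot_of_adj hb hrt.symm h.symm,
    actRoot_of_adj b hrt h, actRoot_of_adj b hrt.symm h.symm, mul_zpow, mul_zpow]
  -- The powers of `b_r` and `b_t` agree on both sides. Each side carries three quotients, and the
  -- outer two of one side combine to the middle one of the other.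
  have e1 : parQuot p b f r.1.1 ^ multExp r m *
      parQuot p (actRoot t (actRoot r b)) (actCoord p (actRoot r b) (actCoord p b f r) t) r.1.1 ^
        multExp r m = parQuot p (actRoot t b) (actCoord p b f t) r.1.1 ^ multExp r m := by
    by_cases hr : r.1.2 = 0
    · rw [← mul_zpow, parQuot_braid hN hk hl hdvd hb h hr h₀ h₁ h₂ h₃]
    · simp [multExp_of_ne hr]
  have e2 : parQuot p b f t.1.1 ^ multExp t m *
      parQuot p (actRoot r (actRoot t b)) (actCoord p (actRoot t b) (actCoord p b f t) r) t.1.1 ^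
        multExp t m = parQuot p (actRoot r b) (actCoord p b f r) t.1.1 ^ multExp t m := by
    by_cases ht : t.1.2 = 0
    · rw [← mul_zpow, parQuot_braid hN hk hl hdvd hb h.symm ht h₀ h₃ h₄ h₁]
    · simp [multExp_of_ne ht]
  rw [← e1, ← e2]
  ring

end Braid

/-! ### The Weyl group action on the field of rational functions -/

section GenericAction

theorem isCoord_fractionRing (ι K : Type*) [Field K] :
    IsCoord K (fun i : ι => algebraMap (MvPolynomial ι K) (FractionRing (MvPolynomial ι K))
      (MvPolynomial.X i)) := by
  have h : (MvPolynomial.aeval (fun i : ι => algebraMap (MvPolynomial ι K)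
      (FractionRing (MvPolynomial ι K)) (MvPolynomial.X i)) : MvPolynomial ι K →ₐ[K] _) =
      IsScalarTower.toAlgHom K (MvPolynomial ι K) (FractionRing (MvPolynomial ι K)) := by
    apply MvPolynomial.algHom_ext
    intro i
    simp
  constructor
  · rw [algebraicIndependent_iff_injective_aeval, h]
    exact IsFractionRing.injective (MvPolynomial ι K) (FractionRing (MvPolynomial ι K))
  · rw [eq_top_iff]
    rintro x -
    obtain ⟨a, c, -, rfl⟩ := IsFractionRing.div_surjective (A := MvPolynomial ι K) x
    rw [IntermediateField.mem_adjoin_range_iff]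
    exact ⟨a, c, by rw [h]; rfl⟩

/-- The reflections move the parameters as well, so they are only automorphisms over `ℂ`. The
variables `b` and `f` together must therefore be seen as coordinates over `ℂ`. -/
theorem IsCoord.tower {ι κ S F : Type*} [Field S] [Field F] [Algebra ℂ S] [Algebra ℂ F]
    [Algebra S F] [IsScalarTower ℂ S F] {x : ι → S} {y : κ → F} (hx : IsCoord ℂ x)
    (hy : IsCoord S y) : IsCoord ℂ (Sum.elim y fun i => algebraMap S F (x i)) := by
  refine ⟨hx.indep.sumElim_comp hy.indep, ?_⟩
  set E := IntermediateField.adjoin ℂ (Set.range (Sum.elim y fun i => algebraMap S F (x i)))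
  have hxE : ∀ i, algebraMap S F (x i) ∈ E := fun i =>
    IntermediateField.subset_adjoin _ _ ⟨Sum.inr i, rfl⟩
  have hyE : ∀ i, y i ∈ E := fun i => IntermediateField.subset_adjoin _ _ ⟨Sum.inl i, rfl⟩
  have hS : ∀ s : S, algebraMap S F s ∈ E := by
    intro s
    obtain ⟨a, c, -, rfl⟩ := hx.exists_div s
    have h : ∀ a : MvPolynomial ι ℂ, algebraMap S F (MvPolynomial.aeval x a) ∈ E := fun a => by
      rw [← MvPolynomial.aeval_algebraMap_apply]
      exact aeval_mem_adjoin_range _ a _ hxE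
    rw [map_div₀]
    exact div_mem (h a) (h c)
  have hM : ∀ a : MvPolynomial κ S, MvPolynomial.aeval y a ∈ E := by
    intro a
    induction a using MvPolynomial.induction_on with
    | C s => rw [MvPolynomial.aeval_C]; exact hS s
    | add a c ha hc => rw [map_add]; exact add_mem ha hc
    | mul_X a i ha => rw [map_mul, MvPolynomial.aeval_X]; exact mul_mem ha (hyE i)
  rw [eq_top_iff]
  rintro z -
  obtain ⟨a, c, -, rfl⟩ := hy.exists_div z
  exact div_mem (hM a) (hM c)

variable {N : ℕ} {k l : ZMod N → ℕ}

theorem finite_root [Finite (ZMod N)] : Finite (Root k l) := by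
  have h : (⋃ n : ZMod N, ({n} : Set (ZMod N)) ×ˢ
      Set.Icc (-(l n : ℤ) + 1) ((k n : ℤ) - 1)).Finite :=
    Set.finite_iUnion fun n => (Set.finite_singleton n).prod (Set.finite_Icc _ _)
  have h2 : {r : ZMod N × ℤ | -(l r.1 : ℤ) + 1 ≤ r.2 ∧ r.2 ≤ (k r.1 : ℤ) - 1}.Finite := by
    refine h.subset ?_
    rintro ⟨n, i⟩ hr
    exact Set.mem_iUnion.2 ⟨n, rfl, hr⟩
  exact h2.to_subtype

/-- The variables `b_n^i` in the field of parameters. -/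
def paramRoot (k l : ZMod N → ℕ) (r : Root k l) : ParamField k l :=
  algebraMap (MvPolynomial (Root k l) ℂ) (ParamField k l) (MvPolynomial.X r)

theorem genRoot_eq (k l : ZMod N → ℕ) (r : Root k l) :
    genRoot k l r = algebraMap (ParamField k l) (GenField k l) (paramRoot k l r) := by
  rw [IsScalarTower.algebraMap_apply (ParamField k l) (MvPolynomial (ZMod N) (ParamField k l))]
  rfl

theorem isCoord_genCoord (k l : ZMod N → ℕ) : IsCoord (ParamField k l) (genCoord k l) :=
  isCoord_fractionRing (ZMod N) (ParamField k l)

theorem isCoord_gen (k l : ZMod N → ℕ) : IsCoord ℂ (Sum.elim (genCoord k l) (genRoot k l)) := by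
  have h := (isCoord_fractionRing (Root k l) ℂ).tower (isCoord_genCoord k l)
  have h2 : genRoot k l = fun r => algebraMap (ParamField k l) (GenField k l) (paramRoot k l r) :=
    funext (genRoot_eq k l)
  rw [h2]; exact h

theorem genRoot_ne_zero (k l : ZMod N → ℕ) (r : Root k l) : genRoot k l r ≠ 0 :=
  (isCoord_gen k l).ne_zero (Sum.inr r)

theorem nonvanishing_gen (p : ℕ) (k l : ZMod N → ℕ) :
    Nonvanishing p (genRoot k l) (genCoord k l) := by
  intro n θ h
  have h2 : genRoot k l = fun r => algebraMap (ParamField k l) (GenField k l) (paramRoot k l r) :=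
    funext (genRoot_eq k l)
  rw [h2, par_map] at h
  set w := par p (paramRoot k l) n θ
  have h3 : (MvPolynomial.X n + MvPolynomial.C w : MvPolynomial (ZMod N) (ParamField k l)) = 0 :=
    (isCoord_genCoord k l).aeval_injective (by simpa using h)
  -- Evaluating `X_n + w` at `0` and at `1` shows that it cannot be the zero polynomial.
  have e0 := congrArg (MvPolynomial.eval fun _ => (0 : ParamField k l)) h3
  have e1 := congrArg (MvPolynomial.eval fun _ => (1 : ParamField k l)) h3
  simp only [map_add, MvPolynomial.eval_X, MvPolynomial.eval_C, map_zero, zero_add] at e0 e1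
  rw [e0, add_zero] at e1
  exact one_ne_zero e1

theorem par_mem {F : Type*} [Field F] [Algebra ℂ F] (E : IntermediateField ℂ F) (p : ℕ)
    {b : Root k l → F} (h : ∀ t, b t ∈ E) (n : ZMod N) (θ : ℤ) : par p b n θ ∈ E := by
  refine prod_mem fun m _ => zpow_mem ?_ _
  rw [rv]; split_ifs
  · exact h _
  · exact one_mem _

/-- The substitution is triangular: `b_r` is recovered from `1 / b_r`, then the other `b_t`, then
`f_n` and hence the quotient, and finally the remaining `f_m`. -/
theorem exists_genAut [Finite (ZMod N)] (hN : 3 ≤ N) (hk : ∀ n, 0 < k n) (hl : ∀ n, 0 < l n)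
    (p : ℕ) (r : Root k l) :
    ∃ σ : GenField k l ≃ₐ[ℂ] GenField k l,
      (∀ t, σ (genRoot k l t) = actRoot r (genRoot k l) t) ∧
      ∀ m, σ (genCoord k l m) = actCoord p (genRoot k l) (genCoord k l) r m := by
  have := finite_root (k := k) (l := l)
  have hw : IsCoord ℂ (Sum.elim (fun m => actCoord p (genRoot k l) (genCoord k l) r m)
      (fun t => actRoot r (genRoot k l) t)) := by
    refine (isCoord_gen k l).of_mem ?_
    set E := IntermediateField.adjoin ℂ (Set.range (Sum.elim
      (fun m => actCoord p (genRoot k l) (genCoord k l) r m) (fun t => actRoot r (genRoot k l) t)))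
    have hE : ∀ i, Sum.elim (fun m => actCoord p (genRoot k l) (genCoord k l) r m)
        (fun t => actRoot r (genRoot k l) t) i ∈ E := fun i =>
      IntermediateField.subset_adjoin _ _ ⟨i, rfl⟩
    have hr : genRoot k l r ∈ E := by
      have h := hE (Sum.inr r)
      simp only [Sum.elim_inr, actRoot_self] at h
      simpa using inv_mem h
    have hroot : ∀ t, genRoot k l t ∈ E := by
      intro t
      have h := hE (Sum.inr t)
      simp only [Sum.elim_inr, actRoot_eq (genRoot_ne_zero k l)] at h
      have h2 := mul_mem h (inv_mem (zpow_mem hr (rootExp r t.1.1 t.1.2)))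
      rwa [mul_inv_cancel_right₀ (zpow_ne_zero _ (genRoot_ne_zero k l r))] at h2
    rintro (m | t)
    · have h := hE (Sum.inl m)
      simp only [Sum.elim_inl] at h ⊢
      have hn := hE (Sum.inl r.1.1)
      simp only [Sum.elim_inl, actCoord_self hN] at hn
      rw [actCoord_eq hk hl] at h
      have hY : parQuot p (genRoot k l) (genCoord k l) r.1.1 ∈ E :=
        div_mem (add_mem hn (par_mem E p hroot _ _)) (add_mem hn (par_mem E p hroot _ _))
      have h2 := mul_mem (mul_mem h (inv_mem (zpow_mem hY (multExp r m))))
        (inv_mem (zpow_mem hr (coordExp p r m)))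
      rwa [mul_inv_cancel_right₀ (zpow_ne_zero _ ((nonvanishing_gen p k l).parQuot_ne_zero _)),
        mul_inv_cancel_right₀ (zpow_ne_zero _ (genRoot_ne_zero k l r))] at h2
    · exact hroot t
  obtain ⟨σ, hσ⟩ := (isCoord_gen k l).exists_equiv hw
  exact ⟨σ, fun t => hσ (Sum.inr t), fun m => hσ (Sum.inl m)⟩

theorem genAut_ext {σ τ : GenField k l ≃ₐ[ℂ] GenField k l}
    (h : ∀ t, σ (genRoot k l t) = τ (genRoot k l t))
    (h' : ∀ m, σ (genCoord k l m) = τ (genCoord k l m)) : σ = τ := by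
  have h2 : σ.toAlgHom = τ.toAlgHom := by
    refine algHom_ext_of_adjoin_eq_top (isCoord_gen k l).top ?_
    rintro _ ⟨m | t, rfl⟩
    · exact h' m
    · exact h t
  exact AlgEquiv.ext fun x => DFunLike.congr_fun h2 x

theorem exists_weylAction (hN : 3 ≤ N) (hk : ∀ n, 0 < k n) (hl : ∀ n, 0 < l n) {p : ℕ}
    (hdvd : ∀ n, (k n + l n) ∣ p) :
    ∃ ρ : (coxeterMatrix k l).Group →* (GenField k l ≃ₐ[ℂ] GenField k l), ∀ r : Root k l,
      (∀ t, ρ ((coxeterMatrix k l).simple r) (genRoot k l t) = actRoot r (genRoot k l) t) ∧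
      (∀ m, ρ ((coxeterMatrix k l).simple r) (genCoord k l m) =
        actCoord p (genRoot k l) (genCoord k l) r m) := by
  have : NeZero N := ⟨by omega⟩
  choose S hB hF using exists_genAut (k := k) (l := l) hN hk hl p
  have hBf : ∀ r, (fun t => S r (genRoot k l t)) = actRoot r (genRoot k l) := fun r => funext (hB r)
  have hFf : ∀ r, (fun m => S r (genCoord k l m)) = actCoord p (genRoot k l) (genCoord k l) r :=
    fun r => funext (hF r)
  have mapB : ∀ (s r : Root k l) (b : Root k l → GenField k l) (t : Root k l),
      S s (actRoot r b t) = actRoot r (fun t => S s (b t)) t := fun s r b t =>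
    (actRoot_map (S s : GenField k l →+* GenField k l) r b t).symm
  have mapF : ∀ (s r : Root k l) (b : Root k l → GenField k l) (f : ZMod N → GenField k l)
      (m : ZMod N), S s (actCoord p b f r m) =
        actCoord p (fun t => S s (b t)) (fun n => S s (f n)) r m := fun s r b f m =>
    (actCoord_map hk hl (S s : GenField k l →+* GenField k l) p b f r m).symm
  -- Automorphisms commute with the rational formulas. So `S r ∘ S t` is the formula of `t`
  -- evaluated at the variables already transformed by `r`: composition reads the word from left to
  -- right as iterated substitution.
  have hB2 : ∀ r t x, S r (S t (genRoot k l x)) = actRoot t (actRoot r (genRoot k l)) x :=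
    fun r t x => by rw [hB, mapB, hBf]
  have hF2 : ∀ r t m, S r (S t (genCoord k l m)) =
      actCoord p (actRoot r (genRoot k l)) (actCoord p (genRoot k l) (genCoord k l) r) t m :=
    fun r t m => by rw [hF, mapF, hBf, hFf]
  have hB2f : ∀ r t, (fun x => S r (actRoot t (genRoot k l) x)) =
      actRoot t (actRoot r (genRoot k l)) := fun r t => funext fun x => by rw [mapB, hBf]
  have hF2f : ∀ r t, (fun m => S r (actCoord p (genRoot k l) (genCoord k l) t m)) =
      actCoord p (actRoot r (genRoot k l)) (actCoord p (genRoot k l) (genCoord k l) r) t :=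
    fun r t => funext fun m => by rw [mapF, hBf, hFf]
  have hB3 : ∀ r t s x, S r (S t (S s (genRoot k l x))) =
      actRoot s (actRoot t (actRoot r (genRoot k l))) x := fun r t s x => by
    rw [hB2, mapB]
    simp only [mapB, hBf]
  have hF3 : ∀ r t s m, S r (S t (S s (genCoord k l m))) =
      actCoord p (actRoot t (actRoot r (genRoot k l)))
        (actCoord p (actRoot r (genRoot k l)) (actCoord p (genRoot k l) (genCoord k l) r) t) s m :=
    fun r t s m => by
      rw [hF2, mapF, hF2f, hB2f]
  have hNV := nonvanishing_gen p k l
  -- The denominators met in the iterated substitutions are images of generic ones under field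
  -- automorphisms, hence nonzero.
  have hNV1 : ∀ r, Nonvanishing p (actRoot r (genRoot k l))
      (actCoord p (genRoot k l) (genCoord k l) r) := fun r => by
    have := hNV.map (S r : GenField k l →+* GenField k l)
    simp only [RingHom.coe_coe] at this
    rwa [hBf, hFf] at this
  have hNV2 : ∀ r t, Nonvanishing p (actRoot t (actRoot r (genRoot k l)))
      (actCoord p (actRoot r (genRoot k l)) (actCoord p (genRoot k l) (genCoord k l) r) t) :=
    fun r t => by
      have := (hNV1 t).map (S r : GenField k l →+* GenField k l)
      simp only [RingHom.coe_coe] at this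
      rwa [hB2f, hF2f] at this
  have hne := genRoot_ne_zero k l
  have hsq : ∀ r, S r * S r = 1 := fun r => genAut_ext
    (fun x => (hB2 r r x).trans (actRoot_actRoot_self hne r x))
    (fun m => (hF2 r r m).trans (actCoord_actCoord_self hN hk hl hdvd hne hNV r m))
  have hcomm : ∀ r t, r ≠ t → ¬ Adj r t → S r * S t = S t * S r := fun r t hrt h => genAut_ext
    (fun x => (hB2 r t x).trans ((actRoot_comm hne hrt h x).trans (hB2 t r x).symm))
    (fun m => (hF2 r t m).trans
      ((actCoord_comm hk hl hdvd hne _ hrt h m).trans (hF2 t r m).symm))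
  have hbraid : ∀ r t, r ≠ t → Adj r t → S r * (S t * S r) = S t * (S r * S t) :=
    fun r t hrt h => genAut_ext
      (fun x => (hB3 r t r x).trans ((actRoot_braid hne hrt h x).trans (hB3 t r t x).symm))
      (fun m => (hF3 r t r m).trans ((actCoord_braid hN hk hl hdvd hne hrt h hNV (hNV1 r)
        (hNV2 r t) (hNV1 t) (hNV2 t r) m).trans (hF3 t r t m).symm))
  have hlift : (coxeterMatrix k l).IsLiftable S := by
    intro r t
    change (S r * S t) ^ (if r = t then 1 else if Adj r t then 3 else 2) = 1
    split_ifs with h1 h2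
    · rw [h1, pow_one, hsq]
    · have h3 := hbraid r t h1 h2
      calc (S r * S t) ^ 3 = (S r * (S t * S r)) * (S t * (S r * S t)) := by
            simp only [pow_succ, pow_zero, one_mul, mul_assoc]
        _ = S t * (S r * (S t * S t) * S r) * S t := by rw [h3]; simp only [mul_assoc]
        _ = 1 := by rw [hsq, mul_one, hsq, mul_one, hsq]
    · calc (S r * S t) ^ 2 = S r * S t * (S r * S t) := pow_two _
        _ = S r * S t * (S t * S r) := by rw [hcomm r t h1 h2]
        _ = S r * (S t * S t) * S r := by simp only [mul_assoc]
        _ = 1 := by rw [hsq, mul_one, hsq]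
  refine ⟨(coxeterMatrix k l).toCoxeterSystem.lift ⟨S, hlift⟩, fun r => ?_⟩
  have h : (coxeterMatrix k l).toCoxeterSystem.lift ⟨S, hlift⟩ ((coxeterMatrix k l).simple r) =
      S r := by
    have := (coxeterMatrix k l).toCoxeterSystem.lift_apply_simple hlift r
    rwa [CoxeterMatrix.toCoxeterSystem_simple] at this
  rw [h]
  exact ⟨hB r, hF r⟩

end GenericAction

/-! ### The centres and their transformation under the reflections -/

section Labels

variable {N : ℕ} {k l : ZMod N → ℕ}

theorem finite_label [Finite (ZMod N)] : Finite (Label k l) := by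
  have h : (⋃ n : ZMod N, ({n} : Set (ZMod N)) ×ˢ Set.Icc (-(l n : ℤ)) (k n : ℤ)).Finite :=
    Set.finite_iUnion fun n => (Set.finite_singleton n).prod (Set.finite_Icc _ _)
  have h2 : {c : ZMod N × ℤ | c.2 ≠ 0 ∧ -(l c.1 : ℤ) ≤ c.2 ∧ c.2 ≤ (k c.1 : ℤ)}.Finite := by
    refine h.subset ?_
    rintro ⟨n, i⟩ hc
    exact Set.mem_iUnion.2 ⟨n, rfl, hc.2⟩
  exact h2.to_subtype

/-- The position of the parameter of a centre in the sequence `par p b n`. -/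
def slot (c : Label k l) : ℤ := if 0 < c.1.2 then c.1.2 else 1 + c.1.2

/-- The index of the vanishing coordinate of a centre. -/
def cenZer (c : Label k l) : ZMod N := if 0 < c.1.2 then c.1.1 - 1 else c.1.1 + 1

/-- The index of the infinite coordinate of a centre. -/
def cenInf (c : Label k l) : ZMod N := if 0 < c.1.2 then c.1.1 + 1 else c.1.1 - 1

theorem slot_of_pos {c : Label k l} (h : 0 < c.1.2) : slot c = c.1.2 := if_pos h

theorem slot_of_not_pos {c : Label k l} (h : ¬ 0 < c.1.2) : slot c = 1 + c.1.2 := if_neg h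

theorem slot_pos_iff (c : Label k l) : 0 < slot c ↔ 0 < c.1.2 := by
  have := c.2.1
  rw [slot]; split_ifs <;> omega

theorem le_slot (hl : ∀ n, 0 < l n) (c : Label k l) : 1 - (l c.1.1 : ℤ) ≤ slot c := by
  have := c.2.2.1
  have := hl c.1.1
  rw [slot]; split_ifs <;> omega

theorem slot_le (hk : ∀ n, 0 < k n) (c : Label k l) : slot c ≤ k c.1.1 := by
  have := c.2.2.2
  have := hk c.1.1
  rw [slot]; split_ifs <;> omega

theorem label_ext {c c' : Label k l} (h : c.1.1 = c'.1.1) (hs : slot c = slot c') : c = c' := by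
  have h1 := slot_pos_iff c
  have h2 := slot_pos_iff c'
  refine Subtype.ext (Prod.ext h ?_)
  by_cases h3 : 0 < c.1.2
  · have h4 : 0 < c'.1.2 := h2.1 (hs ▸ h1.2 h3)
    rwa [slot_of_pos h3, slot_of_pos h4] at hs
  · have h4 : ¬ 0 < c'.1.2 := fun h => h3 (h1.1 (hs ▸ h2.2 h))
    rw [slot_of_not_pos h3, slot_of_not_pos h4] at hs
    omega

/-- The equations of a centre. -/
def cenEqs (n : ZMod N) (d : ℂ) (m : ZMod N) : Option ℂ :=
  if m = n - 1 ∨ m = n + 1 then some 0 else if m = n then some (-d) else none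

theorem centre_eq (hk : ∀ n, 0 < k n) (hl : ∀ n, 0 < l n) {p : ℕ} (hdvd : ∀ n, (k n + l n) ∣ p)
    {b : Root k l → ℂ} (hb : ∀ t, b t ≠ 0) (c : Label k l) :
    centre p b c = linearPoint (· = cenInf c) (cenEqs c.1.1 (par p b c.1.1 (slot c))) := by
  have h1 := c.2.2.1
  have h2 := c.2.2.2
  have h0 := c.2.1
  rw [centre]
  split_ifs with h
  · have e : par p b c.1.1 (slot c) = uSeq p b c.1.1 c.1.2.natAbs := by
      rw [uSeq_eq hk hl hdvd hb _ (by omega) (by omega), slot_of_pos h]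
      congr 1; omega
    rw [e, cenInf, if_pos h]
    rfl
  · have e : par p b c.1.1 (slot c) = 1 / vSeq p b c.1.1 c.1.2.natAbs := by
      rw [vSeq_eq hk hl hdvd hb _ (by omega) (by omega), slot_of_not_pos h]
      congr 1; omega
    rw [e, cenInf, if_neg h, neg_div]
    rfl

/-- A centre is determined by its row, by its parameter, and by the sign of its slot, which tells
which neighbouring coordinate vanishes and which is infinite. -/
theorem centre_congr (hk : ∀ n, 0 < k n) (hl : ∀ n, 0 < l n) {p : ℕ}
    (hdvd : ∀ n, (k n + l n) ∣ p) {b b' : Root k l → ℂ} (hb : ∀ t, b t ≠ 0) (hb' : ∀ t, b' t ≠ 0)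
    {c c' : Label k l} (h : c.1.1 = c'.1.1) (hs : 0 < slot c ↔ 0 < slot c')
    (hp : par p b' c.1.1 (slot c) = par p b c.1.1 (slot c')) : centre p b' c = centre p b c' := by
  rw [centre_eq hk hl hdvd hb, centre_eq hk hl hdvd hb', hp, h]
  rw [slot_pos_iff, slot_pos_iff] at hs
  simp only [cenInf, hs, h]

theorem par_ne_of_distinct (hk : ∀ n, 0 < k n) (hl : ∀ n, 0 < l n) {p : ℕ}
    (hdvd : ∀ n, (k n + l n) ∣ p) {b : Root k l → ℂ} (hb : ∀ t, b t ≠ 0)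
    (hd : DistinctCentres p b) {c c' : Label k l} (hne : c ≠ c') (h : c.1.1 = c'.1.1)
    (hs : 0 < slot c ↔ 0 < slot c') : par p b c.1.1 (slot c) ≠ par p b c.1.1 (slot c') :=
  fun hp => hne (hd (centre_congr hk hl hdvd hb hb h hs hp))

theorem cenZer_ne (hN : 3 ≤ N) (c : Label k l) : cenZer c ≠ c.1.1 := by
  rw [cenZer]; split_ifs
  · exact zmod_sub_one_ne hN _
  · exact zmod_add_one_ne hN _

theorem cenInf_ne (hN : 3 ≤ N) (c : Label k l) : cenInf c ≠ c.1.1 := by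
  rw [cenInf]; split_ifs
  · exact zmod_add_one_ne hN _
  · exact zmod_sub_one_ne hN _

theorem cenZer_ne_cenInf (hN : 3 ≤ N) (c : Label k l) : cenZer c ≠ cenInf c := by
  rw [cenZer, cenInf]; split_ifs
  · exact zmod_sub_one_ne_add_one hN _
  · exact (zmod_sub_one_ne_add_one hN _).symm

theorem mem_cen_iff (c : Label k l) (m : ZMod N) (d : ℂ) :
    m ∈ ({cenZer c, c.1.1, cenInf c} : Finset (ZMod N)) ↔ cenEqs c.1.1 d m ≠ none := by
  simp only [Finset.mem_insert, Finset.mem_singleton, cenZer, cenInf, cenEqs]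
  split_ifs <;> simp <;> tauto

/-- The centres of the blow-up `X_a`. -/
def centreData (hN : 3 ≤ N) (hk : ∀ n, 0 < k n) (hl : ∀ n, 0 < l n) {p : ℕ}
    (hdvd : ∀ n, (k n + l n) ∣ p) {b : Root k l → ℂ} (hb : ∀ t, b t ≠ 0)
    (hd : DistinctCentres p b) : CentreData N (Label k l) where
  n c := c.1.1
  zer := cenZer
  inf := cenInf
  d c := par p b c.1.1 (slot c)
  P := centre p b
  zer_ne := cenZer_ne hN
  inf_ne := cenInf_ne hN
  zer_ne_inf := cenZer_ne_cenInf hN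
  isLin c := by
    rw [centre_eq hk hl hdvd hb, cenCoord_eq_shift (cenInf_ne hN c)]
    have h := isLin_linearPoint (· = cenInf c) (cenEqs c.1.1 (par p b c.1.1 (slot c)))
      {cenZer c, c.1.1, cenInf c} (fun m => mem_cen_iff c m _)
    convert h using 3 with m
    rw [cenEqs]
    have h1 := zmod_add_one_ne hN c.1.1
    have h2 := zmod_sub_one_ne hN c.1.1
    split_ifs with h3 h4 h4
    · rcases h4 with h4 | h4
      · exact absurd (h4.symm.trans h3) h2
      · exact absurd (h4.symm.trans h3) h1
    all_goals rfl
  mem c := by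
    rw [centre_eq hk hl hdvd hb]
    exact linearPoint_mem_projLineProd _ _
  inj := hd

theorem isBlowUpOf_blowUpX (hN : 3 ≤ N) (hk : ∀ n, 0 < k n) (hl : ∀ n, 0 < l n) {p : ℕ}
    (hdvd : ∀ n, (k n + l n) ∣ p) {b : Root k l → ℂ} (hb : ∀ t, b t ≠ 0)
    (hd : DistinctCentres p b) {o : List (Label k l)} (ho : IsOrdering o) :
    IsBlowUpOf (centreData hN hk hl hdvd hb hd) (blowUpX p b o) := by
  have : NeZero N := ⟨by omega⟩
  have hgood : IsGood (ZMod N) (centre p b '' {a | a ∈ o}) (projLineProd N) := by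
    refine isGood_projLineProd ?_
    rintro _ ⟨c, -, rfl⟩
    exact ⟨_, _, {cenZer c, c.1.1, cenInf c}, (centreData hN hk hl hdvd hb hd).card_eq c,
      fun m => mem_cen_iff c m _, centre_eq hk hl hdvd hb c⟩
  obtain ⟨h1, h2⟩ := IsGood.foldl (centre p b) hd o ho.1 hgood
  refine ⟨h1.lfg, h1.sep, fun R hR => ?_, fun Q hQ => (h2 Q hQ).trans ?_⟩
  · obtain ⟨y, hy, hRy, -⟩ := h1.adapted R hR
    exact ⟨y, hy, hRy⟩
  · exact or_congr Iff.rfl ⟨fun ⟨c, _, h⟩ => ⟨c, h⟩, fun ⟨c, h⟩ => ⟨c, ho.2 c, h⟩⟩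

/-- The label `(n, 1)`. -/
def labelPos (hk : ∀ n, 0 < k n) (n : ZMod N) : Label k l :=
  ⟨(n, 1), one_ne_zero, by dsimp only; omega, by have := hk n; dsimp only; omega⟩

/-- The label `(n, -1)`. -/
def labelNeg (hl : ∀ n, 0 < l n) (n : ZMod N) : Label k l :=
  ⟨(n, -1), neg_ne_zero.2 one_ne_zero, by have := hl n; dsimp only; omega, by dsimp only; omega⟩

theorem slot_labelPos (hk : ∀ n, 0 < k n) (n : ZMod N) :
    slot (labelPos hk n : Label k l) = 1 := rfl

theorem slot_labelNeg (hl : ∀ n, 0 < l n) (n : ZMod N) :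
    slot (labelNeg hl n : Label k l) = 0 := rfl

theorem exists_funAut (hN : 3 ≤ N) (hk : ∀ n, 0 < k n) (hl : ∀ n, 0 < l n) (p : ℕ)
    {b : Root k l → ℂ} (hb : ∀ t, b t ≠ 0) (r : Root k l) :
    ∃ σ : FunField N ≃ₐ[ℂ] FunField N, ∀ m, σ (coord m) =
      actCoord p (fun t => algebraMap ℂ (FunField N) (b t)) coord r m := by
  have : NeZero N := ⟨by omega⟩
  have hw : IsCoord ℂ (fun m => actCoord p (fun t => algebraMap ℂ (FunField N) (b t)) coord r m) := by
    refine isCoord_coord.of_mem fun m => ?_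
    set E := IntermediateField.adjoin ℂ (Set.range fun m =>
      actCoord p (fun t => algebraMap ℂ (FunField N) (b t)) coord r m)
    have hE : ∀ m, actCoord p (fun t => algebraMap ℂ (FunField N) (b t)) coord r m ∈ E := fun m =>
      IntermediateField.subset_adjoin _ _ ⟨m, rfl⟩
    have h := hE m
    have hn := hE r.1.1
    rw [actCoord_self hN] at hn
    rw [actCoord_eq hk hl] at h
    have hC : ∀ z : ℂ, algebraMap ℂ (FunField N) z ∈ E := fun z => E.algebraMap_mem z
    have hY : parQuot p (fun t => algebraMap ℂ (FunField N) (b t)) coord r.1.1 ∈ E :=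
      div_mem (add_mem hn (par_mem E p (fun t => hC (b t)) _ _))
        (add_mem hn (par_mem E p (fun t => hC (b t)) _ _))
    have hY0 : parQuot p (fun t => algebraMap ℂ (FunField N) (b t)) coord r.1.1 ≠ 0 := by
      rw [parQuot, par_map, par_map]
      exact div_ne_zero (coord_add_ne_zero _ _) (coord_add_ne_zero _ _)
    have h2 := mul_mem (mul_mem h (inv_mem (zpow_mem hY (multExp r m))))
      (inv_mem (zpow_mem (hC (b r)) (coordExp p r m)))
    rwa [mul_inv_cancel_right₀ (zpow_ne_zero _ hY0),
      mul_inv_cancel_right₀ (zpow_ne_zero _ (by simpa using hb r))] at h2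
  exact isCoord_coord.exists_equiv hw

/-- The reflection at the vertex `(n, 0)`. -/
def elemTransf (hN : 3 ≤ N) (hk : ∀ n, 0 < k n) (hl : ∀ n, 0 < l n) {p : ℕ}
    (hdvd : ∀ n, (k n + l n) ∣ p) {b : Root k l → ℂ} (hb : ∀ t, b t ≠ 0)
    {r : Root k l} (hr : r.1.2 = 0) (hbr : b r ^ p ≠ 1)
    (hd : DistinctCentres p b) (hd' : DistinctCentres p (actRoot r b))
    {σ : FunField N ≃ₐ[ℂ] FunField N} (hσ : ∀ m, σ (coord m) =
      actCoord p (fun t => algebraMap ℂ (FunField N) (b t)) coord r m) :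
    ElemTransf (centreData hN hk hl hdvd hb hd)
      (centreData hN hk hl hdvd (actRoot_ne_zero hb r) hd') σ where
  n := r.1.1
  α := r.1.1 - 1
  β := r.1.1 + 1
  s := par p b r.1.1 0
  t := par p b r.1.1 1
  A := b r ^ ((l (r.1.1 - 1) : ℤ) * (p / (k (r.1.1 - 1) + l (r.1.1 - 1)) : ℕ))
  B := b r ^ (-((k (r.1.1 + 1) : ℤ) * (p / (k (r.1.1 + 1) + l (r.1.1 + 1)) : ℕ)))
  cp := labelPos hk r.1.1
  cm := labelNeg hl r.1.1
  α_ne := zmod_sub_one_ne hN _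
  β_ne := zmod_add_one_ne hN _
  α_ne_β := zmod_sub_one_ne_add_one hN _
  s_ne := par_ne_zero p hb _ _
  t_ne := par_ne_zero p hb _ _
  -- The ratio of the two parameters is `a_r = b_r ^ p`.
  s_ne_t h := hbr (by
    rw [par_one_eq hk hl hdvd hb hr] at h
    exact mul_right_cancel₀ (par_ne_zero p hb r.1.1 0) (by rw [← h, one_mul]))
  A_ne := zpow_ne_zero _ (hb r)
  B_ne := zpow_ne_zero _ (hb r)
  σ_α := by
    rw [hσ, actCoord_pred hk hl p _ _ hr rfl, parQuot, par_map, par_map, map_zpow₀]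
    ring
  σ_β := by
    rw [hσ, actCoord_succ hN hk hl p _ _ hr rfl, parQuot, par_map, par_map, map_zpow₀, inv_div]
    ring
  σ_of_ne m h h' := by rw [hσ, actCoord_of_ne p _ _ h h']
  n_eq c := rfl
  zer_eq c := rfl
  inf_eq c := rfl
  n_cp := rfl
  zer_cp := rfl
  inf_cp := rfl
  d_cp := rfl
  d'_cp := by
    change par p (actRoot r b) r.1.1 1 = _
    have := hk r.1.1
    have := hl r.1.1
    rw [par_actRoot_same hdvd hb r (by omega) (by omega), hr]
    simp
  n_cm := rfl
  zer_cm := rfl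
  inf_cm := rfl
  d_cm := rfl
  d'_cm := by
    change par p (actRoot r b) r.1.1 0 = _
    have := hk r.1.1
    have := hl r.1.1
    rw [par_actRoot_same hdvd hb r (by omega) (by omega), hr]
    simp
  d_eq c hp hm h1 h2 := by
    change par p (actRoot r b) c.1.1 (slot c) = par p b c.1.1 (slot c)
    by_cases h : r.1.1 = c.1.1
    · rw [par_actRoot_row hdvd hb r h (le_slot hl c) (slot_le hk c), hr, zero_add,
        Equiv.swap_apply_of_ne_of_ne]
      · exact fun hs => hm (label_ext h.symm hs)
      · exact fun hs => hp (label_ext h.symm hs)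
    · refine par_actRoot_of_ne p hb (Ne.symm h) ?_ _
      rintro ⟨-, h3 | h3⟩
      · exact h2 h3
      · exact h1 (eq_sub_of_add_eq h3.symm)
  d_ne c hp hm h := by
    change c.1.1 = r.1.1 at h
    have hs0 : slot c ≠ 0 := fun hs => hm (label_ext h hs)
    have hs1 : slot c ≠ 1 := fun hs => hp (label_ext h hs)
    have hb' := actRoot_ne_zero hb r
    have h0 : par p (actRoot r b) r.1.1 0 = par p b r.1.1 1 := by
      have := hk r.1.1
      have := hl r.1.1
      rw [par_actRoot_same hdvd hb r (by omega) (by omega), hr]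
      simp
    have h1 : par p (actRoot r b) r.1.1 1 = par p b r.1.1 0 := by
      have := hk r.1.1
      have := hl r.1.1
      rw [par_actRoot_same hdvd hb r (by omega) (by omega), hr]
      simp
    have hc : par p (actRoot r b) c.1.1 (slot c) = par p b c.1.1 (slot c) := by
      rw [par_actRoot_row hdvd hb r h.symm (le_slot hl c) (slot_le hk c), hr, zero_add,
        Equiv.swap_apply_of_ne_of_ne hs0 hs1]
    change par p b c.1.1 (slot c) ≠ _ ∧ par p b c.1.1 (slot c) ≠ _
    -- Distinctness of centres compares only centres on the same side of row `n`, so on each side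
    -- one inequality comes from `X_a` and the other from `X_{s(a)}`, where `W_0` and `W_1` are
    -- exchanged.
    by_cases hpos : 0 < slot c
    · have e1 := par_ne_of_distinct hk hl hdvd hb hd hp h (by simp [slot_labelPos, hpos])
      have e2 := par_ne_of_distinct hk hl hdvd hb' hd' hp h (by simp [slot_labelPos, hpos])
      rw [hc, h, slot_labelPos, h1] at e2
      rw [h, slot_labelPos] at e1
      rw [h]
      exact ⟨e2, e1⟩
    · have e1 := par_ne_of_distinct hk hl hdvd hb hd hm h (by simp [slot_labelNeg]; omega)
      have e2 := par_ne_of_distinct hk hl hdvd hb' hd' hm h (by simp [slot_labelNeg]; omega)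
      rw [hc, h, slot_labelNeg, h0] at e2
      rw [h, slot_labelNeg] at e1
      rw [h]
      exact ⟨e1, e2⟩
  d_α c h := by
    change c.1.1 = r.1.1 - 1 at h
    change (cenInf c = r.1.1 ∧ par p (actRoot r b) c.1.1 (slot c) = _ * par p b c.1.1 (slot c)) ∨
      (cenZer c = r.1.1 ∧ par p (actRoot r b) c.1.1 (slot c) = _ * par p b c.1.1 (slot c))
    rw [par_actRoot_adj hk hl p hb hr (by rw [h]; exact zmod_sub_one_ne hN _)
      (Or.inr (by rw [h, sub_add_cancel]))]
    by_cases hpos : 0 < slot c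
    · refine Or.inl ⟨?_, ?_⟩
      · rw [cenInf, if_pos ((slot_pos_iff c).1 hpos), h, sub_add_cancel]
      · rw [parExp_of_pos p _ hpos, h, mul_comm]
    · refine Or.inr ⟨?_, ?_⟩
      · rw [cenZer, if_neg (fun hc => hpos ((slot_pos_iff c).2 hc)), h, sub_add_cancel]
      · rw [parExp_of_nonpos p _ (not_lt.1 hpos), zpow_neg_exp (hdvd _) (hb r),
          par_one_eq hk hl hdvd hb hr, h]
        have := hb r
        have := par_ne_zero p hb r.1.1 0
        field_simp
  d_β c h := by
    change c.1.1 = r.1.1 + 1 at h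
    change (cenInf c = r.1.1 ∧ par p (actRoot r b) c.1.1 (slot c) = _ * par p b c.1.1 (slot c)) ∨
      (cenZer c = r.1.1 ∧ par p (actRoot r b) c.1.1 (slot c) = _ * par p b c.1.1 (slot c))
    rw [par_actRoot_adj hk hl p hb hr (by rw [h]; exact zmod_add_one_ne hN _) (Or.inl h)]
    by_cases hpos : 0 < slot c
    · refine Or.inr ⟨?_, ?_⟩
      · rw [cenZer, if_pos ((slot_pos_iff c).1 hpos), h, add_sub_cancel_right]
      · rw [parExp_of_pos p _ hpos, zpow_neg_exp (hdvd _) (hb r),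
          par_one_eq hk hl hdvd hb hr, h]
        have := hb r
        have := par_ne_zero p hb r.1.1 0
        field_simp
    · refine Or.inl ⟨?_, ?_⟩
      · rw [cenInf, if_neg (fun hc => hpos ((slot_pos_iff c).2 hc)), h, add_sub_cancel_right]
      · rw [parExp_of_nonpos p _ (not_lt.1 hpos), h, mul_comm]

/-- The label `(n, i)` for a vertex `(n, i)` with `i ≠ 0`. -/
def labelOf {r : Root k l} (hr : r.1.2 ≠ 0) : Label k l :=
  ⟨r.1, hr, by have := r.2.1; omega, by have := r.2.2; omega⟩

/-- The label next to `(n, i)`, further away from `0`. -/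
def labelNext (r : Root k l) : Label k l :=
  ⟨(r.1.1, if 0 < r.1.2 then r.1.2 + 1 else r.1.2 - 1), by dsimp only; split_ifs <;> omega,
    by have := r.2.1; dsimp only; split_ifs <;> omega,
    by have := r.2.2; dsimp only; split_ifs <;> omega⟩

theorem labelOf_ne_labelNext {r : Root k l} (hr : r.1.2 ≠ 0) : labelOf hr ≠ labelNext r := by
  intro h
  have h2 : r.1.2 = if 0 < r.1.2 then r.1.2 + 1 else r.1.2 - 1 := congrArg (fun c => c.1.2) h
  split_ifs at h2 <;> omega

theorem slot_labelOf {r : Root k l} (hr : r.1.2 ≠ 0) :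
    slot (labelOf hr) = if 0 < r.1.2 then r.1.2 else 1 + r.1.2 := rfl

theorem slot_labelNext (r : Root k l) :
    slot (labelNext r) = if 0 < r.1.2 then r.1.2 + 1 else r.1.2 := by
  have : (labelNext r).1.2 = if 0 < r.1.2 then r.1.2 + 1 else r.1.2 - 1 := rfl
  rw [slot, this]
  split_ifs <;> omega

/-- The slots `i` and `i + 1` are exchanged. For `i ≠ 0` they have the same sign type, since the
border runs between `0` and `1`; so the two centres belong to the same family and just trade places.
-/
theorem centre_actRoot_of_ne_zero (hk : ∀ n, 0 < k n) (hl : ∀ n, 0 < l n) {p : ℕ}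
    (hdvd : ∀ n, (k n + l n) ∣ p) {b : Root k l → ℂ} (hb : ∀ t, b t ≠ 0) {r : Root k l}
    (hr : r.1.2 ≠ 0) (c : Label k l) :
    centre p (actRoot r b) c = centre p b (Equiv.swap (labelOf hr) (labelNext r) c) := by
  have hb' := actRoot_ne_zero hb r
  have key : ∀ c c' : Label k l, c.1.1 = r.1.1 → c'.1.1 = r.1.1 →
      slot c' = Equiv.swap r.1.2 (r.1.2 + 1) (slot c) → (0 < slot c ↔ 0 < slot c') →
      centre p (actRoot r b) c = centre p b c' := fun c c' h h' hs hpos => by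
    refine centre_congr hk hl hdvd hb hb' (h.trans h'.symm) hpos ?_
    rw [par_actRoot_row hdvd hb r h.symm (le_slot hl c) (slot_le hk c), hs]
  have s1 := slot_labelOf hr
  have s2 := slot_labelNext r
  by_cases h1 : c = labelOf hr
  · rw [h1, Equiv.swap_apply_left]
    refine key _ _ rfl rfl ?_ ?_
    · rw [s1, s2]
      split_ifs
      · rw [Equiv.swap_apply_left]
      · rw [add_comm 1, Equiv.swap_apply_right]
    · rw [s1, s2]; split_ifs <;> omega
  by_cases h2 : c = labelNext r
  · rw [h2, Equiv.swap_apply_right]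
    refine key _ _ rfl rfl ?_ ?_
    · rw [s1, s2]
      split_ifs
      · rw [Equiv.swap_apply_right]
      · rw [Equiv.swap_apply_left, add_comm]
    · rw [s1, s2]; split_ifs <;> omega
  rw [Equiv.swap_apply_of_ne_of_ne h1 h2]
  by_cases h : c.1.1 = r.1.1
  · refine key _ _ h h ?_ Iff.rfl
    have e1 : slot c ≠ slot (labelOf hr) := fun e => h1 (label_ext h e)
    have e2 : slot c ≠ slot (labelNext r) := fun e => h2 (label_ext h e)
    rw [s1] at e1
    rw [s2] at e2
    rw [Equiv.swap_apply_of_ne_of_ne]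
    · split_ifs at e1 e2 <;> omega
    · split_ifs at e1 e2 <;> omega
  · exact centre_congr hk hl hdvd hb hb' rfl Iff.rfl
      (par_actRoot_of_ne p hb h (fun h3 => hr h3.1) _)

end Labels

/-! ### The lattices and the reflections -/

section Lattice

variable {N : ℕ} {k l : ZMod N → ℕ}

/-- The self-intersections of the basis vectors. -/
def basisSign : ZMod N ⊕ Label k l → ℤ := Sum.elim (fun _ => 1) (fun _ => -1)

theorem basisSign_mul_self (s : ZMod N ⊕ Label k l) : basisSign s * basisSign s = 1 := by
  rcases s with m | c <;> rfl

theorem pairing_add_left (x x' y : Lat k l) : pairing (x + x') y = pairing x y + pairing x' y :=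
  Finsupp.sum_add_index' (fun s => by simp) (fun s a c => by ring)

theorem pairing_add_right (x y y' : Lat k l) : pairing x (y + y') = pairing x y + pairing x y' := by
  simp only [pairing, ← Finsupp.sum_add, Finsupp.add_apply, mul_add]

theorem pairing_single (s : ZMod N ⊕ Label k l) (y : Lat k l) :
    pairing (Finsupp.single s 1) y = basisSign s * y s := by
  rw [pairing, Finsupp.sum_single_index (by simp), mul_one]; rfl

/-- The functional given by the pairing with `y`. -/
def pairingHom (y : Lat k l) : Lat k l →+ ℤ where
  toFun x := pairing x y
  map_zero' := Finsupp.sum_zero_index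
  map_add' x x' := pairing_add_left x x' y

theorem pairingHom_apply (x y : Lat k l) : pairingHom y x = pairing x y := rfl

theorem pairing_sub_left (x x' y : Lat k l) : pairing (x - x') y = pairing x y - pairing x' y :=
  map_sub (pairingHom y) x x'

theorem pairing_zsmul_left (z : ℤ) (x y : Lat k l) : pairing (z • x) y = z * pairing x y := by
  rw [← pairingHom_apply, map_zsmul, smul_eq_mul, pairingHom_apply]

theorem pairing_zsmul_right (z : ℤ) (x y : Lat k l) : pairing x (z • y) = z * pairing x y := by
  simp only [pairing, Finsupp.sum, Finset.mul_sum, Finsupp.smul_apply, smul_eq_mul]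
  exact Finset.sum_congr rfl fun s _ => by ring

/-- The pairing is perfect. -/
def pairingEquiv [Finite (ZMod N ⊕ Label k l)] : Lat k l ≃+ (Lat k l →+ ℤ) :=
  AddEquiv.ofBijective
    ({ toFun := pairingHom
       map_zero' := by
        ext x
        simp [pairingHom_apply, pairing]
       map_add' := fun y y' => AddMonoidHom.ext fun x => pairing_add_right x y y' } :
      Lat k l →+ (Lat k l →+ ℤ)) (by
    constructor
    · intro y y' h
      refine Finsupp.ext fun s => ?_
      have h1 : pairing (Finsupp.single s 1) y = pairing (Finsupp.single s 1) y' :=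
        DFunLike.congr_fun h (Finsupp.single s 1)
      rw [pairing_single, pairing_single] at h1
      have h2 := congrArg (basisSign s * ·) h1
      simpa only [← mul_assoc, basisSign_mul_self, one_mul] using h2
    · intro φ
      refine ⟨Finsupp.equivFunOnFinite.symm fun s => basisSign s * φ (Finsupp.single s 1), ?_⟩
      refine Finsupp.addHom_ext' fun s => AddMonoidHom.ext_int ?_
      change pairing (Finsupp.single s 1) _ = φ (Finsupp.single s 1)
      rw [pairing_single, Finsupp.equivFunOnFinite_symm_apply_apply, ← mul_assoc,
        basisSign_mul_self, one_mul])

/-- Both sides equal `⟨x, y⟩ + ⟨x, α̌⟩ ⟨α, y⟩`: the two reflections are adjoint. -/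
theorem pairing_reflH2 (r : Root k l) (x y : Lat k l) :
    pairing (reflH2 r x) y = pairing x (reflH1 r y) := by
  rw [reflH2, reflH1, pairing_add_left, pairing_add_right, pairing_zsmul_left,
    pairing_zsmul_right, mul_comm]

/-- The reflection on `H²` as a homomorphism. -/
def reflHom (r : Root k l) : Lat k l →+ Lat k l where
  toFun := reflH2 r
  map_zero' := by simp [reflH2, pairing]
  map_add' x x' := by
    simp only [reflH2, pairing_add_left, add_smul]
    abel

theorem latE_label (c : Label k l) : latE k l c.1.1 c.1.2 = Finsupp.single (Sum.inr c) 1 :=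
  dif_pos c.2

theorem simpleRoot_eq_of_zero (hk : ∀ n, 0 < k n) (hl : ∀ n, 0 < l n) {r : Root k l}
    (hr : r.1.2 = 0) : simpleRoot r = Finsupp.single (Sum.inl r.1.1) 1 -
      Finsupp.single (Sum.inr (labelPos hk r.1.1)) 1 -
      Finsupp.single (Sum.inr (labelNeg hl r.1.1)) 1 := by
  rw [simpleRoot, if_pos hr, ← latE_label, ← latE_label]
  rfl

theorem simpleCoroot_eq_of_zero (hk : ∀ n, 0 < k n) (hl : ∀ n, 0 < l n) {r : Root k l}
    (hr : r.1.2 = 0) : simpleCoroot r = Finsupp.single (Sum.inl (r.1.1 - 1)) 1 +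
      Finsupp.single (Sum.inl (r.1.1 + 1)) 1 -
      Finsupp.single (Sum.inr (labelPos hk r.1.1)) 1 -
      Finsupp.single (Sum.inr (labelNeg hl r.1.1)) 1 := by
  rw [simpleCoroot, if_pos hr, ← latE_label, ← latE_label]
  rfl

theorem simpleCoroot_eq_simpleRoot {r : Root k l} (hr : r.1.2 ≠ 0) :
    simpleCoroot r = simpleRoot r := by
  rw [simpleCoroot, simpleRoot, if_neg hr, if_neg hr]

theorem simpleRoot_eq_of_ne {r : Root k l} (hr : r.1.2 ≠ 0) :
    simpleRoot r = Finsupp.single (Sum.inr (labelOf hr)) 1 -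
      Finsupp.single (Sum.inr (labelNext r)) 1 := by
  rw [simpleRoot, if_neg hr, ← latE_label, ← latE_label]
  have : (labelNext r).1.2 = if 0 < r.1.2 then r.1.2 + 1 else r.1.2 - 1 := rfl
  rw [this]
  split_ifs <;> rfl

theorem labelPos_ne_labelNeg (hk : ∀ n, 0 < k n) (hl : ∀ n, 0 < l n) (n : ZMod N) :
    (labelPos hk n : Label k l) ≠ labelNeg hl n := fun h => by
  have := congrArg slot h
  rw [slot_labelPos, slot_labelNeg] at this
  exact one_ne_zero this

/-- Only the two exceptional terms contribute, each with `-1`. With this sign convention, `-2` is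
what makes `x + ⟨x, α̌⟩ α` an involution. -/
theorem pairing_simpleRoot_simpleCoroot (hN : 3 ≤ N) (hk : ∀ n, 0 < k n) (hl : ∀ n, 0 < l n)
    (r : Root k l) : pairing (simpleRoot r) (simpleCoroot r) = -2 := by
  by_cases hr : r.1.2 = 0
  · have h1 := zmod_sub_one_ne hN r.1.1
    have h2 := zmod_add_one_ne hN r.1.1
    have h3 := labelPos_ne_labelNeg hk hl r.1.1
    rw [simpleRoot_eq_of_zero hk hl hr, simpleCoroot_eq_of_zero hk hl hr]
    simp [pairing_sub_left, pairing_single, basisSign, h1, h2, h3, h3.symm]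
  · have h := labelOf_ne_labelNext hr
    rw [simpleCoroot_eq_simpleRoot hr, simpleRoot_eq_of_ne hr]
    simp [pairing_sub_left, pairing_single, basisSign, h, h.symm]

theorem reflH2_reflH2 (hN : 3 ≤ N) (hk : ∀ n, 0 < k n) (hl : ∀ n, 0 < l n) (r : Root k l)
    (x : Lat k l) : reflH2 r (reflH2 r x) = x := by
  rw [reflH2, reflH2, pairing_add_left, pairing_zsmul_left,
    pairing_simpleRoot_simpleCoroot hN hk hl, add_assoc, ← add_smul]
  ring_nf
  simp

theorem reflH2_single_inl_of_zero (hN : 3 ≤ N) (hk : ∀ n, 0 < k n) (hl : ∀ n, 0 < l n)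
    {r : Root k l} (hr : r.1.2 = 0) (m : ZMod N) :
    reflH2 r (Finsupp.single (Sum.inl m) 1) = if m = r.1.1 - 1 ∨ m = r.1.1 + 1 then
      Finsupp.single (Sum.inl m) 1 + (Finsupp.single (Sum.inl r.1.1) 1 -
        Finsupp.single (Sum.inr (labelPos hk r.1.1)) 1 -
        Finsupp.single (Sum.inr (labelNeg hl r.1.1)) 1) else Finsupp.single (Sum.inl m) 1 := by
  have h1 := zmod_sub_one_ne_add_one hN r.1.1
  rw [reflH2, pairing_single, ← simpleRoot_eq_of_zero hk hl hr, simpleCoroot_eq_of_zero hk hl hr]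
  by_cases h2 : m = r.1.1 - 1
  · subst h2
    simp [basisSign, h1.symm]
  · by_cases h3 : m = r.1.1 + 1
    · subst h3
      simp [basisSign, h1]
    · simp [h2, h3]

theorem reflH2_single_inr_of_zero (hk : ∀ n, 0 < k n) (hl : ∀ n, 0 < l n)
    {r : Root k l} (hr : r.1.2 = 0) (c : Label k l) :
    reflH2 r (Finsupp.single (Sum.inr c) 1) =
      if c = labelPos hk r.1.1 then Finsupp.single (Sum.inl r.1.1) 1 -
        Finsupp.single (Sum.inr (labelNeg hl r.1.1)) 1
      else if c = labelNeg hl r.1.1 then Finsupp.single (Sum.inl r.1.1) 1 -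
        Finsupp.single (Sum.inr (labelPos hk r.1.1)) 1
      else Finsupp.single (Sum.inr c) 1 := by
  have h1 := labelPos_ne_labelNeg hk hl r.1.1
  rw [reflH2, pairing_single, simpleRoot_eq_of_zero hk hl hr, simpleCoroot_eq_of_zero hk hl hr]
  split_ifs with h2 h3
  · subst h2
    simp [basisSign, h1.symm]
    abel
  · subst h3
    simp [basisSign, h1]
  · simp [basisSign, Ne.symm h2, Ne.symm h3]

theorem reflH2_single_inl_of_ne {r : Root k l} (hr : r.1.2 ≠ 0) (m : ZMod N) :
    reflH2 r (Finsupp.single (Sum.inl m) 1) = Finsupp.single (Sum.inl m) 1 := by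
  rw [reflH2, pairing_single, simpleCoroot_eq_simpleRoot hr, simpleRoot_eq_of_ne hr]
  simp

theorem reflH2_single_inr_of_ne {r : Root k l} (hr : r.1.2 ≠ 0) (c : Label k l) :
    reflH2 r (Finsupp.single (Sum.inr c) 1) =
      Finsupp.single (Sum.inr (Equiv.swap (labelOf hr) (labelNext r) c)) 1 := by
  have h := labelOf_ne_labelNext hr
  rw [reflH2, pairing_single, simpleCoroot_eq_simpleRoot hr, simpleRoot_eq_of_ne hr]
  by_cases h1 : c = labelOf hr
  · rw [h1, Equiv.swap_apply_left]
    simp [basisSign, h.symm]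
  by_cases h2 : c = labelNext r
  · rw [h2, Equiv.swap_apply_right]
    simp [basisSign, h]
  rw [Equiv.swap_apply_of_ne_of_ne h1 h2]
  simp [Ne.symm h1, Ne.symm h2]

theorem eq_reflH2_of_single {A B : Type*} [AddCommGroup A] [AddCommGroup B] (r : Root k l)
    (ι : Lat k l ≃+ A) (ι' : Lat k l ≃+ B) (Φ : B ≃+ A)
    (h : ∀ s, Φ (ι' (Finsupp.single s 1)) = ι (reflH2 r (Finsupp.single s 1))) (x : Lat k l) :
    Φ (ι' x) = ι (reflH2 r x) := by
  have h1 : Φ.toAddMonoidHom.comp ι'.toAddMonoidHom = ι.toAddMonoidHom.comp (reflHom r) :=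
    Finsupp.addHom_ext' fun s => AddMonoidHom.ext_int (h s)
  exact DFunLike.congr_fun h1 x

variable {hN : 3 ≤ N} {hk : ∀ n, 0 < k n} {hl : ∀ n, 0 < l n} {p : ℕ}
  {hdvd : ∀ n, (k n + l n) ∣ p} {b : Root k l → ℂ} {hb : ∀ t, b t ≠ 0}
  {hd : DistinctCentres p b} {X : Set (LocalSubring (FunField N))}

/-- The identification of the lattice with the dual of the class group. -/
def dualLatEquiv [Finite (ZMod N)] [Finite (Label k l)]
    (hX : IsBlowUpOf (centreData hN hk hl hdvd hb hd) X) : Lat k l ≃+ (ClassGroup X →+ ℤ) :=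
  pairingEquiv.trans (AddEquiv.addMonoidHomCongrLeft hX.latEquiv)

theorem dualLatEquiv_apply [Finite (ZMod N)] [Finite (Label k l)]
    (hX : IsBlowUpOf (centreData hN hk hl hdvd hb hd) X) (x y : Lat k l) :
    dualLatEquiv hX y (hX.latEquiv x) = pairing x y := by
  change pairing (hX.latEquiv.symm (hX.latEquiv x)) y = _
  rw [AddEquiv.symm_apply_apply]

theorem isBilattice_blowUp [Finite (ZMod N)] [Finite (Label k l)]
    (hX : IsBlowUpOf (centreData hN hk hl hdvd hb hd) X) :
    IsBilattice p b X hX.latEquiv (dualLatEquiv hX) := by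
  refine ⟨fun n z => ⟨hX.zeroDiv (coord_sub_ne_zero n z), hX.isDivisorOfZeros_zeroDiv _,
    (hX.divClass_zeroDiv_sub n z).symm⟩, fun c => ⟨hX.excDiv c, fun V' => ⟨fun h => ?_, ?_⟩, ?_⟩,
    dualLatEquiv_apply hX⟩
  -- A divisor of `(ℙ¹)^N` cannot dominate a centre, since separatedness would make it equal to a
  -- point of dimension at least two; an exceptional divisor dominates only its own centre.
  · rcases hX.mem_or_eq_exc V' with hV | ⟨c', hV⟩
    · exact absurd h ((centreData hN hk hl hdvd hb hd).not_le_of_mem (c := c) hV V'.2.2)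
    · rw [hV] at h
      have := ((centreData hN hk hl hdvd hb hd).le_exc_iff (c := c)).1 h
      exact Subtype.ext (by rw [hV, ← this]; rfl)
  · rintro rfl
    exact (centreData hN hk hl hdvd hb hd).le_exc c
  · rw [latE_label]
    exact ElemTransf.latEquiv_exc hX c

/-- The reflection is an involution, so the inverse of the pullback is again given by it.
Adjointness then moves it to the other argument of the pairing. -/
theorem dual_pullback [Finite (ZMod N)] [Finite (Label k l)]
    (hX : IsBlowUpOf (centreData hN hk hl hdvd hb hd) X) {b' : Root k l → ℂ}
    {hb' : ∀ t, b' t ≠ 0} {hd' : DistinctCentres p b'} {X' : Set (LocalSubring (FunField N))}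
    (hX' : IsBlowUpOf (centreData hN hk hl hdvd hb' hd') X') (r : Root k l)
    (Φ : ClassGroup X' ≃+ ClassGroup X)
    (h : ∀ x, Φ (hX'.latEquiv x) = hX.latEquiv (reflH2 r x)) (y : Lat k l) (c : ClassGroup X) :
    dualLatEquiv hX' y (Φ.symm c) = dualLatEquiv hX (reflH1 r y) c := by
  obtain ⟨x, rfl⟩ := hX.latEquiv.surjective c
  have h1 : Φ.symm (hX.latEquiv x) = hX'.latEquiv (reflH2 r x) := by
    rw [AddEquiv.symm_apply_eq, h, reflH2_reflH2 hN hk hl]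
  rw [h1, dualLatEquiv_apply, dualLatEquiv_apply, pairing_reflH2]

/-- For `i = 0` the elementary transformation acts, and its values on the basis classes are those of
the reflection. For `i ≠ 0` the identity of the function field works, with two exceptional classes
exchanged. Both cases depend only on `X` and `X'` in codimension one, so the orders of blowing up
play no role. -/
theorem exists_pseudoIso (hN : 3 ≤ N) (hk : ∀ n, 0 < k n) (hl : ∀ n, 0 < l n) {p : ℕ}
    (hdvd : ∀ n, (k n + l n) ∣ p) {b : Root k l → ℂ} {r : Root k l} (hb : ∀ t, b t ≠ 0)
    (hbr : b r ^ p ≠ 1) (hd : DistinctCentres p b) (hd' : DistinctCentres p (actRoot r b))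
    {X X' : Set (LocalSubring (FunField N))} [Finite (ZMod N)] [Finite (Label k l)]
    (hX : IsBlowUpOf (centreData hN hk hl hdvd hb hd) X)
    (hX' : IsBlowUpOf (centreData hN hk hl hdvd (actRoot_ne_zero hb r) hd') X') :
    ∃ σ : FunField N ≃ₐ[ℂ] FunField N,
      (∀ m, σ (coord m) = actCoord p (fun t => algebraMap ℂ (FunField N) (b t)) coord r m) ∧
      IsPseudoIso (σ : FunField N →+* FunField N) X X' ∧
      ∃ Φ : ClassGroup X' ≃+ ClassGroup X,
        IsPullback (σ : FunField N →+* FunField N) X X' Φ.toAddMonoidHom ∧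
        ∀ x, Φ (hX'.latEquiv x) = hX.latEquiv (reflH2 r x) := by
  by_cases hr : r.1.2 = 0
  · obtain ⟨σ, hσ⟩ := exists_funAut hN hk hl p hb r
    let T := elemTransf hN hk hl hdvd hb hr hbr hd hd' hσ
    refine ⟨σ, hσ, T.isPseudoIso hX hX', T.pullback hX hX',
      hX.isPullback hX' σ _ (T.divEquiv_val hX hX'), eq_reflH2_of_single r _ _ _ ?_⟩
    rintro (m | c)
    · rw [reflH2_single_inl_of_zero hN hk hl hr]
      split_ifs with h
      · rcases h with rfl | rfl
        · exact T.pullback_α hX hX'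
        · exact T.pullback_β hX hX'
      · exact T.pullback_coord_of_ne hX hX' (fun h1 => h (Or.inl h1)) (fun h1 => h (Or.inr h1))
    · rw [reflH2_single_inr_of_zero hk hl hr]
      split_ifs with h1 h2
      · rw [h1]; exact T.pullback_cp hX hX'
      · rw [h2]; exact T.pullback_cm hX hX'
      · exact T.pullback_exc hX hX' h1 h2
  · have hperm : ∀ c, (centreData hN hk hl hdvd (actRoot_ne_zero hb r) hd').P c =
        (centreData hN hk hl hdvd hb hd).P (Equiv.swap (labelOf hr) (labelNext r) c) :=
      centre_actRoot_of_ne_zero hk hl hdvd hb hr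
    refine ⟨AlgEquiv.refl, fun m => (actCoord_of_ne_zero p
      (fun t => algebraMap ℂ (FunField N) (b t)) coord hr m).symm,
      isPseudoIso_refl_of_perm hX hX' hperm, permPullback hX hX' hperm,
      hX.isPullback hX' AlgEquiv.refl _ (permDivEquiv_val hX hX' hperm),
      eq_reflH2_of_single r _ _ _ ?_⟩
    rintro (m | c)
    · rw [reflH2_single_inl_of_ne hr]
      exact permPullback_coord hX hX' hperm m
    · rw [reflH2_single_inr_of_ne hr]
      exact permPullback_exc hX hX' hperm c

end Lattice

end TropicalWeyl

end

theorem theorem2p1 {N : ℕ} (hN : 3 ≤ N) (k l : ZMod N → ℕ)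
    (hk : ∀ n, 0 < k n) (hl : ∀ n, 0 < l n)
    (p : ℕ) (hp : 0 < p) (hdvd : ∀ n, (k n + l n) ∣ p) :
    (∃ ρ : (TropicalWeyl.coxeterMatrix k l).Group →*
        (TropicalWeyl.GenField k l ≃ₐ[ℂ] TropicalWeyl.GenField k l),
      ∀ r : TropicalWeyl.Root k l,
        (∀ t, ρ ((TropicalWeyl.coxeterMatrix k l).simple r) (TropicalWeyl.genRoot k l t) =
          TropicalWeyl.actRoot r (TropicalWeyl.genRoot k l) t) ∧
        (∀ m, ρ ((TropicalWeyl.coxeterMatrix k l).simple r) (TropicalWeyl.genCoord k l m) =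
          TropicalWeyl.actCoord p (TropicalWeyl.genRoot k l) (TropicalWeyl.genCoord k l) r m)) ∧
    (∀ (b : TropicalWeyl.Root k l → ℂ) (r : TropicalWeyl.Root k l),
      (∀ t, b t ≠ 0) → b r ^ p ≠ 1 →
      TropicalWeyl.DistinctCentres p b →
      TropicalWeyl.DistinctCentres p (TropicalWeyl.actRoot r b) →
      ∀ o o' : List (TropicalWeyl.Label k l),
        TropicalWeyl.IsOrdering o → TropicalWeyl.IsOrdering o' →
        ∃ σ : TropicalWeyl.FunField N ≃ₐ[ℂ] TropicalWeyl.FunField N,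
          (∀ m, σ (TropicalWeyl.coord m) =
            TropicalWeyl.actCoord p (fun t => algebraMap ℂ (TropicalWeyl.FunField N) (b t))
              TropicalWeyl.coord r m) ∧
          TropicalWeyl.IsPseudoIso (σ : TropicalWeyl.FunField N →+* TropicalWeyl.FunField N)
            (TropicalWeyl.blowUpX p b o)
            (TropicalWeyl.blowUpX p (TropicalWeyl.actRoot r b) o') ∧
          ∃ (ι : TropicalWeyl.Lat k l ≃+
                TropicalWeyl.ClassGroup (TropicalWeyl.blowUpX p b o))
            (κ : TropicalWeyl.Lat k l ≃+
                (TropicalWeyl.ClassGroup (TropicalWeyl.blowUpX p b o) →+ ℤ))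
            (ι' : TropicalWeyl.Lat k l ≃+
                TropicalWeyl.ClassGroup
                  (TropicalWeyl.blowUpX p (TropicalWeyl.actRoot r b) o'))
            (κ' : TropicalWeyl.Lat k l ≃+
                (TropicalWeyl.ClassGroup
                  (TropicalWeyl.blowUpX p (TropicalWeyl.actRoot r b) o') →+ ℤ))
            (Φ : TropicalWeyl.ClassGroup
                  (TropicalWeyl.blowUpX p (TropicalWeyl.actRoot r b) o') ≃+
                TropicalWeyl.ClassGroup (TropicalWeyl.blowUpX p b o)),
            TropicalWeyl.IsBilattice p b (TropicalWeyl.blowUpX p b o) ι κ ∧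
            TropicalWeyl.IsBilattice p (TropicalWeyl.actRoot r b)
              (TropicalWeyl.blowUpX p (TropicalWeyl.actRoot r b) o') ι' κ' ∧
            TropicalWeyl.IsPullback (σ : TropicalWeyl.FunField N →+* TropicalWeyl.FunField N)
              (TropicalWeyl.blowUpX p b o)
              (TropicalWeyl.blowUpX p (TropicalWeyl.actRoot r b) o') Φ.toAddMonoidHom ∧
            (∀ x, Φ (ι' x) = ι (TropicalWeyl.reflH2 r x)) ∧
            (∀ y c, κ' y (Φ.symm c) = κ (TropicalWeyl.reflH1 r y) c)) := by
  refine ⟨TropicalWeyl.exists_weylAction hN hk hl hdvd, ?_⟩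
  intro b r hb hbr hd hd' o o' ho ho'
  have : NeZero N := ⟨by omega⟩
  have : Finite (TropicalWeyl.Label k l) := TropicalWeyl.finite_label
  have hX := TropicalWeyl.isBlowUpOf_blowUpX hN hk hl hdvd hb hd ho
  have hX' := TropicalWeyl.isBlowUpOf_blowUpX hN hk hl hdvd
    (TropicalWeyl.actRoot_ne_zero hb r) hd' ho'
  obtain ⟨σ, hσ, hps, Φ, hΦ, hrefl⟩ :=
    TropicalWeyl.exists_pseudoIso hN hk hl hdvd hb hbr hd hd' hX hX'
  exact ⟨σ, hσ, hps, hX.latEquiv, TropicalWeyl.dualLatEquiv hX, hX'.latEquiv,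
    TropicalWeyl.dualLatEquiv hX', Φ, TropicalWeyl.isBilattice_blowUp hX,
    TropicalWeyl.isBilattice_blowUp hX', hΦ, hrefl, TropicalWeyl.dual_pullback hX hX' r Φ hrefl⟩
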